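/- **Conventions.** Fix $p_0,p_1\in\mathbb C^*$ with $p_0^2\neq1$, $p_1^2\ne 1$. For $n\ge 0$, let $\mathcal H_n^B$ be the affine Hecke algebra of type B: the $\mathbb C$-algebra generated by $T_0,\dots,T_{n-1},X_1^{\pm1},\dots,X_n^{\pm1}$ with relations - $X_iX_j=X_jX_i$; - $T_0T_1T_0T_1=T_1T_0T_1T_0$, $T_iT_{i+1}T_i=T_{i+1}T_iT_{i+1}$ $(1\le i\le n-2)$, $T_iT_j=T_jT_i$ $(|i-j|>1)$; - $(T_i-p_i)(T_i+p_i^{-1})=0$ $(0\le i\le n-1)$, where $p_i:=p_1$ for $i\ge1$; - $T_0X_1^{-1}T_0=X_1$, $T_iX_iT_i=X_{i+1}$ $(1\le i\le n-1)$, $T_iX_j=X_jT_i$ $(j\ne i,i+1)$. So $\mathcal H^B_0=\mathbb C$. Let $\mathcal H_n^A$ be the affine Hecke algebra of type A with parameter $p_1$, generated by $T_1,\dots,T_{n-1},X_1^{\pm1},\dots,X_n^{\pm1}$ with those of the above relations that do not involve $T_0$; there is a natural homomorphism $\mathcal H_n^A\to\mathcal H_n^B$, and $\operatorname{Ind}_{\mathcal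 H_n^A}^{\mathcal H_n^B}M=\mathcal H_n^B\otimes_{\mathcal H_n^A}M$. For $J\subset\mathbb C^*$, an $\mathcal H_n^B$-module is *of type $J$* if it is finite-dimensional and all eigenvalues of $X_1,\dots,X_n$ on it lie in $J$. The group $\mathbb Z\rtimes\mathbb Z_2=\mathbb Z\times\{\pm1\}$ acts on $\mathbb C^*$ by $(k,\epsilon):a\mapsto a^{\epsilon}p_1^{2k}$, and its subgroup $\mathbb Z$ by $k:a\mapsto ap_1^{2k}$. Let $\mathrm{Pol}_r=\mathbb C[X_1^{\pm1},\dots,X_r^{\pm1}]$. For $n,m\ge0$ put $\mathbf F_{n,m}=\mathrm{Pol}_{n+m}[D^{-1}]$ with $$D=\prod_{1\le i\le n<j\le n+m}(X_i-p_1^2X_j)(X_i-p_1^{-2}X_j)(X_i-p_1^2X_j^{-1})(X_i-p_1^{-2}X_j^{-1})(X_i-X_j)(X_i-X_j^{-1}).$$ In the localized algebra $\mathcal H_{n+m}^B\otimes_{\mathrm{Pol}_{n+m}}\mathbb C(X_1,\dots,X_{n+m})$, consider, for $1\le i<n+m$, $$\tilde\varphi_i=(p_1^{-1}-p_1X_iX_{i+1}^{-1})^{-1}\bigl((1-X_iX_{i+1}^{-1})T_i-(p_1-p_1^{-1})\bigr).$$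 Then $\mathcal H_m^B$ embeds in $\mathcal H_{n+m}^B\otimes_{\mathrm{Pol}_{n+m}}\mathbf F_{n,m}$ by $T_0\mapsto\tilde\varphi_n\cdots\tilde\varphi_1T_0\tilde\varphi_1\cdots\tilde\varphi_n$, $T_i\mapsto T_{n+i}$ $(1\le i<m)$, $X_i\mapsto X_{n+i}$ $(1\le i\le m)$, and its image commutes with $\mathcal H_n^B\subset\mathcal H_{n+m}^B$; this makes $\mathcal H_{n+m}^B\otimes_{\mathrm{Pol}_{n+m}}\mathbf F_{n,m}$ a right module over the algebra $(\mathcal H_n^B\otimes\mathcal H_m^B)\otimes_{\mathrm{Pol}_{n+m}}\mathbf F_{n,m}$. Let $J_1,J_2$ be disjoint $\mathbb Z\rtimes\mathbb Z_2$-invariant subsets of $\mathbb C^*$. If $N$ is an $\mathcal H_n^B$-module of type $J_1$ and $M$ an $\mathcal H_m^B$-module of type $J_2$, then $D$ acts invertibly on $N\otimes M$, so $N\otimes M$ is a left module over this algebra, and one defines the $\mathcal H^B_{n+m}$-module $$N\diamond M=(\mathcal H_{n+m}^B\otimes_{\mathrm{Pol}_{n+m}}\mathbf F_{n,m})\otimes_{(\mathcal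 H_n^B\otimes\mathcal H_m^B)\otimes_{\mathrm{Pol}_{n+m}}\mathbf F_{n,m}}(N\otimes M).$$ **Proposition 6.4.** Let $J_1,J_2\subset\mathbb C^*$ be disjoint $\mathbb Z\rtimes\mathbb Z_2$-invariant subsets. 1. If $N$ is an irreducible $\mathcal H_n^B$-module of type $J_1$ and $M$ is an irreducible $\mathcal H_m^B$-module of type $J_2$, then $N\diamond M$ is an irreducible $\mathcal H_{n+m}^B$-module of type $J_1\cup J_2$. 2. Conversely, if $L$ is an irreducible $\mathcal H_n^B$-module of type $J_1\cup J_2$, then there exist an integer $m$ with $0\le m\le n$, an irreducible $\mathcal H_m^B$-module $N$ of type $J_1$ and an irreducible $\mathcal H_{n-m}^B$-module $M$ of type $J_2$ such that $L\simeq N\diamond M$. 3. Let $J$ be a $\mathbb Z\rtimes\mathbb Z_2$-orbit in $\mathbb C^*$ which decomposes as $J=J_+\sqcup J_-$, where $J_\pm$ are $\mathbb Z$-orbits and $J_-=(J_+)^{-1}$, and assume $\pm1,\pm p_0\notin J$. Then for every irreducible $\mathcal H_n^B$-module $L$ of type $J$ there is an irreducible (finite-dimensional) $\mathcal H_n^A$-module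 $M$ such that $L\simeq\operatorname{Ind}_{\mathcal H_n^A}^{\mathcal H_n^B}M$. -/

import Mathlib

set_option maxSynthPendingDepth 3

open scoped TensorProduct

universe u v w

namespace AffineHecke

/-! ### The affine Hecke algebra of type B

Indices start at `0`: for `i : Fin n`, `T i` is the generator `T_i` (`0 ≤ i ≤ n - 1`), whereas
`X i` is the generator `X_{i+1}` and `Xinv i` its inverse.  Thus the relation
`T_i X_i T_i = X_{i+1}` of the literature reads `T i * X j * T i = X i` with `j + 1 = i`. -/

inductive HBGen (n : ℕ) : Type
  | T (i : Fin n) : HBGen n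
  | X (i : Fin n) : HBGen n
  | Xinv (i : Fin n) : HBGen n

/-- The parameter attached to `T_i`: `p₀` for `i = 0` and `p₁` for `i ≥ 1`. -/
def par (p0 p1 : ℂˣ) {n : ℕ} (i : Fin n) : ℂˣ := if i.val = 0 then p0 else p1

section RelB

variable {n : ℕ}

local notation "gT(" i ")" => FreeAlgebra.ι ℂ (HBGen.T i)
local notation "gX(" i ")" => FreeAlgebra.ι ℂ (HBGen.X i)
local notation "gY(" i ")" => FreeAlgebra.ι ℂ (HBGen.Xinv i)

/-- The defining relations of the affine Hecke algebra of type B. -/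
inductive HBRel (p0 p1 : ℂˣ) : FreeAlgebra ℂ (HBGen n) → FreeAlgebra ℂ (HBGen n) → Prop
  | X_mul_Xinv (i : Fin n) : HBRel p0 p1 (gX(i) * gY(i)) 1
  | Xinv_mul_X (i : Fin n) : HBRel p0 p1 (gY(i) * gX(i)) 1
  | X_comm (i j : Fin n) : HBRel p0 p1 (gX(i) * gX(j)) (gX(j) * gX(i))
  | braid4 (i j : Fin n) (hi : i.val = 0) (hj : j.val = 1) :
      HBRel p0 p1 (gT(i) * gT(j) * gT(i) * gT(j)) (gT(j) * gT(i) * gT(j) * gT(i))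
  | braid3 (i j : Fin n) (hi : 1 ≤ i.val) (hj : j.val = i.val + 1) :
      HBRel p0 p1 (gT(i) * gT(j) * gT(i)) (gT(j) * gT(i) * gT(j))
  | braid2 (i j : Fin n) (h : i.val + 1 < j.val) :
      HBRel p0 p1 (gT(i) * gT(j)) (gT(j) * gT(i))
  | hecke (i : Fin n) :
      HBRel p0 p1
        ((gT(i) - algebraMap ℂ _ (par p0 p1 i : ℂ)) * (gT(i) + algebraMap ℂ _ (par p0 p1 i : ℂ)⁻¹)) 0
  | bernstein_zero (i : Fin n) (hi : i.val = 0) :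
      HBRel p0 p1 (gT(i) * gY(i) * gT(i)) (gX(i))
  | bernstein_succ (i j : Fin n) (h : j.val + 1 = i.val) :
      HBRel p0 p1 (gT(i) * gX(j) * gT(i)) (gX(i))
  | bernstein_comm (i j : Fin n) (h : j.val + 1 ≠ i.val) (h' : j ≠ i) :
      HBRel p0 p1 (gT(i) * gX(j)) (gX(j) * gT(i))

end RelB

/-- The affine Hecke algebra `H_n^B` of type B with parameters `p₀`, `p₁`. -/
def HB (n : ℕ) (p0 p1 : ℂˣ) : Type := RingQuot (HBRel (n := n) p0 p1)

noncomputable instance (n : ℕ) (p0 p1 : ℂˣ) : Ring (HB n p0 p1) :=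
  inferInstanceAs (Ring (RingQuot (HBRel (n := n) p0 p1)))

noncomputable instance (n : ℕ) (p0 p1 : ℂˣ) : Algebra ℂ (HB n p0 p1) :=
  inferInstanceAs (Algebra ℂ (RingQuot (HBRel (n := n) p0 p1)))

namespace HB

noncomputable def mk (n : ℕ) (p0 p1 : ℂˣ) : FreeAlgebra ℂ (HBGen n) →ₐ[ℂ] HB n p0 p1 :=
  RingQuot.mkAlgHom ℂ (HBRel (n := n) p0 p1)

variable {n : ℕ} (p0 p1 : ℂˣ)

noncomputable def T (i : Fin n) : HB n p0 p1 := mk n p0 p1 (FreeAlgebra.ι ℂ (HBGen.T i))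

noncomputable def X (i : Fin n) : HB n p0 p1 := mk n p0 p1 (FreeAlgebra.ι ℂ (HBGen.X i))

noncomputable def Xinv (i : Fin n) : HB n p0 p1 := mk n p0 p1 (FreeAlgebra.ι ℂ (HBGen.Xinv i))

theorem mk_rel {a b : FreeAlgebra ℂ (HBGen n)} (h : HBRel p0 p1 a b) :
    mk n p0 p1 a = mk n p0 p1 b :=
  RingQuot.mkAlgHom_rel ℂ h

end HB

/-! ### The affine Hecke algebra of type A

The same index convention; `T i` exists only for `i ≠ 0`, that is, for `1 ≤ i ≤ n - 1`. -/

inductive HAGen (n : ℕ) : Type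
  | T (i : Fin n) (hi : i.val ≠ 0) : HAGen n
  | X (i : Fin n) : HAGen n
  | Xinv (i : Fin n) : HAGen n

section RelA

variable {n : ℕ}

local notation "aT(" i ", " hi ")" => FreeAlgebra.ι ℂ (HAGen.T i hi)
local notation "aX(" i ")" => FreeAlgebra.ι ℂ (HAGen.X i)
local notation "aY(" i ")" => FreeAlgebra.ι ℂ (HAGen.Xinv i)

/-- The defining relations of the affine Hecke algebra of type A. -/
inductive HARel (p : ℂˣ) : FreeAlgebra ℂ (HAGen n) → FreeAlgebra ℂ (HAGen n) → Prop
  | X_mul_Xinv (i : Fin n) : HARel p (aX(i) * aY(i)) 1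
  | Xinv_mul_X (i : Fin n) : HARel p (aY(i) * aX(i)) 1
  | X_comm (i j : Fin n) : HARel p (aX(i) * aX(j)) (aX(j) * aX(i))
  | braid3 (i j : Fin n) (hi : i.val ≠ 0) (hj : j.val ≠ 0) (h : j.val = i.val + 1) :
      HARel p (aT(i, hi) * aT(j, hj) * aT(i, hi)) (aT(j, hj) * aT(i, hi) * aT(j, hj))
  | braid2 (i j : Fin n) (hi : i.val ≠ 0) (hj : j.val ≠ 0) (h : i.val + 1 < j.val) :
      HARel p (aT(i, hi) * aT(j, hj)) (aT(j, hj) * aT(i, hi))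
  | hecke (i : Fin n) (hi : i.val ≠ 0) :
      HARel p ((aT(i, hi) - algebraMap ℂ _ (p : ℂ)) * (aT(i, hi) + algebraMap ℂ _ (p : ℂ)⁻¹)) 0
  | bernstein_succ (i j : Fin n) (hi : i.val ≠ 0) (h : j.val + 1 = i.val) :
      HARel p (aT(i, hi) * aX(j) * aT(i, hi)) (aX(i))
  | bernstein_comm (i j : Fin n) (hi : i.val ≠ 0) (h : j.val + 1 ≠ i.val) (h' : j ≠ i) :
      HARel p (aT(i, hi) * aX(j)) (aX(j) * aT(i, hi))

end RelA

/-- The affine Hecke algebra `H_n^A` of type A with parameter `p`. -/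
def HA (n : ℕ) (p : ℂˣ) : Type := RingQuot (HARel (n := n) p)

noncomputable instance (n : ℕ) (p : ℂˣ) : Ring (HA n p) :=
  inferInstanceAs (Ring (RingQuot (HARel (n := n) p)))

noncomputable instance (n : ℕ) (p : ℂˣ) : Algebra ℂ (HA n p) :=
  inferInstanceAs (Algebra ℂ (RingQuot (HARel (n := n) p)))

/-- The natural map on generators `H_n^A → H_n^B`. -/
noncomputable def HA.genToHB {n : ℕ} (p0 p1 : ℂˣ) : HAGen n → HB n p0 p1
  | .T i _ => HB.T p0 p1 i
  | .X i => HB.X p0 p1 i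
  | .Xinv i => HB.Xinv p0 p1 i

/-- The natural homomorphism `H_n^A → H_n^B`, for `H_n^A` with parameter `p₁`. -/
noncomputable def HA.toHB (n : ℕ) (p0 p1 : ℂˣ) : HA n p1 →ₐ[ℂ] HB n p0 p1 :=
  RingQuot.liftAlgHom ℂ ⟨FreeAlgebra.lift ℂ (HA.genToHB p0 p1), by
    intro a b h
    induction h with
    | X_mul_Xinv i => simpa [HA.genToHB, HB.T, HB.X, HB.Xinv] using HB.mk_rel p0 p1 (.X_mul_Xinv i)
    | Xinv_mul_X i => simpa [HA.genToHB, HB.T, HB.X, HB.Xinv] using HB.mk_rel p0 p1 (.Xinv_mul_X i)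
    | X_comm i j => simpa [HA.genToHB, HB.T, HB.X, HB.Xinv] using HB.mk_rel p0 p1 (.X_comm i j)
    | braid3 i j hi hj h =>
      simpa [HA.genToHB, HB.T, HB.X, HB.Xinv] using HB.mk_rel p0 p1 (.braid3 i j (Nat.one_le_iff_ne_zero.2 hi) h)
    | braid2 i j hi hj h => simpa [HA.genToHB, HB.T, HB.X, HB.Xinv] using HB.mk_rel p0 p1 (.braid2 i j h)
    | hecke i hi =>
      have := HB.mk_rel p0 p1 (.hecke i)
      simpa [HA.genToHB, HB.T, par, hi] using this
    | bernstein_succ i j hi h => simpa [HA.genToHB, HB.T, HB.X, HB.Xinv] using HB.mk_rel p0 p1 (.bernstein_succ i j h)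
    | bernstein_comm i j hi h h' =>
      simpa [HA.genToHB, HB.T, HB.X, HB.Xinv] using HB.mk_rel p0 p1 (.bernstein_comm i j h h')⟩

/-- The induced module `B ⊗_A M` along `f : A → B`, as the quotient of `B ⊗_ℂ M` by the
`B`-submodule generated by the balancing relations. -/
abbrev Ind {A B : Type*} [Ring A] [Ring B] [Algebra ℂ A] [Algebra ℂ B] (f : A →ₐ[ℂ] B)
    (M : Type*) [AddCommGroup M] [Module ℂ M] [Module A M] : Type _ :=
  (B ⊗[ℂ] M) ⧸ Submodule.span B
    {z : B ⊗[ℂ] M | ∃ (b : B) (a : A) (x : M), z = (b * f a) ⊗ₜ[ℂ] x - b ⊗ₜ[ℂ] (a • x)}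

/-! ### Modules of type `J` and the action of `ℤ ⋊ ℤ₂` on `ℂ^*` -/

/-- `M` is a finite-dimensional `H_n^B`-module all of whose eigenvalues of `X_1, …, X_n` lie
in `J`. -/
def IsOfType {n : ℕ} (p0 p1 : ℂˣ) (J : Set ℂˣ) (M : Type*) [AddCommGroup M] [Module ℂ M]
    [Module (HB n p0 p1) M] [IsScalarTower ℂ (HB n p0 p1) M] : Prop :=
  FiniteDimensional ℂ M ∧
    ∀ (i : Fin n) (a : ℂ),
      Module.End.HasEigenvalue (Algebra.lsmul ℂ ℂ M (HB.X p0 p1 i)) a → ∃ u ∈ J, (u : ℂ) = a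

/-- The `ℤ ⋊ ℤ₂`-orbit of `a`, where `(k, ε)` acts by `a ↦ a^ε p₁^{2k}`. -/
def orbitZZ2 (p1 a : ℂˣ) : Set ℂˣ :=
  {b | ∃ (k : ℤ) (ε : ℤˣ), b = a ^ (ε : ℤ) * p1 ^ (2 * k)}

/-- The `ℤ`-orbit of `a`, where `k` acts by `a ↦ a p₁^{2k}`. -/
def orbitZ (p1 a : ℂˣ) : Set ℂˣ := {b | ∃ k : ℤ, b = a * p1 ^ (2 * k)}

/-- `J` is `ℤ ⋊ ℤ₂`-invariant. -/
def IsInvariantZZ2 (p1 : ℂˣ) (J : Set ℂˣ) : Prop :=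
  ∀ a ∈ J, ∀ (k : ℤ) (ε : ℤˣ), a ^ (ε : ℤ) * p1 ^ (2 * k) ∈ J

/-! ### The localized algebra -/

/-- The field `ℂ(X_1, …, X_r)`. -/
abbrev RatField (r : ℕ) : Type := FractionRing (MvPolynomial (Fin r) ℂ)

/-- The variable `X_{i+1}` of `ℂ(X_1, …, X_r)`. -/
noncomputable def kX {r : ℕ} (i : Fin r) : RatField r :=
  algebraMap (MvPolynomial (Fin r) ℂ) (RatField r) (MvPolynomial.X i)

section RelLoc

variable {r : ℕ} {p0 p1 : ℂˣ}

local notation "inH(" h ")" => FreeAlgebra.ι ℂ (Sum.inl h)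
local notation "inK(" f ")" => FreeAlgebra.ι ℂ (Sum.inr f)

/-- Relations saying that `H_r^B` and `ℂ(X_1, …, X_r)` map to the quotient by `ℂ`-algebra
homomorphisms, and that these agree on the Laurent polynomials in the `X_i`. -/
inductive HLocRel : FreeAlgebra ℂ (HB r p0 p1 ⊕ RatField r) →
    FreeAlgebra ℂ (HB r p0 p1 ⊕ RatField r) → Prop
  | addH (a b : HB r p0 p1) : HLocRel inH(a + b) (inH(a) + inH(b))
  | mulH (a b : HB r p0 p1) : HLocRel inH(a * b) (inH(a) * inH(b))
  | scalarH (c : ℂ) : HLocRel (inH(algebraMap ℂ (HB r p0 p1) c)) (algebraMap ℂ _ c)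
  | addK (a b : RatField r) : HLocRel inK(a + b) (inK(a) + inK(b))
  | mulK (a b : RatField r) : HLocRel inK(a * b) (inK(a) * inK(b))
  | scalarK (c : ℂ) : HLocRel (inK(algebraMap ℂ (RatField r) c)) (algebraMap ℂ _ c)
  | glue (i : Fin r) : HLocRel inH(HB.X p0 p1 i) inK(kX i)

end RelLoc

/-- The algebra `H_r^B ⊗_{Pol_r} ℂ(X_1, …, X_r)`, that is, the (noncommutative) localization of
`H_r^B` at the nonzero Laurent polynomials in the `X_i`, given by its universal property: it is the
universal `ℂ`-algebra receiving `H_r^B` and `ℂ(X_1, …, X_r)` compatibly on `Pol_r`. -/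
def HLoc (r : ℕ) (p0 p1 : ℂˣ) : Type := RingQuot (HLocRel (r := r) (p0 := p0) (p1 := p1))

noncomputable instance (r : ℕ) (p0 p1 : ℂˣ) : Ring (HLoc r p0 p1) :=
  inferInstanceAs (Ring (RingQuot (HLocRel (r := r) (p0 := p0) (p1 := p1))))

noncomputable instance (r : ℕ) (p0 p1 : ℂˣ) : Algebra ℂ (HLoc r p0 p1) :=
  inferInstanceAs (Algebra ℂ (RingQuot (HLocRel (r := r) (p0 := p0) (p1 := p1))))

namespace HLoc

noncomputable def mk (r : ℕ) (p0 p1 : ℂˣ) :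
    FreeAlgebra ℂ (HB r p0 p1 ⊕ RatField r) →ₐ[ℂ] HLoc r p0 p1 :=
  RingQuot.mkAlgHom ℂ (HLocRel (r := r) (p0 := p0) (p1 := p1))

variable {r : ℕ} (p0 p1 : ℂˣ)

theorem mk_rel {a b : FreeAlgebra ℂ (HB r p0 p1 ⊕ RatField r)} (h : HLocRel a b) :
    mk r p0 p1 a = mk r p0 p1 b :=
  RingQuot.mkAlgHom_rel ℂ h

/-- The canonical map `H_r^B → H_r^B ⊗_{Pol_r} ℂ(X_1, …, X_r)`. -/
noncomputable def ofHB : HB r p0 p1 →ₐ[ℂ] HLoc r p0 p1 :=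
  AlgHom.ofLinearMap
    { toFun := fun a => mk r p0 p1 (FreeAlgebra.ι ℂ (Sum.inl a))
      map_add' := fun a b => by simpa using mk_rel p0 p1 (.addH a b)
      map_smul' := fun c a => by
        have h1 := mk_rel p0 p1 (.mulH (algebraMap ℂ (HB r p0 p1) c) a)
        have h2 := mk_rel p0 p1 (.scalarH (r := r) (p0 := p0) (p1 := p1) c)
        simp only [map_mul, AlgHom.commutes] at h1 h2
        rw [h2] at h1
        simpa [Algebra.smul_def] using h1 }
    (by
      have h := mk_rel p0 p1 (.scalarH (r := r) (p0 := p0) (p1 := p1) 1)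
      simpa using h)
    (fun a b => by simpa using mk_rel p0 p1 (.mulH a b))

/-- The canonical map `ℂ(X_1, …, X_r) → H_r^B ⊗_{Pol_r} ℂ(X_1, …, X_r)`. -/
noncomputable def ofK : RatField r →ₐ[ℂ] HLoc r p0 p1 :=
  AlgHom.ofLinearMap
    { toFun := fun a => mk r p0 p1 (FreeAlgebra.ι ℂ (Sum.inr a))
      map_add' := fun a b => by simpa using mk_rel p0 p1 (.addK a b)
      map_smul' := fun c a => by
        have h1 := mk_rel p0 p1 (.mulK (algebraMap ℂ (RatField r) c) a)
        have h2 := mk_rel p0 p1 (.scalarK (r := r) (p0 := p0) (p1 := p1) c)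
        simp only [map_mul, AlgHom.commutes] at h1 h2
        rw [h2] at h1
        simpa [Algebra.smul_def] using h1 }
    (by
      have h := mk_rel p0 p1 (.scalarK (r := r) (p0 := p0) (p1 := p1) 1)
      simpa using h)
    (fun a b => by simpa using mk_rel p0 p1 (.mulK a b))

end HLoc

/-- `H_r^B` acts on its localization by left multiplication. -/
noncomputable instance (r : ℕ) (p0 p1 : ℂˣ) : Module (HB r p0 p1) (HLoc r p0 p1) :=
  Module.compHom (HLoc r p0 p1) (HLoc.ofHB (r := r) p0 p1).toRingHom

instance (r : ℕ) (p0 p1 : ℂˣ) : IsScalarTower ℂ (HB r p0 p1) (HLoc r p0 p1) where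
  smul_assoc c h x := by
    change HLoc.ofHB p0 p1 (c • h) * x = c • (HLoc.ofHB p0 p1 h * x)
    rw [map_smul, smul_mul_assoc]

/-- The Laurent monomial `X^{-α_i^∨}`: it is `X_1^{-2}` for `i = 0` and `X_i X_{i+1}^{-1}` for
`1 ≤ i < r`. -/
noncomputable def kRoot {r : ℕ} (i : Fin r) : RatField r :=
  if i.val = 0 then (kX i)⁻¹ ^ 2 else kX ⟨i.val - 1, by omega⟩ * (kX i)⁻¹

/-- The intertwiner
`φ̃_i = (p_i^{-1} - p_i X^{-α_i^∨})^{-1} ((1 - X^{-α_i^∨}) T_i - (p_i - p_i^{-1}))`. -/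
noncomputable def intertwiner {r : ℕ} (p0 p1 : ℂˣ) (i : Fin r) : HLoc r p0 p1 :=
  HLoc.ofK p0 p1
      (algebraMap ℂ (RatField r) (par p0 p1 i : ℂ)⁻¹
        - algebraMap ℂ (RatField r) (par p0 p1 i : ℂ) * kRoot i)⁻¹ *
    (HLoc.ofK p0 p1 (1 - kRoot i) * HLoc.ofHB p0 p1 (HB.T p0 p1 i)
      - algebraMap ℂ (HLoc r p0 p1) ((par p0 p1 i : ℂ) - (par p0 p1 i : ℂ)⁻¹))

/-- The element `φ̃_k ⋯ φ̃_1 T_0 φ̃_1 ⋯ φ̃_k`. -/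
noncomputable def conjT0 {r : ℕ} (p0 p1 : ℂˣ) : (k : ℕ) → k < r → HLoc r p0 p1
  | 0, h => HLoc.ofHB p0 p1 (HB.T p0 p1 ⟨0, h⟩)
  | k + 1, h =>
      intertwiner p0 p1 ⟨k + 1, h⟩ * conjT0 p0 p1 k (Nat.lt_of_succ_lt h)
        * intertwiner p0 p1 ⟨k + 1, h⟩

/-! ### The product `N ◇ M`

Throughout `n + m = r`; the first `n` of the `r` variables belong to `H_n^B`, the last `m` of them
to `H_m^B`. -/

section Diamond

variable {n m r : ℕ}

/-- Position in `Fin r` of the `i`-th of the first `n` variables. -/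
def posL (hr : n + m = r) (i : Fin n) : Fin r := ⟨i.val, by omega⟩

/-- Position in `Fin r` of the `j`-th of the last `m` variables. -/
def posR (hr : n + m = r) (j : Fin m) : Fin r := ⟨n + j.val, by omega⟩

/-- The factor of `D` belonging to a pair `i ≤ n < j`, evaluated at elements `x`, `y`, `y'` of a
`ℂ`-algebra standing for `X_i`, `X_j`, `X_j^{-1}`. -/
noncomputable def dFactor {R : Type*} [Ring R] [Algebra ℂ R] (p1 : ℂˣ) (x y y' : R) : R :=
  (x - (p1 : ℂ) ^ 2 • y) * (x - ((p1 : ℂ)⁻¹) ^ 2 • y) * (x - (p1 : ℂ) ^ 2 • y')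
    * (x - ((p1 : ℂ)⁻¹) ^ 2 • y') * (x - y) * (x - y')

/-- The product `D` over all pairs `i ≤ n < j`, evaluated in a `ℂ`-algebra. -/
noncomputable def dElem {R : Type*} [Ring R] [Algebra ℂ R] (p1 : ℂˣ)
    (x : Fin n → R) (y y' : Fin m → R) : R :=
  ((List.finRange n).map fun i =>
    ((List.finRange m).map fun j => dFactor p1 (x i) (y j) (y' j)).prod).prod

/-- The Laurent polynomial `D` in `ℂ(X_1, …, X_r)`. -/
noncomputable def kD (p1 : ℂˣ) (hr : n + m = r) : RatField r :=
  dElem p1 (fun i : Fin n => kX (posL hr i)) (fun j : Fin m => kX (posR hr j))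
    (fun j : Fin m => (kX (posR hr j))⁻¹)

/-- The algebra `F_{n,m} = ℂ[X_1^{±1}, …, X_r^{±1}, D^{-1}]`. -/
noncomputable def Floc (p1 : ℂˣ) (hr : n + m = r) : Subalgebra ℂ (RatField r) :=
  Algebra.adjoin ℂ (Set.range (kX (r := r)) ∪ Set.range (fun i : Fin r => (kX i)⁻¹)
    ∪ {(kD p1 hr)⁻¹})

/-- The left `H_r^B`-module `H_r^B ⊗_{Pol_r} F_{n,m}`, as the subspace `H_r^B · F_{n,m}` of
`H_r^B ⊗_{Pol_r} ℂ(X_1, …, X_r)`. -/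
noncomputable def HF (p0 p1 : ℂˣ) (hr : n + m = r) : Submodule (HB r p0 p1) (HLoc r p0 p1) :=
  Submodule.span (HB r p0 p1) (HLoc.ofK p0 p1 '' (Floc p1 hr : Set (RatField r)))

/-- The image of the generator `T_j` of `H_m^B` under the embedding of `H_m^B`: it is
`φ̃_n ⋯ φ̃_1 T_0 φ̃_1 ⋯ φ̃_n` for `j = 0` and `T_{n+j}` for `1 ≤ j < m`. -/
noncomputable def embT (p0 p1 : ℂˣ) (hr : n + m = r) (j : Fin m) : HLoc r p0 p1 :=
  if j.val = 0 then conjT0 p0 p1 n (by have := j.isLt; omega)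
  else HLoc.ofHB p0 p1 (HB.T p0 p1 (posR hr j))

variable (N M : Type*) [AddCommGroup N] [AddCommGroup M] [Module ℂ N] [Module ℂ M]

/-- The action of `D` on `N ⊗ M`, where `X_1, …, X_n` act on `N`, and `X_{n+1}, …, X_{n+m}` act
on `M` as the generators `X_1, …, X_m` of `H_m^B`. -/
noncomputable def actD (n m : ℕ) (p0 p1 : ℂˣ)
    [Module (HB n p0 p1) N] [IsScalarTower ℂ (HB n p0 p1) N]
    [Module (HB m p0 p1) M] [IsScalarTower ℂ (HB m p0 p1) M] : Module.End ℂ (N ⊗[ℂ] M) :=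
  dElem p1
    (fun i : Fin n => LinearMap.rTensor M (Algebra.lsmul ℂ ℂ N (HB.X p0 p1 i)))
    (fun j : Fin m => LinearMap.lTensor N (Algebra.lsmul ℂ ℂ M (HB.X p0 p1 j)))
    (fun j : Fin m => LinearMap.lTensor N (Algebra.lsmul ℂ ℂ M (HB.Xinv p0 p1 j)))

/-- The balancing relations `q a ⊗ v = q ⊗ a v` for `a` in the generators `T_i`, `X_i`
of `H_n^B` and of `H_m^B`, and `D^{-1}`, of the algebra `(H_n^B ⊗ H_m^B) ⊗_{Pol_r} F_{n,m}`. Here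
`q` and `q' = q a` lie in `H_r^B ⊗_{Pol_r} F_{n,m}`, which is stable under right multiplication by
these elements of `HLoc`. Being balanced over an algebra is the same as being balanced over a set
of generators. -/
inductive DiamondRel (p0 p1 : ℂˣ) (hr : n + m = r)
    [Module (HB n p0 p1) N] [IsScalarTower ℂ (HB n p0 p1) N]
    [Module (HB m p0 p1) M] [IsScalarTower ℂ (HB m p0 p1) M] :
    (HF p0 p1 hr) ⊗[ℂ] (N ⊗[ℂ] M) → Prop
  | leftT (i : Fin n) (q q' : HF p0 p1 hr) (x : N) (y : M)
      (h : (q' : HLoc r p0 p1) = q * HLoc.ofHB p0 p1 (HB.T p0 p1 (posL hr i))) :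
      DiamondRel p0 p1 hr (q' ⊗ₜ[ℂ] (x ⊗ₜ[ℂ] y) - q ⊗ₜ[ℂ] ((HB.T p0 p1 i • x) ⊗ₜ[ℂ] y))
  | leftX (i : Fin n) (q q' : HF p0 p1 hr) (x : N) (y : M)
      (h : (q' : HLoc r p0 p1) = q * HLoc.ofHB p0 p1 (HB.X p0 p1 (posL hr i))) :
      DiamondRel p0 p1 hr (q' ⊗ₜ[ℂ] (x ⊗ₜ[ℂ] y) - q ⊗ₜ[ℂ] ((HB.X p0 p1 i • x) ⊗ₜ[ℂ] y))
  | rightT (j : Fin m) (q q' : HF p0 p1 hr) (x : N) (y : M)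
      (h : (q' : HLoc r p0 p1) = q * embT p0 p1 hr j) :
      DiamondRel p0 p1 hr (q' ⊗ₜ[ℂ] (x ⊗ₜ[ℂ] y) - q ⊗ₜ[ℂ] (x ⊗ₜ[ℂ] (HB.T p0 p1 j • y)))
  | rightX (j : Fin m) (q q' : HF p0 p1 hr) (x : N) (y : M)
      (h : (q' : HLoc r p0 p1) = q * HLoc.ofHB p0 p1 (HB.X p0 p1 (posR hr j))) :
      DiamondRel p0 p1 hr (q' ⊗ₜ[ℂ] (x ⊗ₜ[ℂ] y) - q ⊗ₜ[ℂ] (x ⊗ₜ[ℂ] (HB.X p0 p1 j • y)))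
  | invD (q q' : HF p0 p1 hr) (v w : N ⊗[ℂ] M)
      (h : (q' : HLoc r p0 p1) = q * HLoc.ofK p0 p1 (kD p1 hr)⁻¹)
      (hw : actD N M n m p0 p1 w = v) :
      DiamondRel p0 p1 hr (q' ⊗ₜ[ℂ] v - q ⊗ₜ[ℂ] w)

/-- The `H_r^B`-module
`N ◇ M = (H_r^B ⊗_{Pol_r} F_{n,m}) ⊗_{(H_n^B ⊗ H_m^B) ⊗_{Pol_r} F_{n,m}} (N ⊗ M)`, `r = n + m`. -/
abbrev Diamond (p0 p1 : ℂˣ) (hr : n + m = r)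
    [Module (HB n p0 p1) N] [IsScalarTower ℂ (HB n p0 p1) N]
    [Module (HB m p0 p1) M] [IsScalarTower ℂ (HB m p0 p1) M] : Type _ :=
  ((HF p0 p1 hr) ⊗[ℂ] (N ⊗[ℂ] M)) ⧸
    Submodule.span (HB r p0 p1) {z | DiamondRel N M p0 p1 hr z}

end Diamond

end AffineHecke

open AffineHecke

/-!
# Irreducible modules of affine Hecke algebras of type B and their blocks

Both constructions in question, `N ◇ M` and induction from `H_n^A`, are tensor products of a
localization of `H_r^B` with a simple module `E` of an algebra `𝔄` (`H_n^B ⊗ H_m^B`, respectively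
`H_n^A`), on which a denominator `z` acts by a nonzero scalar. After localization at `z`, the
algebra `H_r^B` becomes free over the localization of `𝔄`, with a basis that permutes the variables
`X_i` and their inverses. The eigenvalues of the `X_i` therefore tell the components of the tensor
product apart, and the intertwiners allow one to move into any component that one wishes.

**The polynomial representation.** All algebras are realized as operators on `ℂ(X_1, …, X_r)`: the
`X_i` act by multiplication and the `T_i` by Demazure–Lusztig operators `p + a (s - 1)`. This
representation is faithful (`varRep_injective`): over the Laurent polynomials `H_r^B` is spanned by
`2^r r!` products of the `T_i`, and the span of their images over `ℂ(X_1, …, X_r)` contains all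
signed permutations of the variables, which are as many and are linearly independent by Dedekind's
lemma. The same count handles `H_n^B ⊗ H_m^B` (`pairRep_injective`), and the localized algebra is
faithfully represented as well (`HLoc.rep_injective`). There the normalized intertwiners become the
simple reflections (`rep_intertwiner`), so that the conjugate of `T_0` by intertwiners is the
Demazure–Lusztig operator attached to the change of sign of `X_{n+1}` (`rep_embT`).

**Coset data.** Only inverses of a single element `z` are needed, and the localization is the space
`rightLoc` of the operators `q` for which some `q z^k` comes from the algebra. A `CosetDatum`
records that the localization of `H_r^B` has a basis of automorphisms over that of `𝔄`: the shuffles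
for two blocks of variables (`pairDatum`), and the minimal representatives of the symmetric group in
the hyperoctahedral group for `H_n^A` (`indDatum`). The denominators are symmetric for the Weyl
group of `𝔄`, and are divisible by `p - p⁻¹ e` and `1 - e` for the roots `e` that the basis elements
meet; this makes the basis elements fractions with denominator a power of `z`, and gives the
expansion of `T_i w` for `w` in the basis.
A `CosetDatum` has its balanced products `IsBalancedProduct`, and `N ◇ M` and the induced modules
are such (`isBalancedProduct_diamond`, `exists_isBalancedProduct_ind`). By freeness, `E` embeds in
its balanced product (`cl_one_injective`).

**Simplicity.** On the component of the automorphism `w`, the operator `X_i` has the eigenvalues of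
`w⁻¹(X_i)` on `E`. If the eigenvalues of a weight vector are compatible with the trivial coset only,
the vector comes from `E` (`exists_eq_cl_one`). The intertwiners provide such vectors in every
nonzero submodule: `X_i`-eigenvalues in `J₁` and in `J₂` never differ by a factor `p₁^{±2}` and can
be exchanged until those in `J₁` come first (`exists_sorted_weight`); an eigenvalue in `J_-` can be
moved to the first position and inverted there, since it is not `±p₀^{±1}`
(`exists_positive_weight`). Hence every nonzero submodule meets `E`, and as `E` is simple and
generates, the balanced product is simple (`IsBalancedProduct.isSimpleModule`).

**Decomposition.** Conversely, a simple module `L` contains a weight vector `x` of the sorted, or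
positive, kind, and `z` acts on it by a nonzero scalar. The algebra `𝔄` acts on the corresponding
eigenspace of `z` (`exists_action`), so `x` generates an `𝔄`-module `W` (`exists_cyclic`). Central
polynomials such as `∏ (t - X_k - X_k⁻¹)` show that all eigenvalues on `W` are, up to inversion,
those of `x` (`exists_eq_of_central`). A simple module that maps to `W` extends to a nonzero map
from the balanced product to `L` (`exists_hom`), and a nonzero map between simple modules is an
isomorphism.
-/

namespace AffineHecke

/-! ### Demazure–Lusztig operators -/

/-- Elements `x 0, …, x (m-1)` of a field together with automorphisms `s 0, …, s (m-1)` that act on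
them as the simple reflections of the Weyl group of type `B_m`: `s 0` inverts `x 0`, and `s i`
exchanges `x (i-1)` and `x i` for `i ≥ 1`. -/
structure ReflectionDatum (m : ℕ) (K : Type*) [Field K] [Algebra ℂ K] where
  x : Fin m → K
  s : Fin m → K ≃ₐ[ℂ] K
  x_ne_zero : ∀ i, x i ≠ 0
  x_ne : ∀ {i j}, i ≠ j → x i ≠ x j
  x_mul_ne : ∀ i j, x i * x j ≠ 1
  s_s : ∀ i f, s i (s i f) = f
  s_zero : ∀ i : Fin m, i.val = 0 → s i (x i) = (x i)⁻¹
  s_left : ∀ i j : Fin m, j.val + 1 = i.val → s i (x j) = x i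
  s_right : ∀ i j : Fin m, j.val + 1 = i.val → s i (x i) = x j
  s_fix : ∀ i j : Fin m, j.val + 1 ≠ i.val → j ≠ i → s i (x j) = x j
  braid4 : ∀ i j : Fin m, i.val = 0 → j.val = 1 → ∀ f,
    s i (s j (s i (s j f))) = s j (s i (s j (s i f)))
  braid3 : ∀ i j : Fin m, 1 ≤ i.val → j.val = i.val + 1 → ∀ f,
    s i (s j (s i f)) = s j (s i (s j f))
  braid2 : ∀ i j : Fin m, i.val + 1 < j.val → ∀ f, s i (s j f) = s j (s i f)

/-- The coefficient `(p⁻¹ - p e) / (1 - e)` of the reflection in a Demazure–Lusztig operator with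
parameter `p` and root `e`. -/
noncomputable def dlCoeff {K : Type*} [Field K] (p e : K) : K := (p⁻¹ - p * e) / (1 - e)

theorem dlCoeff_eq {K : Type*} [Field K] {p e : K} (he : e ≠ 1) :
    dlCoeff p e = p + (p⁻¹ - p) * (1 - e)⁻¹ := by
  have := sub_ne_zero.2 he.symm
  rw [dlCoeff]
  field_simp
  ring

theorem map_dlCoeff {K : Type*} [Field K] [Algebra ℂ K] (σ : K ≃ₐ[ℂ] K) (c : ℂ) (e : K) :
    σ (dlCoeff (algebraMap ℂ K c) e) = dlCoeff (algebraMap ℂ K c) (σ e) := by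
  simp [dlCoeff]

/-- The Demazure–Lusztig operator `f ↦ p f + a (s f - f)` with `a = (p⁻¹ - p e) / (1 - e)`. -/
noncomputable def dlOp {K : Type*} [Field K] [Algebra ℂ K] (p : ℂ) (e : K) (s : K ≃ₐ[ℂ] K) :
    Module.End ℂ K :=
  p • 1 + Algebra.lmul ℂ K (dlCoeff (algebraMap ℂ K p) e) * (s.toLinearMap - 1)

theorem dlOp_apply {K : Type*} [Field K] [Algebra ℂ K] (p : ℂ) (e : K) (s : K ≃ₐ[ℂ] K) (f : K) :
    dlOp p e s f = algebraMap ℂ K p * f + dlCoeff (algebraMap ℂ K p) e * (s f - f) := by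
  simp [dlOp, Algebra.smul_def]

section Braid

variable {K : Type*} [Field K] [Algebra ℂ K]

theorem dlOp_braid_three {σ τ : K ≃ₐ[ℂ] K} {p : ℂ} (hp : p ≠ 0) {x y z : K}
    (hy : y ≠ 0) (hz : z ≠ 0) (hxy : x ≠ y) (hyz : y ≠ z) (hxz : x ≠ z)
    (h1 : σ x = y) (h2 : σ y = x) (h3 : σ z = z) (h4 : τ x = x) (h5 : τ y = z) (h6 : τ z = y)
    (hs : ∀ f, σ (σ f) = f) (ht : ∀ f, τ (τ f) = f) (hb : ∀ f, σ (τ (σ f)) = τ (σ (τ f))) :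
    dlOp p (x * y⁻¹) σ * dlOp p (y * z⁻¹) τ * dlOp p (x * y⁻¹) σ =
      dlOp p (y * z⁻¹) τ * dlOp p (x * y⁻¹) σ * dlOp p (y * z⁻¹) τ := by
  ext f
  have hp' : algebraMap ℂ K p ≠ 0 := by simpa using hp
  have e1 := sub_ne_zero.2 hxy
  have e2 := sub_ne_zero.2 hyz
  have e3 := sub_ne_zero.2 hxz
  have e1' := sub_ne_zero.2 hxy.symm
  have e2' := sub_ne_zero.2 hyz.symm
  have e3' := sub_ne_zero.2 hxz.symm
  have d : ∀ {u v : K}, u ≠ 0 → dlCoeff (algebraMap ℂ K p) (v * u⁻¹) =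
      ((algebraMap ℂ K p)⁻¹ * u - (algebraMap ℂ K p) * v) / (u - v) := by
    intro u v hu
    rw [dlCoeff]
    field_simp
  simp only [Module.End.mul_apply, dlOp_apply]
  rw [d hy, d hz]
  simp only [map_add, map_sub, map_mul, map_div₀, map_inv₀, AlgEquiv.commutes, h1, h2, h3, h4, h5,
    h6, hs, ht, hb]
  generalize algebraMap ℂ K p = p at *
  field_simp
  ring

/-- The braid relation of length four for reflections `S = q σ + k A (σ - 1)` and
`T = p τ + l C (τ - 1)`. The hypotheses `R1`, `R2` are satisfied by the values of `u ↦ (1 - u)⁻¹` at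
`x⁻²`, `y⁻²`, `x y⁻¹`, `x⁻¹ y⁻¹`, which are called `A`, `B`, `C`, `D`. -/
theorem braid_four_aux (σ τ : K ≃ₐ[ℂ] K) (p q k l A B C D : K)
    (hk : σ k = k) (hl : σ l = l) (tk : τ k = k) (tl : τ l = l)
    (R1 : B * (C + D - 1) = C * D) (R2 : D * (A + C - 1) = A * C)
    (pσ : σ p = p) (pτ : τ p = p) (qσ : σ q = q) (qτ : τ q = q)
    (h1 : σ A = 1 - A) (h2 : σ B = B) (h3 : σ C = D) (h3' : σ D = C)
    (h4 : τ A = B) (h5 : τ B = A) (h6 : τ C = 1 - C) (h7 : τ D = D)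
    (hs : ∀ f, σ (σ f) = f) (ht : ∀ f, τ (τ f) = f)
    (hb : ∀ f, σ (τ (σ (τ f))) = τ (σ (τ (σ f)))) (S T : K → K)
    (hS : ∀ f, S f = q * σ f + k * A * (σ f - f))
    (hT : ∀ f, T f = p * τ f + l * C * (τ f - f)) (f : K) :
    S (T (S (T f))) = T (S (T (S f))) := by
  -- After expanding, both sides are combinations of the eight elements `w f`, `w ∈ ⟨σ, τ⟩`; these
  -- are abstracted to independent unknowns, and the coefficients are compared by means of `R1` and
  -- `R2`.
  simp only [hS, hT, map_add, map_sub, map_mul, map_one, pσ, pτ, qσ, qτ, h1, h2, h3, h3', h4, h5,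
    h6, h7, hs, ht, hb, hk, hl, tk, tl]
  generalize τ (σ (τ (σ f))) = f7
  generalize (σ (τ (σ f))) = f6
  generalize τ (σ (τ (f))) = f5
  generalize τ (σ f) = f4
  generalize σ (τ f) = f3
  generalize τ f = f2
  generalize σ f = f1
  clear hs ht hb hS hT h1 h2 h3 h3' h4 h5 h6 h7 pσ pτ qσ qτ hk hl tk tl S T σ τ
  grind

/-- The braid relation between the operators of `T_0` and `T_1`. -/
theorem dlOp_braid_four {σ τ : K ≃ₐ[ℂ] K} {p q : ℂ} {x y : K}
    (hx : x ≠ 0) (hy : y ≠ 0) (hxy : x ≠ y) (hxy' : x * y ≠ 1) (hx1 : x * x ≠ 1) (hy1 : y * y ≠ 1)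
    (h1 : σ x = x⁻¹) (h2 : σ y = y) (h4 : τ x = y) (h5 : τ y = x)
    (hs : ∀ f, σ (σ f) = f) (ht : ∀ f, τ (τ f) = f)
    (hb : ∀ f, σ (τ (σ (τ f))) = τ (σ (τ (σ f)))) :
    dlOp q (x⁻¹ ^ 2) σ * dlOp p (x * y⁻¹) τ * dlOp q (x⁻¹ ^ 2) σ * dlOp p (x * y⁻¹) τ =
      dlOp p (x * y⁻¹) τ * dlOp q (x⁻¹ ^ 2) σ * dlOp p (x * y⁻¹) τ * dlOp q (x⁻¹ ^ 2) σ := by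
  ext f
  simp only [Module.End.mul_apply]
  have e1 := sub_ne_zero.2 hxy
  have e1' := sub_ne_zero.2 hxy.symm
  have e2 := sub_ne_zero.2 hxy'
  have e2' := sub_ne_zero.2 (mul_comm x y ▸ hxy')
  rw [← sq] at hx1 hy1
  have e3 := sub_ne_zero.2 hx1
  have e3' := sub_ne_zero.2 hx1.symm
  have e4 := sub_ne_zero.2 hy1
  have n1 : x⁻¹ ^ 2 ≠ 1 := fun h => hx1 (by field_simp at h; exact h.symm)
  have n2 : x * y⁻¹ ≠ 1 := fun h => hxy (by field_simp at h; exact h)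
  have A1 : (1 - x⁻¹ ^ 2)⁻¹ = x ^ 2 / (x ^ 2 - 1) := by field_simp
  have B1 : (1 - y⁻¹ ^ 2)⁻¹ = y ^ 2 / (y ^ 2 - 1) := by field_simp
  have C1 : (1 - x * y⁻¹)⁻¹ = y / (y - x) := by field_simp
  have D1 : (1 - x⁻¹ * y⁻¹)⁻¹ = x * y / (x * y - 1) := by field_simp
  refine braid_four_aux σ τ (algebraMap ℂ K p) (algebraMap ℂ K q)
    ((algebraMap ℂ K q)⁻¹ - algebraMap ℂ K q) ((algebraMap ℂ K p)⁻¹ - algebraMap ℂ K p)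
    (1 - x⁻¹ ^ 2)⁻¹ (1 - y⁻¹ ^ 2)⁻¹ (1 - x * y⁻¹)⁻¹ (1 - x⁻¹ * y⁻¹)⁻¹
    (by simp) (by simp) (by simp) (by simp) ?_ ?_ (by simp) (by simp) (by simp) (by simp)
    ?_ (by simp [h2]) (by simp [h1, h2]) (by simp [h1, h2]) (by simp [h4]) (by simp [h5]) ?_
    (by simp [h4, h5, mul_comm]) hs ht hb _ _
    (fun f => by rw [dlOp_apply, dlCoeff_eq n1]; ring)
    (fun f => by rw [dlOp_apply, dlCoeff_eq n2]; ring) f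
  · rw [B1, C1, D1]
    field_simp
    ring
  · rw [A1, C1, D1]
    field_simp
    ring
  · simp only [map_inv₀, map_sub, map_one, map_pow, h1, inv_inv]
    rw [A1]
    field_simp
    ring
  · simp only [map_inv₀, map_sub, map_one, map_mul, h4, h5]
    rw [C1]
    field_simp
    ring

theorem dlOp_comm {σ τ : K ≃ₐ[ℂ] K} {p q : ℂ} {d e : K} (h1 : σ d = d) (h2 : τ e = e)
    (hb : ∀ f, σ (τ f) = τ (σ f)) :
    dlOp p e σ * dlOp q d τ = dlOp q d τ * dlOp p e σ := by
  ext f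
  simp only [Module.End.mul_apply, dlOp_apply, map_add, map_sub, map_mul, map_dlCoeff, h1, h2, hb,
    AlgEquiv.commutes]
  ring

theorem dlOp_hecke {σ : K ≃ₐ[ℂ] K} {p : ℂ} {e : K} (hp : p ≠ 0) (he : e ≠ 1)
    (he0 : e ≠ 0) (h1 : σ e = e⁻¹) (hs : ∀ f, σ (σ f) = f) :
    (dlOp p e σ - algebraMap ℂ _ p) * (dlOp p e σ + algebraMap ℂ _ p⁻¹) = 0 := by
  ext f
  have hp' : algebraMap ℂ K p ≠ 0 := by simpa using hp
  have e1 := sub_ne_zero.2 he.symm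
  have e2 := sub_ne_zero.2 he
  simp only [Module.End.mul_apply, LinearMap.sub_apply, LinearMap.add_apply, dlOp_apply, map_add,
    map_sub, map_mul, map_dlCoeff, h1, hs, AlgEquiv.commutes, LinearMap.zero_apply, map_inv₀,
    Module.algebraMap_end_apply, Algebra.smul_def]
  simp only [dlCoeff]
  generalize algebraMap ℂ K p = p at *
  field_simp
  ring

theorem dlOp_mul_lmul {σ : K ≃ₐ[ℂ] K} {p : ℂ} {e : K} (f : K) :
    dlOp p e σ * Algebra.lmul ℂ K f = Algebra.lmul ℂ K (σ f) * dlOp p e σ +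
      Algebra.lmul ℂ K ((algebraMap ℂ K p - dlCoeff (algebraMap ℂ K p) e) * (f - σ f)) := by
  ext g
  simp only [Module.End.mul_apply, LinearMap.add_apply, dlOp_apply, map_mul, Algebra.coe_lmul_eq_mul,
    LinearMap.mul_apply']
  ring

/-- If `e = x y⁻¹`, then multiplication by `x` and by `y = σ x` satisfy the Bernstein relation. -/
theorem dlOp_bernstein {σ : K ≃ₐ[ℂ] K} {p : ℂ} {x y : K} (hp : p ≠ 0) (hx : x ≠ 0) (hy : y ≠ 0)
    (hxy : x ≠ y) (h1 : σ x = y) (h2 : σ y = x) (hs : ∀ f, σ (σ f) = f) :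
    dlOp p (x * y⁻¹) σ * Algebra.lmul ℂ K x * dlOp p (x * y⁻¹) σ = Algebra.lmul ℂ K y := by
  ext f
  have hp' : algebraMap ℂ K p ≠ 0 := by simpa using hp
  have e1 := sub_ne_zero.2 hxy
  have e1' := sub_ne_zero.2 hxy.symm
  simp only [Module.End.mul_apply, dlOp_apply, map_mul, Algebra.coe_lmul_eq_mul,
    LinearMap.mul_apply', map_add, map_sub, h1, h2, hs, map_dlCoeff, AlgEquiv.commutes, map_inv₀]
  simp only [dlCoeff]
  generalize algebraMap ℂ K p = p at *
  field_simp
  ring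

end Braid

namespace ReflectionDatum

variable {m : ℕ} {K : Type*} [Field K] [Algebra ℂ K] (R : ReflectionDatum m K) (p0 p1 : ℂˣ)

/-- The Laurent monomial `X^{-α_i^∨}` in the variables of the datum. -/
noncomputable def root (i : Fin m) : K :=
  if i.val = 0 then (R.x i)⁻¹ ^ 2 else R.x ⟨i.val - 1, by omega⟩ * (R.x i)⁻¹

/-- The Demazure–Lusztig operator attached to `s i`. -/
noncomputable def op (i : Fin m) : Module.End ℂ K := dlOp (par p0 p1 i : ℂ) (R.root i) (R.s i)

theorem root_zero {i : Fin m} (hi : i.val = 0) : R.root i = (R.x i)⁻¹ ^ 2 := by simp [root, hi]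

theorem root_succ {i j : Fin m} (h : j.val + 1 = i.val) : R.root i = R.x j * (R.x i)⁻¹ := by
  have : (⟨i.val - 1, by omega⟩ : Fin m) = j := Fin.ext (by simp; omega)
  simp [root, this, show i.val ≠ 0 by omega]

theorem root_ne_zero (i : Fin m) : R.root i ≠ 0 := by
  unfold root
  split_ifs <;> simp [R.x_ne_zero]

theorem root_ne_one (i : Fin m) : R.root i ≠ 1 := by
  have hi := R.x_ne_zero i
  unfold root
  split_ifs with h
  · intro h
    apply R.x_mul_ne i i
    field_simp at h
    rw [← sq, h]
  · intro h'
    refine R.x_ne (i := ⟨i.val - 1, by omega⟩) (j := i) (fun h'' => ?_) ?_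
    · have := congrArg Fin.val h''
      simp at this
      omega
    · field_simp at h'
      exact h'

theorem s_root (i : Fin m) : R.s i (R.root i) = (R.root i)⁻¹ := by
  unfold root
  split_ifs with h
  · simp [R.s_zero i h]
  · have h1 := R.s_left i ⟨i.val - 1, by omega⟩ (by simp; omega)
    have h2 := R.s_right i ⟨i.val - 1, by omega⟩ (by simp; omega)
    simp [h1, h2, mul_comm]

theorem s_root_of_lt {i j : Fin m} (h : i.val + 1 < j.val) : R.s i (R.root j) = R.root j := by
  have h1 := R.s_fix i j (by omega) (by rintro rfl; omega)
  have h2 := R.s_fix i ⟨j.val - 1, by omega⟩ (by simp; omega)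
    (by intro h; simp [Fin.ext_iff] at h; omega)
  rw [R.root_succ (j := ⟨j.val - 1, by omega⟩) (by simp; omega)]
  simp [h1, h2]

theorem s_root_of_gt {i j : Fin m} (h : i.val + 1 < j.val) : R.s j (R.root i) = R.root i := by
  have h1 := R.s_fix j i (by omega) (by rintro rfl; omega)
  unfold root
  split_ifs with h0
  · simp [h1]
  · have h2 := R.s_fix j ⟨i.val - 1, by omega⟩ (by simp; omega)
      (by intro h; simp [Fin.ext_iff] at h; omega)
    simp [h1, h2]

/-- The images of the generators of `H_m^B` in the polynomial representation. -/
noncomputable def genRep : HBGen m → Module.End ℂ K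
  | .T i => R.op p0 p1 i
  | .X i => Algebra.lmul ℂ K (R.x i)
  | .Xinv i => Algebra.lmul ℂ K (R.x i)⁻¹

theorem par_zero {i : Fin m} (hi : i.val = 0) : par p0 p1 i = p0 := by simp [par, hi]

theorem par_pos {i : Fin m} (hi : 1 ≤ i.val) : par p0 p1 i = p1 := by
  simp [par, show i.val ≠ 0 by omega]

/-- The polynomial representation of `H_m^B`, in which the `T_i` act by Demazure–Lusztig operators
and the `X_i` by multiplication. -/
noncomputable def rep : HB m p0 p1 →ₐ[ℂ] Module.End ℂ K :=
  RingQuot.liftAlgHom ℂ ⟨FreeAlgebra.lift ℂ (R.genRep p0 p1), by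
    intro a b h
    induction h with
    | X_mul_Xinv i =>
      simp only [map_mul, FreeAlgebra.lift_ι_apply, genRep, map_one]
      rw [← map_mul, mul_inv_cancel₀ (R.x_ne_zero i), map_one]
    | Xinv_mul_X i =>
      simp only [map_mul, FreeAlgebra.lift_ι_apply, genRep, map_one]
      rw [← map_mul, inv_mul_cancel₀ (R.x_ne_zero i), map_one]
    | X_comm i j =>
      simp only [map_mul, FreeAlgebra.lift_ι_apply, genRep]
      rw [← map_mul, ← map_mul, mul_comm]
    | braid4 i j hi hj =>
      simp only [map_mul, FreeAlgebra.lift_ι_apply, genRep, op, par_zero p0 p1 hi,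
        par_pos p0 p1 hj.ge, R.root_zero hi, R.root_succ (i := j) (j := i) (by omega)]
      have hij : i ≠ j := by rintro rfl; omega
      exact dlOp_braid_four (R.x_ne_zero _) (R.x_ne_zero _) (R.x_ne hij) (R.x_mul_ne _ _)
        (R.x_mul_ne _ _) (R.x_mul_ne _ _) (R.s_zero i hi) (R.s_fix i j (by omega) hij.symm)
        (R.s_left j i (by omega)) (R.s_right j i (by omega)) (R.s_s i) (R.s_s j)
        (R.braid4 i j hi hj)
    | braid3 i j hi hj =>
      obtain ⟨k, hk⟩ : ∃ k : Fin m, k.val + 1 = i.val := ⟨⟨i.val - 1, by omega⟩, by simp; omega⟩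
      simp only [map_mul, FreeAlgebra.lift_ι_apply, genRep, op,
        par_pos p0 p1 hi, par_pos p0 p1 (show 1 ≤ j.val by omega), R.root_succ hk,
        R.root_succ (i := j) (j := i) (by omega)]
      have hij : i ≠ j := by rintro rfl; omega
      have hkj : k ≠ j := by rintro rfl; omega
      have hki : k ≠ i := by rintro rfl; omega
      exact dlOp_braid_three (by simp) (R.x_ne_zero _) (R.x_ne_zero _) (R.x_ne hki)
        (R.x_ne hij) (R.x_ne hkj) (R.s_left i k hk) (R.s_right i k hk)
        (R.s_fix i j (by omega) hij.symm) (R.s_fix j k (by omega) hkj)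
        (R.s_left j i (by omega)) (R.s_right j i (by omega)) (R.s_s i) (R.s_s j)
        (R.braid3 i j hi hj)
    | braid2 i j h =>
      simp only [map_mul, FreeAlgebra.lift_ι_apply, genRep, op]
      exact dlOp_comm (R.s_root_of_lt h) (R.s_root_of_gt h) (R.braid2 i j h)
    | hecke i =>
      simp only [map_mul, map_add, map_sub, FreeAlgebra.lift_ι_apply, genRep, op, AlgHom.commutes,
        map_zero]
      exact dlOp_hecke (by simp) (R.root_ne_one i) (R.root_ne_zero i) (R.s_root i) (R.s_s i)
    | bernstein_zero i hi =>
      simp only [map_mul, FreeAlgebra.lift_ι_apply, genRep, op]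
      have h := dlOp_bernstein (σ := R.s i) (p := (par p0 p1 i : ℂ)) (x := (R.x i)⁻¹) (y := R.x i)
        (by simp) (by simp [R.x_ne_zero]) (R.x_ne_zero i)
        (fun h => R.x_mul_ne i i (by nth_rw 1 [← h]; simp [R.x_ne_zero]))
        (by simp [R.s_zero i hi]) (R.s_zero i hi) (R.s_s i)
      rwa [← sq, ← R.root_zero hi] at h
    | bernstein_succ i j h =>
      simp only [map_mul, FreeAlgebra.lift_ι_apply, genRep, op, R.root_succ h]
      exact dlOp_bernstein (by simp) (R.x_ne_zero _) (R.x_ne_zero _)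
        (R.x_ne (by rintro rfl; omega)) (R.s_left i j h) (R.s_right i j h) (R.s_s i)
    | bernstein_comm i j h h' =>
      simp only [map_mul, FreeAlgebra.lift_ι_apply, genRep, op]
      rw [dlOp_mul_lmul, R.s_fix i j h h']
      simp⟩

theorem rep_mk (g : HBGen m) :
    R.rep p0 p1 (HB.mk m p0 p1 (FreeAlgebra.ι ℂ g)) = R.genRep p0 p1 g :=
  (RingQuot.liftAlgHom_mkAlgHom_apply ℂ _ _ _).trans (FreeAlgebra.lift_ι_apply _ _)

theorem rep_T (i : Fin m) : R.rep p0 p1 (HB.T p0 p1 i) = R.op p0 p1 i :=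
  R.rep_mk p0 p1 (.T i)

theorem rep_X (i : Fin m) : R.rep p0 p1 (HB.X p0 p1 i) = Algebra.lmul ℂ K (R.x i) :=
  R.rep_mk p0 p1 (.X i)

theorem rep_Xinv (i : Fin m) : R.rep p0 p1 (HB.Xinv p0 p1 i) = Algebra.lmul ℂ K (R.x i)⁻¹ :=
  R.rep_mk p0 p1 (.Xinv i)

end ReflectionDatum

/-! ### Signed permutations of the variables -/

section SignedPerm

variable {r : ℕ}

theorem kX_ne_zero (i : Fin r) : kX i ≠ 0 := by
  simp [kX]

theorem kX_injective : Function.Injective (kX (r := r)) :=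
  (IsFractionRing.injective (MvPolynomial (Fin r) ℂ) (RatField r)).comp
    (MvPolynomial.X_injective)

theorem kX_mul_ne_one (i j : Fin r) : kX i * kX j ≠ 1 := by
  intro h
  rw [kX, kX, ← map_mul, ← map_one (algebraMap (MvPolynomial (Fin r) ℂ) (RatField r))] at h
  have h' := IsFractionRing.injective (MvPolynomial (Fin r) ℂ) (RatField r) h
  simpa using congrArg (MvPolynomial.eval (0 : Fin r → ℂ)) h'

theorem kX_ne_inv (i j : Fin r) : kX i ≠ (kX j)⁻¹ := fun h =>
  kX_mul_ne_one i j (by rw [h, inv_mul_cancel₀ (kX_ne_zero j)])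

theorem ratField_algHom_ext {A : Type*} [Semiring A] [Algebra ℂ A]
    {σ τ : RatField r →ₐ[ℂ] A} (h : ∀ i, σ (kX i) = τ (kX i)) : σ = τ := by
  have : σ.comp (IsScalarTower.toAlgHom ℂ (MvPolynomial (Fin r) ℂ) (RatField r)) =
      τ.comp (IsScalarTower.toAlgHom ℂ (MvPolynomial (Fin r) ℂ) (RatField r)) :=
    MvPolynomial.algHom_ext (fun i => h i)
  apply AlgHom.coe_ringHom_injective
  apply IsLocalization.ringHom_ext (nonZeroDivisors (MvPolynomial (Fin r) ℂ))
  ext x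
  · exact DFunLike.congr_fun this (MvPolynomial.C x)
  · exact DFunLike.congr_fun this (MvPolynomial.X x)

theorem ratField_algEquiv_ext {σ τ : RatField r ≃ₐ[ℂ] RatField r}
    (h : ∀ i, σ (kX i) = τ (kX i)) : σ = τ := by
  have := ratField_algHom_ext (σ := σ.toAlgHom) (τ := τ.toAlgHom) h
  ext f
  exact DFunLike.congr_fun this f

/-- The `Fin r`-indexed family `X_{π i}^{ε_i}` generates a field over which `ℂ(X_1, …, X_r)` is
algebraic, so it is a transcendence basis by comparison of cardinalities. -/
theorem algebraicIndependent_signed (π : Equiv.Perm (Fin r)) (ε : Fin r → ℤˣ) :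
    AlgebraicIndependent ℂ (fun i => kX (π i) ^ (ε i : ℤ)) := by
  set y : Fin r → RatField r := fun i => kX (π i) ^ (ε i : ℤ) with hy
  have hb : IsTranscendenceBasis ℂ (kX (r := r)) :=
    have := IsLocalization.isAlgebraic (RatField r) (nonZeroDivisors (MvPolynomial (Fin r) ℂ))
    (IsTranscendenceBasis.mvPolynomial (Fin r) ℂ).algebraMap_comp (A := RatField r)
  have alg : Algebra.IsAlgebraic (Algebra.adjoin ℂ (Set.range y)) (RatField r) := by
    rw [hb.isAlgebraic_iff]
    intro i
    have hmem : y (π.symm i) ∈ Algebra.adjoin ℂ (Set.range y) := Algebra.subset_adjoin ⟨_, rfl⟩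
    have hal : IsAlgebraic (Algebra.adjoin ℂ (Set.range y)) (y (π.symm i)) :=
      isAlgebraic_algebraMap (⟨_, hmem⟩ : Algebra.adjoin ℂ (Set.range y))
    rcases Int.units_eq_one_or (ε (π.symm i)) with h | h
    · simpa [hy, h] using hal
    · have := hal.inv
      simpa [hy, h] using this
  refine (Algebra.IsAlgebraic.isTranscendenceBasis_of_le_trdeg_of_finite ℂ y ?_).1
  rw [← hb.cardinalMk_eq_trdeg]

/-- The endomorphism `X_i ↦ X_{π i}^{ε_i}` of `ℂ(X_1, …, X_r)`. -/
noncomputable def signedHom (π : Equiv.Perm (Fin r)) (ε : Fin r → ℤˣ) :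
    RatField r →ₐ[ℂ] RatField r :=
  IsFractionRing.liftAlgHom (K := RatField r) (g := MvPolynomial.aeval fun i => kX (π i) ^ (ε i : ℤ))
    (algebraicIndependent_iff_injective_aeval.1 (algebraicIndependent_signed π ε))

theorem signedHom_kX (π : Equiv.Perm (Fin r)) (ε : Fin r → ℤˣ) (i : Fin r) :
    signedHom π ε (kX i) = kX (π i) ^ (ε i : ℤ) := by
  rw [signedHom, IsFractionRing.liftAlgHom_apply, kX, IsFractionRing.lift_algebraMap]
  simp

/-- The automorphism `X_i ↦ X_{π i}^{ε_i}` of `ℂ(X_1, …, X_r)`. -/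
noncomputable def signedAut (π : Equiv.Perm (Fin r)) (ε : Fin r → ℤˣ) :
    RatField r ≃ₐ[ℂ] RatField r :=
  AlgEquiv.ofAlgHom (signedHom π ε) (signedHom π.symm (fun i => ε (π.symm i)))
    (ratField_algHom_ext fun i => by
      simp only [AlgHom.comp_apply, signedHom_kX, map_zpow₀, ← zpow_mul]
      rcases Int.units_eq_one_or (ε (π.symm i)) with h | h <;> simp [h])
    (ratField_algHom_ext fun i => by
      simp only [AlgHom.comp_apply, signedHom_kX, map_zpow₀, ← zpow_mul]
      rcases Int.units_eq_one_or (ε i) with h | h <;> simp [h])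

theorem signedAut_kX (π : Equiv.Perm (Fin r)) (ε : Fin r → ℤˣ) (i : Fin r) :
    signedAut π ε (kX i) = kX (π i) ^ (ε i : ℤ) :=
  signedHom_kX π ε i

theorem signedAut_mul (π π' : Equiv.Perm (Fin r)) (ε ε' : Fin r → ℤˣ) :
    signedAut π ε * signedAut π' ε' = signedAut (π * π') (fun i => ε (π' i) * ε' i) := by
  apply ratField_algEquiv_ext
  intro i
  simp [AlgEquiv.mul_apply, signedAut_kX, map_zpow₀, ← zpow_mul]

theorem signedAut_one : signedAut (1 : Equiv.Perm (Fin r)) 1 = 1 := by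
  apply ratField_algEquiv_ext
  intro i
  simp [signedAut_kX]

theorem kX_zpow_inj {i j : Fin r} {ε η : ℤˣ} (h : kX i ^ (ε : ℤ) = kX j ^ (η : ℤ)) :
    i = j ∧ ε = η := by
  rcases Int.units_eq_one_or ε with rfl | rfl <;> rcases Int.units_eq_one_or η with rfl | rfl <;>
    simp at h ⊢
  · exact kX_injective h
  · exact kX_ne_inv _ _ h
  · exact kX_ne_inv _ _ h.symm
  · exact kX_injective h

/-- The automorphism inverting the variable `X_k`. -/
noncomputable def flipAut (k : Fin r) : RatField r ≃ₐ[ℂ] RatField r :=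
  signedAut 1 (Pi.mulSingle k (-1))

/-- The automorphism exchanging the variables `X_k` and `X_l`. -/
noncomputable def swapAut (k l : Fin r) : RatField r ≃ₐ[ℂ] RatField r :=
  signedAut (Equiv.swap k l) 1

theorem flipAut_kX (k j : Fin r) : flipAut k (kX j) = if j = k then (kX k)⁻¹ else kX j := by
  rw [flipAut, signedAut_kX]
  split_ifs with h
  · subst h; simp
  · simp [h]

theorem swapAut_kX (k l j : Fin r) :
    swapAut k l (kX j) = if j = k then kX l else if j = l then kX k else kX j := by
  rw [swapAut, signedAut_kX, Equiv.swap_apply_def]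
  split_ifs <;> simp

end SignedPerm

section Datum

variable {m r : ℕ} (ι : Fin m → Fin r)

/-- The simple reflection `s_i` of the Weyl group of type `B_m`, acting on the variables `X_{ι j}`.
-/
noncomputable def simpleAut (i : Fin m) : RatField r ≃ₐ[ℂ] RatField r :=
  if i.val = 0 then flipAut (ι i) else swapAut (ι ⟨i.val - 1, by omega⟩) (ι i)

theorem simpleAut_zero {i : Fin m} (hi : i.val = 0) : simpleAut ι i = flipAut (ι i) := by
  simp [simpleAut, hi]

theorem simpleAut_succ {i j : Fin m} (h : j.val + 1 = i.val) :
    simpleAut ι i = swapAut (ι j) (ι i) := by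
  have : (⟨i.val - 1, by omega⟩ : Fin m) = j := Fin.ext (by simp; omega)
  simp [simpleAut, this, show i.val ≠ 0 by omega]

theorem algEquiv_apply_eq {σ τ : RatField r ≃ₐ[ℂ] RatField r} (h : ∀ k, σ (kX k) = τ (kX k))
    (f : RatField r) : σ f = τ f := by
  rw [ratField_algEquiv_ext h]

theorem exists_pred {i : Fin m} (hi : i.val ≠ 0) : ∃ j : Fin m, j.val + 1 = i.val :=
  ⟨⟨i.val - 1, by omega⟩, by simp; omega⟩

/-- The variables `X_{ι 0}, …, X_{ι (m-1)}` of `ℂ(X_1, …, X_r)`, with the automorphisms that act on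
them as simple reflections and fix the other variables. -/
noncomputable def varDatum (hι : Function.Injective ι) : ReflectionDatum m (RatField r) where
  x j := kX (ι j)
  s := simpleAut ι
  x_ne_zero _ := kX_ne_zero _
  x_ne h h' := h (hι (kX_injective h'))
  x_mul_ne _ _ := kX_mul_ne_one _ _
  s_s i f := by
    refine algEquiv_apply_eq (σ := simpleAut ι i * simpleAut ι i) (τ := 1) (fun k => ?_) f
    by_cases hi : i.val = 0
    · rw [simpleAut_zero ι hi]
      simp only [AlgEquiv.mul_apply, flipAut_kX, AlgEquiv.one_apply]
      split_ifs with h <;> simp [flipAut_kX, h]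
    · obtain ⟨j, hj⟩ := exists_pred hi
      rw [simpleAut_succ ι hj]
      have hij : ι i ≠ ι j := hι.ne (by rintro rfl; omega)
      simp only [AlgEquiv.mul_apply, swapAut_kX, AlgEquiv.one_apply]
      split_ifs with h h' <;> simp [swapAut_kX, hij, *]
  s_zero i hi := by simp [simpleAut_zero ι hi, flipAut_kX]
  s_left i j h := by simp [simpleAut_succ ι h, swapAut_kX]
  s_right i j h := by
    have : i ≠ j := by rintro rfl; omega
    simp [simpleAut_succ ι h, swapAut_kX, hι.ne this]
  s_fix i j h h' := by
    by_cases hi : i.val = 0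
    · simp [simpleAut_zero ι hi, flipAut_kX, hι.ne h']
    · obtain ⟨k, hk⟩ := exists_pred hi
      have : j ≠ k := by rintro rfl; omega
      simp [simpleAut_succ ι hk, swapAut_kX, hι.ne h', hι.ne this]
  braid4 i j hi hj f := by
    have hij : ι i ≠ ι j := hι.ne (by rintro rfl; omega)
    refine algEquiv_apply_eq
      (σ := simpleAut ι i * simpleAut ι j * simpleAut ι i * simpleAut ι j)
      (τ := simpleAut ι j * simpleAut ι i * simpleAut ι j * simpleAut ι i) (fun k => ?_) f
    rw [simpleAut_zero ι hi, simpleAut_succ (i := j) (j := i) ι (by omega)]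
    simp only [AlgEquiv.mul_apply]
    by_cases h1 : k = ι i
    · simp [h1, flipAut_kX, swapAut_kX, hij, hij.symm]
    · by_cases h2 : k = ι j
      · simp [h2, flipAut_kX, swapAut_kX, hij, hij.symm]
      · simp [h1, h2, flipAut_kX, swapAut_kX]
  braid3 i j hi hj f := by
    obtain ⟨l, hl⟩ := exists_pred (i := i) (by omega)
    have hij : ι i ≠ ι j := hι.ne (by rintro rfl; omega)
    have hil : ι i ≠ ι l := hι.ne (by rintro rfl; omega)
    have hjl : ι j ≠ ι l := hι.ne (by rintro rfl; omega)
    refine algEquiv_apply_eq (σ := simpleAut ι i * simpleAut ι j * simpleAut ι i)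
      (τ := simpleAut ι j * simpleAut ι i * simpleAut ι j) (fun k => ?_) f
    rw [simpleAut_succ ι hl, simpleAut_succ (i := j) (j := i) ι (by omega)]
    simp only [AlgEquiv.mul_apply]
    by_cases h1 : k = ι i
    · simp [h1, swapAut_kX, hij, hil, hjl, hij.symm, hil.symm, hjl.symm]
    · by_cases h2 : k = ι j
      · simp [h2, swapAut_kX, hij, hil, hjl, hij.symm, hil.symm, hjl.symm]
      · by_cases h3 : k = ι l
        · simp [h3, swapAut_kX, hij, hil, hjl, hij.symm, hil.symm, hjl.symm]
        · simp [h1, h2, h3, swapAut_kX]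
  braid2 i j h f := by
    have hij : ι i ≠ ι j := hι.ne (by rintro rfl; omega)
    obtain ⟨l, hl⟩ := exists_pred (i := j) (by omega)
    have hil : ι i ≠ ι l := hι.ne (by rintro rfl; omega)
    have hjl : ι j ≠ ι l := hι.ne (by rintro rfl; omega)
    refine algEquiv_apply_eq (σ := simpleAut ι i * simpleAut ι j)
      (τ := simpleAut ι j * simpleAut ι i) (fun k => ?_) f
    rw [simpleAut_succ ι hl]
    simp only [AlgEquiv.mul_apply]
    by_cases hi : i.val = 0
    · rw [simpleAut_zero ι hi]
      by_cases h1 : k = ι i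
      · simp [h1, flipAut_kX, swapAut_kX, hij, hil]
      · by_cases h2 : k = ι j
        · simp [h2, flipAut_kX, swapAut_kX, hij.symm, hil.symm, hjl]
        · by_cases h3 : k = ι l
          · simp [h3, flipAut_kX, swapAut_kX, hij.symm, hil.symm]
          · simp [h1, h2, h3, flipAut_kX, swapAut_kX]
    · obtain ⟨t, ht⟩ := exists_pred hi
      have htj : ι t ≠ ι j := hι.ne (by rintro rfl; omega)
      have htl : ι t ≠ ι l := hι.ne (by rintro rfl; omega)
      have hit : ι i ≠ ι t := hι.ne (by rintro rfl; omega)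
      rw [simpleAut_succ ι ht]
      by_cases h1 : k = ι i
      · simp [h1, swapAut_kX, hij, hil, hit, htj, htl]
      · by_cases h2 : k = ι j
        · simp [h2, swapAut_kX, htj.symm, htl.symm, hij.symm, hil.symm, hjl]
        · by_cases h3 : k = ι l
          · simp [h3, swapAut_kX, htj.symm, htl.symm, hij.symm, hil.symm]
          · by_cases h4 : k = ι t
            · simp [h4, swapAut_kX, hij, hil, htj, htl]
            · simp [h1, h2, h3, h4, swapAut_kX]

end Datum

/-! ### A spanning family of the finite Hecke algebra -/

/-- Elements `T 0, …, T (N-1)` of an algebra that satisfy the relations of the finite Hecke algebra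
of type `B_N`. -/
structure FiniteHeckeRel {A : Type*} [Ring A] [Algebra ℂ A] (N : ℕ) (T : ℕ → A) (c : ℕ → ℂ) :
    Prop where
  quad : ∀ i < N, T i * T i = c i • T i + 1
  comm : ∀ i j, i + 1 < j → j < N → T i * T j = T j * T i
  braid3 : ∀ i, 1 ≤ i → i + 1 < N → T i * T (i + 1) * T i = T (i + 1) * T i * T (i + 1)
  braid4 : 1 < N → T 0 * T 1 * T 0 * T 1 = T 1 * T 0 * T 1 * T 0

section Coset

/-- The suffix of length `j` of the word `T_{k-1} ⋯ T_1 T_0 T_1 ⋯ T_{k-1}`. For `j < 2k` these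
suffixes represent the cosets of the Weyl group of type `B_k` modulo that of type `B_{k-1}`. -/
def cosetWord {A : Type*} [Ring A] (T : ℕ → A) (k : ℕ) : ℕ → A
  | 0 => 1
  | j + 1 => T (if j < k then k - 1 - j else j + 1 - k) * cosetWord T k j

theorem cosetWord_down {A : Type*} [Ring A] (T : ℕ → A) {k j i : ℕ} (h : i + j + 1 = k) :
    cosetWord T k (j + 1) = T i * cosetWord T k j := by
  rw [cosetWord, if_pos (by omega)]
  congr 2
  omega

theorem cosetWord_up {A : Type*} [Ring A] (T : ℕ → A) {k l : ℕ} :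
    cosetWord T k (k + l + 1) = T (l + 1) * cosetWord T k (k + l) := by
  rw [cosetWord, if_neg (by omega)]
  congr 2
  omega

variable {A : Type*} [Ring A] [Algebra ℂ A] {N : ℕ} {T : ℕ → A} {c : ℕ → ℂ}

theorem cosetWord_comm_down (H : FiniteHeckeRel N T c) {k j i : ℕ} (hk : k ≤ N) (h : i + j + 1 < k) :
    T i * cosetWord T k j = cosetWord T k j * T i := by
  induction j with
  | zero => simp [cosetWord]
  | succ j ih =>
    rw [cosetWord_down (i := k - 1 - j) T (by omega), ← mul_assoc,
      H.comm i (k - 1 - j) (by omega) (by omega), mul_assoc, ih (by omega), mul_assoc]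

theorem cosetWord_shift_down (H : FiniteHeckeRel N T c) {k j i : ℕ} (hk : k ≤ N) (hj : j ≤ k)
    (h : k < i + 1 + j) (hi : i + 1 < k)
    (h' : ¬ (j = k ∧ i = 0)) :
    T (i + 1) * cosetWord T k j = cosetWord T k j * T i := by
  induction j with
  | zero => omega
  | succ j ih =>
    rw [cosetWord_down (i := k - 1 - j) T (by omega)]
    by_cases h1 : k < i + 1 + j
    · rw [← mul_assoc, ← H.comm (k - 1 - j) (i + 1) (by omega) (by omega), mul_assoc,
        ih (by omega) h1 (by omega), mul_assoc]
    · obtain ⟨j, rfl⟩ : ∃ j', j = j' + 1 := ⟨j - 1, by omega⟩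
      rw [cosetWord_down (i := i + 1) T (by omega), show k - 1 - (j + 1) = i by omega, ← mul_assoc,
        ← mul_assoc, ← H.braid3 i (by omega) (by omega), mul_assoc,
        cosetWord_comm_down H hk (by omega)]
      simp only [mul_assoc]

theorem cosetWord_shift_up (H : FiniteHeckeRel N T c) {k l i : ℕ} (hk : k ≤ N) (h : l < i) (hi : i + 1 < k) :
    T (i + 1) * cosetWord T k (k + l) = cosetWord T k (k + l) * T i := by
  induction l with
  | zero => exact cosetWord_shift_down H hk le_rfl (by omega) hi (by omega)
  | succ l ih =>
    rw [← add_assoc, cosetWord_up, ← mul_assoc, ← H.comm (l + 1) (i + 1) (by omega) (by omega),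
      mul_assoc, ih (by omega), mul_assoc]

theorem cosetWord_comm_up (H : FiniteHeckeRel N T c) {k l i : ℕ} (hk : k ≤ N) (h : i < l) (hl : l < k) :
    T i * cosetWord T k (k + l) = cosetWord T k (k + l) * T i := by
  induction l with
  | zero => omega
  | succ l ih =>
    rw [← add_assoc, cosetWord_up]
    by_cases h1 : i < l
    · rw [← mul_assoc, H.comm i (l + 1) (by omega) (by omega), mul_assoc, ih h1 (by omega), mul_assoc]
    · obtain rfl : i = l := by omega
      rcases i with _ | i
      · obtain ⟨k, rfl⟩ : ∃ k', k = k' + 2 := ⟨k - 2, by omega⟩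
        rw [add_zero, cosetWord_down (j := k + 1) (i := 0) T (by omega),
          cosetWord_down (j := k) (i := 1) T (by omega)]
        have h2 := cosetWord_comm_down (i := 0) (j := k) H hk (by omega)
        have h3 := H.braid4 (by omega)
        calc _ = T 0 * T 1 * T 0 * T 1 * cosetWord T (k + 2) k := by simp only [mul_assoc, zero_add]
          _ = _ := by rw [h3, mul_assoc, h2]; simp only [mul_assoc, zero_add]
      · rw [← add_assoc, cosetWord_up]
        have h2 := cosetWord_shift_up (i := i + 1) (l := i) H hk (by omega) (by omega)
        have h3 := H.braid3 (i + 1) (by omega) (by omega)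
        calc _ = T (i + 1) * T (i + 1 + 1) * T (i + 1) * cosetWord T k (k + i) := by
              simp only [mul_assoc]
          _ = _ := by rw [h3, mul_assoc, h2]; simp only [mul_assoc]

/-- Left multiplication by a generator sends a coset word to another coset word, or to a combination
of two coset words, or is moved past it. -/
theorem T_mul_cosetWord (H : FiniteHeckeRel N T c) {k j i : ℕ} (hk : k ≤ N) (hj : j < 2 * k)
    (hi : i < k) :
    (∃ a b : ℂ, ∃ j₁ j₂, j₁ < 2 * k ∧ j₂ < 2 * k ∧
        T i * cosetWord T k j = a • cosetWord T k j₁ + b • cosetWord T k j₂) ∨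
      ∃ i', i' + 1 < k ∧ T i * cosetWord T k j = cosetWord T k j * T i' := by
  -- For `j ≤ k` the word is `T_{k-j} ⋯ T_{k-1}`, and for larger `j` it continues beyond `T_0`; in
  -- both cases `T_i` prolongs the word, shortens it, or commutes past it, possibly with a shifted
  -- index.
  by_cases hjk : j ≤ k
  · by_cases h1 : i + j + 1 = k
    · exact .inl ⟨1, 0, j + 1, 0, by omega, by omega, by simp [cosetWord_down T h1]⟩
    by_cases h2 : i + j = k
    · obtain ⟨j, rfl⟩ : ∃ j', j = j' + 1 := ⟨j - 1, by omega⟩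
      refine .inl ⟨c i, 1, j + 1, j, by omega, by omega, ?_⟩
      rw [cosetWord_down T (i := i) (by omega), ← mul_assoc, H.quad i (by omega), add_mul, one_mul,
        smul_mul_assoc, one_smul]
    by_cases h3 : i + j + 1 < k
    · exact .inr ⟨i, by omega, cosetWord_comm_down H hk h3⟩
    obtain ⟨i, rfl⟩ : ∃ i', i = i' + 1 := ⟨i - 1, by omega⟩
    by_cases h4 : j = k ∧ i = 0
    · obtain ⟨rfl, rfl⟩ := h4
      refine .inl ⟨1, 0, j + 1, 0, by omega, by omega, ?_⟩
      have := cosetWord_up T (k := j) (l := 0)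
      simp at this
      simp [this]
    · exact .inr ⟨i, by omega, cosetWord_shift_down H hk hjk (by omega) hi h4⟩
  · obtain ⟨l, rfl⟩ : ∃ l, j = k + l + 1 := ⟨j - k - 1, by omega⟩
    by_cases h1 : i = l + 1
    · refine .inl ⟨c i, 1, k + l + 1, k + l, by omega, by omega, ?_⟩
      rw [cosetWord_up, ← h1, ← mul_assoc, H.quad i (by omega), add_mul, one_mul,
        smul_mul_assoc, one_smul]
    by_cases h2 : i = l + 2
    · refine .inl ⟨1, 0, k + (l + 1) + 1, 0, by omega, by omega, ?_⟩
      rw [cosetWord_up T (l := l + 1), h2]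
      simp [add_assoc]
    by_cases h3 : i < l + 1
    · exact .inr ⟨i, by omega, cosetWord_comm_up (l := l + 1) H hk h3 (by omega)⟩
    · obtain ⟨i, rfl⟩ : ∃ i', i = i' + 1 := ⟨i - 1, by omega⟩
      exact .inr ⟨i, by omega, cosetWord_shift_up (l := l + 1) H hk (by omega) (by omega)⟩

/-- A family of `2^k k!` elements whose span is stable under left multiplication by
`T_0, …, T_{k-1}`. -/
theorem exists_finiteHecke_span (H : FiniteHeckeRel N T c) {k : ℕ} (hk : k ≤ N) :
    ∃ (ι : Type) (_ : Fintype ι) (t : ι → A), Fintype.card ι = 2 ^ k * k.factorial ∧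
      1 ∈ Submodule.span ℂ (Set.range t) ∧
      ∀ i < k, ∀ x ∈ Submodule.span ℂ (Set.range t), T i * x ∈ Submodule.span ℂ (Set.range t) := by
  induction k with
  | zero => exact ⟨Unit, inferInstance, fun _ => 1, by simp, Submodule.subset_span ⟨(), rfl⟩, by simp⟩
  | succ k ih =>
    obtain ⟨ι, _, t, hcard, h1, ht⟩ := ih (by omega)
    refine ⟨Fin (2 * (k + 1)) × ι, inferInstance, fun x => cosetWord T (k + 1) x.1 * t x.2, ?_, ?_, ?_⟩
    · rw [Fintype.card_prod, Fintype.card_fin, hcard, Nat.factorial_succ, pow_succ]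
      ring
    all_goals
      set S := Submodule.span ℂ
        (Set.range fun x : Fin (2 * (k + 1)) × ι => cosetWord T (k + 1) x.1 * t x.2)
      have key : ∀ j < 2 * (k + 1), ∀ x ∈ Submodule.span ℂ (Set.range t),
          cosetWord T (k + 1) j * x ∈ S := by
        intro j hj x hx
        have : Submodule.span ℂ (Set.range t) ≤
            S.comap (LinearMap.mulLeft ℂ (cosetWord T (k + 1) j)) := by
          rw [Submodule.span_le]
          rintro _ ⟨i, rfl⟩
          exact Submodule.subset_span ⟨(⟨j, hj⟩, i), rfl⟩
        exact this hx
    · simpa [cosetWord] using key 0 (by omega) 1 h1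
    · intro i hi x hx
      suffices h : S ≤ S.comap (LinearMap.mulLeft ℂ (T i)) from h hx
      refine Submodule.span_le.2 ?_
      rintro _ ⟨⟨j, l⟩, rfl⟩
      have hl : t l ∈ Submodule.span ℂ (Set.range t) := Submodule.subset_span ⟨l, rfl⟩
      change T i * (cosetWord T (k + 1) j * t l) ∈ S
      rw [← mul_assoc]
      rcases T_mul_cosetWord H hk j.2 hi with ⟨a, b, j₁, j₂, h₁, h₂, h⟩ | ⟨i', hi', h⟩
      · rw [h, add_mul, smul_mul_assoc, smul_mul_assoc]
        exact S.add_mem (S.smul_mem _ (key _ h₁ _ hl)) (S.smul_mem _ (key _ h₂ _ hl))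
      · rw [h, mul_assoc]
        exact key _ j.2 _ (ht i' (by omega) _ hl)

end Coset

/-! ### Relations in the affine Hecke algebra -/

namespace HB

variable {n : ℕ} (p0 p1 : ℂˣ)

theorem X_mul_Xinv (i : Fin n) : X p0 p1 i * Xinv p0 p1 i = 1 := by
  simpa [X, Xinv] using mk_rel p0 p1 (.X_mul_Xinv i)

theorem Xinv_mul_X (i : Fin n) : Xinv p0 p1 i * X p0 p1 i = 1 := by
  simpa [X, Xinv] using mk_rel p0 p1 (.Xinv_mul_X i)

theorem X_comm (i j : Fin n) : X p0 p1 i * X p0 p1 j = X p0 p1 j * X p0 p1 i := by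
  simpa [X] using mk_rel p0 p1 (.X_comm i j)

/-- The coefficient `p_i - p_i⁻¹` in the quadratic relation of `T_i`. -/
noncomputable def quadCoeff (i : Fin n) : ℂ := (par p0 p1 i : ℂ) - (par p0 p1 i : ℂ)⁻¹

theorem T_mul_T (i : Fin n) :
    T p0 p1 i * T p0 p1 i = quadCoeff p0 p1 i • T p0 p1 i + 1 := by
  have h := mk_rel p0 p1 (.hecke i)
  simp only [map_mul, map_sub, map_add, AlgHom.commutes, map_zero] at h
  change (T p0 p1 i - _) * (T p0 p1 i + _) = 0 at h
  have hp : (par p0 p1 i : ℂ) ≠ 0 := by simp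
  rw [sub_mul, mul_add, mul_add, ← map_mul, mul_inv_cancel₀ hp, map_one,
    ← Algebra.commutes, ← Algebra.smul_def, ← Algebra.smul_def] at h
  rw [quadCoeff, sub_smul, ← sub_eq_zero, ← h]
  abel

theorem braid2 (i j : Fin n) (h : i.val + 1 < j.val) :
    T p0 p1 i * T p0 p1 j = T p0 p1 j * T p0 p1 i := by
  simpa [T] using mk_rel p0 p1 (.braid2 i j h)

theorem bernstein_comm (i j : Fin n) (h : j.val + 1 ≠ i.val) (h' : j ≠ i) :
    T p0 p1 i * X p0 p1 j = X p0 p1 j * T p0 p1 i := by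
  simpa [T, X] using mk_rel p0 p1 (.bernstein_comm i j h h')

theorem T_mul_sub (i : Fin n) :
    T p0 p1 i * (T p0 p1 i - quadCoeff p0 p1 i • 1) = 1 := by
  rw [mul_sub, T_mul_T]
  simp

theorem T_X_left (i j : Fin n) (h : j.val + 1 = i.val) :
    T p0 p1 i * X p0 p1 j = X p0 p1 i * T p0 p1 i - quadCoeff p0 p1 i • X p0 p1 i := by
  have hb : T p0 p1 i * X p0 p1 j * T p0 p1 i = X p0 p1 i := by
    simpa [T, X] using mk_rel p0 p1 (.bernstein_succ i j h)
  calc T p0 p1 i * X p0 p1 j = T p0 p1 i * X p0 p1 j * (T p0 p1 i *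
        (T p0 p1 i - quadCoeff p0 p1 i • 1)) := by rw [T_mul_sub, mul_one]
    _ = _ := by rw [← mul_assoc, hb, mul_sub, mul_smul_comm, mul_one]

theorem T_X_right (i j : Fin n) (h : j.val + 1 = i.val) :
    T p0 p1 i * X p0 p1 i = X p0 p1 j * T p0 p1 i + quadCoeff p0 p1 i • X p0 p1 i := by
  have hb : T p0 p1 i * X p0 p1 j * T p0 p1 i = X p0 p1 i := by
    simpa [T, X] using mk_rel p0 p1 (.bernstein_succ i j h)
  rw [← hb, ← mul_assoc, ← mul_assoc, T_mul_T]
  simp [add_mul, mul_assoc, add_comm]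

theorem T_Xinv_zero (i : Fin n) (hi : i.val = 0) :
    T p0 p1 i * Xinv p0 p1 i = X p0 p1 i * T p0 p1 i - quadCoeff p0 p1 i • X p0 p1 i := by
  have hb : T p0 p1 i * Xinv p0 p1 i * T p0 p1 i = X p0 p1 i := by
    simpa [T, X, Xinv] using mk_rel p0 p1 (.bernstein_zero i hi)
  calc T p0 p1 i * Xinv p0 p1 i = T p0 p1 i * Xinv p0 p1 i * (T p0 p1 i *
        (T p0 p1 i - quadCoeff p0 p1 i • 1)) := by rw [T_mul_sub, mul_one]
    _ = _ := by rw [← mul_assoc, hb, mul_sub, mul_smul_comm, mul_one]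

theorem T_X_zero (i : Fin n) (hi : i.val = 0) :
    T p0 p1 i * X p0 p1 i = Xinv p0 p1 i * T p0 p1 i + quadCoeff p0 p1 i • X p0 p1 i := by
  have hb : T p0 p1 i * Xinv p0 p1 i * T p0 p1 i = X p0 p1 i := by
    simpa [T, X, Xinv] using mk_rel p0 p1 (.bernstein_zero i hi)
  rw [← hb, ← mul_assoc, ← mul_assoc, T_mul_T]
  simp [add_mul, mul_assoc, add_comm]

/-- Passing a relation `t x = y t + u` to the inverses of `x` and `y`. -/
theorem mul_inv_of_mul {A : Type*} [Ring A] {t x x' y y' u : A} (hx : x * x' = 1) (hy : y' * y = 1)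
    (h : t * x = y * t + u) : t * x' = y' * t - y' * u * x' := by
  have h1 : y' * (t * x) * x' = y' * t := by rw [mul_assoc, mul_assoc, hx, mul_one]
  rw [h, mul_add, add_mul, ← mul_assoc, hy, one_mul] at h1
  exact eq_sub_of_add_eq h1

/-- The commutative subalgebra of Laurent polynomials in the `X_i`. -/
noncomputable def pol (n : ℕ) (p0 p1 : ℂˣ) : Subalgebra ℂ (HB n p0 p1) :=
  Algebra.adjoin ℂ (Set.range (X p0 p1) ∪ Set.range (Xinv p0 p1))

theorem X_mem_pol (i : Fin n) : X p0 p1 i ∈ pol n p0 p1 :=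
  Algebra.subset_adjoin (.inl ⟨i, rfl⟩)

theorem Xinv_mem_pol (i : Fin n) : Xinv p0 p1 i ∈ pol n p0 p1 :=
  Algebra.subset_adjoin (.inr ⟨i, rfl⟩)

theorem exists_T_mul_X (i j : Fin n) :
    ∃ y y' u, y ∈ pol n p0 p1 ∧ y' ∈ pol n p0 p1 ∧ u ∈ pol n p0 p1 ∧ y' * y = 1 ∧
      T p0 p1 i * X p0 p1 j = y * T p0 p1 i + u := by
  have hc : quadCoeff p0 p1 i • X p0 p1 i ∈ pol n p0 p1 := Subalgebra.smul_mem _ (X_mem_pol _ _ _) _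
  by_cases hji : j = i
  · subst hji
    by_cases hj : j.val = 0
    · exact ⟨_, _, _, Xinv_mem_pol _ _ _, X_mem_pol _ _ _, hc, X_mul_Xinv _ _ _, T_X_zero p0 p1 j hj⟩
    · obtain ⟨k, hk⟩ := exists_pred hj
      exact ⟨_, _, _, X_mem_pol _ _ _, Xinv_mem_pol _ _ _, hc, Xinv_mul_X _ _ _,
        T_X_right p0 p1 j k hk⟩
  · by_cases hj : j.val + 1 = i.val
    · refine ⟨_, _, _, X_mem_pol _ _ i, Xinv_mem_pol _ _ i, neg_mem hc, Xinv_mul_X _ _ i, ?_⟩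
      rw [T_X_left p0 p1 i j hj, sub_eq_add_neg]
    · exact ⟨_, _, 0, X_mem_pol _ _ j, Xinv_mem_pol _ _ j, zero_mem _, Xinv_mul_X _ _ j,
        by rw [add_zero, bernstein_comm p0 p1 i j hj hji]⟩

theorem exists_T_mul_pol (i : Fin n) {g : HB n p0 p1} (hg : g ∈ pol n p0 p1) :
    ∃ g₁ ∈ pol n p0 p1, ∃ g₂ ∈ pol n p0 p1, T p0 p1 i * g = g₁ * T p0 p1 i + g₂ := by
  induction hg using Algebra.adjoin_induction with
  | mem x hx =>
    rcases hx with ⟨j, rfl⟩ | ⟨j, rfl⟩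
    · obtain ⟨y, y', u, hy, hy', hu, h1, h⟩ := exists_T_mul_X p0 p1 i j
      exact ⟨y, hy, u, hu, h⟩
    · obtain ⟨y, y', u, hy, hy', hu, h1, h⟩ := exists_T_mul_X p0 p1 i j
      refine ⟨y', hy', -(y' * u * Xinv p0 p1 j),
        neg_mem (mul_mem (mul_mem hy' hu) (Xinv_mem_pol _ _ _)), ?_⟩
      rw [mul_inv_of_mul (X_mul_Xinv p0 p1 j) h1 h, sub_eq_add_neg]
  | algebraMap c =>
    exact ⟨_, Subalgebra.algebraMap_mem _ c, 0, zero_mem _, by rw [add_zero, Algebra.commutes]⟩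
  | add x y _ _ hx hy =>
    obtain ⟨a, ha, b, hb, h⟩ := hx
    obtain ⟨a', ha', b', hb', h'⟩ := hy
    exact ⟨a + a', add_mem ha ha', b + b', add_mem hb hb', by rw [mul_add, h, h', add_mul]; abel⟩
  | mul x y hx' hy' hx hy =>
    obtain ⟨a, ha, b, hb, h⟩ := hx
    obtain ⟨a', ha', b', hb', h'⟩ := hy
    refine ⟨a * a', mul_mem ha ha', a * b' + b * y, add_mem (mul_mem ha hb') (mul_mem hb hy'), ?_⟩
    rw [← mul_assoc, h, add_mul, mul_assoc, h', mul_add, mul_assoc, add_assoc]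

/-- To prove a property closed under left multiplication by the generators, it suffices to check it
for sums and at `1`. -/
theorem induction_left {P : HB n p0 p1 → Prop} (one : P 1) (add : ∀ a b, P a → P b → P (a + b))
    (smul : ∀ (c : ℂ) a, P a → P (c • a)) (hT : ∀ i a, P a → P (T p0 p1 i * a))
    (hX : ∀ i a, P a → P (X p0 p1 i * a)) (hY : ∀ i a, P a → P (Xinv p0 p1 i * a))
    (a : HB n p0 p1) : P a := by
  obtain ⟨a, rfl⟩ : ∃ a', mk n p0 p1 a' = a := RingQuot.mkAlgHom_surjective ℂ _ a
  suffices h : ∀ a b, P b → P (mk n p0 p1 a * b) by simpa using h a 1 one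
  intro a
  induction a using FreeAlgebra.induction with
  | grade0 c =>
    intro b hb
    rw [AlgHom.commutes, ← Algebra.smul_def]
    exact smul c b hb
  | grade1 g =>
    intro b hb
    cases g with
    | T i => exact hT i b hb
    | X i => exact hX i b hb
    | Xinv i => exact hY i b hb
  | mul x y hx hy =>
    intro b hb
    rw [map_mul, mul_assoc]
    exact hx _ (hy _ hb)
  | add x y hx hy =>
    intro b hb
    rw [map_add, add_mul]
    exact add _ _ (hx _ hb) (hy _ hb)

theorem finiteHeckeRel : FiniteHeckeRel n
    (fun i => if h : i < n then T p0 p1 ⟨i, h⟩ else 1)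
    (fun i => if h : i < n then quadCoeff p0 p1 (⟨i, h⟩ : Fin n) else 0) where
  quad i hi := by simpa [hi] using T_mul_T p0 p1 ⟨i, hi⟩
  comm i j h hj := by
    simpa [hj, show i < n by omega] using braid2 p0 p1 ⟨i, by omega⟩ ⟨j, hj⟩ h
  braid3 i hi h := by
    have := mk_rel p0 p1 (.braid3 (⟨i, by omega⟩ : Fin n) ⟨i + 1, h⟩ hi rfl)
    simpa [h, show i < n by omega, T] using this
  braid4 h := by
    have := mk_rel p0 p1 (.braid4 (⟨0, by omega⟩ : Fin n) ⟨1, h⟩ rfl rfl)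
    simpa [h, show 0 < n by omega, T] using this

/-- `H_n^B` is generated by `2^n n!` elements as a module over the Laurent polynomials. -/
theorem exists_span : ∃ (ι : Type) (_ : Fintype ι) (t : ι → HB n p0 p1),
    Fintype.card ι = 2 ^ n * n.factorial ∧
      ∀ h, ∃ g : ι → HB n p0 p1, (∀ k, g k ∈ pol n p0 p1) ∧ h = ∑ k, g k * t k := by
  obtain ⟨ι, hι, t, hcard, h1, ht⟩ := exists_finiteHecke_span (finiteHeckeRel (n := n) p0 p1) le_rfl
  refine ⟨ι, hι, t, hcard, ?_⟩
  let P : HB n p0 p1 → Prop := fun h =>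
    ∃ g : ι → HB n p0 p1, (∀ k, g k ∈ pol n p0 p1) ∧ h = ∑ k, g k * t k
  have Padd : ∀ a b, P a → P b → P (a + b) := by
    rintro _ _ ⟨g, hg, rfl⟩ ⟨g', hg', rfl⟩
    exact ⟨fun k => g k + g' k, fun k => add_mem (hg k) (hg' k), by
      simp only [add_mul, Finset.sum_add_distrib]⟩
  have Pmul : ∀ f ∈ pol n p0 p1, ∀ a, P a → P (f * a) := by
    rintro f hf _ ⟨g, hg, rfl⟩
    exact ⟨fun k => f * g k, fun k => mul_mem hf (hg k), by simp only [Finset.mul_sum, mul_assoc]⟩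
  have Pspan : ∀ x ∈ Submodule.span ℂ (Set.range t), P x := by
    intro x hx
    obtain ⟨c, rfl⟩ := (Submodule.mem_span_range_iff_exists_fun ℂ).1 hx
    exact ⟨fun k => algebraMap ℂ _ (c k), fun k => Subalgebra.algebraMap_mem _ _, by
      simp only [Algebra.smul_def]⟩
  have Psum : ∀ f : ι → HB n p0 p1, (∀ k, P (f k)) → P (∑ k, f k) := fun f hf =>
    Finset.sum_induction _ P Padd ⟨fun _ => 0, fun _ => zero_mem _, by simp⟩ (fun k _ => hf k)
  refine induction_left p0 p1 (P := P) (Pspan 1 h1) Padd ?_ ?_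
    (fun i => Pmul _ (X_mem_pol _ _ i)) (fun i => Pmul _ (Xinv_mem_pol _ _ i))
  · intro c a ha
    rw [Algebra.smul_def]
    exact Pmul _ (Subalgebra.algebraMap_mem _ _) _ ha
  · rintro i _ ⟨g, hg, rfl⟩
    rw [Finset.mul_sum]
    refine Psum _ fun k => ?_
    obtain ⟨g₁, h₁, g₂, h₂, h⟩ := exists_T_mul_pol p0 p1 i (hg k)
    have hk : t k ∈ Submodule.span ℂ (Set.range t) := Submodule.subset_span ⟨k, rfl⟩
    have := ht i i.2 _ hk
    simp only [i.2, dite_true] at this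
    rw [← mul_assoc, h, add_mul, mul_assoc]
    exact Padd _ _ (Pmul _ h₁ _ (Pspan _ this)) (Pmul _ h₂ _ (Pspan _ hk))

end HB

/-! ### Faithfulness by counting automorphisms -/

section Counting

variable {r : ℕ}

theorem toLinearMap_mul (σ τ : RatField r ≃ₐ[ℂ] RatField r) :
    (σ * τ).toLinearMap = σ.toLinearMap * τ.toLinearMap := rfl

theorem smul_end_eq (f : RatField r) (q : Module.End ℂ (RatField r)) :
    f • q = Algebra.lmul ℂ (RatField r) f * q := by
  ext x
  simp

/-- Distinct automorphisms of `ℂ(X_1, …, X_r)` are linearly independent over it. If a representation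
`ρ` by Demazure–Lusztig operators is spanned by a family `t` with no more members than there are
automorphisms in the group generated by the reflections, then `ρ ∘ t` is linearly independent, since
its span contains these automorphisms. -/
theorem linearIndependent_of_card_le {A : Type*} [Ring A] [Algebra ℂ A]
    (ρ : A →ₐ[ℂ] Module.End ℂ (RatField r)) {ι τ κ : Type*} [Fintype ι] [Fintype κ] (t : ι → A)
    (T : τ → A) (p : τ → ℂ) (e : τ → RatField r) (s : τ → RatField r ≃ₐ[ℂ] RatField r)
    (hT : ∀ i, ρ (T i) = dlOp (p i) (e i) (s i))
    (hne : ∀ i, dlCoeff (algebraMap ℂ (RatField r) (p i)) (e i) ≠ 0)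
    (P : Set A) (hP : ∀ g ∈ P, ∃ f, ρ g = Algebra.lmul ℂ (RatField r) f)
    (hspan : ∀ a, ∃ g : ι → A, (∀ k, g k ∈ P) ∧ a = ∑ k, g k * t k)
    (σ : κ → RatField r ≃ₐ[ℂ] RatField r) (hσ : Function.Injective σ)
    (hmem : ∀ k, σ k ∈ Submonoid.closure (Set.range s))
    (hcard : Fintype.card ι ≤ Fintype.card κ) :
    LinearIndependent (RatField r) (fun k => ρ (t k)) := by
  set W := Submodule.span (RatField r) (Set.range fun k => ρ (t k)) with hW
  -- The span `W` of the operators `ρ (t k)` over `ℂ(X_1, …, X_r)` is stable under the reflections,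
  -- which are combinations of `1` and of Demazure–Lusztig operators with invertible leading
  -- coefficient.
  have hρ : ∀ a, ρ a ∈ W := by
    intro a
    obtain ⟨g, hg, rfl⟩ := hspan a
    rw [map_sum]
    refine Submodule.sum_mem _ fun k _ => ?_
    obtain ⟨f, hf⟩ := hP _ (hg k)
    rw [map_mul, hf, ← smul_end_eq]
    exact W.smul_mem _ (Submodule.subset_span ⟨k, rfl⟩)
  have hTW : ∀ i, ∀ x ∈ W, ρ (T i) * x ∈ W := by
    intro i x hx
    induction hx using Submodule.span_induction with
    | mem x hx =>
      obtain ⟨k, rfl⟩ := hx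
      rw [← map_mul]
      exact hρ _
    | zero => simp
    | add x y _ _ hx hy => rw [mul_add]; exact add_mem hx hy
    | smul f x hx' hx =>
      rw [smul_end_eq, ← mul_assoc, hT, dlOp_mul_lmul, add_mul, mul_assoc, ← hT, ← smul_end_eq,
        ← smul_end_eq]
      exact add_mem (W.smul_mem _ hx) (W.smul_mem _ hx')
  have hsW : ∀ i, ∀ x ∈ W, (s i).toLinearMap * x ∈ W := by
    intro i x hx
    have h : (dlCoeff (algebraMap ℂ (RatField r) (p i)) (e i)) • ((s i).toLinearMap * x) =
        ρ (T i) * x - p i • x + (dlCoeff (algebraMap ℂ (RatField r) (p i)) (e i)) • x := by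
      rw [hT, dlOp, add_mul, smul_mul_assoc, one_mul, add_sub_cancel_left, mul_assoc,
        ← smul_end_eq, sub_mul, one_mul, smul_sub, sub_add_cancel]
    rw [← inv_smul_smul₀ (hne i) ((s i).toLinearMap * x), h]
    refine W.smul_mem _ (add_mem (sub_mem (hTW i x hx) ?_) (W.smul_mem _ hx))
    rw [← algebraMap_smul (RatField r)]
    exact W.smul_mem _ hx
  have hclos : ∀ g ∈ Submonoid.closure (Set.range s), g.toLinearMap ∈ W := by
    intro g hg
    induction hg using Submonoid.closure_induction_left with
    | one => simpa using hρ 1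
    | mul_left x hx y _ hy =>
      obtain ⟨i, rfl⟩ := hx
      exact hsW i _ hy
  -- By Dedekind, `W` has dimension at least the number of automorphisms it contains.
  have hind : LinearIndependent (RatField r) (fun k => (σ k).toLinearMap) :=
    (linearIndependent_algHom_toLinearMap ℂ (RatField r) (RatField r)).comp
      (fun k => (σ k : RatField r →ₐ[ℂ] RatField r))
      (fun a b h => hσ (AlgEquiv.coe_toAlgHom_injective h))
  have : Module.Finite (RatField r) W := FiniteDimensional.span_of_finite _ (Set.finite_range _)
  have hind' : LinearIndependent (RatField r)
      (fun k => (⟨(σ k).toLinearMap, hclos _ (hmem k)⟩ : W)) :=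
    LinearIndependent.of_comp W.subtype hind
  rw [linearIndependent_iff_card_le_finrank_span]
  exact hcard.trans hind'.fintype_card_le_finrank

/-- A Laurent polynomial that vanishes in `ℂ(X_1, …, X_r)` vanishes. -/
theorem eq_zero_of_laurent {C I : Type*} [CommRing C] [Algebra ℂ C] (ψ : C →ₐ[ℂ] RatField r)
    (x y : I → C) (hxy : ∀ i, x i * y i = 1) (v : I → Fin r) (hv : Function.Injective v)
    (hψ : ∀ i, ψ (x i) = kX (v i)) {g : C} (hg : g ∈ Algebra.adjoin ℂ (Set.range x ∪ Set.range y))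
    (h0 : ψ g = 0) : g = 0 := by
  -- A monomial `u` in the `x i` clears the denominators of `g`.
  have hex : ∃ u ∈ Submonoid.closure (Set.range x), ∃ P : MvPolynomial I ℂ,
      g * u = MvPolynomial.aeval x P := by
    have hcl : ∀ u ∈ Submonoid.closure (Set.range x), ∃ P : MvPolynomial I ℂ,
        u = MvPolynomial.aeval x P := by
      intro u hu
      induction hu using Submonoid.closure_induction with
      | mem u hu => obtain ⟨i, rfl⟩ := hu; exact ⟨.X i, by simp⟩
      | one => exact ⟨1, by simp⟩
      | mul a b _ _ ha hb =>
        obtain ⟨P, rfl⟩ := ha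
        obtain ⟨Q, rfl⟩ := hb
        exact ⟨P * Q, by simp⟩
    clear h0
    induction hg using Algebra.adjoin_induction with
    | mem g hg =>
      rcases hg with ⟨i, rfl⟩ | ⟨i, rfl⟩
      · exact ⟨1, one_mem _, .X i, by simp⟩
      · exact ⟨x i, Submonoid.subset_closure ⟨i, rfl⟩, 1, by rw [mul_comm, hxy, map_one]⟩
    | algebraMap c => exact ⟨1, one_mem _, .C c, by simp⟩
    | add a b _ _ ha hb =>
      obtain ⟨u, hu, P, hP⟩ := ha
      obtain ⟨u', hu', Q, hQ⟩ := hb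
      obtain ⟨U, hU⟩ := hcl u hu
      obtain ⟨U', hU'⟩ := hcl u' hu'
      refine ⟨u * u', mul_mem hu hu', P * U' + Q * U, ?_⟩
      rw [map_add, map_mul, map_mul, ← hP, ← hQ, ← hU, ← hU']
      ring
    | mul a b _ _ ha hb =>
      obtain ⟨u, hu, P, hP⟩ := ha
      obtain ⟨u', hu', Q, hQ⟩ := hb
      exact ⟨u * u', mul_mem hu hu', P * Q, by rw [map_mul, ← hP, ← hQ]; ring⟩
  obtain ⟨u, hu, P, hP⟩ := hex
  have hu' : IsUnit u := by
    clear hP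
    induction hu using Submonoid.closure_induction with
    | mem u hu => obtain ⟨i, rfl⟩ := hu; exact IsUnit.of_mul_eq_one _ (hxy i)
    | one => exact isUnit_one
    | mul a b _ _ ha hb => exact ha.mul hb
  -- The map `ψ` is injective on the polynomials in the `x i`, since it sends them to distinct
  -- variables.
  have h1 : ψ (MvPolynomial.aeval x P) =
      algebraMap (MvPolynomial (Fin r) ℂ) (RatField r) (MvPolynomial.rename v P) := by
    have : ψ.comp (MvPolynomial.aeval x) = (IsScalarTower.toAlgHom ℂ (MvPolynomial (Fin r) ℂ)
        (RatField r)).comp (MvPolynomial.rename v) := by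
      apply MvPolynomial.algHom_ext
      intro i
      simp [hψ, kX]
    exact DFunLike.congr_fun this P
  rw [← hP, map_mul, h0, zero_mul] at h1
  have h2 := IsFractionRing.injective (MvPolynomial (Fin r) ℂ) (RatField r)
    (h1.symm.trans (map_zero _).symm)
  have h3 : P = 0 := MvPolynomial.rename_injective v hv (h2.trans (map_zero _).symm)
  rw [h3, map_zero] at hP
  exact (hu'.mul_left_eq_zero).1 hP

end Counting

/-! ### Realization of signed permutations by products of simple reflections -/

section Realize

variable {m r : ℕ} (ι : Fin m → Fin r)

/-- `σ` acts on the variables `X_{ι k}` as the signed permutation `(π, ε)` and fixes the others. -/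
def Realizes (σ : RatField r ≃ₐ[ℂ] RatField r) (π : Equiv.Perm (Fin m)) (ε : Fin m → ℤˣ) : Prop :=
  (∀ k, σ (kX (ι k)) = kX (ι (π k)) ^ (ε k : ℤ)) ∧ ∀ j, j ∉ Set.range ι → σ (kX j) = kX j

variable {ι}

theorem Realizes.mul {σ τ : RatField r ≃ₐ[ℂ] RatField r} {π ρ : Equiv.Perm (Fin m)}
    {ε η : Fin m → ℤˣ} (h : Realizes ι σ π ε) (h' : Realizes ι τ ρ η) :
    Realizes ι (σ * τ) (π * ρ) (fun k => ε (ρ k) * η k) := by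
  refine ⟨fun k => ?_, fun j hj => ?_⟩
  · simp [AlgEquiv.mul_apply, h'.1, h.1, map_zpow₀, ← zpow_mul]
  · simp [AlgEquiv.mul_apply, h'.2 j hj, h.2 j hj]

theorem Realizes.one : Realizes ι 1 1 1 := ⟨by simp, by simp⟩

theorem Realizes.inj {σ τ : RatField r ≃ₐ[ℂ] RatField r} {π ρ : Equiv.Perm (Fin m)}
    {ε η : Fin m → ℤˣ} (hι : Function.Injective ι) (h : Realizes ι σ π ε) (h' : Realizes ι τ ρ η)
    (heq : ∀ k, σ (kX (ι k)) = τ (kX (ι k))) : π = ρ ∧ ε = η := by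
  have : ∀ k, π k = ρ k ∧ ε k = η k := fun k => by
    have := kX_zpow_inj ((h.1 k).symm.trans ((heq k).trans (h'.1 k)))
    exact ⟨hι this.1, this.2⟩
  exact ⟨Equiv.ext fun k => (this k).1, funext fun k => (this k).2⟩

theorem realizes_swapAut (hι : Function.Injective ι) (a b : Fin m) :
    Realizes ι (swapAut (ι a) (ι b)) (Equiv.swap a b) 1 := by
  refine ⟨fun k => ?_, fun j hj => ?_⟩
  · rw [swapAut_kX, Equiv.swap_apply_def]
    simp only [hι.eq_iff]
    split_ifs <;> simp
  · rw [swapAut_kX, if_neg (by rintro rfl; exact hj ⟨_, rfl⟩), if_neg (by rintro rfl; exact hj ⟨_, rfl⟩)]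

theorem realizes_flipAut (hι : Function.Injective ι) (a : Fin m) :
    Realizes ι (flipAut (ι a)) 1 (Pi.mulSingle a (-1)) := by
  refine ⟨fun k => ?_, fun j hj => ?_⟩
  · rw [flipAut_kX]
    simp only [hι.eq_iff, Equiv.Perm.coe_one, id]
    split_ifs with h
    · subst h; simp
    · simp [h]
  · rw [flipAut_kX, if_neg (by rintro rfl; exact hj ⟨_, rfl⟩)]

/-- The group generated by the simple reflections contains all signed permutations. -/
theorem exists_realizes (hι : Function.Injective ι) (π : Equiv.Perm (Fin m)) (ε : Fin m → ℤˣ) :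
    ∃ σ ∈ Submonoid.closure (Set.range (simpleAut ι)), Realizes ι σ π ε := by
  set Γ := Submonoid.closure (Set.range (simpleAut ι))
  have hmul : ∀ π ρ ε η, (∃ σ ∈ Γ, Realizes ι σ π ε) → (∃ σ ∈ Γ, Realizes ι σ ρ η) →
      ∃ σ ∈ Γ, Realizes ι σ (π * ρ) (fun k => ε (ρ k) * η k) := by
    rintro π ρ ε η ⟨σ, hσ, h⟩ ⟨τ, hτ, h'⟩
    exact ⟨σ * τ, mul_mem hσ hτ, h.mul h'⟩
  have hadj : ∀ i j : Fin m, j.val + 1 = i.val → swapAut (ι j) (ι i) ∈ Γ := fun i j h =>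
    simpleAut_succ ι h ▸ Submonoid.subset_closure ⟨i, rfl⟩
  -- Adjacent transpositions generate the permutations.
  have hperm : ∀ π, ∃ σ ∈ Γ, Realizes ι σ π 1 := by
    rcases m with _ | m
    · intro π
      exact ⟨1, one_mem _, Subsingleton.elim (1 : Equiv.Perm (Fin 0)) π ▸ Realizes.one⟩
    · intro π
      have hπ : π ∈ (⊤ : Submonoid (Equiv.Perm (Fin (m + 1)))) := trivial
      rw [← Equiv.Perm.mclosure_swap_castSucc_succ] at hπ
      induction hπ using Submonoid.closure_induction with
      | mem x hx =>
        obtain ⟨i, rfl⟩ := hx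
        exact ⟨_, hadj i.succ i.castSucc (by simp), realizes_swapAut hι _ _⟩
      | one => exact ⟨1, one_mem _, Realizes.one⟩
      | mul x y _ _ hx hy =>
        have := hmul _ _ _ _ hx hy
        simp only [Pi.one_apply, one_mul] at this
        exact this
  -- The sign changes of single variables are conjugate to that of the first one.
  have hflip : ∀ (k : ℕ) (hk : k < m), ∃ σ ∈ Γ, Realizes ι σ 1 (Pi.mulSingle ⟨k, hk⟩ (-1)) := by
    intro k
    induction k with
    | zero =>
      intro hk
      exact ⟨_, Submonoid.subset_closure ⟨⟨0, hk⟩, rfl⟩,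
        simpleAut_zero ι (i := ⟨0, hk⟩) rfl ▸ realizes_flipAut hι _⟩
    | succ k ih =>
      intro hk
      obtain ⟨σ, hσ, h⟩ := ih (by omega)
      obtain ⟨τ, hτ, h'⟩ := hperm (Equiv.swap ⟨k, by omega⟩ ⟨k + 1, hk⟩)
      refine ⟨τ * (σ * τ), mul_mem hτ (mul_mem hσ hτ), ?_⟩
      convert h'.mul (h.mul h') using 1
      · simp
      · ext j
        simp only [Pi.one_apply, one_mul, mul_one, Pi.mulSingle_apply, Equiv.swap_apply_eq_iff,
          Equiv.swap_apply_left]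
  have hsign : ∀ ε, ∃ σ ∈ Γ, Realizes ι σ 1 ε := by
    let S : Submonoid (Fin m → ℤˣ) :=
      { carrier := {ε | ∃ σ ∈ Γ, Realizes ι σ 1 ε}
        mul_mem' := fun {a b} ha hb => by
          obtain ⟨σ, hσ, h⟩ := hmul _ _ _ _ ha hb
          exact ⟨σ, hσ, by rwa [one_mul] at h⟩
        one_mem' := ⟨1, one_mem _, Realizes.one⟩ }
    intro ε
    change ε ∈ S
    rw [← Finset.univ_prod_mulSingle ε]
    refine prod_mem fun k _ => ?_
    rcases Int.units_eq_one_or (ε k) with h | h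
    · rw [h, Pi.mulSingle_one]
      exact one_mem S
    · rw [h]
      exact hflip k k.2
  simpa using hmul _ _ _ _ (hperm π) (hsign ε)

/-- An element of the group generated by the simple reflections that acts as a given signed
permutation. -/
noncomputable def realizer (hι : Function.Injective ι) (x : Equiv.Perm (Fin m) × (Fin m → ℤˣ)) :
    RatField r ≃ₐ[ℂ] RatField r := (exists_realizes hι x.1 x.2).choose

theorem realizer_mem (hι : Function.Injective ι) (x) :
    realizer hι x ∈ Submonoid.closure (Set.range (simpleAut ι)) :=
  (exists_realizes hι x.1 x.2).choose_spec.1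

theorem realizer_realizes (hι : Function.Injective ι) (x) :
    Realizes ι (realizer hι x) x.1 x.2 :=
  (exists_realizes hι x.1 x.2).choose_spec.2

theorem card_signedPerm (m : ℕ) :
    Fintype.card (Equiv.Perm (Fin m) × (Fin m → ℤˣ)) = 2 ^ m * m.factorial := by
  rw [Fintype.card_prod, Fintype.card_perm, Fintype.card_fin, Fintype.card_fun, Fintype.card_fin,
    mul_comm]
  rfl

end Realize

/-! ### The polynomial representation in a subset of the variables -/

section Root

variable {r : ℕ}

theorem algebraMap_X_eq (i : Fin r) :
    algebraMap (MvPolynomial (Fin r) ℂ) (RatField r) (.X i) = kX i := rfl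

theorem algebraMap_C_eq (c : ℂ) :
    algebraMap (MvPolynomial (Fin r) ℂ) (RatField r) (.C c) = algebraMap ℂ (RatField r) c := by
  rw [IsScalarTower.algebraMap_apply ℂ (MvPolynomial (Fin r) ℂ) (RatField r)]
  rfl

theorem kX_mul_inv_ne (c : ℂ) {i j : Fin r} (h : i ≠ j) :
    kX i * (kX j)⁻¹ ≠ algebraMap ℂ (RatField r) c := by
  intro h'
  rw [mul_inv_eq_iff_eq_mul₀ (kX_ne_zero j), ← algebraMap_X_eq, ← algebraMap_X_eq,
    ← algebraMap_C_eq, ← map_mul] at h'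
  have h'' := IsFractionRing.injective (MvPolynomial (Fin r) ℂ) (RatField r) h'
  simpa [h.symm] using congrArg (MvPolynomial.eval (Pi.single i 1 : Fin r → ℂ)) h''

theorem kX_mul_ne (c : ℂ) {i j : Fin r} : kX i * kX j ≠ algebraMap ℂ (RatField r) c := by
  intro h'
  rw [← algebraMap_X_eq, ← algebraMap_X_eq, ← algebraMap_C_eq, ← map_mul] at h'
  have h'' := IsFractionRing.injective (MvPolynomial (Fin r) ℂ) (RatField r) h'
  have h0 := congrArg (MvPolynomial.eval (0 : Fin r → ℂ)) h''
  have h1 := congrArg (MvPolynomial.eval (1 : Fin r → ℂ)) h''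
  simp at h0 h1
  rw [← h0] at h1
  exact one_ne_zero h1

theorem dlCoeff_ne_zero {p : ℂ} {e : RatField r} (hp : p ≠ 0)
    (he : ∀ c, e ≠ algebraMap ℂ (RatField r) c) : dlCoeff (algebraMap ℂ (RatField r) p) e ≠ 0 := by
  have hp' : algebraMap ℂ (RatField r) p ≠ 0 := by simpa using hp
  refine div_ne_zero (fun h => he (p⁻¹ * p⁻¹) ?_) (sub_ne_zero.2 (Ne.symm ?_))
  · rw [map_mul, map_inv₀]
    nth_rw 1 [sub_eq_zero.1 h]
    field_simp
  · simpa using he 1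

variable {m : ℕ} {ι : Fin m → Fin r}

theorem varDatum_root_ne (hι : Function.Injective ι) (i : Fin m) (c : ℂ) :
    (varDatum ι hι).root i ≠ algebraMap ℂ (RatField r) c := by
  by_cases hi : i.val = 0
  · rw [ReflectionDatum.root_zero _ hi]
    intro h
    change (kX (ι i))⁻¹ ^ 2 = _ at h
    rw [inv_pow, inv_eq_iff_eq_inv, sq, ← map_inv₀] at h
    exact kX_mul_ne _ h
  · obtain ⟨j, hj⟩ := exists_pred hi
    rw [ReflectionDatum.root_succ _ hj]
    exact kX_mul_inv_ne c (hι.ne (by rintro rfl; omega))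

/-- The polynomial representation of `H_m^B` on `ℂ(X_1, …, X_r)` through the variables `X_{ι j}`. -/
noncomputable def varRep (hι : Function.Injective ι) (p0 p1 : ℂˣ) :
    HB m p0 p1 →ₐ[ℂ] Module.End ℂ (RatField r) := (varDatum ι hι).rep p0 p1

theorem varRep_T (hι : Function.Injective ι) (p0 p1 : ℂˣ) (i : Fin m) :
    varRep hι p0 p1 (HB.T p0 p1 i) =
      dlOp (par p0 p1 i : ℂ) ((varDatum ι hι).root i) (simpleAut ι i) :=
  (varDatum ι hι).rep_T p0 p1 i

theorem varRep_X (hι : Function.Injective ι) (p0 p1 : ℂˣ) (i : Fin m) :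
    varRep hι p0 p1 (HB.X p0 p1 i) = Algebra.lmul ℂ (RatField r) (kX (ι i)) :=
  (varDatum ι hι).rep_X p0 p1 i

theorem varRep_Xinv (hι : Function.Injective ι) (p0 p1 : ℂˣ) (i : Fin m) :
    varRep hι p0 p1 (HB.Xinv p0 p1 i) = Algebra.lmul ℂ (RatField r) (kX (ι i))⁻¹ :=
  (varDatum ι hι).rep_Xinv p0 p1 i

theorem varRep_pol (hι : Function.Injective ι) (p0 p1 : ℂˣ) {g : HB m p0 p1}
    (hg : g ∈ HB.pol m p0 p1) :
    ∃ f, varRep hι p0 p1 g = Algebra.lmul ℂ (RatField r) f := by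
  induction hg using Algebra.adjoin_induction with
  | mem x hx =>
    rcases hx with ⟨i, rfl⟩ | ⟨i, rfl⟩
    · exact ⟨_, varRep_X hι p0 p1 i⟩
    · exact ⟨_, varRep_Xinv hι p0 p1 i⟩
  | algebraMap c => exact ⟨algebraMap ℂ _ c, by rw [AlgHom.commutes, AlgHom.commutes]⟩
  | add a b _ _ ha hb =>
    obtain ⟨f, hf⟩ := ha
    obtain ⟨f', hf'⟩ := hb
    exact ⟨f + f', by rw [map_add, map_add, hf, hf']⟩
  | mul a b _ _ ha hb =>
    obtain ⟨f, hf⟩ := ha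
    obtain ⟨f', hf'⟩ := hb
    exact ⟨f * f', by rw [map_mul, map_mul, hf, hf']⟩

end Root

/-! ### Faithfulness of the polynomial representation -/

section Injective

variable {r : ℕ}

/-- A representation whose restriction to commuting invertible elements `x i` is multiplication by
distinct variables is faithful if it sends generators `t k` over the Laurent polynomials in the
`x i` to linearly independent operators. -/
theorem injective_of_linearIndependent {A : Type*} [Ring A] [Algebra ℂ A]
    (ρ : A →ₐ[ℂ] Module.End ℂ (RatField r)) {ι I : Type*} [Fintype ι] (t : ι → A)
    (x y : I → A) (hxy : ∀ i, x i * y i = 1)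
    (hcomm : ∀ a ∈ Set.range x ∪ Set.range y, ∀ b ∈ Set.range x ∪ Set.range y, a * b = b * a)
    (v : I → Fin r) (hv : Function.Injective v)
    (hρ : ∀ i, ρ (x i) = Algebra.lmul ℂ (RatField r) (kX (v i)))
    (hP : ∀ g ∈ Algebra.adjoin ℂ (Set.range x ∪ Set.range y),
      ∃ f, ρ g = Algebra.lmul ℂ (RatField r) f)
    (hspan : ∀ a, ∃ g : ι → A,
      (∀ k, g k ∈ Algebra.adjoin ℂ (Set.range x ∪ Set.range y)) ∧ a = ∑ k, g k * t k)
    (hind : LinearIndependent (RatField r) (fun k => ρ (t k))) : Function.Injective ρ := by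
  set S := Algebra.adjoin ℂ (Set.range x ∪ Set.range y) with hS
  have hmc := Algebra.isMulCommutative_adjoin ℂ hcomm
  let _ : CommRing S := { (inferInstance : Ring S) with mul_comm := hmc.1.1 }
  -- On the commutative subalgebra `S` the representation is multiplication by `ψ g = ρ(g) 1`.
  let ψ : S →ₐ[ℂ] RatField r := AlgHom.ofLinearMap
    { toFun := fun g => ρ g 1
      map_add' := fun a b => by simp
      map_smul' := fun c a => by simp }
    (by simp) (fun a b => by
      obtain ⟨f, hf⟩ := hP a a.2
      change ρ (a * b : A) 1 = ρ a 1 * ρ b 1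
      rw [map_mul, Module.End.mul_apply, hf]
      simp)
  have hψ : ∀ g : S, ρ g = Algebra.lmul ℂ (RatField r) (ψ g) := fun g => by
    obtain ⟨f, hf⟩ := hP g g.2
    have : ψ g = f := by
      change ρ g 1 = f
      rw [hf]
      simp
    rw [this, hf]
  have hx : ∀ i, x i ∈ S := fun i => Algebra.subset_adjoin (.inl ⟨i, rfl⟩)
  have hy : ∀ i, y i ∈ S := fun i => Algebra.subset_adjoin (.inr ⟨i, rfl⟩)
  have h0 : ∀ g : S, ψ g = 0 → g = 0 := by
    intro g hg
    refine eq_zero_of_laurent ψ (fun i => ⟨x i, hx i⟩) (fun i => ⟨y i, hy i⟩)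
      (fun i => Subtype.ext (hxy i)) v hv (fun i => ?_) ?_ hg
    · change ρ (x i) 1 = _
      rw [hρ]
      simp
    · have : (Algebra.adjoin ℂ (Set.range (fun i => (⟨x i, hx i⟩ : S)) ∪
          Set.range (fun i => (⟨y i, hy i⟩ : S)))).map S.val = S := by
        rw [AlgHom.map_adjoin, Set.image_union, ← Set.range_comp, ← Set.range_comp]
        rfl
      obtain ⟨g', hg', h⟩ := this.symm.le g.2
      rwa [← Subtype.ext (show (g' : A) = g from h)]
  rw [injective_iff_map_eq_zero]
  intro a ha
  obtain ⟨g, hg, rfl⟩ := hspan a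
  rw [map_sum] at ha
  simp only [map_mul] at ha
  have h1 : ∑ k, ψ ⟨g k, hg k⟩ • ρ (t k) = 0 := by
    rw [← ha]
    refine Finset.sum_congr rfl fun k _ => ?_
    rw [smul_end_eq, ← hψ]
  have h2 := Fintype.linearIndependent_iff.1 hind _ h1
  refine Finset.sum_eq_zero fun k _ => ?_
  have := congrArg Subtype.val (h0 _ (h2 k))
  rw [show g k = 0 from this, zero_mul]

end Injective

namespace HB

variable {n : ℕ} (p0 p1 : ℂˣ)

theorem commute_Xinv {a : HB n p0 p1} {i : Fin n} (h : a * X p0 p1 i = X p0 p1 i * a) :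
    a * Xinv p0 p1 i = Xinv p0 p1 i * a := by
  calc a * Xinv p0 p1 i = Xinv p0 p1 i * (X p0 p1 i * a) * Xinv p0 p1 i := by
        rw [← mul_assoc, Xinv_mul_X, one_mul]
    _ = _ := by rw [← h, mul_assoc, mul_assoc, X_mul_Xinv, mul_one]

theorem pol_comm : ∀ a ∈ Set.range (X (n := n) p0 p1) ∪ Set.range (Xinv p0 p1),
    ∀ b ∈ Set.range (X (n := n) p0 p1) ∪ Set.range (Xinv p0 p1), a * b = b * a := by
  rintro _ (⟨i, rfl⟩ | ⟨i, rfl⟩) _ (⟨j, rfl⟩ | ⟨j, rfl⟩)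
  · exact X_comm p0 p1 i j
  · exact commute_Xinv p0 p1 (X_comm p0 p1 i j)
  · exact (commute_Xinv p0 p1 (X_comm p0 p1 j i)).symm
  · exact commute_Xinv p0 p1 (commute_Xinv p0 p1 (X_comm p0 p1 j i)).symm

end HB

section Faithful

variable {n m r : ℕ} {ι : Fin n → Fin r} {κ : Fin m → Fin r}

/-- The spanning family of `H_n^B` over the Laurent polynomials has `2^n n!` members, as many as
there are signed permutations; therefore it acts by linearly independent operators. -/
theorem varRep_linearIndependent (hι : Function.Injective ι) (p0 p1 : ℂˣ) :
    ∃ (J : Type) (_ : Fintype J) (t : J → HB n p0 p1),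
      LinearIndependent (RatField r) (fun k => varRep hι p0 p1 (t k)) ∧
      ∀ h, ∃ g : J → HB n p0 p1, (∀ k, g k ∈ HB.pol n p0 p1) ∧ h = ∑ k, g k * t k := by
  obtain ⟨J, hJ, t, hcard, hspan⟩ := HB.exists_span (n := n) p0 p1
  refine ⟨J, hJ, t, ?_, hspan⟩
  refine linearIndependent_of_card_le (varRep hι p0 p1) t (HB.T p0 p1) _ _ (simpleAut ι)
    (varRep_T hι p0 p1) (fun i => dlCoeff_ne_zero (by simp) (varDatum_root_ne hι i))
    (HB.pol n p0 p1) (fun g hg => varRep_pol hι p0 p1 hg) hspan (realizer hι) ?_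
    (realizer_mem hι) (by rw [hcard, card_signedPerm])
  intro a b hab
  have := (realizer_realizes hι a).inj hι (realizer_realizes hι b) (fun k => by rw [hab])
  exact Prod.ext this.1 this.2

/-- The polynomial representation is faithful. -/
theorem varRep_injective (hι : Function.Injective ι) (p0 p1 : ℂˣ) :
    Function.Injective (varRep hι p0 p1) := by
  obtain ⟨J, hJ, t, hind, hspan⟩ := varRep_linearIndependent hι p0 p1
  exact injective_of_linearIndependent (varRep hι p0 p1) t (HB.X p0 p1) (HB.Xinv p0 p1)
    (HB.X_mul_Xinv p0 p1) (HB.pol_comm p0 p1) ι hι (varRep_X hι p0 p1)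
    (fun g hg => varRep_pol hι p0 p1 hg) hspan hind

theorem exists_realizes_simpleAut (hι : Function.Injective ι) (i : Fin n) :
    ∃ π ε, Realizes ι (simpleAut ι i) π ε := by
  by_cases hi : i.val = 0
  · rw [simpleAut_zero ι hi]
    exact ⟨_, _, realizes_flipAut hι i⟩
  · obtain ⟨j, hj⟩ := exists_pred hi
    rw [simpleAut_succ ι hj]
    exact ⟨_, _, realizes_swapAut hι j i⟩

theorem Realizes.commute {σ τ : RatField r ≃ₐ[ℂ] RatField r} {π : Equiv.Perm (Fin n)}
    {ε : Fin n → ℤˣ} {ρ : Equiv.Perm (Fin m)} {η : Fin m → ℤˣ} (h : Realizes ι σ π ε)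
    (h' : Realizes κ τ ρ η) (hd : ∀ i j, ι i ≠ κ j) (f : RatField r) : σ (τ f) = τ (σ f) := by
  have hι : ∀ i, ι i ∉ Set.range κ := by rintro i ⟨j, hj⟩; exact hd i j hj.symm
  have hκ : ∀ j, κ j ∉ Set.range ι := by rintro i ⟨j, hj⟩; exact hd j i hj
  refine algEquiv_apply_eq (σ := σ * τ) (τ := τ * σ) (fun k => ?_) f
  simp only [AlgEquiv.mul_apply]
  by_cases h1 : k ∈ Set.range ι
  · obtain ⟨i, rfl⟩ := h1
    rw [h'.2 _ (hι i), h.1, map_zpow₀, h'.2 _ (hι _)]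
  · by_cases h2 : k ∈ Set.range κ
    · obtain ⟨j, rfl⟩ := h2
      rw [h.2 _ (hκ j), h'.1, map_zpow₀, h.2 _ (hκ _)]
    · rw [h'.2 k h2, h.2 k h1, h'.2 k h2]

theorem simpleAut_fix (hι : Function.Injective ι) (hd : ∀ i j, ι i ≠ κ j) (i : Fin n) (j : Fin m) :
    simpleAut ι i (kX (κ j)) = kX (κ j) := by
  obtain ⟨π, ε, h⟩ := exists_realizes_simpleAut hι i
  exact h.2 _ (by rintro ⟨k, hk⟩; exact hd k j hk)

theorem simpleAut_root (hι : Function.Injective ι) (hκ : Function.Injective κ)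
    (hd : ∀ i j, ι i ≠ κ j) (i : Fin n) (j : Fin m) :
    simpleAut ι i ((varDatum κ hκ).root j) = (varDatum κ hκ).root j := by
  unfold ReflectionDatum.root
  change simpleAut ι i (if _ then (kX (κ _))⁻¹ ^ 2 else kX (κ _) * (kX (κ _))⁻¹) =
    if _ then (kX (κ _))⁻¹ ^ 2 else kX (κ _) * (kX (κ _))⁻¹
  split_ifs <;> simp [simpleAut_fix hι hd]

theorem dlOp_mul_lmul_of_fix {σ : RatField r ≃ₐ[ℂ] RatField r} {p : ℂ} {e f : RatField r}
    (h : σ f = f) : Commute (dlOp p e σ) (Algebra.lmul ℂ _ f) := by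
  rw [Commute, SemiconjBy, dlOp_mul_lmul, h, sub_self, mul_zero, map_zero, add_zero]

/-- An operator commutes with the image of `H_n^B` if it commutes with the images of the `T_i` and
the `X_i`. -/
theorem commute_of_generators {A : Type*} [Ring A] [Algebra ℂ A] {p0 p1 : ℂˣ}
    (ρ : HB n p0 p1 →ₐ[ℂ] A) {y : A}
    (hT : ∀ i, Commute (ρ (HB.T p0 p1 i)) y) (hX : ∀ i, Commute (ρ (HB.X p0 p1 i)) y)
    (a : HB n p0 p1) : Commute (ρ a) y := by
  refine HB.induction_left p0 p1 (P := fun a => Commute (ρ a) y) (by simp) ?_ ?_ ?_ ?_ ?_ a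
  · intro a b ha hb; rw [map_add]; exact ha.add_left hb
  · intro c a ha; rw [map_smul]; exact ha.smul_left c
  · intro i a ha; rw [map_mul]; exact (hT i).mul_left ha
  · intro i a ha; rw [map_mul]; exact (hX i).mul_left ha
  · intro i a ha
    rw [map_mul]
    have h1 : ρ (HB.X p0 p1 i) * ρ (HB.Xinv p0 p1 i) = 1 := by
      rw [← map_mul, HB.X_mul_Xinv, map_one]
    have h2 : ρ (HB.Xinv p0 p1 i) * ρ (HB.X p0 p1 i) = 1 := by
      rw [← map_mul, HB.Xinv_mul_X, map_one]
    refine Commute.mul_left ?_ ha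
    exact Commute.units_inv_left (u := ⟨_, _, h1, h2⟩) (hX i)

theorem varRep_commute (hι : Function.Injective ι) (hκ : Function.Injective κ)
    (hd : ∀ i j, ι i ≠ κ j) (p0 p1 : ℂˣ) (a : HB n p0 p1) (b : HB m p0 p1) :
    Commute (varRep hι p0 p1 a) (varRep hκ p0 p1 b) := by
  have hd' : ∀ i j, κ i ≠ ι j := fun i j h => hd j i h.symm
  refine commute_of_generators _ (fun i => ?_) (fun i => ?_) a
  · refine (commute_of_generators _ (fun j => ?_) (fun j => ?_) b).symm
    · rw [varRep_T, varRep_T]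
      obtain ⟨π, ε, h⟩ := exists_realizes_simpleAut hι i
      obtain ⟨ρ, η, h'⟩ := exists_realizes_simpleAut hκ j
      exact dlOp_comm (simpleAut_root hκ hι hd' j i) (simpleAut_root hι hκ hd i j)
        (h'.commute h hd')
    · rw [varRep_T, varRep_X]
      exact (dlOp_mul_lmul_of_fix (simpleAut_fix hι hd i j)).symm
  · refine (commute_of_generators _ (fun j => ?_) (fun j => ?_) b).symm
    · rw [varRep_T, varRep_X]
      exact dlOp_mul_lmul_of_fix (simpleAut_fix hκ hd' j i)
    · rw [varRep_X, varRep_X]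
      exact (Commute.all _ _).map _

/-- The representation of `H_n^B ⊗ H_m^B` on `ℂ(X_1, …, X_r)` through two disjoint sets of
variables. -/
noncomputable def pairRep (hι : Function.Injective ι) (hκ : Function.Injective κ)
    (hd : ∀ i j, ι i ≠ κ j) (p0 p1 : ℂˣ) :
    HB n p0 p1 ⊗[ℂ] HB m p0 p1 →ₐ[ℂ] Module.End ℂ (RatField r) :=
  Algebra.TensorProduct.lift (varRep hι p0 p1) (varRep hκ p0 p1) (varRep_commute hι hκ hd p0 p1)

theorem pairRep_tmul (hι : Function.Injective ι) (hκ : Function.Injective κ)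
    (hd : ∀ i j, ι i ≠ κ j) (p0 p1 : ℂˣ) (a : HB n p0 p1) (b : HB m p0 p1) :
    pairRep hι hκ hd p0 p1 (a ⊗ₜ b) = varRep hι p0 p1 a * varRep hκ p0 p1 b := by
  simp [pairRep]

/-- The action of `H_n^B ⊗ H_m^B` in two disjoint sets of variables is faithful, by the same count
as for a single algebra. -/
theorem pairRep_injective (hι : Function.Injective ι) (hκ : Function.Injective κ)
    (hd : ∀ i j, ι i ≠ κ j) (p0 p1 : ℂˣ) : Function.Injective (pairRep hι hκ hd p0 p1) := by
  obtain ⟨J, hJ, t, hcard, hspan⟩ := HB.exists_span (n := n) p0 p1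
  obtain ⟨J', hJ', t', hcard', hspan'⟩ := HB.exists_span (n := m) p0 p1
  let x : Fin n ⊕ Fin m → HB n p0 p1 ⊗[ℂ] HB m p0 p1 :=
    Sum.elim (fun i => HB.X p0 p1 i ⊗ₜ 1) (fun j => 1 ⊗ₜ HB.X p0 p1 j)
  let y : Fin n ⊕ Fin m → HB n p0 p1 ⊗[ℂ] HB m p0 p1 :=
    Sum.elim (fun i => HB.Xinv p0 p1 i ⊗ₜ 1) (fun j => 1 ⊗ₜ HB.Xinv p0 p1 j)
  set S := Algebra.adjoin ℂ (Set.range x ∪ Set.range y)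
  have hmemL : ∀ g ∈ HB.pol n p0 p1, g ⊗ₜ[ℂ] (1 : HB m p0 p1) ∈ S := by
    suffices h : HB.pol n p0 p1 ≤ S.comap Algebra.TensorProduct.includeLeft from fun g hg => h hg
    refine Algebra.adjoin_le ?_
    rintro _ (⟨i, rfl⟩ | ⟨i, rfl⟩)
    · exact Algebra.subset_adjoin (.inl ⟨.inl i, rfl⟩)
    · exact Algebra.subset_adjoin (.inr ⟨.inl i, rfl⟩)
  have hmemR : ∀ g ∈ HB.pol m p0 p1, (1 : HB n p0 p1) ⊗ₜ[ℂ] g ∈ S := by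
    suffices h : HB.pol m p0 p1 ≤ S.comap Algebra.TensorProduct.includeRight from fun g hg => h hg
    refine Algebra.adjoin_le ?_
    rintro _ (⟨i, rfl⟩ | ⟨i, rfl⟩)
    · exact Algebra.subset_adjoin (.inl ⟨.inr i, rfl⟩)
    · exact Algebra.subset_adjoin (.inr ⟨.inr i, rfl⟩)
  -- Pairs from the two spanning families span the tensor product over the Laurent polynomials in
  -- all variables.
  have hspan'' : ∀ a, ∃ g : J × J' → HB n p0 p1 ⊗[ℂ] HB m p0 p1,
      (∀ k, g k ∈ S) ∧ a = ∑ k, g k * (t k.1 ⊗ₜ t' k.2) := by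
    intro a
    induction a using TensorProduct.induction_on with
    | zero => exact ⟨fun _ => 0, fun _ => zero_mem _, by simp⟩
    | add a b ha hb =>
      obtain ⟨g, hg, rfl⟩ := ha
      obtain ⟨g', hg', rfl⟩ := hb
      exact ⟨fun k => g k + g' k, fun k => add_mem (hg k) (hg' k), by
        simp only [add_mul, Finset.sum_add_distrib]⟩
    | tmul a b =>
      obtain ⟨g, hg, rfl⟩ := hspan a
      obtain ⟨g', hg', rfl⟩ := hspan' b
      refine ⟨fun k => g k.1 ⊗ₜ g' k.2, fun k => ?_, ?_⟩
      · have := mul_mem (hmemL _ (hg k.1)) (hmemR _ (hg' k.2))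
        simpa using this
      · rw [TensorProduct.sum_tmul, Fintype.sum_prod_type]
        refine Finset.sum_congr rfl fun k _ => ?_
        rw [TensorProduct.tmul_sum]
        simp
  have hP : ∀ g ∈ S, ∃ f, pairRep hι hκ hd p0 p1 g = Algebra.lmul ℂ (RatField r) f := by
    intro g hg
    have : S ≤ (Algebra.lmul ℂ (RatField r)).range.comap (pairRep hι hκ hd p0 p1) := by
      refine Algebra.adjoin_le ?_
      rintro _ (⟨i | i, rfl⟩ | ⟨i | i, rfl⟩) <;>
        simp only [x, y, Sum.elim_inl, Sum.elim_inr, Subalgebra.coe_comap, Set.mem_preimage,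
          pairRep_tmul, map_one, one_mul, mul_one, varRep_X, varRep_Xinv] <;>
        exact ⟨_, rfl⟩
    obtain ⟨f, hf⟩ := this hg
    exact ⟨f, hf.symm⟩
  -- The two groups of signed permutations act on disjoint sets of variables, so that all products
  -- of their elements are distinct, and their number is the number of pairs.
  have hind := linearIndependent_of_card_le (pairRep hι hκ hd p0 p1) (fun k : J × J' => t k.1 ⊗ₜ t' k.2)
    (Sum.elim (fun i => HB.T p0 p1 i ⊗ₜ 1) (fun j => 1 ⊗ₜ HB.T p0 p1 j))
    (Sum.elim (fun i => (par p0 p1 i : ℂ)) (fun j => (par p0 p1 j : ℂ)))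
    (Sum.elim (varDatum ι hι).root (varDatum κ hκ).root)
    (Sum.elim (simpleAut ι) (simpleAut κ))
    (by rintro (i | j) <;> simp [pairRep_tmul, varRep_T])
    (by
      rintro (i | j)
      · exact dlCoeff_ne_zero (by simp) (varDatum_root_ne hι i)
      · exact dlCoeff_ne_zero (by simp) (varDatum_root_ne hκ j))
    S hP hspan'' (fun a : (Equiv.Perm (Fin n) × (Fin n → ℤˣ)) × (Equiv.Perm (Fin m) × (Fin m → ℤˣ)) =>
      realizer hι a.1 * realizer hκ a.2)
    (by
      intro a b hab
      have hab' := fun f => DFunLike.congr_fun hab f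
      simp only [AlgEquiv.mul_apply] at hab'
      have hL : ∀ k, realizer hι a.1 (kX (ι k)) = realizer hι b.1 (kX (ι k)) := fun k => by
        have := hab' (kX (ι k))
        rwa [(realizer_realizes hκ a.2).2 _ (by rintro ⟨j, hj⟩; exact hd k j hj.symm),
          (realizer_realizes hκ b.2).2 _ (by rintro ⟨j, hj⟩; exact hd k j hj.symm)] at this
      have hR : ∀ k, realizer hκ a.2 (kX (κ k)) = realizer hκ b.2 (kX (κ k)) := fun k => by
        have := hab' (kX (κ k))
        rwa [(realizer_realizes hκ a.2).1, (realizer_realizes hκ b.2).1, map_zpow₀, map_zpow₀,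
          (realizer_realizes hι a.1).2 _ (by rintro ⟨j, hj⟩; exact hd j _ hj),
          (realizer_realizes hι b.1).2 _ (by rintro ⟨j, hj⟩; exact hd j _ hj),
          ← (realizer_realizes hκ a.2).1, ← (realizer_realizes hκ b.2).1] at this
      have h1 := (realizer_realizes hι a.1).inj hι (realizer_realizes hι b.1) hL
      have h2 := (realizer_realizes hκ a.2).inj hκ (realizer_realizes hκ b.2) hR
      exact Prod.ext (Prod.ext h1.1 h1.2) (Prod.ext h2.1 h2.2))
    (by
      intro a
      have hsub : ∀ s' : Set (RatField r ≃ₐ[ℂ] RatField r),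
          s' ⊆ Set.range (Sum.elim (simpleAut ι) (simpleAut κ)) →
          Submonoid.closure s' ≤ Submonoid.closure (Set.range (Sum.elim (simpleAut ι) (simpleAut κ))) :=
        fun s' h => Submonoid.closure_mono h
      refine mul_mem (hsub _ ?_ (realizer_mem hι a.1)) (hsub _ ?_ (realizer_mem hκ a.2))
      · rintro _ ⟨i, rfl⟩; exact ⟨.inl i, rfl⟩
      · rintro _ ⟨i, rfl⟩; exact ⟨.inr i, rfl⟩)
    (by rw [Fintype.card_prod, hcard, hcard', Fintype.card_prod, card_signedPerm, card_signedPerm])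
  refine injective_of_linearIndependent (pairRep hι hκ hd p0 p1) _ x y ?_ ?_ (Sum.elim ι κ)
    (hι.sumElim hκ hd) ?_ hP hspan'' hind
  · rintro (i | j) <;> simp [x, y, HB.X_mul_Xinv, Algebra.TensorProduct.one_def]
  · rintro _ (⟨i | i, rfl⟩ | ⟨i | i, rfl⟩) _ (⟨j | j, rfl⟩ | ⟨j | j, rfl⟩) <;>
      simp only [x, y, Sum.elim_inl, Sum.elim_inr, Algebra.TensorProduct.tmul_mul_tmul, one_mul, mul_one] <;>
      first
        | rfl
        | exact congrArg (· ⊗ₜ[ℂ] (1 : HB m p0 p1)) (HB.pol_comm p0 p1 _ (by simp) _ (by simp))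
        | exact congrArg ((1 : HB n p0 p1) ⊗ₜ[ℂ] ·) (HB.pol_comm p0 p1 _ (by simp) _ (by simp))
  · rintro (i | j) <;> simp only [x, Sum.elim_inl, Sum.elim_inr, pairRep_tmul, map_one, one_mul,
      mul_one, varRep_X]

end Faithful

/-! ### Localization at one denominator, and coset data -/

section Localization

variable {B R : Type*} [Ring B] [Algebra ℂ B] [Ring R] [Algebra ℂ R]

/-- The elements of `R` that lie in the image of `j` after multiplication on the right by a power
of `j z`; when `j z` is invertible, this is the localization `j(B)[(j z)⁻¹]` (a subspace only). -/
def rightLoc (j : B →ₐ[ℂ] R) (z : B) : Submodule ℂ R where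
  carrier := {q | ∃ (k : ℕ) (b : B), q * j z ^ k = j b}
  zero_mem' := ⟨0, 0, by simp⟩
  add_mem' := by
    rintro q q' ⟨k, b, h⟩ ⟨k', b', h'⟩
    refine ⟨k + k', b * z ^ k' + b' * z ^ k, ?_⟩
    rw [add_mul, map_add, map_mul, map_mul, map_pow, map_pow, ← h, ← h', mul_assoc, mul_assoc,
      ← pow_add, ← pow_add, add_comm k' k]
  smul_mem' := by
    rintro c q ⟨k, b, h⟩
    exact ⟨k, c • b, by rw [smul_mul_assoc, h, map_smul]⟩

variable {j : B →ₐ[ℂ] R} {z : B}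

theorem map_mem_rightLoc (b : B) : j b ∈ rightLoc j z := ⟨0, b, by simp⟩

theorem map_mul_mem_rightLoc (b : B) {q : R} (hq : q ∈ rightLoc j z) : j b * q ∈ rightLoc j z := by
  obtain ⟨k, c, h⟩ := hq
  exact ⟨k, b * c, by rw [mul_assoc, h, map_mul]⟩

theorem mul_mem_rightLoc {q q' : R} (hq : q ∈ rightLoc j z) (hq' : q' ∈ rightLoc j z)
    (hc : Commute q' (j z)) : q * q' ∈ rightLoc j z := by
  obtain ⟨k, b, h⟩ := hq
  obtain ⟨k', b', h'⟩ := hq'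
  refine ⟨k + k', b * b', ?_⟩
  rw [map_mul, ← h, ← h', pow_add, mul_assoc q q', ← mul_assoc q', (hc.pow_right k).eq]
  simp only [mul_assoc]

theorem of_mul_mem_rightLoc {q : R} (h : q * j z ∈ rightLoc j z) : q ∈ rightLoc j z := by
  obtain ⟨k, b, h⟩ := h
  exact ⟨k + 1, b, by rw [pow_succ', ← mul_assoc, h]⟩

variable {V : Type*} [AddCommGroup V] [Module ℂ V]

theorem rightLoc_unique (hz : IsUnit (j z)) {F : B →ₗ[ℂ] V} {l : ℂ} (hl : l ≠ 0)
    (hF : ∀ b, F (b * z) = l • F b) (h0 : ∀ b, j b = 0 → F b = 0) {q : R} {k k' : ℕ} {b b' : B}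
    (h : q * j z ^ k = j b) (h' : q * j z ^ k' = j b') :
    (l⁻¹) ^ k • F b = (l⁻¹) ^ k' • F b' := by
  have hFk : ∀ (k : ℕ) b, F (b * z ^ k) = l ^ k • F b := by
    intro k
    induction k with
    | zero => simp
    | succ k ih => intro b; rw [pow_succ', ← mul_assoc, ih, hF, smul_smul, pow_succ]
  have h1 : j (b * z ^ k' - b' * z ^ k) = 0 := by
    rw [map_sub, map_mul, map_mul, ← h, ← h', map_pow, map_pow, mul_assoc, mul_assoc, ← pow_add,
      ← pow_add, add_comm, sub_self]
  have h2 := h0 _ h1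
  rw [map_sub, hFk, hFk, sub_eq_zero] at h2
  have h3 : F b = (l⁻¹) ^ k' • l ^ k • F b' := by
    rw [← h2, smul_smul, inv_pow, inv_mul_cancel₀ (pow_ne_zero _ hl), one_smul]
  rw [h3, smul_comm ((l⁻¹) ^ k), smul_smul ((l⁻¹) ^ k), inv_pow l k,
    inv_mul_cancel₀ (pow_ne_zero _ hl), one_smul]

/-- A linear map on `B` for which right multiplication by `z` is multiplication by the scalar
`l ≠ 0` extends to the localization at `z`. -/
theorem exists_rightLoc_extension (hz : IsUnit (j z)) {F : B →ₗ[ℂ] V} {l : ℂ} (hl : l ≠ 0)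
    (hF : ∀ b, F (b * z) = l • F b) (h0 : ∀ b, j b = 0 → F b = 0) :
    ∃ G : rightLoc j z →ₗ[ℂ] V, ∀ (q : rightLoc j z) (k : ℕ) (b : B),
      (q : R) * j z ^ k = j b → G q = (l⁻¹) ^ k • F b := by
  choose k b h using fun q : rightLoc j z => q.2
  refine ⟨{ toFun := fun q => (l⁻¹) ^ k q • F (b q), map_add' := ?_, map_smul' := ?_ }, ?_⟩
  · intro q q'
    have hFk : ∀ (k : ℕ) b, F (b * z ^ k) = l ^ k • F b := by
      intro k
      induction k with
      | zero => simp
      | succ k ih => intro b; rw [pow_succ', ← mul_assoc, ih, hF, smul_smul, pow_succ]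
    rw [rightLoc_unique hz hl hF h0 (k' := k q + k q') (b' := b q * z ^ k q' + b q' * z ^ k q)
      (h (q + q')), map_add, hFk, hFk, smul_add, smul_smul, smul_smul, pow_add, mul_assoc,
      mul_right_comm, inv_pow l (k q'), inv_mul_cancel₀ (pow_ne_zero _ hl), mul_one, inv_pow l (k q),
      inv_mul_cancel₀ (pow_ne_zero _ hl), one_mul]
    change ((q : R) + q') * _ = _
    rw [add_mul, map_add, map_mul, map_mul, map_pow, map_pow, ← h, ← h, mul_assoc, mul_assoc,
      ← pow_add, ← pow_add, add_comm (k q') (k q)]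
  · intro c q
    rw [rightLoc_unique hz hl hF h0 (k' := k q) (b' := c • b q) (h (c • q)), map_smul,
      RingHom.id_apply, smul_comm]
    change (c • (q : R)) * _ = _
    rw [smul_mul_assoc, h, map_smul]
  · intro q k' b' h'
    exact rightLoc_unique hz hl hF h0 (h q) h'

end Localization

/-- The polynomial representation of `H_r^B` on `ℂ(X_1, …, X_r)`. -/
noncomputable abbrev stdRep (r : ℕ) (p0 p1 : ℂˣ) : HB r p0 p1 →ₐ[ℂ] Module.End ℂ (RatField r) :=
  varRep (ι := (id : Fin r → Fin r)) Function.injective_id p0 p1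

/-- Data exhibiting the localization of `H_r^B` at `z` as a free right module over a localized
algebra `𝔄`, with a basis of automorphisms of `ℂ(X_1, …, X_r)`. Everything takes place inside the
algebra of operators on `ℂ(X_1, …, X_r)`. -/
structure CosetDatum (r : ℕ) (p0 p1 : ℂˣ) (A : Type*) [Ring A] [Algebra ℂ A] where
  /-- The representation of `𝔄`. -/
  j : A →ₐ[ℂ] Module.End ℂ (RatField r)
  /-- The denominator, as an element of `H_r^B`. -/
  zH : HB r p0 p1
  /-- The denominator, as an element of `𝔄`. -/
  zA : A
  j_zA : j zA = stdRep r p0 p1 zH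
  isUnit_z : IsUnit (j zA)
  comm : ∀ a, Commute (j a) (j zA)
  j_mem : ∀ a, j a ∈ rightLoc (stdRep r p0 p1) zH
  /-- The index set of the basis. -/
  I : Type
  fintype : Fintype I
  /-- The automorphisms forming the basis. -/
  aut : I → (RatField r ≃ₐ[ℂ] RatField r)
  one : I
  aut_one : aut one = 1
  aut_mem : ∀ s, (aut s).toLinearMap ∈ rightLoc (stdRep r p0 p1) zH
  /-- The element of `𝔄` by which `X_{i+1}` acts after being moved past the automorphism `s`. -/
  y : I → Fin r → A
  X_mul_aut : ∀ s i, Algebra.lmul ℂ (RatField r) (kX i) * (aut s).toLinearMap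
    = (aut s).toLinearMap * j (y s i)
  Xinv_mul_aut : ∀ s i, ∃ y', Algebra.lmul ℂ (RatField r) (kX i)⁻¹ * (aut s).toLinearMap
    = (aut s).toLinearMap * j y'
  T_mul_aut : ∀ i s, ∃ s', ∃ q ∈ rightLoc j zA, ∃ q' ∈ rightLoc j zA,
    stdRep r p0 p1 (HB.T p0 p1 i) * (aut s).toLinearMap
      = (aut s).toLinearMap * q + (aut s').toLinearMap * q'
  indep : ∀ c : I → rightLoc j zA, ∑ s, (aut s).toLinearMap * (c s : Module.End ℂ (RatField r)) = 0 →
    (c one : Module.End ℂ (RatField r)) = 0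

attribute [instance] CosetDatum.fintype

namespace CosetDatum

variable {r : ℕ} {p0 p1 : ℂˣ} {A : Type*} [Ring A] [Algebra ℂ A] (D : CosetDatum r p0 p1 A)

/-- The localization of `H_r^B`. -/
noncomputable abbrev locH : Submodule ℂ (Module.End ℂ (RatField r)) := rightLoc (stdRep r p0 p1) D.zH

/-- The localization of `𝔄`. -/
noncomputable abbrev locA : Submodule ℂ (Module.End ℂ (RatField r)) := rightLoc D.j D.zA

theorem commute_locA {q : Module.End ℂ (RatField r)} (hq : q ∈ D.locA) : Commute q (D.j D.zA) := by
  obtain ⟨k, a, h⟩ := hq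
  have h1 := D.comm a
  rw [← h] at h1
  have hu := D.isUnit_z.pow k
  have h2 : (q * D.j D.zA) * D.j D.zA ^ k = (D.j D.zA * q) * D.j D.zA ^ k := by
    have := h1.eq
    rw [mul_assoc, ← pow_succ] at this
    rw [mul_assoc, ← pow_succ', this, mul_assoc]
  exact hu.mul_left_inj.1 h2

theorem locA_mul {q q' : Module.End ℂ (RatField r)} (hq : q ∈ D.locA) (hq' : q' ∈ D.locA) :
    q * q' ∈ D.locA := mul_mem_rightLoc hq hq' (D.commute_locA hq')

theorem locA_le_locH : D.locA ≤ D.locH := by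
  intro q ⟨k, a, h⟩
  have h1 : q * stdRep r p0 p1 D.zH ^ k ∈ D.locH := by
    rw [← D.j_zA, h]
    exact D.j_mem a
  clear h
  induction k with
  | zero => simpa using h1
  | succ k ih =>
    rw [pow_succ, ← mul_assoc] at h1
    exact ih (of_mul_mem_rightLoc h1)

theorem locH_mul_locA {q q' : Module.End ℂ (RatField r)} (hq : q ∈ D.locH) (hq' : q' ∈ D.locA) :
    q * q' ∈ D.locH :=
  mul_mem_rightLoc hq (D.locA_le_locH hq') (by rw [← D.j_zA]; exact D.commute_locA hq')

theorem one_mem_locH : (1 : Module.End ℂ (RatField r)) ∈ D.locH := by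
  simpa using map_mem_rightLoc (j := stdRep r p0 p1) (z := D.zH) 1

theorem exists_z_inv : ∃ y ∈ D.locA, D.j D.zA * y = 1 ∧ y * D.j D.zA = 1 := by
  obtain ⟨u, hu⟩ := D.isUnit_z
  refine ⟨↑u⁻¹, ⟨1, 1, ?_⟩, ?_, ?_⟩ <;> simp [← hu]

/-- The elements of the localization of `H_r^B` are combinations of the automorphisms with
coefficients in the localization of `𝔄`. -/
theorem exists_expansion {q : Module.End ℂ (RatField r)} (hq : q ∈ D.locH) :
    ∃ c : D.I → D.locA, q = ∑ s, (D.aut s).toLinearMap * (c s : Module.End ℂ (RatField r)) := by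
  classical
  -- the set of combinations is stable under left multiplication by the generators of `H_r^B`
  let P : Submodule ℂ (Module.End ℂ (RatField r)) :=
    ⨆ s, D.locA.map (LinearMap.mulLeft ℂ (D.aut s).toLinearMap)
  have hmem : ∀ s, ∀ q ∈ D.locA, (D.aut s).toLinearMap * q ∈ P := fun s q hq =>
    Submodule.mem_iSup_of_mem s ⟨q, hq, rfl⟩
  have hind : ∀ (Q : Module.End ℂ (RatField r)),
      (∀ s, ∀ q ∈ D.locA, Q * ((D.aut s).toLinearMap * q) ∈ P) → ∀ x ∈ P, Q * x ∈ P := by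
    intro Q hQ x hx
    induction hx using Submodule.iSup_induction' with
    | mem s x hx => obtain ⟨q, hq, rfl⟩ := hx; exact hQ s q hq
    | zero => rw [mul_zero]; exact zero_mem _
    | add x y _ _ hx hy => rw [mul_add]; exact add_mem hx hy
  have hHP : ∀ (h : HB r p0 p1), ∀ x ∈ P, stdRep r p0 p1 h * x ∈ P := by
    intro h
    refine HB.induction_left p0 p1 (P := fun h => ∀ x ∈ P, stdRep r p0 p1 h * x ∈ P)
      ?_ ?_ ?_ ?_ ?_ ?_ h
    · intro x hx; simpa using hx
    · intro a b ha hb x hx; rw [map_add, add_mul]; exact add_mem (ha x hx) (hb x hx)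
    · intro c a ha x hx
      rw [map_smul, smul_mul_assoc]; exact Submodule.smul_mem _ _ (ha x hx)
    · intro i a ha x hx
      rw [map_mul, mul_assoc]
      refine hind _ (fun s q hq => ?_) _ (ha x hx)
      obtain ⟨s', q1, h1, q2, h2, h3⟩ := D.T_mul_aut i s
      rw [← mul_assoc, h3, add_mul, mul_assoc, mul_assoc]
      exact add_mem (hmem _ _ (D.locA_mul h1 hq)) (hmem _ _ (D.locA_mul h2 hq))
    · intro i a ha x hx
      rw [map_mul, mul_assoc]
      refine hind _ (fun s q hq => ?_) _ (ha x hx)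
      rw [varRep_X, id, ← mul_assoc, D.X_mul_aut, mul_assoc]
      exact hmem _ _ (D.locA_mul (map_mem_rightLoc _) hq)
    · intro i a ha x hx
      rw [map_mul, mul_assoc]
      refine hind _ (fun s q hq => ?_) _ (ha x hx)
      obtain ⟨y', h'⟩ := D.Xinv_mul_aut s i
      rw [varRep_Xinv, id, ← mul_assoc, h', mul_assoc]
      exact hmem _ _ (D.locA_mul (map_mem_rightLoc _) hq)
  have hP : ∀ x ∈ P, ∃ c : D.I → D.locA,
      x = ∑ s, (D.aut s).toLinearMap * (c s : Module.End ℂ (RatField r)) := by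
    intro x hx
    induction hx using Submodule.iSup_induction' with
    | mem s x hx =>
      obtain ⟨q, hq, rfl⟩ := hx
      refine ⟨Pi.single s ⟨q, hq⟩, ?_⟩
      rw [Finset.sum_eq_single s]
      · simp
      · intro b _ hb; simp [Pi.single_eq_of_ne hb]
      · simp
    | zero => exact ⟨0, by simp⟩
    | add x y _ _ hx hy =>
      obtain ⟨c, hc⟩ := hx
      obtain ⟨d, hd⟩ := hy
      refine ⟨c + d, ?_⟩
      rw [hc, hd, ← Finset.sum_add_distrib]
      simp [mul_add]
  -- An element of the localization has the form `h z⁻ᵏ`; apply `h` to the unit and divide by `zᵏ`.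
  obtain ⟨k, h, hk⟩ := hq
  obtain ⟨y, hy, hzy, -⟩ := D.exists_z_inv
  have h1 : (1 : Module.End ℂ (RatField r)) ∈ P := by
    have := hmem D.one 1 (by simpa using map_mem_rightLoc (j := D.j) (z := D.zA) 1)
    rwa [D.aut_one, mul_one] at this
  obtain ⟨c, hc⟩ := hP _ (hHP h 1 h1)
  have hyk : y ^ k ∈ D.locA := by
    clear hk
    induction k with
    | zero => simpa using map_mem_rightLoc (j := D.j) (z := D.zA) 1
    | succ k ih => rw [pow_succ]; exact D.locA_mul ih hy
  refine ⟨fun s => ⟨c s * y ^ k, D.locA_mul (c s).2 hyk⟩, ?_⟩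
  have hzyk : D.j D.zA ^ k * y ^ k = 1 := by
    rw [← (D.commute_locA hy).symm.mul_pow, hzy, one_pow]
  have : q = stdRep r p0 p1 h * y ^ k := by
    rw [← hk, ← D.j_zA, mul_assoc, hzyk, mul_one]
  rw [this, ← mul_one (stdRep r p0 p1 h), hc, Finset.sum_mul]
  simp only [mul_assoc]

/-- The projection of the localization of `H_r^B` onto the localization of `𝔄`, along the other
automorphisms. -/
theorem exists_projection : ∃ π : D.locH →ₗ[ℂ] D.locA,
    (∀ (q q' : D.locH) (a : A), (q' : Module.End ℂ (RatField r)) = q * D.j a →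
      (π q' : Module.End ℂ (RatField r)) = π q * D.j a) ∧
    π ⟨1, D.one_mem_locH⟩ = ⟨1, by simpa using map_mem_rightLoc (j := D.j) (z := D.zA) 1⟩ := by
  classical
  choose c hc using fun q : D.locH => D.exists_expansion q.2
  -- The coefficient of the unit in an expansion is unique.
  have huniq : ∀ c d : D.I → D.locA,
      ∑ s, (D.aut s).toLinearMap * (c s : Module.End ℂ (RatField r))
        = ∑ s, (D.aut s).toLinearMap * (d s : Module.End ℂ (RatField r)) → c D.one = d D.one := by
    intro c d h
    have := D.indep (c - d) (by
      simp only [Pi.sub_apply, AddSubgroupClass.coe_sub, mul_sub, Finset.sum_sub_distrib, h, sub_self])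
    exact Subtype.ext (sub_eq_zero.1 this)
  refine ⟨{ toFun := fun q => c q D.one, map_add' := ?_, map_smul' := ?_ }, ?_, ?_⟩
  · intro q q'
    refine huniq (c (q + q')) (c q + c q') ?_
    rw [← hc]
    simp only [Pi.add_apply, Submodule.coe_add, mul_add, Finset.sum_add_distrib, ← hc]
  · intro l q
    refine huniq (c (l • q)) (l • c q) ?_
    rw [← hc]
    simp only [Pi.smul_apply, Submodule.coe_smul, mul_smul_comm, ← Finset.smul_sum, ← hc]
  · intro q q' a h
    have := huniq (c q') (fun s => ⟨c q s * D.j a, D.locA_mul (c q s).2 (map_mem_rightLoc a)⟩) (by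
      simp only [← mul_assoc, ← Finset.sum_mul, ← hc, h])
    exact congrArg Subtype.val this
  · refine (huniq (c ⟨1, D.one_mem_locH⟩) (Pi.single D.one ⟨1, by
      simpa using map_mem_rightLoc (j := D.j) (z := D.zA) 1⟩) ?_).trans (Pi.single_eq_same _ _)
    rw [← hc, Finset.sum_eq_single D.one]
    · simp only [Pi.single_eq_same, D.aut_one, mul_one]; rfl
    · intro b _ hb; simp [Pi.single_eq_of_ne hb]
    · simp

end CosetDatum

/-! ### Balanced products -/

namespace CosetDatum

variable {r : ℕ} {p0 p1 : ℂˣ} {A : Type*} [Ring A] [Algebra ℂ A] (D : CosetDatum r p0 p1 A)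

/-- `cl` exhibits the `H_r^B`-module `P` as the tensor product of the localization of `H_r^B` with
the `𝔄`-module `E`, balanced over `𝔄`. -/
structure IsBalancedProduct {E : Type u} {P : Type v} [AddCommGroup E] [Module ℂ E] [Module A E]
    [AddCommGroup P] [Module ℂ P] [Module (HB r p0 p1) P]
    (cl : D.locH →ₗ[ℂ] E →ₗ[ℂ] P) : Prop where
  smul_cl : ∀ (h : HB r p0 p1) (q q' : D.locH) (x : E),
    (q' : Module.End ℂ (RatField r)) = stdRep r p0 p1 h * q → h • cl q x = cl q' x
  balanced : ∀ (a : A) (q q' : D.locH) (x : E),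
    (q' : Module.End ℂ (RatField r)) = q * D.j a → cl q' x = cl q (a • x)
  span : Submodule.span ℂ {d | ∃ q x, cl q x = d} = ⊤
  univ : ∀ (V : Type u) [AddCommGroup V] [Module ℂ V] (Ψ : D.locH →ₗ[ℂ] E →ₗ[ℂ] V),
    (∀ (a : A) (q q' : D.locH) (x : E),
      (q' : Module.End ℂ (RatField r)) = q * D.j a → Ψ q' x = Ψ q (a • x)) →
    ∃ Φ : P →ₗ[ℂ] V, ∀ q x, Φ (cl q x) = Ψ q x

/-- `𝔄`-modules on which the denominator acts by a nonzero scalar, and which factor through the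
representation `j`. -/
structure IsAdmissible (E : Type*) [AddCommGroup E] [Module ℂ E] [Module A E] (l : ℂ) : Prop where
  ne_zero : l ≠ 0
  smul_z : ∀ x : E, D.zA • x = l • x
  smul_eq_zero : ∀ a : A, D.j a = 0 → ∀ x : E, a • x = 0

/-- The unit element of the localization. -/
noncomputable def oneH : D.locH := ⟨1, D.one_mem_locH⟩

/-- The automorphisms as elements of the localization. -/
noncomputable def autH (s : D.I) : D.locH := ⟨(D.aut s).toLinearMap, D.aut_mem s⟩

theorem autH_one : D.autH D.one = D.oneH := by
  refine Subtype.ext ?_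
  change (D.aut D.one).toLinearMap = 1
  rw [D.aut_one]; rfl

namespace IsBalancedProduct

variable {D} {E : Type u} {P : Type v} [AddCommGroup E] [Module ℂ E] [Module A E]
  [IsScalarTower ℂ A E]
  [AddCommGroup P] [Module ℂ P] [Module (HB r p0 p1) P] [IsScalarTower ℂ (HB r p0 p1) P]
  {cl : D.locH →ₗ[ℂ] E →ₗ[ℂ] P} {l : ℂ}

theorem cl_mul_locA (hcl : D.IsBalancedProduct cl) (hE : D.IsAdmissible E l) (q q' : D.locH)
    (c : D.locA) (h : (q' : Module.End ℂ (RatField r)) = q * c) (x : E) :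
    ∃ y, cl q' x = cl q y := by
  obtain ⟨k, a, hk⟩ := c.2
  have hz : ∀ (k : ℕ) (q q' : D.locH), (q' : Module.End ℂ (RatField r)) = q * D.j D.zA ^ k →
      cl q' x = l ^ k • cl q x := by
    intro k
    induction k with
    | zero =>
      intro q q' h
      rw [pow_zero, one_smul,
        Subtype.ext (h.trans (by rw [pow_zero, mul_one]) : (q' : Module.End ℂ (RatField r)) = q)]
    | succ k ih =>
      intro q q' h
      have hq : (q : Module.End ℂ (RatField r)) * D.j D.zA ^ k ∈ D.locH :=
        D.locH_mul_locA q.2 (by rw [← map_pow]; exact map_mem_rightLoc _)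
      rw [hcl.balanced D.zA ⟨_, hq⟩ q' x (by rw [h, pow_succ, mul_assoc]), hE.smul_z, map_smul,
        ih q ⟨_, hq⟩ rfl, smul_smul, pow_succ']
  have hqa : (q : Module.End ℂ (RatField r)) * D.j a ∈ D.locH :=
    D.locH_mul_locA q.2 (map_mem_rightLoc _)
  have h1 := hz k q' ⟨_, hqa⟩ (by rw [h, mul_assoc, hk])
  rw [hcl.balanced a q ⟨_, hqa⟩ x rfl] at h1
  refine ⟨(l⁻¹) ^ k • a • x, ?_⟩
  rw [map_smul, h1, smul_smul, ← mul_pow, inv_mul_cancel₀ hE.ne_zero, one_pow, one_smul]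

/-- Every element is a combination of automorphisms with coefficients in `E`. -/
theorem exists_eq_sum (hcl : D.IsBalancedProduct cl) (hE : D.IsAdmissible E l) (d : P) :
    ∃ x : D.I → E, d = ∑ s, cl (D.autH s) (x s) := by
  have hd : d ∈ Submodule.span ℂ {d | ∃ q x, cl q x = d} := by rw [hcl.span]; trivial
  induction hd using Submodule.span_induction with
  | mem d hd =>
    obtain ⟨q, x, rfl⟩ := hd
    obtain ⟨c, hc⟩ := D.exists_expansion q.2
    have hmem : ∀ s, (D.aut s).toLinearMap * (c s : Module.End ℂ (RatField r)) ∈ D.locH :=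
      fun s => D.locH_mul_locA (D.aut_mem s) (c s).2
    choose y hy using fun s => hcl.cl_mul_locA hE (D.autH s) ⟨_, hmem s⟩ (c s) rfl x
    refine ⟨y, ?_⟩
    have : q = ∑ s, ⟨_, hmem s⟩ := by
      refine Subtype.ext ?_
      rw [hc, AddSubmonoidClass.coe_finsetSum]
    rw [this, map_sum, LinearMap.sum_apply]
    exact Finset.sum_congr rfl fun s _ => hy s
  | zero => exact ⟨0, by simp⟩
  | add d d' _ _ hd hd' =>
    obtain ⟨x, rfl⟩ := hd
    obtain ⟨y, rfl⟩ := hd'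
    exact ⟨x + y, by simp [Finset.sum_add_distrib]⟩
  | smul c d _ hd =>
    obtain ⟨x, rfl⟩ := hd
    exact ⟨c • x, by simp [Finset.smul_sum]⟩

theorem finiteDimensional (hcl : D.IsBalancedProduct cl) (hE : D.IsAdmissible E l)
    [FiniteDimensional ℂ E] : FiniteDimensional ℂ P := by
  let f : (D.I → E) →ₗ[ℂ] P := ∑ s, (cl (D.autH s)).comp (LinearMap.proj s)
  refine Module.Finite.of_surjective f fun d => ?_
  obtain ⟨x, rfl⟩ := hcl.exists_eq_sum hE d
  exact ⟨x, by simp [f]⟩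

/-- The component of an automorphism is stable under the `X_i`, which act by conjugated variables.
-/
theorem X_smul_cl (hcl : D.IsBalancedProduct cl) (s : D.I) (i : Fin r) (x : E) :
    HB.X p0 p1 i • cl (D.autH s) x = cl (D.autH s) (D.y s i • x) := by
  have hmem : (D.aut s).toLinearMap * D.j (D.y s i) ∈ D.locH :=
    D.locH_mul_locA (D.aut_mem s) (map_mem_rightLoc _)
  rw [hcl.smul_cl (HB.X p0 p1 i) (D.autH s) ⟨_, hmem⟩ x, hcl.balanced (D.y s i) (D.autH s) _ x rfl]
  rw [varRep_X]
  exact (D.X_mul_aut s i).symm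

theorem aeval_comp_of_comp_eq {V W : Type*} [AddCommGroup V] [Module ℂ V] [AddCommGroup W]
    [Module ℂ W] {f : V →ₗ[ℂ] W} {S : Module.End ℂ V} {S' : Module.End ℂ W}
    (h : ∀ x, S' (f x) = f (S x)) (g : Polynomial ℂ) (x : V) :
    Polynomial.aeval S' g (f x) = f (Polynomial.aeval S g x) := by
  have hk : ∀ (k : ℕ) x, (S' ^ k) (f x) = f ((S ^ k) x) := by
    intro k
    induction k with
    | zero => simp
    | succ k ih => intro x; rw [pow_succ, pow_succ, Module.End.mul_apply, h, ih]; rfl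
  simp only [Polynomial.aeval_eq_sum_range, LinearMap.sum_apply, LinearMap.smul_apply, hk, map_sum,
    map_smul]

/-- If `X_i` has eigenvalue `a i` on `d` for all `i ∈ S`, only those automorphisms contribute to `d`
which are compatible with these eigenvalues. -/
theorem exists_eq_sum_of_weight (hcl : D.IsBalancedProduct cl) (hE : D.IsAdmissible E l)
    [FiniteDimensional ℂ E] {d : P} (S : Set (Fin r)) (a : Fin r → ℂ)
    (hd : ∀ i ∈ S, HB.X p0 p1 i • d = a i • d) :
    ∃ x : D.I → E, d = ∑ s, cl (D.autH s) (x s) ∧ ∀ s, (∃ i ∈ S,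
      ¬ Module.End.HasEigenvalue (Algebra.lsmul ℂ ℂ E (D.y s i)) (a i)) → x s = 0 := by
  classical
  suffices h : ∀ B : Finset D.I, (∀ s ∈ B, ∃ i ∈ S,
      ¬ Module.End.HasEigenvalue (Algebra.lsmul ℂ ℂ E (D.y s i)) (a i)) →
      ∃ x : D.I → E, d = ∑ s, cl (D.autH s) (x s) ∧ ∀ s ∈ B, x s = 0 by
    obtain ⟨x, hx, h0⟩ := h (Finset.univ.filter fun s => ∃ i ∈ S,
      ¬ Module.End.HasEigenvalue (Algebra.lsmul ℂ ℂ E (D.y s i)) (a i)) (by simp)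
    exact ⟨x, hx, fun s hs => h0 s (by simpa using hs)⟩
  intro B
  induction B using Finset.induction_on with
  | empty =>
    intro _
    obtain ⟨x, hx⟩ := hcl.exists_eq_sum hE d
    exact ⟨x, hx, by simp⟩
  | insert s B _ ih =>
    intro hB
    obtain ⟨x, hx, h0⟩ := ih fun s hs => hB s (Finset.mem_insert_of_mem hs)
    obtain ⟨i, hi, hne⟩ := hB s (Finset.mem_insert_self _ _)
    -- the minimal polynomial of the action of `X_i` on the `s`-component does not vanish at `a i`
    set g := minpoly ℂ (Algebra.lsmul ℂ ℂ E (D.y s i)) with hg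
    rw [Module.End.hasEigenvalue_iff_isRoot, Polynomial.IsRoot, ← hg] at hne
    have h1 : Polynomial.aeval (Algebra.lsmul ℂ ℂ P (HB.X p0 p1 i)) g d = g.eval (a i) • d := by
      rcases eq_or_ne d 0 with rfl | hd0
      · simp
      · exact Module.End.aeval_apply_of_hasEigenvector
          ⟨Module.End.mem_eigenspace_iff.2 (hd i hi), hd0⟩
    refine ⟨fun t => (g.eval (a i))⁻¹ • Polynomial.aeval (Algebra.lsmul ℂ ℂ E (D.y t i)) g (x t),
      ?_, ?_⟩
    · simp only [map_smul, ← Finset.smul_sum]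
      rw [eq_inv_smul_iff₀ hne, ← h1]
      conv_lhs => rw [hx]
      rw [map_sum]
      refine Finset.sum_congr rfl fun t _ => ?_
      exact aeval_comp_of_comp_eq (f := cl (D.autH t)) (fun x => hcl.X_smul_cl t i x) g (x t)
    · intro t ht
      rcases Finset.mem_insert.1 ht with rfl | ht
      · beta_reduce
        rw [hg, minpoly.aeval, LinearMap.zero_apply, smul_zero]
      · beta_reduce
        rw [h0 t ht, map_zero, smul_zero]

/-- Eigenvalues of `X_i` on the balanced product come from eigenvalues on `E`. -/
theorem exists_hasEigenvalue (hcl : D.IsBalancedProduct cl) (hE : D.IsAdmissible E l)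
    [FiniteDimensional ℂ E] {d : P} (hd0 : d ≠ 0) (S : Set (Fin r)) (a : Fin r → ℂ)
    (hd : ∀ i ∈ S, HB.X p0 p1 i • d = a i • d) :
    ∃ s, ∀ i ∈ S, Module.End.HasEigenvalue (Algebra.lsmul ℂ ℂ E (D.y s i)) (a i) := by
  obtain ⟨x, hx, h0⟩ := hcl.exists_eq_sum_of_weight hE S a hd
  by_contra! hcon
  refine hd0 ?_
  rw [hx]
  exact Finset.sum_eq_zero fun s _ => by rw [h0 s (hcon s), map_zero]

/-- A weight vector whose weight occurs in the component of the trivial coset only belongs to the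
image of `E`. -/
theorem exists_eq_cl_one (hcl : D.IsBalancedProduct cl) (hE : D.IsAdmissible E l)
    [FiniteDimensional ℂ E] {d : P} (a : Fin r → ℂ)
    (hd : ∀ i, HB.X p0 p1 i • d = a i • d)
    (ha : ∀ s, s ≠ D.one → ∃ i, ¬ Module.End.HasEigenvalue (Algebra.lsmul ℂ ℂ E (D.y s i)) (a i)) :
    ∃ x, d = cl D.oneH x := by
  obtain ⟨x, hx, h0⟩ := hcl.exists_eq_sum_of_weight hE Set.univ a (fun i _ => hd i)
  refine ⟨x D.one, ?_⟩
  rw [hx, Finset.sum_eq_single D.one, autH_one]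
  · intro s _ hs
    obtain ⟨i, hi⟩ := ha s hs
    rw [h0 s ⟨i, trivial, hi⟩, map_zero]
  · simp

/-- The module `E` embeds into the balanced product: the projection onto the trivial coset provides
a left inverse. -/
theorem cl_one_injective (hcl : D.IsBalancedProduct cl) (hE : D.IsAdmissible E l) :
    Function.Injective (cl D.oneH) := by
  obtain ⟨π, hπ, hπ1⟩ := D.exists_projection
  -- the action of `𝔄` on `E` extends to the localization of `𝔄`
  obtain ⟨Θ, hΘ⟩ := exists_rightLoc_extension (j := D.j) (z := D.zA) D.isUnit_z
    (F := (Algebra.lsmul ℂ ℂ E).toLinearMap) hE.ne_zero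
    (fun b => by
      ext x
      change (b * D.zA) • x = l • b • x
      rw [mul_smul, hE.smul_z, smul_comm])
    (fun b hb => by ext x; simpa using hE.smul_eq_zero b hb x)
  obtain ⟨Φ, hΦ⟩ := hcl.univ E (Θ ∘ₗ π) (by
    intro a q q' x h
    obtain ⟨k, b, hk⟩ := (π q).2
    have h1 := hΘ _ k b hk
    have h2 := hΘ (π q') k (b * a) (by
      rw [hπ q q' a h, mul_assoc, ((D.comm a).pow_right k).eq,
        ← mul_assoc, hk, map_mul])
    rw [LinearMap.comp_apply, LinearMap.comp_apply, h1, h2]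
    change (l⁻¹) ^ k • (b * a) • x = (l⁻¹) ^ k • b • a • x
    rw [mul_smul])
  have h1 : Θ ⟨1, by simpa using map_mem_rightLoc (j := D.j) (z := D.zA) 1⟩ = 1 := by
    rw [hΘ _ 0 1 (by simp)]
    ext x; simp
  refine Function.LeftInverse.injective (g := Φ) fun x => ?_
  rw [hΦ, LinearMap.comp_apply]
  unfold oneH
  rw [hπ1, h1]
  rfl

/-- The balanced product with a simple module is simple as soon as every nonzero submodule meets
the image of `E`. -/
theorem isSimpleModule (hcl : D.IsBalancedProduct cl) (hE : D.IsAdmissible E l)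
    [IsSimpleModule A E]
    (hU : ∀ U : Submodule (HB r p0 p1) P, U ≠ ⊥ → ∃ x ≠ 0, cl D.oneH x ∈ U) :
    IsSimpleModule (HB r p0 p1) P := by
  have : Nontrivial E := IsSimpleModule.nontrivial A E
  have : Nontrivial P := (hcl.cl_one_injective hE).nontrivial
  have hz : ∀ (k : ℕ) (q q' : D.locH) (x : E),
      (q' : Module.End ℂ (RatField r)) = q * D.j D.zA ^ k → cl q' x = l ^ k • cl q x := by
    intro k q q' x h
    rw [← map_pow] at h
    rw [hcl.balanced _ q q' x h, ← map_smul]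
    congr 1
    clear h
    induction k with
    | zero => simp
    | succ k ih =>
      rw [pow_succ', mul_smul, ih, smul_comm, hE.smul_z, smul_smul, pow_succ]
  -- As `z` is a nonzero scalar on `E`, every class is obtained from `cl 1 x` by the action of
  -- `H_r^B`.
  have hq : ∀ (q : D.locH), ∃ (c : ℂ) (h : HB r p0 p1), ∀ x, cl q x = c • h • cl D.oneH x := by
    intro q
    obtain ⟨k, h, hk⟩ := q.2
    rw [← D.j_zA] at hk
    refine ⟨(l⁻¹) ^ k, h, fun x => ?_⟩
    have hmem : (q : Module.End ℂ (RatField r)) * D.j D.zA ^ k ∈ D.locH := by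
      rw [hk]; exact map_mem_rightLoc h
    rw [hcl.smul_cl h D.oneH ⟨_, hmem⟩ x (by rw [← hk]; exact (mul_one _).symm),
      hz k q ⟨_, hmem⟩ x rfl, smul_smul, ← mul_pow,
      inv_mul_cancel₀ hE.ne_zero, one_pow, one_smul]
  refine (isSimpleModule_iff _ _).2 { eq_bot_or_eq_top := fun U => ?_ }
  by_cases h0 : U = ⊥
  · exact .inl h0
  right
  obtain ⟨x, hx0, hx⟩ := hU U h0
  -- the part of `E` that lies in `U` is an `𝔄`-submodule
  let E' : Submodule A E :=
    { carrier := {x | cl D.oneH x ∈ U}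
      zero_mem' := by simp
      add_mem' := fun {x y} hx hy => by
        change cl D.oneH (x + y) ∈ U
        rw [map_add]; exact add_mem hx hy
      smul_mem' := fun a x hx => by
        change cl D.oneH (a • x) ∈ U
        have hmem : (D.oneH : Module.End ℂ (RatField r)) * D.j a ∈ D.locH :=
          D.locH_mul_locA D.one_mem_locH (map_mem_rightLoc a)
        rw [← hcl.balanced a D.oneH ⟨_, hmem⟩ x rfl]
        obtain ⟨c, h, hch⟩ := hq ⟨_, hmem⟩
        rw [hch]
        exact Submodule.smul_of_tower_mem _ _ (Submodule.smul_mem _ _ hx) }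
  have hE' : E' = ⊤ := (eq_bot_or_eq_top E').resolve_left fun h => hx0 (by
    have : x ∈ E' := hx
    rwa [h, Submodule.mem_bot] at this)
  have hall : ∀ x, cl D.oneH x ∈ U := fun x => by
    have : x ∈ E' := by rw [hE']; trivial
    exact this
  rw [eq_top_iff]
  intro d _
  have hd : d ∈ Submodule.span ℂ {d | ∃ q x, cl q x = d} := by rw [hcl.span]; trivial
  have hle : Submodule.span ℂ {d | ∃ q x, cl q x = d} ≤ U.restrictScalars ℂ := by
    refine Submodule.span_le.2 ?_
    rintro _ ⟨q, x, rfl⟩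
    obtain ⟨c, h, hch⟩ := hq q
    rw [hch]
    exact Submodule.smul_of_tower_mem _ _ (Submodule.smul_mem _ _ (hall x))
  exact hle hd

/-- The universal property of the balanced product for `H_r^B`-linear maps. -/
theorem exists_hom (hcl : D.IsBalancedProduct cl) (hE : D.IsAdmissible E l)
    {L : Type u} [AddCommGroup L] [Module ℂ L] [Module (HB r p0 p1) L]
    [IsScalarTower ℂ (HB r p0 p1) L] (φ : E →ₗ[ℂ] L)
    (hφ : ∀ (a : A) (k : ℕ) (h : HB r p0 p1), D.j a * D.j D.zA ^ k = stdRep r p0 p1 h →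
      ∀ x, h • φ x = l ^ k • φ (a • x)) :
    ∃ Φ : P →ₗ[HB r p0 p1] L, ∀ x, Φ (cl D.oneH x) = φ x := by
  -- The map `h, x ↦ h φ(x)` extends to the localization, and the extension is balanced.
  let F : HB r p0 p1 →ₗ[ℂ] E →ₗ[ℂ] L :=
    (LinearMap.lcomp ℂ L φ).comp (Algebra.lsmul ℂ ℂ L).toLinearMap
  have hF : ∀ h x, F h x = h • φ x := fun h x => rfl
  obtain ⟨Ψ, hΨ⟩ := exists_rightLoc_extension (j := stdRep r p0 p1) (z := D.zH)
    (by rw [← D.j_zA]; exact D.isUnit_z) (F := F) hE.ne_zero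
    (fun h => by
      ext x
      rw [hF, mul_smul, hφ D.zA 0 D.zH (by rw [pow_zero, mul_one, D.j_zA]) x, LinearMap.smul_apply,
        hF, hE.smul_z, map_smul, pow_zero, one_smul, smul_comm])
    (fun h h0 => by
      rw [(map_eq_zero_iff _ (varRep_injective Function.injective_id p0 p1)).1 h0, map_zero])
  obtain ⟨Φ, hΦ⟩ := hcl.univ L Ψ (by
    intro a q q' x hq'
    obtain ⟨k, h, hk⟩ := q.2
    obtain ⟨k', h', hk'⟩ := D.j_mem a
    rw [hΨ q k h hk, hΨ q' (k + k') (h * h') (by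
      rw [hq', map_mul, ← hk, ← hk', ← D.j_zA, pow_add, mul_assoc _ (D.j a), ← mul_assoc (D.j a),
        ((D.comm a).pow_right k).eq]
      simp only [mul_assoc])]
    simp only [LinearMap.smul_apply, hF]
    rw [mul_smul, hφ a k' h' (by rw [D.j_zA, hk']), smul_comm h, smul_smul, pow_add, mul_assoc,
      ← mul_pow, inv_mul_cancel₀ hE.ne_zero, one_pow, mul_one])
  have hlin : ∀ (h : HB r p0 p1) (d : P), Φ (h • d) = h • Φ d := by
    intro h d
    have hd : d ∈ Submodule.span ℂ {d | ∃ q x, cl q x = d} := by rw [hcl.span]; trivial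
    induction hd using Submodule.span_induction with
    | mem d hd =>
      obtain ⟨q, x, rfl⟩ := hd
      have hmem : stdRep r p0 p1 h * q ∈ D.locH := map_mul_mem_rightLoc h q.2
      obtain ⟨k, h', hk⟩ := q.2
      rw [hcl.smul_cl h q ⟨_, hmem⟩ x rfl, hΦ, hΦ, hΨ q k h' hk, hΨ ⟨_, hmem⟩ k (h * h') (by
        rw [mul_assoc, hk, map_mul])]
      simp only [LinearMap.smul_apply, hF, mul_smul]
      rw [smul_comm h ((l⁻¹) ^ k)]
    | zero => simp
    | add d d' _ _ hd hd' => rw [smul_add, map_add, map_add, hd, hd', smul_add]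
    | smul c d _ hd => rw [smul_comm, map_smul, hd, map_smul, smul_comm]
  refine ⟨{ Φ with map_smul' := hlin }, fun x => ?_⟩
  change Φ _ = _
  rw [hΦ, hΨ D.oneH 0 1 (by simp [oneH])]
  simp [hF]

end IsBalancedProduct

end CosetDatum

/-! ### Eigenspaces of the denominator -/

namespace CosetDatum

variable {r : ℕ} {p0 p1 : ℂˣ} {A : Type*} [Ring A] [Algebra ℂ A] (D : CosetDatum r p0 p1 A)
  (L : Type*) [AddCommGroup L] [Module ℂ L] [Module (HB r p0 p1) L]
  [IsScalarTower ℂ (HB r p0 p1) L] (l : ℂ)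

/-- The eigenspace of the denominator on an `H_r^B`-module. -/
noncomputable def zSpace : Submodule ℂ L := Module.End.eigenspace (Algebra.lsmul ℂ ℂ L D.zH) l

variable {L l}

theorem mem_zSpace {x : L} : x ∈ D.zSpace L l ↔ D.zH • x = l • x := Module.End.mem_eigenspace_iff

/-- The algebra `𝔄` acts on the eigenspaces of the denominator with nonzero eigenvalue. -/
theorem exists_action (hl : l ≠ 0) : ∃ act : A →ₐ[ℂ] Module.End ℂ (D.zSpace L l),
    (∀ (a : A) (k : ℕ) (h : HB r p0 p1), D.j a * D.j D.zA ^ k = stdRep r p0 p1 h →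
      ∀ x : D.zSpace L l, h • (x : L) = l ^ k • (act a x : L)) ∧
    ∀ a, D.j a = 0 → act a = 0 := by
  have hinj := varRep_injective (Function.injective_id (α := Fin r)) p0 p1
  let F : HB r p0 p1 →ₗ[ℂ] D.zSpace L l →ₗ[ℂ] L :=
    (LinearMap.lcomp ℂ L (D.zSpace L l).subtype).comp (Algebra.lsmul ℂ ℂ L).toLinearMap
  have hF : ∀ h (x : D.zSpace L l), F h x = h • (x : L) := fun h x => rfl
  obtain ⟨G, hG⟩ := exists_rightLoc_extension (j := stdRep r p0 p1) (z := D.zH)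
    (by rw [← D.j_zA]; exact D.isUnit_z) (F := F) hl
    (fun h => by
      ext x
      rw [LinearMap.smul_apply, hF, hF, mul_smul, D.mem_zSpace.1 x.2, smul_comm])
    (fun h h0 => by rw [(map_eq_zero_iff _ hinj).1 h0, map_zero])
  -- If `a zᵏ = h`, then `a` acts as `l⁻ᵏ h`; this preserves the eigenspace because `h` commutes
  -- with `z`.
  have hmem : ∀ (a : A) (x : D.zSpace L l), G ⟨D.j a, D.j_mem a⟩ x ∈ D.zSpace L l := by
    intro a x
    obtain ⟨k, h, hk⟩ := D.j_mem a
    rw [hG _ k h hk, LinearMap.smul_apply, hF]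
    refine Submodule.smul_mem _ _ ?_
    have hc : D.zH * h = h * D.zH := by
      apply hinj
      have := ((D.comm a).mul_left (Commute.pow_self (D.j D.zA) k)).eq
      rw [D.j_zA, hk] at this
      rw [map_mul, map_mul, ← this]
    rw [mem_zSpace, ← mul_smul, hc, mul_smul, D.mem_zSpace.1 x.2, smul_comm]
  have hinv : ∀ (k : ℕ) (y : L), l ^ k • (l⁻¹) ^ k • y = y := fun k y => by
    rw [smul_smul, ← mul_pow, mul_inv_cancel₀ hl, one_pow, one_smul]
  let act : A →ₗ[ℂ] Module.End ℂ (D.zSpace L l) :=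
    { toFun := fun a => (G ⟨D.j a, D.j_mem a⟩).codRestrict _ (hmem a)
      map_add' := fun a b => by
        ext x
        have : (⟨D.j (a + b), D.j_mem _⟩ : D.locH) = ⟨D.j a, D.j_mem a⟩ + ⟨D.j b, D.j_mem b⟩ :=
          Subtype.ext (map_add _ _ _)
        change (G ⟨D.j (a + b), D.j_mem _⟩ x : L) = G ⟨D.j a, D.j_mem a⟩ x + G ⟨D.j b, D.j_mem b⟩ x
        rw [this, map_add, LinearMap.add_apply]
      map_smul' := fun c a => by
        ext x
        have : (⟨D.j (c • a), D.j_mem _⟩ : D.locH) = c • ⟨D.j a, D.j_mem a⟩ :=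
          Subtype.ext (map_smul _ _ _)
        change (G ⟨D.j (c • a), D.j_mem _⟩ x : L) = c • G ⟨D.j a, D.j_mem a⟩ x
        rw [this, map_smul, LinearMap.smul_apply] }
  have hact : ∀ a x, (act a x : L) = G ⟨D.j a, D.j_mem a⟩ x := fun a x => rfl
  refine ⟨AlgHom.ofLinearMap act ?_ ?_, ?_, ?_⟩
  · ext x
    rw [hact, hG _ 0 1 (by simp)]
    simp [hF]
  · intro a b
    ext x
    obtain ⟨k, h, hk⟩ := D.j_mem a
    obtain ⟨k', h', hk'⟩ := D.j_mem b
    rw [Module.End.mul_apply, hact, hact, hG ⟨D.j a, _⟩ k h hk, hG _ (k + k') (h * h') (by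
      change D.j (a * b) * _ = _
      rw [map_mul, map_mul, ← hk, ← hk', ← D.j_zA, pow_add, mul_assoc, ← mul_assoc (D.j b),
        ((D.comm b).pow_right k).eq]
      simp only [mul_assoc])]
    rw [LinearMap.smul_apply, LinearMap.smul_apply, hF, hF, hact, hG _ k' h' hk',
      LinearMap.smul_apply, hF, smul_comm h ((l⁻¹) ^ k'), smul_smul, pow_add, mul_smul, mul_smul, smul_smul]
  · intro a k h hk x
    rw [AlgHom.ofLinearMap_apply, hact, hG _ k h (by rw [← D.j_zA]; exact hk), LinearMap.smul_apply, hinv, hF]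
  · intro a ha
    ext x
    have : (⟨D.j a, D.j_mem a⟩ : D.locH) = 0 := Subtype.ext ha
    rw [AlgHom.ofLinearMap_apply, hact, this, map_zero]
    rfl

end CosetDatum

/-! ### Weight vectors and intertwiners -/

section Weights

variable {r : ℕ} {p0 p1 : ℂˣ} (L : Type*) [AddCommGroup L] [Module ℂ L] [Module (HB r p0 p1) L]
  [IsScalarTower ℂ (HB r p0 p1) L]

/-- A common eigenvector of commuting operators. -/
theorem exists_common_eigenvector {V : Type*} [AddCommGroup V] [Module ℂ V] [FiniteDimensional ℂ V]
    [Nontrivial V] {k : ℕ} (f : Fin k → Module.End ℂ V) (hf : ∀ i j, Commute (f i) (f j)) :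
    ∃ (a : Fin k → ℂ) (x : V), x ≠ 0 ∧ ∀ i, f i x = a i • x := by
  induction k generalizing V with
  | zero => obtain ⟨x, hx⟩ := exists_ne (0 : V); exact ⟨Fin.elim0, x, hx, fun i => i.elim0⟩
  | succ k ih =>
    obtain ⟨b, hb⟩ := Module.End.exists_eigenvalue (f 0)
    set W := Module.End.eigenspace (f 0) b
    have : Nontrivial W := (Submodule.nontrivial_iff_ne_bot).2 hb
    have hW : ∀ i, ∀ x ∈ W, f i x ∈ W := fun i x hx => by
      rw [Module.End.mem_eigenspace_iff] at hx ⊢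
      rw [← Module.End.mul_apply, (hf 0 i).eq, Module.End.mul_apply, hx, map_smul]
    obtain ⟨a, x, hx, ha⟩ := ih (fun i => (f i.succ).restrict (hW i.succ)) (fun i j => by
      ext x
      exact LinearMap.congr_fun (hf i.succ j.succ).eq x)
    refine ⟨Fin.cons b a, x, by simpa using hx, fun i => ?_⟩
    refine Fin.cases ?_ (fun i => ?_) i
    · exact Module.End.mem_eigenspace_iff.1 x.2
    · exact congrArg Subtype.val (ha i)

variable {L}

/-- `x` is a common eigenvector of the `X_i`, with eigenvalues `a i`. -/
def IsWeightVector {r : ℕ} (p0 p1 : ℂˣ) {L : Type*} [AddCommGroup L] [Module ℂ L]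
    [Module (HB r p0 p1) L] (a : Fin r → ℂ) (x : L) : Prop :=
  x ≠ 0 ∧ ∀ i, HB.X p0 p1 i • x = a i • x

variable (L) in
theorem exists_isWeightVector [FiniteDimensional ℂ L] [Nontrivial L] :
    ∃ (a : Fin r → ℂ) (x : L), IsWeightVector p0 p1 a x := by
  obtain ⟨a, x, hx, h⟩ := exists_common_eigenvector
    (fun i : Fin r => Algebra.lsmul ℂ ℂ L (HB.X p0 p1 i)) (fun i j => by
      rw [Commute, SemiconjBy, ← map_mul, HB.X_comm, map_mul])
  exact ⟨a, x, hx, h⟩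

theorem IsWeightVector.hasEigenvalue {a : Fin r → ℂ} {x : L}
    (h : IsWeightVector p0 p1 a x) (i : Fin r) :
    Module.End.HasEigenvalue (Algebra.lsmul ℂ ℂ L (HB.X p0 p1 i)) (a i) :=
  Module.End.hasEigenvalue_of_hasEigenvector ⟨Module.End.mem_eigenspace_iff.2 (h.2 i), h.1⟩

theorem eigenvalue_ne_zero {i : Fin r} {b : ℂ}
    (h : Module.End.HasEigenvalue (Algebra.lsmul ℂ ℂ L (HB.X p0 p1 i)) b) : b ≠ 0 := by
  rintro rfl
  obtain ⟨x, hx⟩ := h.exists_hasEigenvector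
  refine hx.2 ?_
  have h1 : HB.X p0 p1 i • x = 0 := by simpa using hx.apply_eq_smul
  rw [← one_smul (HB r p0 p1) x, ← HB.Xinv_mul_X p0 p1 i, mul_smul, h1, smul_zero]

theorem IsWeightVector.ne_zero {a : Fin r → ℂ} {x : L}
    (h : IsWeightVector p0 p1 a x) (i : Fin r) : a i ≠ 0 :=
  eigenvalue_ne_zero (h.hasEigenvalue i)

theorem IsWeightVector.Xinv_smul {a : Fin r → ℂ} {x : L}
    (h : IsWeightVector p0 p1 a x) (i : Fin r) :
    HB.Xinv p0 p1 i • x = (a i)⁻¹ • x := by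
  have h1 : x = a i • HB.Xinv p0 p1 i • x := by
    rw [smul_comm, ← h.2 i, ← mul_smul, HB.Xinv_mul_X, one_smul]
  conv_rhs => rw [h1, smul_smul, inv_mul_cancel₀ (h.ne_zero i), one_smul]

/-- If `s T_i + t` has a nonzero kernel, then `-t / s` is a root of the quadratic relation of `T_i`.
-/
theorem quadratic_of_T_smul {x : L} (hx : x ≠ 0) {i : Fin r} {s t : ℂ}
    (h : s • HB.T p0 p1 i • x + t • x = 0) :
    t ^ 2 + s * HB.quadCoeff p0 p1 i * t - s ^ 2 = 0 := by
  have h1 : HB.T p0 p1 i • HB.T p0 p1 i • x = HB.quadCoeff p0 p1 i • HB.T p0 p1 i • x + x := by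
    rw [← mul_smul, HB.T_mul_T, add_smul, smul_assoc, one_smul]
  have h2 : s • HB.T p0 p1 i • x = (-t) • x := by rw [neg_smul]; exact eq_neg_of_add_eq_zero_left h
  have h3 : (s * s) • HB.T p0 p1 i • HB.T p0 p1 i • x = (t ^ 2) • x := by
    rw [mul_smul, smul_comm s (HB.T p0 p1 i), h2, smul_comm _ (-t), smul_comm s (-t), h2, smul_smul]
    congr 1; ring
  rw [h1, smul_add, mul_smul, smul_comm s (HB.quadCoeff p0 p1 i), h2, smul_smul, smul_smul,
    ← add_smul] at h3
  have h4 : (t ^ 2 + s * HB.quadCoeff p0 p1 i * t - s ^ 2) • x = 0 := by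
    rw [sub_smul, add_smul, ← h3, ← add_smul, ← sub_smul]
    rw [show s * HB.quadCoeff p0 p1 i * -t + s * s + s * HB.quadCoeff p0 p1 i * t - s ^ 2 = 0 by
      ring, zero_smul]
  exact (smul_eq_zero.1 h4).resolve_right hx

/-- The intertwiner attached to `T_i`, `i ≥ 1`, exchanges two neighbouring eigenvalues. -/
theorem IsWeightVector.swap {a : Fin r → ℂ} {x : L}
    (h : IsWeightVector p0 p1 a x) {i j : Fin r} (hij : j.val + 1 = i.val)
    (h1 : a j ≠ (p1 : ℂ) ^ 2 * a i) (h2 : a i ≠ (p1 : ℂ) ^ 2 * a j) :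
    ∃ x' : L, IsWeightVector p0 p1 (a ∘ Equiv.swap j i) x' := by
  have hp : (p1 : ℂ) ≠ 0 := p1.ne_zero
  have hq : HB.quadCoeff p0 p1 i = (p1 : ℂ) - (p1 : ℂ)⁻¹ := by
    simp [HB.quadCoeff, par, show i.val ≠ 0 by omega]
  set c := HB.quadCoeff p0 p1 i with hc
  have hji : j ≠ i := by rintro rfl; omega
  have hXi : HB.X p0 p1 i • HB.T p0 p1 i • x = a j • HB.T p0 p1 i • x + (c * a i) • x := by
    have := congrArg (· • x) (HB.T_X_left p0 p1 i j hij)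
    simp only [sub_smul, mul_smul, smul_assoc, h.2, ← hc] at this
    rw [smul_comm _ (a j), eq_sub_iff_add_eq] at this
    rw [mul_smul, this]
  have hXj : HB.X p0 p1 j • HB.T p0 p1 i • x = a i • HB.T p0 p1 i • x - (c * a i) • x := by
    have := congrArg (· • x) (HB.T_X_right p0 p1 i j hij)
    simp only [add_smul, mul_smul, smul_assoc, h.2, ← hc] at this
    rw [smul_comm _ (a i)] at this
    rw [mul_smul, this, add_sub_cancel_right]
  -- This is the image of `x` under the unnormalized intertwiner. It does not vanish, as otherwise
  -- the quadratic relation would force `a i / a j = p₁^{±2}`.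
  refine ⟨(a j - a i) • HB.T p0 p1 i • x + (c * a i) • x, fun h0 => ?_, fun k => ?_⟩
  · have := quadratic_of_T_smul h.1 h0
    rw [← hc, hq] at this
    have h4 : ((p1 : ℂ) ^ 2 * a i - a j) * ((p1 : ℂ) ^ 2 * a j - a i) = 0 := by
      field_simp at this
      linear_combination this
    rcases mul_eq_zero.1 h4 with h5 | h5
    · exact h1 (sub_eq_zero.1 h5).symm
    · exact h2 (sub_eq_zero.1 h5).symm
  · simp only [Function.comp_apply]
    rw [smul_add, smul_comm _ (a j - a i), smul_comm _ (c * a i), h.2]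
    by_cases hki : k = i
    · rw [hki, hXi, Equiv.swap_apply_right]
      generalize HB.T p0 p1 i • x = y
      module
    by_cases hkj : k = j
    · rw [hkj, hXj, Equiv.swap_apply_left]
      generalize HB.T p0 p1 i • x = y
      module
    · rw [Equiv.swap_apply_of_ne_of_ne hkj hki, ← mul_smul (HB.X p0 p1 k),
        ← HB.bernstein_comm p0 p1 i k (fun h => hkj (Fin.ext (by omega))) hki, mul_smul, h.2]
      rw [smul_comm _ (a k)]
      generalize HB.T p0 p1 i • x = y
      module

/-- The intertwiner attached to `T_0` inverts the first eigenvalue. -/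
theorem IsWeightVector.flip {a : Fin r → ℂ} {x : L}
    (h : IsWeightVector p0 p1 a x) {i : Fin r} (hi : i.val = 0)
    (h1 : a i ^ 2 ≠ (p0 : ℂ) ^ 2) (h2 : a i ^ 2 * (p0 : ℂ) ^ 2 ≠ 1) :
    ∃ x' : L, IsWeightVector p0 p1 (Function.update a i (a i)⁻¹) x' := by
  have hp : (p0 : ℂ) ≠ 0 := p0.ne_zero
  have hai := h.ne_zero i
  have hq : HB.quadCoeff p0 p1 i = (p0 : ℂ) - (p0 : ℂ)⁻¹ := by
    simp [HB.quadCoeff, par, hi]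
  set c := HB.quadCoeff p0 p1 i with hc
  have hXi : HB.X p0 p1 i • HB.T p0 p1 i • x = (a i)⁻¹ • HB.T p0 p1 i • x + (c * a i) • x := by
    have := congrArg (· • x) (HB.T_Xinv_zero p0 p1 i hi)
    simp only [sub_smul, mul_smul, smul_assoc, h.2, h.Xinv_smul, ← hc] at this
    rw [smul_comm _ (a i)⁻¹, eq_sub_iff_add_eq] at this
    rw [mul_smul, this]
  -- If this vector vanished, the quadratic relation would force `a i = ± p₀^{±1}`.
  refine ⟨((a i)⁻¹ - a i) • HB.T p0 p1 i • x + (c * a i) • x, fun h0 => ?_, fun k => ?_⟩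
  · have := quadratic_of_T_smul h.1 h0
    rw [← hc, hq] at this
    have h4 : (a i ^ 2 - (p0 : ℂ) ^ 2) * (a i ^ 2 * (p0 : ℂ) ^ 2 - 1) = 0 := by
      field_simp at this
      linear_combination -this
    rcases mul_eq_zero.1 h4 with h5 | h5
    · exact h1 (sub_eq_zero.1 h5)
    · exact h2 (sub_eq_zero.1 h5)
  · rw [smul_add, smul_comm _ ((a i)⁻¹ - a i), smul_comm _ (c * a i), h.2]
    by_cases hki : k = i
    · rw [hki, hXi, Function.update_self, smul_add, smul_add, smul_smul, smul_smul, smul_smul,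
        smul_smul, smul_smul]
      rw [add_assoc, ← add_smul]
      congr 2
      · ring
      · field_simp; ring
    · rw [Function.update_of_ne hki, ← mul_smul (HB.X p0 p1 k),
        ← HB.bernstein_comm p0 p1 i k (by omega) hki, mul_smul, h.2]
      rw [smul_comm _ (a k)]
      generalize HB.T p0 p1 i • x = y
      module

theorem sum_swap_lt {r : ℕ} (P : ℂ → Prop) [DecidablePred P] (c : ℕ) (a : Fin r → ℂ) {i j : Fin r}
    (hij : j.val < i.val) (hj : ¬ P (a j)) (hi : P (a i)) :
    ∑ k, (if P ((a ∘ Equiv.swap j i) k) then k.val + c else 0)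
      < ∑ k, (if P (a k) then k.val + c else 0) := by
  rw [← Equiv.sum_comp (Equiv.swap j i)]
  simp only [Function.comp_apply, Equiv.swap_apply_self]
  refine Finset.sum_lt_sum (fun k _ => ?_) ⟨i, Finset.mem_univ _, ?_⟩
  · by_cases hki : k = i
    · subst hki; rw [Equiv.swap_apply_right, if_pos hi, if_pos hi]; omega
    by_cases hkj : k = j
    · subst hkj; rw [if_neg hj, if_neg hj]
    · rw [Equiv.swap_apply_of_ne_of_ne hkj hki]
  · rw [Equiv.swap_apply_right, if_pos hi, if_pos hi]; omega

variable (L) in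
/-- If eigenvalues satisfying `P` and eigenvalues not satisfying `P` never differ by `p₁^{±2}`,
there is a weight vector for which the eigenvalues satisfying `P` come first. -/
theorem exists_sorted_weight [FiniteDimensional ℂ L] [Nontrivial L] (P : ℂ → Prop)
    (hP : ∀ (a : Fin r → ℂ) (x : L), IsWeightVector p0 p1 a x → ∀ i j, P (a i) → ¬ P (a j) →
      a j ≠ (p1 : ℂ) ^ 2 * a i ∧ a i ≠ (p1 : ℂ) ^ 2 * a j) :
    ∃ (a : Fin r → ℂ) (x : L), IsWeightVector p0 p1 a x ∧ ∀ i j, j < i → P (a i) → P (a j) := by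
  classical
  obtain ⟨a0, x0, h0⟩ := exists_isWeightVector (r := r) (p0 := p0) (p1 := p1) L
  -- minimize the sum of the positions at which `P` holds
  obtain ⟨n, ⟨a, x, h, hn⟩, hmin⟩ := WellFounded.has_min (wellFounded_lt (α := ℕ))
    {n | ∃ (a : Fin r → ℂ) (x : L), IsWeightVector p0 p1 a x ∧
      ∑ k, (if P (a k) then k.val + 0 else 0) = n} ⟨_, a0, x0, h0, rfl⟩
  have hadj : ∀ i j : Fin r, j.val + 1 = i.val → P (a i) → P (a j) := by
    intro i j hij hi
    by_contra hj
    obtain ⟨h1, h2⟩ := hP a x h i j hi hj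
    obtain ⟨x', hx'⟩ := h.swap hij h1 h2
    exact hmin _ ⟨_, x', hx', rfl⟩ (hn ▸ sum_swap_lt P 0 a (by omega) hj hi)
  refine ⟨a, x, h, ?_⟩
  rintro ⟨i, hi⟩
  induction i with
  | zero => intro j hj; exact absurd hj (Nat.not_lt_zero _)
  | succ i ih =>
    rintro ⟨j, hj⟩ hji hP'
    have h1 := hadj ⟨i + 1, hi⟩ ⟨i, by omega⟩ rfl hP'
    rcases Nat.lt_succ_iff_lt_or_eq.1 (show j < i + 1 from hji) with h2 | h2
    · exact ih (by omega) ⟨j, hj⟩ h2 h1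
    · subst h2; exact h1

variable (L) in
/-- If moreover inverting the first eigenvalue is possible, there is a weight vector all of whose
eigenvalues satisfy `P`. -/
theorem exists_positive_weight [FiniteDimensional ℂ L] [Nontrivial L] (P : ℂ → Prop)
    (hP : ∀ (a : Fin r → ℂ) (x : L), IsWeightVector p0 p1 a x → ∀ i j, P (a i) → ¬ P (a j) →
      a j ≠ (p1 : ℂ) ^ 2 * a i ∧ a i ≠ (p1 : ℂ) ^ 2 * a j)
    (hinv : ∀ (a : Fin r → ℂ) (x : L), IsWeightVector p0 p1 a x → ∀ i, ¬ P (a i) →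
      P (a i)⁻¹ ∧ a i ^ 2 ≠ (p0 : ℂ) ^ 2 ∧ a i ^ 2 * (p0 : ℂ) ^ 2 ≠ 1) :
    ∃ (a : Fin r → ℂ) (x : L), IsWeightVector p0 p1 a x ∧ ∀ i, P (a i) := by
  classical
  obtain ⟨a0, x0, h0⟩ := exists_isWeightVector (r := r) (p0 := p0) (p1 := p1) L
  -- minimize the sum of the positions at which `P` fails, counted from `1` so that a failure at the
  -- first position contributes as well
  obtain ⟨n, ⟨a, x, h, hn⟩, hmin⟩ := WellFounded.has_min (wellFounded_lt (α := ℕ))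
    {n | ∃ (a : Fin r → ℂ) (x : L), IsWeightVector p0 p1 a x ∧
      ∑ k, (if ¬ P (a k) then k.val + 1 else 0) = n} ⟨_, a0, x0, h0, rfl⟩
  refine ⟨a, x, h, ?_⟩
  rintro ⟨i, hi⟩
  induction i with
  | zero =>
    by_contra hi'
    obtain ⟨h1, h2, h3⟩ := hinv a x h _ hi'
    obtain ⟨x', hx'⟩ := h.flip rfl h2 h3
    refine hmin _ ⟨_, x', hx', rfl⟩ (hn ▸ Finset.sum_lt_sum (fun k _ => ?_)
      ⟨⟨0, hi⟩, Finset.mem_univ _, ?_⟩)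
    · by_cases hk : k = ⟨0, hi⟩
      · subst hk; rw [Function.update_self, if_neg (not_not.2 h1)]; exact Nat.zero_le _
      · rw [Function.update_of_ne hk]
    · rw [Function.update_self, if_neg (not_not.2 h1), if_pos hi']; exact Nat.succ_pos _
  | succ i ih =>
    by_contra hi'
    have hj := ih (by omega)
    obtain ⟨h1, h2⟩ := hP a x h _ _ hj hi'
    obtain ⟨x', hx'⟩ := h.swap (i := ⟨i + 1, hi⟩) (j := ⟨i, by omega⟩) rfl h2 h1
    exact hmin _ ⟨_, x', hx', rfl⟩ (hn ▸ sum_swap_lt (fun b => ¬ P b) 1 a (by simp)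
      (not_not.2 hj) hi')

end Weights

/-! ### Laurent polynomials and automorphisms in the localization -/

section Operators

variable {K : Type*} [Field K] [Algebra ℂ K]

theorem aut_mul_lmul (w : K ≃ₐ[ℂ] K) (f : K) :
    w.toLinearMap * Algebra.lmul ℂ K f = Algebra.lmul ℂ K (w f) * w.toLinearMap := by
  ext g; simp

/-- A Demazure–Lusztig operator followed by an automorphism `w` is a combination of `w` and `s w`.
-/
theorem dlOp_mul_aut {s w : K ≃ₐ[ℂ] K} {p : ℂ} {e e' : K} (hp : p ≠ 0) (he0 : e ≠ 0) (he : e ≠ 1)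
    (hs : s e = e⁻¹) (hw : w e' = e) :
    dlOp p e s * w.toLinearMap =
      w.toLinearMap * Algebra.lmul ℂ K ((algebraMap ℂ K p - (algebraMap ℂ K p)⁻¹) / (1 - e')) +
      (s * w).toLinearMap *
        Algebra.lmul ℂ K ((algebraMap ℂ K p - (algebraMap ℂ K p)⁻¹ * e') / (1 - e')) := by
  ext f
  have hp' : algebraMap ℂ K p ≠ 0 := by simpa using hp
  have e1 := sub_ne_zero.2 he.symm
  have e2 := sub_ne_zero.2 he
  simp only [Module.End.mul_apply, LinearMap.add_apply, dlOp_apply, AlgEquiv.toLinearMap_apply,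
    Algebra.coe_lmul_eq_mul, LinearMap.mul_apply', map_mul, map_div₀, map_sub, map_inv₀, map_one,
    AlgEquiv.commutes, AlgEquiv.mul_apply, hw, hs, dlCoeff]
  field_simp
  ring

theorem dlOp_mul_aut_of_conj {s s' w : K ≃ₐ[ℂ] K} {p : ℂ} {e e' : K} (hw : w e' = e)
    (hs : s * w = w * s') :
    dlOp p e s * w.toLinearMap = w.toLinearMap * dlOp p e' s' := by
  ext f
  have := DFunLike.congr_fun hs f
  simp only [AlgEquiv.mul_apply] at this
  simp only [Module.End.mul_apply, dlOp_apply, AlgEquiv.toLinearMap_apply, map_add, map_mul,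
    map_sub, AlgEquiv.commutes, map_dlCoeff, hw, this]

/-- The reflection `s` times a multiple of `p - p⁻¹ e` is polynomial in the Demazure–Lusztig
operator. -/
theorem aut_mul_lmul_eq {s : K ≃ₐ[ℂ] K} {p : ℂ} {e : K} (hp : p ≠ 0) (he0 : e ≠ 0) (he : e ≠ 1)
    (hs : s e = e⁻¹) (f : K) :
    s.toLinearMap * Algebra.lmul ℂ K ((algebraMap ℂ K p - (algebraMap ℂ K p)⁻¹ * e) * f) =
      dlOp p e s * Algebra.lmul ℂ K ((1 - e) * f) -
        Algebra.lmul ℂ K ((algebraMap ℂ K p - (algebraMap ℂ K p)⁻¹) * f) := by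
  ext g
  have hp' : algebraMap ℂ K p ≠ 0 := by simpa using hp
  have e1 := sub_ne_zero.2 he.symm
  have e2 := sub_ne_zero.2 he
  change s ((algebraMap ℂ K p - (algebraMap ℂ K p)⁻¹ * e) * f * g) =
    dlOp p e s ((1 - e) * f * g) - (algebraMap ℂ K p - (algebraMap ℂ K p)⁻¹) * f * g
  simp only [dlOp_apply, map_mul, map_sub, map_inv₀, map_one, AlgEquiv.commutes, hs, dlCoeff]
  field_simp
  ring

end Operators

section Laurent

variable (r : ℕ)

/-- The Laurent polynomials in `ℂ(X_1, …, X_r)`. -/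
noncomputable def laurent : Subalgebra ℂ (RatField r) :=
  Algebra.adjoin ℂ (Set.range (kX (r := r)) ∪ Set.range (fun i : Fin r => (kX i)⁻¹))

variable {r}

theorem kX_mem_laurent (i : Fin r) : kX i ∈ laurent r := Algebra.subset_adjoin (.inl ⟨i, rfl⟩)

theorem kX_inv_mem_laurent (i : Fin r) : (kX i)⁻¹ ∈ laurent r :=
  Algebra.subset_adjoin (.inr ⟨i, rfl⟩)

theorem kX_zpow_mem_laurent (i : Fin r) (ε : ℤˣ) : kX i ^ (ε : ℤ) ∈ laurent r := by
  rcases Int.units_eq_one_or ε with rfl | rfl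
  · simpa using kX_mem_laurent i
  · simpa using kX_inv_mem_laurent i

theorem algebraMap_mem_laurent (c : ℂ) : algebraMap ℂ (RatField r) c ∈ laurent r :=
  Subalgebra.algebraMap_mem _ c

theorem signedAut_mem_laurent {f : RatField r} (hf : f ∈ laurent r) (π : Equiv.Perm (Fin r))
    (ε : Fin r → ℤˣ) : signedAut π ε f ∈ laurent r := by
  suffices h : laurent r ≤ (laurent r).comap (signedAut π ε).toAlgHom from h hf
  refine Algebra.adjoin_le ?_
  rintro _ (⟨i, rfl⟩ | ⟨i, rfl⟩)
  · change signedAut π ε (kX i) ∈ laurent r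
    rw [signedAut_kX]
    exact kX_zpow_mem_laurent _ _
  · change signedAut π ε (kX i)⁻¹ ∈ laurent r
    rw [map_inv₀, signedAut_kX, ← zpow_neg, ← Units.val_neg]
    exact kX_zpow_mem_laurent _ _

/-- An algebra homomorphism whose range contains multiplication by the `X_i^{±1}` reaches all
Laurent polynomials. -/
theorem exists_of_mem_laurent {A : Type*} [Ring A] [Algebra ℂ A]
    (j : A →ₐ[ℂ] Module.End ℂ (RatField r))
    (h1 : ∀ i, ∃ a, j a = Algebra.lmul ℂ (RatField r) (kX i))
    (h2 : ∀ i, ∃ a, j a = Algebra.lmul ℂ (RatField r) (kX i)⁻¹) {f : RatField r}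
    (hf : f ∈ laurent r) : ∃ a, j a = Algebra.lmul ℂ (RatField r) f := by
  suffices h : laurent r ≤ j.range.comap (Algebra.lmul ℂ (RatField r)) from h hf
  refine Algebra.adjoin_le ?_
  rintro _ (⟨i, rfl⟩ | ⟨i, rfl⟩)
  · exact h1 i
  · exact h2 i

theorem stdRep_of_mem_laurent (p0 p1 : ℂˣ) {f : RatField r} (hf : f ∈ laurent r) :
    ∃ h, stdRep r p0 p1 h = Algebra.lmul ℂ (RatField r) f :=
  exists_of_mem_laurent _ (fun i => ⟨_, varRep_X _ p0 p1 i⟩) (fun i => ⟨_, varRep_Xinv _ p0 p1 i⟩) hf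

/-- Divisibility with Laurent polynomial quotient. -/
def LaurentDvd (u f : RatField r) : Prop := ∃ v ∈ laurent r, f = u * v

theorem LaurentDvd.mul_right {u f : RatField r} (h : LaurentDvd u f) {g : RatField r}
    (hg : g ∈ laurent r) : LaurentDvd u (f * g) := by
  obtain ⟨v, hv, rfl⟩ := h
  exact ⟨v * g, mul_mem hv hg, by ring⟩

theorem LaurentDvd.trans {u f g : RatField r} (h : LaurentDvd u f) (h' : LaurentDvd f g) :
    LaurentDvd u g := by
  obtain ⟨v, hv, rfl⟩ := h
  obtain ⟨v', hv', rfl⟩ := h'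
  exact ⟨v * v', mul_mem hv hv', by ring⟩

theorem laurentDvd_prod {ι : Type*} {s : Finset ι} {i : ι} (hi : i ∈ s) {f : ι → RatField r}
    (hf : ∀ i, f i ∈ laurent r) : LaurentDvd (f i) (∏ i ∈ s, f i) := by
  classical
  exact ⟨∏ k ∈ s.erase i, f k, prod_mem fun k _ => hf k, (Finset.mul_prod_erase s f hi).symm⟩

theorem kRoot_zero {i : Fin r} (hi : i.val = 0) : kRoot i = (kX i)⁻¹ ^ 2 := by simp [kRoot, hi]

theorem kRoot_succ {i j : Fin r} (h : j.val + 1 = i.val) : kRoot i = kX j * (kX i)⁻¹ :=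
  (varDatum (id : Fin r → Fin r) Function.injective_id).root_succ h

theorem kRoot_ne_zero (i : Fin r) : kRoot i ≠ 0 :=
  (varDatum (id : Fin r → Fin r) Function.injective_id).root_ne_zero i

theorem kRoot_ne_one (i : Fin r) : kRoot i ≠ 1 :=
  (varDatum (id : Fin r → Fin r) Function.injective_id).root_ne_one i

theorem simpleAut_kRoot (i : Fin r) : simpleAut id i (kRoot i) = (kRoot i)⁻¹ :=
  (varDatum (id : Fin r → Fin r) Function.injective_id).s_root i

theorem kRoot_mem_laurent (i : Fin r) : kRoot i ∈ laurent r := by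
  unfold kRoot
  split_ifs
  · exact pow_mem (kX_inv_mem_laurent i) 2
  · exact mul_mem (kX_mem_laurent _) (kX_inv_mem_laurent i)

theorem stdRep_T (p0 p1 : ℂˣ) (i : Fin r) : stdRep r p0 p1 (HB.T p0 p1 i) =
    dlOp (par p0 p1 i : ℂ) (kRoot i) (simpleAut id i) := varRep_T _ p0 p1 i

theorem simpleAut_eq_signedAut (i : Fin r) : ∃ π ε, simpleAut (id : Fin r → Fin r) i = signedAut π ε := by
  unfold simpleAut
  split_ifs
  · exact ⟨_, _, rfl⟩
  · exact ⟨_, _, rfl⟩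

theorem simpleAut_mem_laurent {f : RatField r} (hf : f ∈ laurent r) (i : Fin r) :
    simpleAut id i f ∈ laurent r := by
  obtain ⟨π, ε, h⟩ := simpleAut_eq_signedAut i
  rw [h]
  exact signedAut_mem_laurent hf π ε

variable {p0 p1 : ℂˣ}

/-- If `x` belongs to the localization of `H_r^B` and moves the denominator `z` to a multiple of
`p_i - p_i⁻¹ e_i`, then `s_i x` belongs to the localization as well. -/
theorem simpleAut_mul_mem_rightLoc {zH : HB r p0 p1} {z g : RatField r}
    (hz : stdRep r p0 p1 zH = Algebra.lmul ℂ (RatField r) z) {x : Module.End ℂ (RatField r)}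
    (hx : x ∈ rightLoc (stdRep r p0 p1) zH) (i : Fin r)
    (hg : x * Algebra.lmul ℂ (RatField r) z = Algebra.lmul ℂ (RatField r) g * x)
    (hd : LaurentDvd (algebraMap ℂ (RatField r) (par p0 p1 i : ℂ)
      - (algebraMap ℂ (RatField r) (par p0 p1 i : ℂ))⁻¹ * kRoot i) g) :
    (simpleAut id i).toLinearMap * x ∈ rightLoc (stdRep r p0 p1) zH := by
  obtain ⟨v, hv, rfl⟩ := hd
  have h1 : ∃ h, stdRep r p0 p1 h = (simpleAut id i).toLinearMap * Algebra.lmul ℂ (RatField r)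
      ((algebraMap ℂ (RatField r) (par p0 p1 i : ℂ)
      - (algebraMap ℂ (RatField r) (par p0 p1 i : ℂ))⁻¹ * kRoot i) * v) := by
    rw [aut_mul_lmul_eq (by simp) (kRoot_ne_zero i) (kRoot_ne_one i) (simpleAut_kRoot i)]
    obtain ⟨h2, e2⟩ := stdRep_of_mem_laurent p0 p1 (f := (1 - kRoot i) * v)
      (mul_mem (sub_mem (one_mem _) (kRoot_mem_laurent i)) hv)
    obtain ⟨h3, e3⟩ := stdRep_of_mem_laurent p0 p1 (f := (algebraMap ℂ (RatField r) (par p0 p1 i : ℂ)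
      - (algebraMap ℂ (RatField r) (par p0 p1 i : ℂ))⁻¹) * v)
      (mul_mem (sub_mem (algebraMap_mem_laurent _)
        (by rw [← map_inv₀]; exact algebraMap_mem_laurent _)) hv)
    exact ⟨HB.T p0 p1 i * h2 - h3, by rw [map_sub, map_mul, e2, e3, stdRep_T]⟩
  obtain ⟨h, hh⟩ := h1
  refine of_mul_mem_rightLoc ?_
  rw [hz, mul_assoc, hg, ← mul_assoc, ← hh]
  exact map_mul_mem_rightLoc h hx

theorem lmul_mem_rightLoc {A : Type*} [Ring A] [Algebra ℂ A]
    {j : A →ₐ[ℂ] Module.End ℂ (RatField r)} {zA : A} {z f : RatField r}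
    (hz : j zA = Algebra.lmul ℂ (RatField r) z)
    (hj : ∀ f ∈ laurent r, ∃ a, j a = Algebra.lmul ℂ (RatField r) f) (h : f * z ∈ laurent r) :
    Algebra.lmul ℂ (RatField r) f ∈ rightLoc j zA := by
  obtain ⟨a, ha⟩ := hj _ h
  exact ⟨1, a, by rw [pow_one, hz, ← map_mul, ha]⟩

/-- The shape of `T_i w` for an automorphism `w` when `z` is divisible by `1 - w⁻¹(e_i)`. -/
theorem T_mul_aut_of_dvd {A : Type*} [Ring A] [Algebra ℂ A]
    {j : A →ₐ[ℂ] Module.End ℂ (RatField r)} {zA : A} {z : RatField r}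
    (hz : j zA = Algebra.lmul ℂ (RatField r) z)
    (hj : ∀ f ∈ laurent r, ∃ a, j a = Algebra.lmul ℂ (RatField r) f)
    (i : Fin r) (w : RatField r ≃ₐ[ℂ] RatField r) {e : RatField r} (he : w e = kRoot i)
    (hel : e ∈ laurent r) (hd : LaurentDvd (1 - e) z) :
    ∃ q ∈ rightLoc j zA, ∃ q' ∈ rightLoc j zA,
      stdRep r p0 p1 (HB.T p0 p1 i) * w.toLinearMap
        = w.toLinearMap * q + (simpleAut id i * w).toLinearMap * q' := by
  obtain ⟨v, hv, rfl⟩ := hd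
  have he1 : 1 - e ≠ 0 := sub_ne_zero.2 fun h => kRoot_ne_one i (by rw [← he, ← h, map_one])
  have hinv : (algebraMap ℂ (RatField r) (par p0 p1 i : ℂ))⁻¹ ∈ laurent r := by
    rw [← map_inv₀]; exact algebraMap_mem_laurent _
  refine ⟨_, ?_, _, ?_, (stdRep_T p0 p1 i).symm ▸ dlOp_mul_aut (by simp) (kRoot_ne_zero i)
    (kRoot_ne_one i) (simpleAut_kRoot i) he⟩ <;> refine lmul_mem_rightLoc hz hj ?_ <;>
    rw [← mul_assoc, div_mul_cancel₀ _ he1] <;> refine mul_mem ?_ hv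
  · exact sub_mem (algebraMap_mem_laurent _) hinv
  · exact sub_mem (algebraMap_mem_laurent _) (mul_mem hinv hel)

end Laurent

/-! ### Linear independence of cosets of automorphisms -/

section Cosets

variable {r : ℕ} (G : Subgroup (RatField r ≃ₐ[ℂ] RatField r))

/-- The operators that are combinations, over `ℂ(X_1, …, X_r)`, of the automorphisms in `G`. -/
noncomputable def autSpan : Subalgebra ℂ (Module.End ℂ (RatField r)) where
  carrier := Submodule.span (RatField r) (AlgEquiv.toLinearMap '' (G : Set (RatField r ≃ₐ[ℂ] RatField r)))
  add_mem' := add_mem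
  algebraMap_mem' c := by
    have : algebraMap ℂ (Module.End ℂ (RatField r)) c
        = algebraMap ℂ (RatField r) c • (1 : RatField r ≃ₐ[ℂ] RatField r).toLinearMap := by
      ext x; simp [Algebra.smul_def]
    rw [this]
    exact Submodule.smul_mem _ _ (Submodule.subset_span ⟨1, one_mem _, rfl⟩)
  mul_mem' := by
    intro a b ha hb
    change a ∈ Submodule.span _ _ at ha
    change b ∈ Submodule.span _ _ at hb
    change a * b ∈ Submodule.span _ _
    induction ha using Submodule.span_induction with
    | mem a ha =>
      obtain ⟨g, hg, rfl⟩ := ha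
      induction hb using Submodule.span_induction with
      | mem b hb =>
        obtain ⟨g', hg', rfl⟩ := hb
        exact Submodule.subset_span ⟨g * g', mul_mem hg hg', rfl⟩
      | zero => rw [mul_zero]; exact zero_mem _
      | add x y _ _ hx hy => rw [mul_add]; exact add_mem hx hy
      | smul f x _ hx =>
        rw [smul_end_eq, ← mul_assoc, aut_mul_lmul, mul_assoc, ← smul_end_eq]
        exact Submodule.smul_mem _ _ hx
    | zero => rw [zero_mul]; exact zero_mem _
    | add x y _ _ hx hy => rw [add_mul]; exact add_mem hx hy
    | smul f x _ hx => rw [smul_mul_assoc]; exact Submodule.smul_mem _ _ hx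

variable {G}

theorem mem_autSpan {q : Module.End ℂ (RatField r)} : q ∈ autSpan G ↔
    q ∈ Submodule.span (RatField r) (AlgEquiv.toLinearMap '' (G : Set (RatField r ≃ₐ[ℂ] RatField r))) :=
  Iff.rfl

theorem aut_mem_autSpan {g : RatField r ≃ₐ[ℂ] RatField r} (hg : g ∈ G) :
    g.toLinearMap ∈ autSpan G := Submodule.subset_span ⟨g, hg, rfl⟩

theorem lmul_mem_autSpan (f : RatField r) : Algebra.lmul ℂ (RatField r) f ∈ autSpan G := by
  have : Algebra.lmul ℂ (RatField r) f = f • (1 : RatField r ≃ₐ[ℂ] RatField r).toLinearMap := by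
    ext x; simp
  rw [this]
  exact Submodule.smul_mem _ _ (Submodule.subset_span ⟨1, one_mem _, rfl⟩)

theorem dlOp_mem_autSpan (p : ℂ) (e : RatField r) {s : RatField r ≃ₐ[ℂ] RatField r} (hs : s ∈ G) :
    dlOp p e s ∈ autSpan G :=
  add_mem (Subalgebra.smul_mem _ (one_mem _) _)
    (mul_mem (lmul_mem_autSpan _) (sub_mem (aut_mem_autSpan hs) (one_mem _)))

theorem rightLoc_le_autSpan {A : Type*} [Ring A] [Algebra ℂ A]
    {j : A →ₐ[ℂ] Module.End ℂ (RatField r)} {zA : A} {z : RatField r} (hz0 : z ≠ 0)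
    (hz : j zA = Algebra.lmul ℂ (RatField r) z) (hj : ∀ a, j a ∈ autSpan G)
    {q : Module.End ℂ (RatField r)} (hq : q ∈ rightLoc j zA) : q ∈ autSpan G := by
  obtain ⟨k, a, h⟩ := hq
  have : q = j a * Algebra.lmul ℂ (RatField r) (z ^ k)⁻¹ := by
    rw [← h, hz, ← map_pow, mul_assoc, ← map_mul, mul_inv_cancel₀ (pow_ne_zero _ hz0), map_one, mul_one]
  rw [this]
  exact mul_mem (hj a) (lmul_mem_autSpan _)

/-- Combinations of automorphisms from different cosets of `G` are linearly independent. -/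
theorem eq_zero_of_sum_cosets {I : Type*} [Fintype I] (w : I → (RatField r ≃ₐ[ℂ] RatField r))
    {o : I} (ho : w o = 1) (hw : ∀ s, w s ∈ G → s = o) (c : I → Module.End ℂ (RatField r))
    (hc : ∀ s, c s ∈ autSpan G) (h : ∑ s, (w s).toLinearMap * c s = 0) : c o = 0 := by
  classical
  have hind : LinearIndependent (RatField r)
      (AlgEquiv.toLinearMap : (RatField r ≃ₐ[ℂ] RatField r) → Module.End ℂ (RatField r)) :=
    (linearIndependent_algHom_toLinearMap ℂ (RatField r) (RatField r)).comp
      (fun σ : RatField r ≃ₐ[ℂ] RatField r => (σ : RatField r →ₐ[ℂ] RatField r))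
      (fun a b h => AlgEquiv.coe_toAlgHom_injective h)
  have hdis := hind.disjoint_span_image
    (disjoint_compl_right (a := (G : Set (RatField r ≃ₐ[ℂ] RatField r))))
  refine Submodule.disjoint_def.1 hdis _ (hc o) ?_
  rw [← Finset.add_sum_erase _ _ (Finset.mem_univ o), ho] at h
  have h1 : c o = - ∑ s ∈ Finset.univ.erase o, (w s).toLinearMap * c s :=
    eq_neg_of_add_eq_zero_left h
  rw [h1]
  refine neg_mem (Submodule.sum_mem _ fun s hs => ?_)
  -- The other terms belong to the span of the automorphisms outside `G`.
  have hs' : w s ∉ G := fun h => (Finset.mem_erase.1 hs).1 (hw s h)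
  have hcs := mem_autSpan.1 (hc s)
  generalize c s = b at hcs ⊢
  induction hcs using Submodule.span_induction with
  | mem b hb =>
    obtain ⟨g, hg, rfl⟩ := hb
    refine Submodule.subset_span ⟨w s * g, fun hmem => hs' ?_, rfl⟩
    simpa using mul_mem (show w s * g ∈ G from hmem) (inv_mem (show g ∈ G from hg))
  | zero => rw [mul_zero]; exact zero_mem _
  | add x y _ _ hx hy => rw [mul_add]; exact add_mem hx hy
  | smul f x _ hx =>
    rw [smul_end_eq, ← mul_assoc, aut_mul_lmul, mul_assoc, ← smul_end_eq]
    exact Submodule.smul_mem _ _ hx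

/-- The automorphisms acting on the variables by signed permutations in which `k` is sent to `l`
with sign `ε` only if `R k l ε`. -/
noncomputable def relGroup (R : Fin r → Fin r → ℤˣ → Prop) (h1 : ∀ k, R k k 1)
    (h2 : ∀ k l m ε η, R k l ε → R l m η → R k m (η * ε)) :
    Subgroup (RatField r ≃ₐ[ℂ] RatField r) where
  carrier := {σ | (∀ k, ∃ l ε, R k l ε ∧ σ (kX k) = kX l ^ ((ε : ℤˣ) : ℤ)) ∧
    ∀ k, ∃ l ε, R k l ε ∧ σ⁻¹ (kX k) = kX l ^ ((ε : ℤˣ) : ℤ)}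
  one_mem' := ⟨fun k => ⟨k, 1, h1 k, by simp⟩, fun k => ⟨k, 1, h1 k, by simp⟩⟩
  mul_mem' := by
    have : ∀ σ τ : RatField r ≃ₐ[ℂ] RatField r,
        (∀ k, ∃ l ε, R k l ε ∧ σ (kX k) = kX l ^ ((ε : ℤˣ) : ℤ)) →
        (∀ k, ∃ l ε, R k l ε ∧ τ (kX k) = kX l ^ ((ε : ℤˣ) : ℤ)) →
        (∀ k, ∃ l ε, R k l ε ∧ (σ * τ) (kX k) = kX l ^ ((ε : ℤˣ) : ℤ)) := by
      intro σ τ hσ hτ k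
      obtain ⟨l, ε, hR, h⟩ := hτ k
      obtain ⟨m, η, hR', h'⟩ := hσ l
      exact ⟨m, η * ε, h2 _ _ _ _ _ hR hR', by
        rw [AlgEquiv.mul_apply, h, map_zpow₀, h', ← zpow_mul, Units.val_mul]⟩
    rintro σ τ ⟨hσ, hσ'⟩ ⟨hτ, hτ'⟩
    exact ⟨this _ _ hσ hτ, by rw [mul_inv_rev]; exact this _ _ hτ' hσ'⟩
  inv_mem' := by
    rintro σ ⟨hσ, hσ'⟩
    exact ⟨hσ', by rw [inv_inv]; exact hσ⟩

end Cosets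

section Membership

variable {n : ℕ} {p0 p1 : ℂˣ}

theorem HB.map_mem {R : Type*} [Ring R] [Algebra ℂ R] (ρ : HB n p0 p1 →ₐ[ℂ] R) (S : Subalgebra ℂ R)
    (hT : ∀ i, ρ (HB.T p0 p1 i) ∈ S) (hX : ∀ i, ρ (HB.X p0 p1 i) ∈ S)
    (hY : ∀ i, ρ (HB.Xinv p0 p1 i) ∈ S) (h : HB n p0 p1) : ρ h ∈ S := by
  refine HB.induction_left p0 p1 (P := fun h => ρ h ∈ S) (by simp) ?_ ?_ ?_ ?_ ?_ h
  · intro a b ha hb; rw [map_add]; exact add_mem ha hb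
  · intro c a ha; rw [map_smul]; exact Subalgebra.smul_mem _ ha _
  · intro i a ha; rw [map_mul]; exact mul_mem (hT i) ha
  · intro i a ha; rw [map_mul]; exact mul_mem (hX i) ha
  · intro i a ha; rw [map_mul]; exact mul_mem (hY i) ha

end Membership

/-! ### The denominator for a pair of blocks of variables -/

section Signed

variable {r : ℕ}

theorem flipAut_mul_signedAut (π : Equiv.Perm (Fin r)) (ε : Fin r → ℤˣ) (a : Fin r) :
    flipAut (π a) * signedAut π ε = signedAut π ε * flipAut a := by
  apply ratField_algEquiv_ext
  intro k
  simp only [AlgEquiv.mul_apply, signedAut_kX, flipAut_kX, map_zpow₀, EmbeddingLike.apply_eq_iff_eq]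
  split_ifs with h
  · subst h; rw [map_inv₀, signedAut_kX, inv_zpow]
  · rw [signedAut_kX]

theorem swapAut_mul_signedAut (π : Equiv.Perm (Fin r)) (ε : Fin r → ℤˣ) {a b : Fin r}
    (h : ε a = ε b) : swapAut (π a) (π b) * signedAut π ε = signedAut π ε * swapAut a b := by
  apply ratField_algEquiv_ext
  intro k
  simp only [AlgEquiv.mul_apply, signedAut_kX, swapAut_kX, map_zpow₀, EmbeddingLike.apply_eq_iff_eq]
  split_ifs with h1 h2
  · subst h1; rw [signedAut_kX, h]
  · subst h2; rw [signedAut_kX, h]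
  · rw [signedAut_kX]

theorem swapAut_comm (a b : Fin r) : swapAut a b = swapAut b a := by
  rw [swapAut, swapAut, Equiv.swap_comm]

theorem swapAut_mul (π : Equiv.Perm (Fin r)) (ε : Fin r → ℤˣ) (a b : Fin r) :
    swapAut a b * signedAut π ε = signedAut (Equiv.swap a b * π) ε := by
  rw [swapAut, signedAut_mul]; simp

theorem flipAut_mul (π : Equiv.Perm (Fin r)) (ε : Fin r → ℤˣ) (a : Fin r) :
    flipAut (π a) * signedAut π ε = signedAut π (Function.update ε a (-ε a)) := by
  rw [flipAut, signedAut_mul, one_mul]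
  congr 1
  ext k
  by_cases h : k = a
  · subst h; simp
  · simp [h]

end Signed

section CommLoc

variable {B R : Type*} [Ring B] [Algebra ℂ B] [Ring R] [Algebra ℂ R]

/-- The elements of the localization that commute with the denominator form an algebra. -/
def rightLocComm (j : B →ₐ[ℂ] R) (z : B) : Subalgebra ℂ R where
  carrier := {q | q ∈ rightLoc j z ∧ Commute q (j z)}
  add_mem' ha hb := ⟨add_mem ha.1 hb.1, ha.2.add_left hb.2⟩
  mul_mem' ha hb := ⟨mul_mem_rightLoc ha.1 hb.1 hb.2, ha.2.mul_left hb.2⟩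
  algebraMap_mem' c := ⟨by rw [← AlgHom.commutes j c]; exact map_mem_rightLoc _,
    Algebra.commutes c _⟩

end CommLoc

section PairDatum

variable {n m r : ℕ} (p0 p1 : ℂˣ) (hr : n + m = r)

theorem posL_injective : Function.Injective (posL hr) := fun i j h => by
  simpa [posL, Fin.ext_iff] using h

theorem posR_injective : Function.Injective (posR hr) := fun i j h => by
  simpa [posR, Fin.ext_iff] using h

theorem posL_ne_posR (i : Fin n) (j : Fin m) : posL hr i ≠ posR hr j := fun h => by
  have := congrArg Fin.val h
  simp only [posL, posR] at this
  omega

theorem exists_pos (k : Fin r) : (∃ i, k = posL hr i) ∨ ∃ j, k = posR hr j := by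
  by_cases h : k.val < n
  · exact .inl ⟨⟨k, h⟩, rfl⟩
  · exact .inr ⟨⟨k - n, by omega⟩, Fin.ext (by simp [posR]; omega)⟩

/-- The representation of `H_n^B ⊗ H_m^B` on `ℂ(X_1, …, X_r)`, `r = n + m`, through the first `n`
and the last `m` variables. -/
noncomputable abbrev blockRep : HB n p0 p1 ⊗[ℂ] HB m p0 p1 →ₐ[ℂ] Module.End ℂ (RatField r) :=
  pairRep (posL_injective hr) (posR_injective hr) (posL_ne_posR hr) p0 p1

theorem blockRep_mem (S : Subalgebra ℂ (Module.End ℂ (RatField r)))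
    (hL : ∀ i, varRep (posL_injective hr) p0 p1 (HB.T p0 p1 i) ∈ S)
    (hR : ∀ i, varRep (posR_injective hr) p0 p1 (HB.T p0 p1 i) ∈ S)
    (hX : ∀ k, Algebra.lmul ℂ (RatField r) (kX k) ∈ S)
    (hY : ∀ k, Algebra.lmul ℂ (RatField r) (kX k)⁻¹ ∈ S) (a : HB n p0 p1 ⊗[ℂ] HB m p0 p1) :
    blockRep p0 p1 hr a ∈ S := by
  induction a using TensorProduct.induction_on with
  | zero => rw [map_zero]; exact zero_mem _
  | add a b ha hb => rw [map_add]; exact add_mem ha hb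
  | tmul a b =>
    rw [pairRep_tmul]
    refine mul_mem (HB.map_mem _ S hL ?_ ?_ a) (HB.map_mem _ S hR ?_ ?_ b) <;> intro i <;>
      simp only [varRep_X, varRep_Xinv, hX, hY]

/-- The generator `X_{k+1}` as an element of `H_n^B ⊗ H_m^B`. -/
noncomputable def blockX (k : Fin r) : HB n p0 p1 ⊗[ℂ] HB m p0 p1 :=
  if h : k.val < n then HB.X p0 p1 ⟨k, h⟩ ⊗ₜ 1 else 1 ⊗ₜ HB.X p0 p1 ⟨k - n, by omega⟩

theorem blockX_posL (i : Fin n) : blockX p0 p1 hr (posL hr i) = HB.X p0 p1 i ⊗ₜ 1 := by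
  simp [blockX, posL]

theorem blockX_posR (i : Fin m) : blockX p0 p1 hr (posR hr i) = 1 ⊗ₜ HB.X p0 p1 i := by
  simp [blockX, posR]

theorem blockRep_blockX (k : Fin r) :
    blockRep p0 p1 hr (blockX p0 p1 hr k) = Algebra.lmul ℂ (RatField r) (kX k) := by
  rcases exists_pos hr k with ⟨i, rfl⟩ | ⟨i, rfl⟩
  · rw [blockX_posL, pairRep_tmul, map_one, mul_one, varRep_X]
  · rw [blockX_posR, pairRep_tmul, map_one, one_mul, varRep_X]

theorem exists_blockRep_Xinv (k : Fin r) :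
    ∃ a, blockRep p0 p1 hr a = Algebra.lmul ℂ (RatField r) (kX k)⁻¹ := by
  rcases exists_pos hr k with ⟨i, rfl⟩ | ⟨i, rfl⟩
  · exact ⟨HB.Xinv p0 p1 i ⊗ₜ 1, by rw [pairRep_tmul, map_one, mul_one, varRep_Xinv]⟩
  · exact ⟨1 ⊗ₜ HB.Xinv p0 p1 i, by rw [pairRep_tmul, map_one, one_mul, varRep_Xinv]⟩

theorem blockRep_of_mem_laurent {f : RatField r} (hf : f ∈ laurent r) :
    ∃ a, blockRep p0 p1 hr a = Algebra.lmul ℂ (RatField r) f :=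
  exists_of_mem_laurent _ (fun k => ⟨_, blockRep_blockX p0 p1 hr k⟩)
    (exists_blockRep_Xinv p0 p1 hr) hf

/-- The factor of the symmetric denominator belonging to a pair of variables: the factor of `D`,
divided by `x³` to make it invariant under inversion of `x` and of `y`. -/
noncomputable def symFactor {r : ℕ} (x y : RatField r) : RatField r := dFactor p1 x y y⁻¹ * x⁻¹ ^ 3

/-- The denominator: `D` times a monomial. -/
noncomputable def symDenom : RatField r :=
  ∏ i : Fin n, ∏ j : Fin m, symFactor p1 (kX (posL hr i)) (kX (posR hr j))

variable {p1}

theorem symFactor_inv_left {x y : RatField r} (hx : x ≠ 0) (hy : y ≠ 0) :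
    symFactor p1 x⁻¹ y = symFactor p1 x y := by
  have hp : algebraMap ℂ (RatField r) p1 ≠ 0 := by simp
  simp only [symFactor, dFactor, Algebra.smul_def, map_pow, map_inv₀, inv_inv]
  field_simp
  ring

theorem symFactor_inv_right {x y : RatField r} :
    symFactor p1 x y⁻¹ = symFactor p1 x y := by
  simp only [symFactor, dFactor, inv_inv]
  ring

theorem symFactor_zpow {i j : Fin r} (ε η : ℤˣ) :
    symFactor p1 (kX i ^ (ε : ℤ)) (kX j ^ (η : ℤ)) = symFactor p1 (kX i) (kX j) := by
  have hi := kX_ne_zero i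
  have hj := kX_ne_zero j
  rcases Int.units_eq_one_or ε with rfl | rfl <;> rcases Int.units_eq_one_or η with rfl | rfl <;>
    simp [symFactor_inv_left, symFactor_inv_right, hi, hj]

theorem map_symFactor (σ : RatField r ≃ₐ[ℂ] RatField r) (x y : RatField r) :
    σ (symFactor p1 x y) = symFactor p1 (σ x) (σ y) := by
  simp only [symFactor, dFactor, Algebra.smul_def, map_mul, map_sub, map_pow, map_inv₀,
    AlgEquiv.commutes]

theorem symFactor_mem_laurent (i j : Fin r) : symFactor p1 (kX i) (kX j) ∈ laurent r := by
  unfold symFactor dFactor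
  have hi := kX_mem_laurent i
  have hj := kX_mem_laurent j
  have hi' := kX_inv_mem_laurent i
  have hj' := kX_inv_mem_laurent j
  have hs : ∀ (c : ℂ) {f : RatField r}, f ∈ laurent r → c • f ∈ laurent r :=
    fun c f hf => Subalgebra.smul_mem _ hf c
  exact mul_mem (mul_mem (mul_mem (mul_mem (mul_mem (mul_mem (sub_mem hi (hs _ hj))
    (sub_mem hi (hs _ hj))) (sub_mem hi (hs _ hj'))) (sub_mem hi (hs _ hj'))) (sub_mem hi hj))
    (sub_mem hi hj')) (pow_mem hi' 3)

theorem symFactor_ne_zero {i j : Fin r} (hij : i ≠ j) : symFactor p1 (kX i) (kX j) ≠ 0 := by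
  have hne : ∀ c : ℂ, kX i - c • kX j ≠ 0 := fun c h => by
    refine kX_mul_inv_ne c hij ?_
    rw [sub_eq_zero.1 h, Algebra.smul_def, mul_assoc, mul_inv_cancel₀ (kX_ne_zero j), mul_one]
  have hne' : ∀ c : ℂ, kX i - c • (kX j)⁻¹ ≠ 0 := fun c h => by
    refine kX_mul_ne c (i := i) (j := j) ?_
    rw [sub_eq_zero.1 h, Algebra.smul_def, mul_assoc, inv_mul_cancel₀ (kX_ne_zero j), mul_one]
  unfold symFactor dFactor
  refine mul_ne_zero (mul_ne_zero (mul_ne_zero (mul_ne_zero (mul_ne_zero (mul_ne_zero (hne _) (hne _))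
    (hne' _)) (hne' _)) ?_) ?_) (pow_ne_zero _ (inv_ne_zero (kX_ne_zero i)))
  · simpa using hne 1
  · simpa using hne' 1

/-- The factor of a pair of variables is divisible by `p₁ - p₁⁻¹ e` and `1 - e` for the roots
`e = (X_i / X_j)^{±1}`. -/
theorem laurentDvd_symFactor (i j : Fin r) :
    (LaurentDvd (algebraMap ℂ (RatField r) p1 - (algebraMap ℂ (RatField r) p1)⁻¹
        * (kX i * (kX j)⁻¹)) (symFactor p1 (kX i) (kX j)) ∧
      LaurentDvd (1 - kX i * (kX j)⁻¹) (symFactor p1 (kX i) (kX j))) ∧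
    LaurentDvd (algebraMap ℂ (RatField r) p1 - (algebraMap ℂ (RatField r) p1)⁻¹
        * (kX j * (kX i)⁻¹)) (symFactor p1 (kX i) (kX j)) ∧
      LaurentDvd (1 - kX j * (kX i)⁻¹) (symFactor p1 (kX i) (kX j)) := by
  have hi := kX_mem_laurent i
  have hj := kX_mem_laurent j
  have hi' := kX_inv_mem_laurent i
  have hj' := kX_inv_mem_laurent j
  have hi0 := kX_ne_zero i
  have hj0 := kX_ne_zero j
  have hp : algebraMap ℂ (RatField r) p1 ≠ 0 := by simp
  have hc : ∀ c, algebraMap ℂ (RatField r) c ∈ laurent r := algebraMap_mem_laurent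
  have hpi : (algebraMap ℂ (RatField r) p1)⁻¹ ∈ laurent r := by rw [← map_inv₀]; exact hc _
  have hs : ∀ (c : ℂ) {f : RatField r}, f ∈ laurent r → c • f ∈ laurent r :=
    fun c f hf => Subalgebra.smul_mem _ hf c
  have hR : (kX i - (p1 : ℂ) ^ 2 • (kX j)⁻¹) * (kX i - ((p1 : ℂ)⁻¹) ^ 2 • (kX j)⁻¹)
      * (kX i - (kX j)⁻¹) * (kX i)⁻¹ ^ 3 ∈ laurent r :=
    mul_mem (mul_mem (mul_mem (sub_mem hi (hs _ hj')) (sub_mem hi (hs _ hj'))) (sub_mem hi hj'))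
      (pow_mem hi' 3)
  have e1 : kX i - (p1 : ℂ) ^ 2 • kX j ∈ laurent r := sub_mem hi (hs _ hj)
  have e2 : kX i - ((p1 : ℂ)⁻¹) ^ 2 • kX j ∈ laurent r := sub_mem hi (hs _ hj)
  have e3 : kX i - kX j ∈ laurent r := sub_mem hi hj
  have key : symFactor p1 (kX i) (kX j) = (kX i - (p1 : ℂ) ^ 2 • kX j)
      * (kX i - ((p1 : ℂ)⁻¹) ^ 2 • kX j) * (kX i - kX j) *
      ((kX i - (p1 : ℂ) ^ 2 • (kX j)⁻¹) * (kX i - ((p1 : ℂ)⁻¹) ^ 2 • (kX j)⁻¹)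
      * (kX i - (kX j)⁻¹) * (kX i)⁻¹ ^ 3) := by
    unfold symFactor dFactor; ring
  rw [key]
  generalize (kX i - (p1 : ℂ) ^ 2 • (kX j)⁻¹) * (kX i - ((p1 : ℂ)⁻¹) ^ 2 • (kX j)⁻¹)
      * (kX i - (kX j)⁻¹) * (kX i)⁻¹ ^ 3 = R at hR
  refine ⟨⟨⟨-(algebraMap ℂ (RatField r) p1 * kX j) * ((kX i - ((p1 : ℂ)⁻¹) ^ 2 • kX j)
      * (kX i - kX j) * R), mul_mem (neg_mem (mul_mem (hc _) hj)) (mul_mem (mul_mem e2 e3) hR), ?_⟩,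
    ⟨-kX j * ((kX i - (p1 : ℂ) ^ 2 • kX j) * (kX i - ((p1 : ℂ)⁻¹) ^ 2 • kX j) * R),
      mul_mem (neg_mem hj) (mul_mem (mul_mem e1 e2) hR), ?_⟩⟩,
    ⟨(algebraMap ℂ (RatField r) p1)⁻¹ * kX i * ((kX i - (p1 : ℂ) ^ 2 • kX j)
      * (kX i - kX j) * R), mul_mem (mul_mem hpi hi) (mul_mem (mul_mem e1 e3) hR), ?_⟩,
    ⟨kX i * ((kX i - (p1 : ℂ) ^ 2 • kX j) * (kX i - ((p1 : ℂ)⁻¹) ^ 2 • kX j) * R),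
      mul_mem hi (mul_mem (mul_mem e1 e2) hR), ?_⟩⟩ <;>
  · simp only [Algebra.smul_def, map_pow, map_inv₀]
    field_simp
    try ring

theorem symDenom_mem_laurent : symDenom p1 hr ∈ laurent r :=
  prod_mem fun _ _ => prod_mem fun _ _ => symFactor_mem_laurent _ _

theorem symDenom_ne_zero : symDenom p1 hr ≠ 0 :=
  Finset.prod_ne_zero_iff.2 fun _ _ => Finset.prod_ne_zero_iff.2 fun _ _ =>
    symFactor_ne_zero (posL_ne_posR hr _ _)

theorem laurentDvd_symDenom (i : Fin n) (j : Fin m) :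
    LaurentDvd (symFactor p1 (kX (posL hr i)) (kX (posR hr j))) (symDenom p1 hr) :=
  LaurentDvd.trans
    (laurentDvd_prod (f := fun j => symFactor p1 (kX (posL hr i)) (kX (posR hr j)))
      (Finset.mem_univ j) fun _ => symFactor_mem_laurent _ _)
    (laurentDvd_prod (f := fun i => ∏ j, symFactor p1 (kX (posL hr i)) (kX (posR hr j)))
      (Finset.mem_univ i) fun _ => prod_mem fun _ _ => symFactor_mem_laurent _ _)

/-- The ratios of variables from different blocks occur in the denominator. -/
theorem laurentDvd_symDenom_of_blocks {a b : Fin r} (h : ¬ (a.val < n ↔ b.val < n)) :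
    LaurentDvd (algebraMap ℂ (RatField r) p1 - (algebraMap ℂ (RatField r) p1)⁻¹
        * (kX a * (kX b)⁻¹)) (symDenom p1 hr) ∧
      LaurentDvd (1 - kX a * (kX b)⁻¹) (symDenom p1 hr) := by
  rcases exists_pos hr a with ⟨i, rfl⟩ | ⟨i, rfl⟩ <;> rcases exists_pos hr b with ⟨j, rfl⟩ | ⟨j, rfl⟩
  · exact absurd (iff_of_true i.2 j.2) h
  · have := (laurentDvd_symFactor (p1 := p1) (posL hr i) (posR hr j)).1
    exact ⟨this.1.trans (laurentDvd_symDenom hr i j), this.2.trans (laurentDvd_symDenom hr i j)⟩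
  · have := (laurentDvd_symFactor (p1 := p1) (posL hr j) (posR hr i)).2
    exact ⟨this.1.trans (laurentDvd_symDenom hr j i), this.2.trans (laurentDvd_symDenom hr j i)⟩
  · exact absurd (by simp [posR]) h

theorem symDenom_of_realizes_left {σ : RatField r ≃ₐ[ℂ] RatField r} {π : Equiv.Perm (Fin n)}
    {ε : Fin n → ℤˣ} (h : Realizes (posL hr) σ π ε) : σ (symDenom p1 hr) = symDenom p1 hr := by
  have hf : ∀ j, σ (kX (posR hr j)) = kX (posR hr j) := fun j =>
    h.2 _ (by rintro ⟨i, hi⟩; exact posL_ne_posR hr i j hi)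
  simp only [symDenom, map_prod, map_symFactor, h.1, hf]
  refine Eq.trans ?_ (Equiv.prod_comp π
    (fun i => ∏ j, symFactor p1 (kX (posL hr i)) (kX (posR hr j))))
  refine Finset.prod_congr rfl fun i _ => Finset.prod_congr rfl fun j _ => ?_
  have := symFactor_zpow (p1 := p1) (i := posL hr (π i)) (j := posR hr j) (ε i) 1
  rwa [Units.val_one, zpow_one] at this

theorem symDenom_of_realizes_right {σ : RatField r ≃ₐ[ℂ] RatField r} {π : Equiv.Perm (Fin m)}
    {ε : Fin m → ℤˣ} (h : Realizes (posR hr) σ π ε) : σ (symDenom p1 hr) = symDenom p1 hr := by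
  have hf : ∀ j, σ (kX (posL hr j)) = kX (posL hr j) := fun j =>
    h.2 _ (by rintro ⟨i, hi⟩; exact posL_ne_posR hr j i hi.symm)
  simp only [symDenom, map_prod, map_symFactor, h.1, hf]
  refine Finset.prod_congr rfl fun i _ => ?_
  refine Eq.trans ?_ (Equiv.prod_comp π (fun j => symFactor p1 (kX (posL hr i)) (kX (posR hr j))))
  refine Finset.prod_congr rfl fun j _ => ?_
  have := symFactor_zpow (p1 := p1) (i := posL hr i) (j := posR hr (π j)) 1 (ε j)
  rwa [Units.val_one, zpow_one] at this

variable (p1) in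
theorem blockRep_commute (a : HB n p0 p1 ⊗[ℂ] HB m p0 p1) :
    Commute (blockRep p0 p1 hr a) (Algebra.lmul ℂ (RatField r) (symDenom p1 hr)) := by
  have : blockRep p0 p1 hr a ∈ Subalgebra.centralizer ℂ
      {Algebra.lmul ℂ (RatField r) (symDenom p1 hr)} := by
    refine blockRep_mem p0 p1 hr _ ?_ ?_ ?_ ?_ a <;> intro i <;> rw [Subalgebra.mem_centralizer_iff] <;>
      rintro _ rfl
    · rw [varRep_T]
      obtain ⟨π, ε, h⟩ := exists_realizes_simpleAut (posL_injective hr) i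
      exact (dlOp_mul_lmul_of_fix (symDenom_of_realizes_left hr h)).symm.eq
    · rw [varRep_T]
      obtain ⟨π, ε, h⟩ := exists_realizes_simpleAut (posR_injective hr) i
      exact (dlOp_mul_lmul_of_fix (symDenom_of_realizes_right hr h)).symm.eq
    · rw [← map_mul, mul_comm, map_mul]
    · rw [← map_mul, mul_comm, map_mul]
  rw [Subalgebra.mem_centralizer_iff] at this
  exact (this _ rfl).symm

theorem par_of_val_eq {a b : ℕ} {i : Fin a} {j : Fin b} (h : i.val = j.val) :
    par p0 p1 i = par p0 p1 j := by simp [par, h]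

theorem varRep_posL_T (i : Fin n) : varRep (posL_injective hr) p0 p1 (HB.T p0 p1 i) =
    stdRep r p0 p1 (HB.T p0 p1 (posL hr i)) := by
  rw [varRep_T, stdRep_T, par_of_val_eq p0 (show i.val = (posL hr i).val from rfl)]
  rfl

theorem varRep_posR_T {i : Fin m} (hi : i.val ≠ 0) :
    varRep (posR_injective hr) p0 p1 (HB.T p0 p1 i) = stdRep r p0 p1 (HB.T p0 p1 (posR hr i)) := by
  obtain ⟨j, hj⟩ := exists_pred hi
  have hj' : (posR hr j).val + 1 = (posR hr i).val := by simp only [posR]; omega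
  have hp : par p0 p1 i = par p0 p1 (posR hr i) := by
    have : (posR hr i).val ≠ 0 := by omega
    simp [par, hi, this]
  rw [varRep_T, stdRep_T, hp, kRoot_succ hj', ReflectionDatum.root_succ _ hj, simpleAut_succ _ hj,
    simpleAut_succ _ hj']
  rfl

end PairDatum

/-! ### The algebra of two blocks inside the localization -/

section Moves

variable {r : ℕ} {p0 p1 : ℂˣ}

/-- A signed permutation in the localization stays there when multiplied by a simple reflection
`s_i` such that the denominator is divisible by `p_i - p_i⁻¹ e`, `e = w⁻¹(e_i)`. -/
theorem simpleAut_mul_signedAut_mem {zH : HB r p0 p1} {z : RatField r}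
    (hz : stdRep r p0 p1 zH = Algebra.lmul ℂ (RatField r) z) {π : Equiv.Perm (Fin r)}
    {ε : Fin r → ℤˣ} (hw : (signedAut π ε).toLinearMap ∈ rightLoc (stdRep r p0 p1) zH) (i : Fin r)
    {e : RatField r} (he : signedAut π ε e = kRoot i)
    (hd : LaurentDvd (algebraMap ℂ (RatField r) (par p0 p1 i : ℂ)
      - (algebraMap ℂ (RatField r) (par p0 p1 i : ℂ))⁻¹ * e) z) :
    (simpleAut id i * signedAut π ε).toLinearMap ∈ rightLoc (stdRep r p0 p1) zH := by
  refine simpleAut_mul_mem_rightLoc hz hw i (aut_mul_lmul _ _) ?_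
  obtain ⟨v, hv, rfl⟩ := hd
  refine ⟨signedAut π ε v, signedAut_mem_laurent hv π ε, ?_⟩
  rw [map_mul, map_sub, map_mul, map_inv₀, he, AlgEquiv.commutes]

theorem signedAut_ratio (π : Equiv.Perm (Fin r)) {i j : Fin r} (h : j.val + 1 = i.val) :
    signedAut π 1 (kX (π.symm j) * (kX (π.symm i))⁻¹) = kRoot i := by
  rw [kRoot_succ h, map_mul, map_inv₀, signedAut_kX, signedAut_kX]
  simp

theorem par_of_pos {i : Fin r} (hi : i.val ≠ 0) : par p0 p1 i = p1 := by simp [par, hi]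

end Moves

section Cycle

variable {n r : ℕ}

/-- The cycle `s_{n-d+1} ⋯ s_n`. -/
def cyclePerm {r : ℕ} (n : ℕ) (hn : n < r) : ℕ → Equiv.Perm (Fin r)
  | 0 => 1
  | d + 1 => Equiv.swap ⟨n - d - 1, by omega⟩ ⟨n - d, by omega⟩ * cyclePerm n hn d

theorem cyclePerm_self (hn : n < r) {d : ℕ} (hd : d ≤ n) :
    cyclePerm n hn d ⟨n, hn⟩ = ⟨n - d, by omega⟩ := by
  induction d with
  | zero => rfl
  | succ d ih => rw [cyclePerm, Equiv.Perm.mul_apply, ih (by omega), Equiv.swap_apply_right]; rfl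

theorem cyclePerm_of_lt (hn : n < r) {d : ℕ} (hd : d ≤ n) {k : Fin r} (hk : k.val < n - d) :
    cyclePerm n hn d k = k := by
  induction d with
  | zero => rfl
  | succ d ih =>
    rw [cyclePerm, Equiv.Perm.mul_apply, ih (by omega) (by omega), Equiv.swap_apply_of_ne_of_ne] <;>
      intro h <;> have := congrArg Fin.val h <;> simp only at this <;> omega

theorem cyclePerm_edge (hn : n < r) {d : ℕ} (hd : d + 1 ≤ n) :
    cyclePerm n hn (d + 1) ⟨n - d - 1, by omega⟩ = ⟨n - d, by omega⟩ := by
  rw [cyclePerm, Equiv.Perm.mul_apply, cyclePerm_of_lt hn (by omega) (by simp; omega),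
    Equiv.swap_apply_left]

end Cycle

section Conjugate

variable {n m r : ℕ} (p0 p1 : ℂˣ) (hr : n + m = r)

/-- The partial products `s_{n-d+1} ⋯ s_n` of simple reflections belong to the localization. -/
theorem cyclePerm_mem {zH : HB r p0 p1}
    (hz : stdRep r p0 p1 zH = Algebra.lmul ℂ (RatField r) (symDenom p1 hr)) (hn : n < r) {d : ℕ}
    (hd : d ≤ n) : (signedAut (cyclePerm n hn d) 1).toLinearMap ∈ rightLoc (stdRep r p0 p1) zH := by
  induction d with
  | zero =>
    rw [cyclePerm, signedAut_one]
    simpa using map_mem_rightLoc (j := stdRep r p0 p1) (z := zH) 1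
  | succ d ih =>
    have hij : (⟨n - d - 1, by omega⟩ : Fin r).val + 1 = (⟨n - d, by omega⟩ : Fin r).val := by
      simp only; omega
    have := simpleAut_mul_signedAut_mem hz (ih (by omega)) ⟨n - d, by omega⟩
      (e := kX ⟨n - d - 1, by omega⟩ * (kX ⟨n, hn⟩)⁻¹) (by
        rw [kRoot_succ hij, map_mul, map_inv₀, signedAut_kX, signedAut_kX,
          cyclePerm_self hn (by omega), cyclePerm_of_lt hn (by omega) (by simp only; omega)]
        simp) (by
        rw [par_of_pos (by simp only; omega)]
        exact (laurentDvd_symDenom_of_blocks hr (by simp only; omega)).1)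
    rwa [simpleAut_succ id hij, id, id, swapAut_mul] at this

/-- The Demazure–Lusztig operator of `T_0`, transported to the variable `X_{k+1}`. -/
noncomputable def flipOp (p0 : ℂˣ) (k : Fin r) : Module.End ℂ (RatField r) :=
  dlOp (p0 : ℂ) ((kX k)⁻¹ ^ 2) (flipAut k)

theorem stdRep_T_zero {i : Fin r} (hi : i.val = 0) : stdRep r p0 p1 (HB.T p0 p1 i) = flipOp p0 i := by
  rw [stdRep_T, kRoot_zero hi, simpleAut_zero _ hi]
  simp [par, hi, flipOp]

theorem varRep_posR_T_zero {i : Fin m} (hi : i.val = 0) :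
    varRep (posR_injective hr) p0 p1 (HB.T p0 p1 i) = flipOp p0 (posR hr i) := by
  rw [varRep_T, ReflectionDatum.root_zero _ hi, simpleAut_zero _ hi]
  simp only [par, hi, if_true]
  rfl

theorem simpleAut_mul_flipOp {i j : Fin r} (h : j.val + 1 = i.val) :
    (simpleAut id i).toLinearMap * flipOp p0 j = flipOp p0 i * (simpleAut id i).toLinearMap := by
  rw [simpleAut_succ id h, id, id, flipOp, flipOp]
  refine (dlOp_mul_aut_of_conj ?_ ?_).symm
  · simp [swapAut_kX]
  · have := flipAut_mul_signedAut (Equiv.swap j i) 1 j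
    rwa [Equiv.swap_apply_left] at this

theorem simpleAut_mul_self (i : Fin r) : simpleAut (id : Fin r → Fin r) i * simpleAut id i = 1 := by
  apply AlgEquiv.ext
  intro f
  exact (varDatum (id : Fin r → Fin r) Function.injective_id).s_s i f

/-- The transported operator belongs to the localization of `H_r^B`: start from
`T_0 s_1 ⋯ s_n` and multiply by `s_1, …, s_n` on the left. -/
theorem flipOp_mem {zH : HB r p0 p1}
    (hz : stdRep r p0 p1 zH = Algebra.lmul ℂ (RatField r) (symDenom p1 hr)) (hm : 0 < m) :
    flipOp p0 (posR hr ⟨0, hm⟩) ∈ rightLoc (stdRep r p0 p1) zH := by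
  have hn : n < r := by omega
  suffices h : ∀ k (hk : k ≤ n), flipOp p0 (⟨k, by omega⟩ : Fin r) *
      (signedAut (cyclePerm n hn (n - k)) 1).toLinearMap ∈ rightLoc (stdRep r p0 p1) zH by
    have := h n le_rfl
    rw [Nat.sub_self, cyclePerm, signedAut_one] at this
    exact this
  intro k
  induction k with
  | zero =>
    intro hk
    rw [← stdRep_T_zero p0 p1 (i := ⟨0, by omega⟩) rfl]
    exact map_mul_mem_rightLoc _ (cyclePerm_mem p0 p1 hr hz hn (by omega))
  | succ k ih =>
    intro hk
    set π := cyclePerm n hn (n - k) with hπ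
    have hπn : π ⟨n, hn⟩ = ⟨k, by omega⟩ := by
      rw [hπ, cyclePerm_self hn (by omega)]; exact Fin.ext (by simp only; omega)
    have hd : n - k = n - (k + 1) + 1 := by omega
    have hπk : π ⟨k, by omega⟩ = ⟨k + 1, by omega⟩ := by
      have h : ∀ d', d' = n - (k + 1) + 1 →
          cyclePerm n hn d' ⟨k, by omega⟩ = ⟨k + 1, by omega⟩ := by
        rintro _ rfl
        have := cyclePerm_edge hn (d := n - (k + 1)) (by omega)
        convert this using 2
        · exact Fin.ext (by simp only; omega)
        · omega
      exact h _ hd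
    have hij : (⟨k, by omega⟩ : Fin r).val + 1 = (⟨k + 1, by omega⟩ : Fin r).val := rfl
    -- The denominator is invariant under `X_{n+1} ↦ X_{n+1}⁻¹`; therefore its conjugate commutes
    -- with the transported operator.
    have hflip : flipAut ⟨n, hn⟩ (symDenom p1 hr) = symDenom p1 hr :=
      symDenom_of_realizes_right hr (realizes_flipAut (posR_injective hr) ⟨0, hm⟩)
    have hcomm : flipAut ⟨k, by omega⟩ (signedAut π 1 (symDenom p1 hr))
        = signedAut π 1 (symDenom p1 hr) := by
      have := DFunLike.congr_fun (flipAut_mul_signedAut π 1 ⟨n, hn⟩) (symDenom p1 hr)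
      rwa [AlgEquiv.mul_apply, AlgEquiv.mul_apply, hflip, hπn] at this
    have := simpleAut_mul_mem_rightLoc (p0 := p0) (p1 := p1) (g := signedAut π 1 (symDenom p1 hr)) hz
      (ih (by omega)) ⟨k + 1, by omega⟩ (by
        rw [mul_assoc, aut_mul_lmul, ← mul_assoc, ← mul_assoc, flipOp,
          (dlOp_mul_lmul_of_fix hcomm).eq]) (by
        obtain ⟨v, hv, h⟩ := (laurentDvd_symDenom_of_blocks (p1 := p1) hr (a := ⟨n, hn⟩)
          (b := ⟨k, by omega⟩) (by simp only; omega)).1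
        refine ⟨signedAut π 1 v, signedAut_mem_laurent hv π 1, ?_⟩
        rw [h, kRoot_succ hij, par_of_pos (by simp)]
        simp only [map_mul, map_sub, map_inv₀, AlgEquiv.commutes, signedAut_kX, hπn, hπk]
        simp)
    rw [← mul_assoc, simpleAut_mul_flipOp p0 hij, mul_assoc] at this
    convert this using 2
    rw [← toLinearMap_mul, hπ]
    congr 1
    -- The reflection that conjugates the operator cancels the first factor of the cycle.
    have h2 : cyclePerm n hn (n - k) = Equiv.swap ⟨k, by omega⟩ ⟨k + 1, by omega⟩ *
        cyclePerm n hn (n - (k + 1)) := by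
      conv_lhs => rw [hd, cyclePerm]
      congr 2 <;> exact Fin.ext (by simp only; omega)
    rw [h2, ← swapAut_mul, simpleAut_succ id hij, id, id, ← mul_assoc]
    have h3 := simpleAut_mul_self (⟨k + 1, by omega⟩ : Fin r)
    rw [simpleAut_succ id hij, id, id] at h3
    rw [h3, one_mul]

theorem blockRep_mem_rightLoc {zH : HB r p0 p1}
    (hz : stdRep r p0 p1 zH = Algebra.lmul ℂ (RatField r) (symDenom p1 hr))
    (a : HB n p0 p1 ⊗[ℂ] HB m p0 p1) : blockRep p0 p1 hr a ∈ rightLoc (stdRep r p0 p1) zH := by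
  suffices h : blockRep p0 p1 hr a ∈ rightLocComm (stdRep r p0 p1) zH from h.1
  have hc := blockRep_commute (p0 := p0) p1 hr
  refine blockRep_mem p0 p1 hr _ ?_ ?_ ?_ ?_ a <;> intro i
  · refine ⟨?_, ?_⟩
    · rw [varRep_posL_T]; exact map_mem_rightLoc _
    · have := hc (HB.T p0 p1 i ⊗ₜ 1)
      rwa [pairRep_tmul, map_one, mul_one, ← hz] at this
  · refine ⟨?_, ?_⟩
    · by_cases hi : i.val = 0
      · rw [varRep_posR_T_zero p0 p1 hr hi]
        have : i = ⟨0, i.pos⟩ := Fin.ext hi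
        rw [this]
        exact flipOp_mem p0 p1 hr hz i.pos
      · rw [varRep_posR_T p0 hr hi]; exact map_mem_rightLoc _
    · have := hc (1 ⊗ₜ HB.T p0 p1 i)
      rwa [pairRep_tmul, map_one, one_mul, ← hz] at this
  · refine ⟨?_, ?_⟩
    · obtain ⟨h, hh⟩ := stdRep_of_mem_laurent p0 p1 (kX_mem_laurent i)
      rw [← hh]; exact map_mem_rightLoc _
    · rw [hz]; exact (Commute.all _ _).map _
  · refine ⟨?_, ?_⟩
    · obtain ⟨h, hh⟩ := stdRep_of_mem_laurent p0 p1 (kX_inv_mem_laurent i)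
      rw [← hh]; exact map_mem_rightLoc _
    · rw [hz]; exact (Commute.all _ _).map _

end Conjugate

/-! ### Shuffles and the coset datum of a pair of blocks -/

section Shuffle

variable {n m r : ℕ}

/-- The permutations of `Fin r` obtained from the identity by exchanging successive values whose
positions lie on different sides of `n`. -/
inductive IsShuffle (n : ℕ) {r : ℕ} : Equiv.Perm (Fin r) → Prop
  | one : IsShuffle n 1
  | step (π : Equiv.Perm (Fin r)) (i j : Fin r) (hij : j.val + 1 = i.val) (hπ : IsShuffle n π)
      (h : ¬ ((π.symm j).val < n ↔ (π.symm i).val < n)) : IsShuffle n (Equiv.swap j i * π)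

theorem IsShuffle.lt {π : Equiv.Perm (Fin r)} (h : IsShuffle n π) {a b : Fin r} (hab : a < b)
    (hblk : a.val < n ↔ b.val < n) : π a < π b := by
  induction h with
  | one => exact hab
  | step π i j hij _ hne ih =>
    rw [Equiv.Perm.mul_apply, Equiv.Perm.mul_apply]
    have hnot : ¬ (π a = j ∧ π b = i) := by
      rintro ⟨rfl, rfl⟩
      exact hne (by simpa using hblk)
    have hne' : π a ≠ π b := π.injective.ne hab.ne
    rw [Fin.lt_def] at ih ⊢
    rw [Equiv.swap_apply_def, Equiv.swap_apply_def]
    simp only [Fin.ext_iff] at hnot hne' ⊢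
    split_ifs <;> omega

theorem IsShuffle.eq_one {π : Equiv.Perm (Fin r)} (h : IsShuffle n π)
    (hblk : ∀ a, a.val < n ↔ (π a).val < n) : π = 1 := by
  have hmono : StrictMono π := by
    intro a b hab
    by_cases hb : a.val < n ↔ b.val < n
    · exact h.lt hab hb
    · have h1 := hblk a
      have h2 := hblk b
      rw [Fin.lt_def] at hab ⊢
      omega
  have := Subsingleton.elim (hmono.orderIsoOfSurjective π π.surjective) (OrderIso.refl (Fin r))
  ext k
  exact congrArg Fin.val (DFunLike.congr_fun this k)

/-- Successive values at positions in the same block have successive positions. -/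
theorem IsShuffle.succ {π : Equiv.Perm (Fin r)} (h : IsShuffle n π) {i j : Fin r}
    (hij : j.val + 1 = i.val) (hblk : (π.symm j).val < n ↔ (π.symm i).val < n) :
    (π.symm j).val + 1 = (π.symm i).val := by
  have hlt : π.symm j < π.symm i := by
    by_contra hcon
    have hne : π.symm i ≠ π.symm j := π.symm.injective.ne (by rintro rfl; omega)
    have := h.lt (lt_of_le_of_ne (not_lt.1 hcon) hne) hblk.symm
    rw [Equiv.apply_symm_apply, Equiv.apply_symm_apply, Fin.lt_def] at this
    omega
  by_contra hne
  have hlt' := Fin.lt_def.1 hlt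
  let c : Fin r := ⟨(π.symm j).val + 1, by omega⟩
  have h1 := h.lt (a := π.symm j) (b := c) (Fin.lt_def.2 (by simp [c])) (by simp only [c]; omega)
  have h2 := h.lt (a := c) (b := π.symm i) (Fin.lt_def.2 (by simp only [c]; omega))
    (by simp only [c]; omega)
  rw [Equiv.apply_symm_apply, Fin.lt_def] at h1 h2
  omega

/-- The value `0` occurs at the first position of a block. -/
theorem IsShuffle.zero {π : Equiv.Perm (Fin r)} (h : IsShuffle n π) {i : Fin r} (hi : i.val = 0) :
    (π.symm i).val = 0 ∨ (π.symm i).val = n := by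
  by_contra hcon
  let c : Fin r := ⟨(π.symm i).val - 1, by omega⟩
  have h1 := h.lt (a := c) (b := π.symm i) (Fin.lt_def.2 (by simp only [c]; omega))
    (by simp only [c]; omega)
  rw [Equiv.apply_symm_apply, Fin.lt_def] at h1
  omega

end Shuffle

section Datum

variable {n m r : ℕ} (p0 p1 : ℂˣ) (hr : n + m = r)

/-- In the case of equal blocks, `T_i` moves past the shuffle as a generator of
`H_n^B ⊗ H_m^B`. -/
theorem exists_T_mul_shuffle {π : Equiv.Perm (Fin r)} (h : IsShuffle n π) (i : Fin r)
    (hcase : i.val = 0 ∨ ∃ j : Fin r, j.val + 1 = i.val ∧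
      ((π.symm j).val < n ↔ (π.symm i).val < n)) :
    ∃ a, stdRep r p0 p1 (HB.T p0 p1 i) * (signedAut π 1).toLinearMap
      = (signedAut π 1).toLinearMap * blockRep p0 p1 hr a := by
  have hL : ∀ k : Fin n, blockRep p0 p1 hr (HB.T p0 p1 k ⊗ₜ 1)
      = varRep (posL_injective hr) p0 p1 (HB.T p0 p1 k) := fun k => by
    rw [pairRep_tmul, map_one, mul_one]
  have hR : ∀ k : Fin m, blockRep p0 p1 hr (1 ⊗ₜ HB.T p0 p1 k)
      = varRep (posR_injective hr) p0 p1 (HB.T p0 p1 k) := fun k => by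
    rw [pairRep_tmul, map_one, one_mul]
  rcases hcase with hi | ⟨j, hij, hblk⟩
  · have hconj : stdRep r p0 p1 (HB.T p0 p1 i) * (signedAut π 1).toLinearMap
        = (signedAut π 1).toLinearMap * flipOp p0 (π.symm i) := by
      rw [stdRep_T_zero p0 p1 hi]
      refine dlOp_mul_aut_of_conj ?_ ?_
      · simp [signedAut_kX]
      · have := flipAut_mul_signedAut π 1 (π.symm i)
        rwa [Equiv.apply_symm_apply] at this
    rw [hconj]
    rcases exists_pos hr (π.symm i) with ⟨k, hk⟩ | ⟨k, hk⟩
    · refine ⟨HB.T p0 p1 k ⊗ₜ 1, ?_⟩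
      have h0 : k.val = 0 := by
        have := h.zero hi
        rw [hk] at this
        have h2 := k.2
        simp only [posL] at this
        omega
      rw [hk, hL, varRep_posL_T, stdRep_T_zero p0 p1 (by simpa [posL] using h0)]
    · refine ⟨1 ⊗ₜ HB.T p0 p1 k, ?_⟩
      have h0 : k.val = 0 := by
        have := h.zero hi
        rw [hk] at this
        simp only [posR] at this
        omega
      rw [hk, hR, varRep_posR_T_zero p0 p1 hr h0]
  · have hsucc := h.succ hij hblk
    have hconj : stdRep r p0 p1 (HB.T p0 p1 i) * (signedAut π 1).toLinearMap
        = (signedAut π 1).toLinearMap * stdRep r p0 p1 (HB.T p0 p1 (π.symm i)) := by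
      rw [stdRep_T, stdRep_T, par_of_pos (by omega), par_of_pos (by omega)]
      refine dlOp_mul_aut_of_conj ?_ ?_
      · rw [kRoot_succ hsucc, signedAut_ratio π hij]
      · rw [simpleAut_succ id hij, simpleAut_succ id hsucc]
        have := swapAut_mul_signedAut π 1 (a := π.symm j) (b := π.symm i) rfl
        rwa [Equiv.apply_symm_apply, Equiv.apply_symm_apply] at this
    rw [hconj]
    rcases exists_pos hr (π.symm i) with ⟨k, hk⟩ | ⟨k, hk⟩
    · exact ⟨HB.T p0 p1 k ⊗ₜ 1, by rw [hk, hL, varRep_posL_T]⟩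
    · refine ⟨1 ⊗ₜ HB.T p0 p1 k, ?_⟩
      have h0 : k.val ≠ 0 := by
        rw [hk] at hblk hsucc
        simp only [posR] at hblk hsucc
        omega
      rw [hk, hR, varRep_posR_T p0 hr h0]

/-- The automorphisms that permute the variables up to inversion and preserve the two blocks. -/
noncomputable def blockGroup (n r : ℕ) : Subgroup (RatField r ≃ₐ[ℂ] RatField r) :=
  relGroup (fun k l (_ : ℤˣ) => k.val < n ↔ l.val < n) (fun _ => Iff.rfl)
    (fun _ _ _ _ _ h1 h2 => Iff.trans h1 h2)

theorem simpleAut_mem_blockGroup {l : ℕ} {ι : Fin l → Fin r} (hι : Function.Injective ι)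
    (hblk : ∀ a b, (ι a).val < n ↔ (ι b).val < n) (i : Fin l) : simpleAut ι i ∈ blockGroup n r := by
  obtain ⟨π, ε, h⟩ := exists_realizes_simpleAut hι i
  have h1 : ∀ k : Fin r, ∃ (l : Fin r) (ε : ℤˣ), (k.val < n ↔ l.val < n) ∧
      simpleAut ι i (kX k) = kX l ^ ((ε : ℤˣ) : ℤ) := by
    intro k
    by_cases hk : k ∈ Set.range ι
    · obtain ⟨a, rfl⟩ := hk
      exact ⟨_, _, hblk _ _, h.1 a⟩
    · exact ⟨k, 1, Iff.rfl, by rw [h.2 k hk]; simp⟩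
  refine ⟨h1, ?_⟩
  have : (simpleAut ι i)⁻¹ = simpleAut ι i := inv_eq_of_mul_eq_one_left
    (AlgEquiv.ext fun f => (varDatum ι hι).s_s i f)
  rw [this]
  exact h1

theorem blockRep_mem_autSpan (a : HB n p0 p1 ⊗[ℂ] HB m p0 p1) :
    blockRep p0 p1 hr a ∈ autSpan (blockGroup n r) := by
  refine blockRep_mem p0 p1 hr _ (fun i => ?_) (fun i => ?_) (fun k => lmul_mem_autSpan _)
    (fun k => lmul_mem_autSpan _) a
  · rw [varRep_T]
    exact dlOp_mem_autSpan _ _ (simpleAut_mem_blockGroup (posL_injective hr)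
      (fun a b => by simp [posL]) i)
  · rw [varRep_T]
    exact dlOp_mem_autSpan _ _ (simpleAut_mem_blockGroup (posR_injective hr)
      (fun a b => by simp [posR]) i)

theorem IsShuffle.eq_one_of_mem {π : Equiv.Perm (Fin r)} (hπ : IsShuffle n π)
    (hs : signedAut π 1 ∈ blockGroup n r) : π = 1 := by
  refine hπ.eq_one fun a => ?_
  obtain ⟨l, ε, hl, h⟩ := hs.1 a
  rw [signedAut_kX] at h
  rw [(kX_zpow_inj h).1]
  exact hl

/-- The element of `H_r^B` acting as multiplication by the common denominator. -/
noncomputable def denomH : HB r p0 p1 :=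
  (stdRep_of_mem_laurent p0 p1 (symDenom_mem_laurent (p1 := p1) hr)).choose

/-- The element of `H_n^B ⊗ H_m^B` acting as multiplication by the common denominator. -/
noncomputable def denomA : HB n p0 p1 ⊗[ℂ] HB m p0 p1 :=
  (blockRep_of_mem_laurent p0 p1 hr (symDenom_mem_laurent (p1 := p1) hr)).choose

theorem stdRep_denomH :
    stdRep r p0 p1 (denomH p0 p1 hr) = Algebra.lmul ℂ (RatField r) (symDenom p1 hr) :=
  (stdRep_of_mem_laurent p0 p1 (symDenom_mem_laurent (p1 := p1) hr)).choose_spec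

theorem blockRep_denomA :
    blockRep p0 p1 hr (denomA p0 p1 hr) = Algebra.lmul ℂ (RatField r) (symDenom p1 hr) :=
  (blockRep_of_mem_laurent p0 p1 hr (symDenom_mem_laurent (p1 := p1) hr)).choose_spec

theorem shuffle_mem {π : Equiv.Perm (Fin r)} (hπ : IsShuffle n π) :
    (signedAut π 1).toLinearMap ∈ rightLoc (stdRep r p0 p1) (denomH p0 p1 hr) := by
  induction hπ with
  | one =>
    rw [signedAut_one]
    simpa using map_mem_rightLoc (j := stdRep r p0 p1) 1
  | step π i j hij hπ h ih =>
    have := simpleAut_mul_signedAut_mem (stdRep_denomH p0 p1 hr) ih i (signedAut_ratio π hij) (by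
      rw [par_of_pos (by omega)]
      exact (laurentDvd_symDenom_of_blocks hr h).1)
    rwa [simpleAut_succ id hij, id, id, swapAut_mul] at this

theorem exists_T_mul_shuffle_add (i : Fin r) (s : {π : Equiv.Perm (Fin r) // IsShuffle n π}) :
    ∃ (s' : {π : Equiv.Perm (Fin r) // IsShuffle n π}),
      ∃ q ∈ rightLoc (blockRep p0 p1 hr) (denomA p0 p1 hr),
      ∃ q' ∈ rightLoc (blockRep p0 p1 hr) (denomA p0 p1 hr),
      stdRep r p0 p1 (HB.T p0 p1 i) * (signedAut s.1 1).toLinearMap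
        = (signedAut s.1 1).toLinearMap * q + (signedAut s'.1 1).toLinearMap * q' := by
  by_cases hcase : i.val = 0 ∨ ∃ j : Fin r, j.val + 1 = i.val ∧
      ((s.1.symm j).val < n ↔ (s.1.symm i).val < n)
  · obtain ⟨a, ha⟩ := exists_T_mul_shuffle p0 p1 hr s.2 i hcase
    exact ⟨s, _, map_mem_rightLoc a, 0, zero_mem _, by rw [ha, mul_zero, add_zero]⟩
  · obtain ⟨j, hij⟩ := exists_pred (i := i) (fun h => hcase (.inl h))
    have hblk : ¬ ((s.1.symm j).val < n ↔ (s.1.symm i).val < n) :=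
      fun h => hcase (.inr ⟨j, hij, h⟩)
    obtain ⟨q, hq, q', hq', h⟩ := T_mul_aut_of_dvd (p0 := p0) (p1 := p1)
      (blockRep_denomA p0 p1 hr)
      (fun f hf => blockRep_of_mem_laurent p0 p1 hr hf) i (signedAut s.1 1)
      (signedAut_ratio s.1 hij) (mul_mem (kX_mem_laurent _) (kX_inv_mem_laurent _))
      (laurentDvd_symDenom_of_blocks hr hblk).2
    refine ⟨⟨_, .step s.1 i j hij s.2 hblk⟩, q, hq, q', hq', ?_⟩
    rw [h, simpleAut_succ id hij, id, id, swapAut_mul]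

theorem shuffle_indep [Fintype {π : Equiv.Perm (Fin r) // IsShuffle n π}]
    (c : {π : Equiv.Perm (Fin r) // IsShuffle n π} → Module.End ℂ (RatField r))
    (hc : ∀ s, c s ∈ autSpan (blockGroup n r))
    (h : ∑ s, (signedAut s.1 1).toLinearMap * c s = 0) : c ⟨1, .one⟩ = 0 :=
  eq_zero_of_sum_cosets (G := blockGroup n r) (I := {π : Equiv.Perm (Fin r) // IsShuffle n π})
    (fun s => signedAut s.1 1) (o := ⟨1, .one⟩) signedAut_one
    (fun s hs => Subtype.ext (s.2.eq_one_of_mem hs)) c hc h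

theorem blockLoc_le_autSpan {q : Module.End ℂ (RatField r)}
    (hq : q ∈ rightLoc (blockRep p0 p1 hr) (denomA p0 p1 hr)) : q ∈ autSpan (blockGroup n r) :=
  rightLoc_le_autSpan (symDenom_ne_zero hr) (blockRep_denomA p0 p1 hr)
    (blockRep_mem_autSpan p0 p1 hr) hq

/-- The coset datum for `H_n^B ⊗ H_m^B` in `H_{n+m}^B`: the basis is given by the shuffles. -/
noncomputable def pairDatum : CosetDatum r p0 p1 (HB n p0 p1 ⊗[ℂ] HB m p0 p1) where
  j := blockRep p0 p1 hr
  zH := denomH p0 p1 hr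
  zA := denomA p0 p1 hr
  j_zA := (blockRep_denomA p0 p1 hr).trans (stdRep_denomH p0 p1 hr).symm
  isUnit_z := by
    rw [blockRep_denomA]
    exact (IsUnit.mk0 _ (symDenom_ne_zero hr)).map _
  comm a := by
    rw [blockRep_denomA]
    exact blockRep_commute (p0 := p0) p1 hr a
  j_mem := blockRep_mem_rightLoc p0 p1 hr (stdRep_denomH p0 p1 hr)
  I := {π : Equiv.Perm (Fin r) // IsShuffle n π}
  fintype := Fintype.ofFinite _
  aut s := signedAut s.1 1
  one := ⟨1, .one⟩
  aut_one := signedAut_one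
  aut_mem s := shuffle_mem p0 p1 hr s.2
  y s i := blockX p0 p1 hr (s.1.symm i)
  X_mul_aut s i := by
    rw [blockRep_blockX, aut_mul_lmul, signedAut_kX]
    simp
  Xinv_mul_aut s i := by
    obtain ⟨a, ha⟩ := exists_blockRep_Xinv p0 p1 hr (s.1.symm i)
    refine ⟨a, ?_⟩
    have h : signedAut s.1 1 (kX (s.1.symm i))⁻¹ = (kX i)⁻¹ := by
      rw [map_inv₀, signedAut_kX]
      simp
    rw [ha, aut_mul_lmul, h]
  T_mul_aut i s := exists_T_mul_shuffle_add p0 p1 hr i s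
  indep c h := @shuffle_indep _ _ (Fintype.ofFinite _) (fun s => (c s).1)
    (fun s => blockLoc_le_autSpan p0 p1 hr (c s).2) h

end Datum

/-! ### The localized algebra as an algebra of operators -/

namespace HLoc

variable {r : ℕ} (p0 p1 : ℂˣ)

/-- The operator representation of the localized algebra: `H_r^B` acts by the polynomial
representation and `ℂ(X_1, …, X_r)` by multiplication. -/
noncomputable def rep (r : ℕ) (p0 p1 : ℂˣ) : HLoc r p0 p1 →ₐ[ℂ] Module.End ℂ (RatField r) :=
  RingQuot.liftAlgHom ℂ ⟨FreeAlgebra.lift ℂ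
    (Sum.elim (stdRep r p0 p1) (Algebra.lmul ℂ (RatField r))), by
    intro a b h
    induction h with
    | addH a b => simp
    | mulH a b => simp
    | scalarH c => simp only [FreeAlgebra.lift_ι_apply, Sum.elim_inl, AlgHom.commutes]
    | addK a b => simp
    | mulK a b => simp only [FreeAlgebra.lift_ι_apply, Sum.elim_inr, map_mul]
    | scalarK c => simp only [FreeAlgebra.lift_ι_apply, Sum.elim_inr, AlgHom.commutes]
    | glue i => simp [varRep_X]⟩

theorem rep_ofHB (h : HB r p0 p1) : rep r p0 p1 (ofHB p0 p1 h) = stdRep r p0 p1 h := by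
  change RingQuot.liftAlgHom ℂ _ (RingQuot.mkAlgHom ℂ _ _) = _
  rw [RingQuot.liftAlgHom_mkAlgHom_apply]
  simp

theorem rep_ofK (f : RatField r) : rep r p0 p1 (ofK p0 p1 f) = Algebra.lmul ℂ (RatField r) f := by
  change RingQuot.liftAlgHom ℂ _ (RingQuot.mkAlgHom ℂ _ _) = _
  rw [RingQuot.liftAlgHom_mkAlgHom_apply]
  simp

theorem ofHB_X (i : Fin r) : ofHB p0 p1 (HB.X p0 p1 i) = ofK p0 p1 (kX i) :=
  mk_rel p0 p1 (.glue i)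

theorem ofHB_Xinv (i : Fin r) : ofHB p0 p1 (HB.Xinv p0 p1 i) = ofK p0 p1 (kX i)⁻¹ := by
  have h1 : ofHB p0 p1 (HB.Xinv p0 p1 i) * ofK p0 p1 (kX i) = 1 := by
    rw [← ofHB_X, ← map_mul, HB.Xinv_mul_X, map_one]
  have h2 : ofK p0 p1 (kX i) * ofK p0 p1 (kX i)⁻¹ = 1 := by
    rw [← map_mul, mul_inv_cancel₀ (kX_ne_zero i), map_one]
  calc _ = ofHB p0 p1 (HB.Xinv p0 p1 i) * (ofK p0 p1 (kX i) * ofK p0 p1 (kX i)⁻¹) := by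
        rw [h2, mul_one]
    _ = _ := by rw [← mul_assoc, h1, one_mul]

/-- Laurent polynomials come from `H_r^B`. -/
theorem exists_ofHB_eq {f : RatField r} (hf : f ∈ laurent r) :
    ∃ h, ofHB p0 p1 h = ofK p0 p1 f ∧ stdRep r p0 p1 h = Algebra.lmul ℂ (RatField r) f := by
  suffices h : ∃ h, ofHB p0 p1 h = ofK p0 p1 f by
    obtain ⟨h, hh⟩ := h
    exact ⟨h, hh, by rw [← rep_ofHB, hh, rep_ofK]⟩
  suffices h : laurent r ≤ (ofHB p0 p1).range.comap (ofK p0 p1) from h hf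
  refine Algebra.adjoin_le ?_
  rintro _ (⟨i, rfl⟩ | ⟨i, rfl⟩)
  · exact ⟨_, ofHB_X p0 p1 i⟩
  · exact ⟨_, ofHB_Xinv p0 p1 i⟩

theorem exists_laurent_div (f : RatField r) : ∃ a ∈ laurent r, ∃ b ∈ laurent r, b ≠ 0 ∧ f * b = a := by
  have hpoly : ∀ P : MvPolynomial (Fin r) ℂ,
      algebraMap (MvPolynomial (Fin r) ℂ) (RatField r) P ∈ laurent r := by
    intro P
    induction P using MvPolynomial.induction_on with
    | C c => rw [algebraMap_C_eq]; exact algebraMap_mem_laurent c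
    | add P Q hP hQ => rw [map_add]; exact add_mem hP hQ
    | mul_X P i hP => rw [map_mul]; exact mul_mem hP (kX_mem_laurent i)
  obtain ⟨P, Q, hQ, rfl⟩ := IsFractionRing.div_surjective (A := MvPolynomial (Fin r) ℂ) f
  have hQ0 : algebraMap (MvPolynomial (Fin r) ℂ) (RatField r) Q ≠ 0 := by
    rw [Ne, IsFractionRing.to_map_eq_zero_iff]
    exact nonZeroDivisors.ne_zero hQ
  exact ⟨_, hpoly P, _, hpoly Q, hQ0, div_mul_cancel₀ _ hQ0⟩

/-- Elements of the localized algebra have a common right denominator. -/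
theorem exists_mul_ofK_eq (x : HLoc r p0 p1) :
    ∃ b ∈ laurent r, b ≠ 0 ∧ ∃ h, x * ofK p0 p1 b = ofHB p0 p1 h := by
  let S : Set (HLoc r p0 p1) := {x | ∃ b ∈ laurent r, b ≠ 0 ∧ ∃ h, x * ofK p0 p1 b = ofHB p0 p1 h}
  have hadd : ∀ x ∈ S, ∀ y ∈ S, x + y ∈ S := by
    rintro x ⟨b, hb, hb0, h, hx⟩ y ⟨b', hb', hb0', h', hy⟩
    obtain ⟨k, hk, -⟩ := exists_ofHB_eq p0 p1 hb
    obtain ⟨k', hk', -⟩ := exists_ofHB_eq p0 p1 hb'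
    refine ⟨b * b', mul_mem hb hb', mul_ne_zero hb0 hb0', h * k' + h' * k, ?_⟩
    rw [map_add, map_mul (ofHB p0 p1), map_mul (ofHB p0 p1), hk, hk', ← hx, ← hy, add_mul,
      mul_assoc x, mul_assoc y, ← map_mul, ← map_mul, mul_comm b']
  have hK : ∀ x ∈ S, ∀ f, x * ofK p0 p1 f ∈ S := by
    rintro x ⟨b, hb, hb0, h, hx⟩ f
    obtain ⟨P, hP, Q, hQ, hQ0, hf⟩ := exists_laurent_div f
    obtain ⟨k, hk, -⟩ := exists_ofHB_eq p0 p1 hP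
    refine ⟨b * Q, mul_mem hb hQ, mul_ne_zero hb0 hQ0, h * k, ?_⟩
    rw [map_mul (ofHB p0 p1), hk, ← hx, mul_assoc, mul_assoc, ← map_mul, ← map_mul, ← hf]
    congr 2
    ring
  have hT : ∀ x ∈ S, ∀ i, x * ofHB p0 p1 (HB.T p0 p1 i) ∈ S := by
    rintro x ⟨b, hb, hb0, h, hx⟩ i
    -- the symmetrized denominator commutes with `T_i`
    have hb' := simpleAut_mem_laurent hb i
    obtain ⟨c, hc, hc'⟩ := exists_ofHB_eq p0 p1 (mul_mem hb hb')
    obtain ⟨k, hk, -⟩ := exists_ofHB_eq p0 p1 hb'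
    have hs : simpleAut id i (b * simpleAut id i b) = b * simpleAut id i b := by
      have := DFunLike.congr_fun (simpleAut_mul_self i) b
      rw [AlgEquiv.mul_apply, AlgEquiv.one_apply] at this
      rw [map_mul, this, mul_comm]
    have hcomm : HB.T p0 p1 i * c = c * HB.T p0 p1 i := by
      refine varRep_injective Function.injective_id p0 p1 ?_
      rw [map_mul, map_mul, hc', stdRep_T]
      exact dlOp_mul_lmul_of_fix hs
    refine ⟨_, mul_mem hb hb', mul_ne_zero hb0 (by simpa using hb0), h * k * HB.T p0 p1 i, ?_⟩
    rw [mul_assoc, ← hc, ← map_mul, hcomm, map_mul, map_mul, map_mul, hc, hk, ← hx, map_mul]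
    simp only [mul_assoc]
  have hone : (1 : HLoc r p0 p1) ∈ S := ⟨1, one_mem _, one_ne_zero, 1, by simp⟩
  have hH : ∀ a : HB r p0 p1, ∀ x ∈ S, x * ofHB p0 p1 a ∈ S := by
    intro a
    refine HB.induction_left p0 p1 (P := fun a => ∀ x ∈ S, x * ofHB p0 p1 a ∈ S)
      ?_ ?_ ?_ ?_ ?_ ?_ a
    · intro x hx; simpa using hx
    · intro a b ha hb x hx; rw [map_add, mul_add]; exact hadd _ (ha x hx) _ (hb x hx)
    · intro c a ha x hx
      have := hK _ (ha x hx) (algebraMap ℂ _ c)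
      rwa [AlgHom.commutes, mul_assoc, ← Algebra.commutes, ← Algebra.smul_def, ← map_smul] at this
    · intro i a ha x hx
      rw [map_mul, ← mul_assoc]
      exact ha _ (hT x hx i)
    · intro i a ha x hx
      rw [map_mul, ← mul_assoc, ofHB_X]
      exact ha _ (hK x hx _)
    · intro i a ha x hx
      rw [map_mul, ← mul_assoc, ofHB_Xinv]
      exact ha _ (hK x hx _)
  suffices h : ∀ a, ∀ x ∈ S, x * mk r p0 p1 a ∈ S by
    obtain ⟨a, rfl⟩ := RingQuot.mkAlgHom_surjective ℂ (HLocRel (r := r) (p0 := p0) (p1 := p1)) x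
    have := h a 1 hone
    rwa [one_mul] at this
  intro a
  induction a using FreeAlgebra.induction with
  | grade0 c =>
    intro x hx
    have := hK x hx (algebraMap ℂ _ c)
    rwa [AlgHom.commutes] at this ⊢
  | grade1 y =>
    rcases y with h | f
    · exact hH h
    · exact fun x hx => hK x hx f
  | mul a b ha hb => intro x hx; rw [map_mul, ← mul_assoc]; exact hb _ (ha x hx)
  | add a b ha hb => intro x hx; rw [map_add, mul_add]; exact hadd _ (ha x hx) _ (hb x hx)

/-- The localized algebra acts faithfully, since `H_r^B` does and every element has a denominator.
-/
theorem rep_injective : Function.Injective (rep r p0 p1) := by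
  rw [injective_iff_map_eq_zero]
  intro x hx
  obtain ⟨b, -, hb0, h, hh⟩ := exists_mul_ofK_eq p0 p1 x
  have h0 : h = 0 := by
    refine varRep_injective Function.injective_id p0 p1 ?_
    rw [map_zero, ← rep_ofHB, ← hh, map_mul, hx, zero_mul]
  rw [h0, map_zero] at hh
  calc x = x * ofK p0 p1 b * ofK p0 p1 b⁻¹ := by
        rw [mul_assoc, ← map_mul, mul_inv_cancel₀ hb0, map_one, mul_one]
    _ = 0 := by rw [hh, zero_mul]

end HLoc

section Embedding

variable {n m r : ℕ} {p0 p1 : ℂˣ}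

/-- The normalized intertwiners act as the simple reflections of the variables. -/
theorem rep_intertwiner (i : Fin r) :
    HLoc.rep r p0 p1 (intertwiner p0 p1 i) = (simpleAut id i).toLinearMap := by
  have hne : algebraMap ℂ (RatField r) (par p0 p1 i : ℂ)⁻¹
        - algebraMap ℂ (RatField r) (par p0 p1 i : ℂ) * kRoot i ≠ 0 := by
    intro h
    have hr : ∀ c, kRoot i ≠ algebraMap ℂ (RatField r) c :=
      varDatum_root_ne (ι := (id : Fin r → Fin r)) Function.injective_id i
    refine dlCoeff_ne_zero (Units.ne_zero (par p0 p1 i)) hr ?_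
    rw [dlCoeff, ← map_inv₀, h, zero_div]
  have he := kRoot_ne_one i
  rw [intertwiner, map_mul, map_sub, map_mul, HLoc.rep_ofK, HLoc.rep_ofK, HLoc.rep_ofHB,
    AlgHom.commutes, stdRep_T]
  ext f
  have h1 : (1 - kRoot i) ≠ 0 := sub_ne_zero.2 he.symm
  change _⁻¹ * ((1 - kRoot i) * dlOp _ _ _ f - _) = _
  rw [dlOp_apply, dlCoeff, Module.algebraMap_end_apply, Algebra.smul_def, map_sub, map_inv₀]
  rw [map_inv₀] at hne
  have : (1 - kRoot i) * (algebraMap ℂ (RatField r) (par p0 p1 i : ℂ) * f +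
      ((algebraMap ℂ (RatField r) (par p0 p1 i : ℂ))⁻¹ - algebraMap ℂ (RatField r) (par p0 p1 i : ℂ)
        * kRoot i) / (1 - kRoot i) * (simpleAut id i f - f)) -
      (algebraMap ℂ (RatField r) (par p0 p1 i : ℂ) - (algebraMap ℂ (RatField r) (par p0 p1 i : ℂ))⁻¹)
        * f = ((algebraMap ℂ (RatField r) (par p0 p1 i : ℂ))⁻¹ - algebraMap ℂ (RatField r)
        (par p0 p1 i : ℂ) * kRoot i) * simpleAut id i f := by
    generalize algebraMap ℂ (RatField r) (par p0 p1 i : ℂ) = p at *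
    generalize p⁻¹ = p' at *
    field_simp
    ring
  rw [this, inv_mul_cancel_left₀ hne]
  rfl

theorem rep_conjT0 (hr : 0 < r) : ∀ (k : ℕ) (hk : k < r),
    HLoc.rep r p0 p1 (conjT0 p0 p1 k hk) = flipOp p0 ⟨k, hk⟩
  | 0, h => by rw [conjT0, HLoc.rep_ofHB, stdRep_T_zero p0 p1 rfl]
  | k + 1, h => by
    have hij : (⟨k, Nat.lt_of_succ_lt h⟩ : Fin r).val + 1 = (⟨k + 1, h⟩ : Fin r).val := rfl
    rw [conjT0, map_mul, map_mul, rep_conjT0 hr k, rep_intertwiner,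
      simpleAut_mul_flipOp p0 hij, mul_assoc, ← toLinearMap_mul, simpleAut_mul_self]
    exact mul_one _

variable (p0 p1) (hr : n + m = r)

theorem rep_embT (j : Fin m) :
    HLoc.rep r p0 p1 (embT p0 p1 hr j) = varRep (posR_injective hr) p0 p1 (HB.T p0 p1 j) := by
  rw [embT]
  split_ifs with h
  · rw [rep_conjT0 (by have := j.2; omega), varRep_posR_T_zero p0 p1 hr h]
    congr 1
    exact Fin.ext (by simp only [posR]; omega)
  · rw [HLoc.rep_ofHB, varRep_posR_T p0 hr h]

/-- The monomial by which the denominator differs from `D`. -/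
noncomputable def denomMonomial : RatField r := ∏ i : Fin n, ∏ _j : Fin m, (kX (posL hr i))⁻¹ ^ 3

theorem symDenom_eq : symDenom p1 hr = kD p1 hr * denomMonomial hr := by
  rw [symDenom, denomMonomial, kD, dElem, ← Fin.prod_univ_def, ← Finset.prod_mul_distrib]
  refine Finset.prod_congr rfl fun i _ => ?_
  rw [← Fin.prod_univ_def, ← Finset.prod_mul_distrib]
  rfl

theorem denomMonomial_mem_laurent : denomMonomial hr ∈ laurent r :=
  prod_mem fun _ _ => prod_mem fun _ _ => pow_mem (kX_inv_mem_laurent _) 3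

theorem denomMonomial_inv_mem_laurent : (denomMonomial hr)⁻¹ ∈ laurent r := by
  rw [denomMonomial, ← Finset.prod_inv_distrib]
  refine prod_mem fun i _ => ?_
  rw [← Finset.prod_inv_distrib]
  refine prod_mem fun _ _ => ?_
  rw [inv_pow, inv_inv]
  exact pow_mem (kX_mem_laurent _) 3

theorem kD_ne_zero : kD p1 hr ≠ 0 := fun h =>
  symDenom_ne_zero (p1 := p1) hr (by rw [symDenom_eq, h, zero_mul])

theorem laurent_le_Floc : laurent r ≤ Floc p1 hr := Algebra.adjoin_mono Set.subset_union_left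

theorem symDenom_inv_mem_Floc : (symDenom p1 hr)⁻¹ ∈ Floc p1 hr := by
  rw [symDenom_eq, mul_inv]
  exact mul_mem (Algebra.subset_adjoin (.inr rfl))
    (laurent_le_Floc p1 hr (denomMonomial_inv_mem_laurent hr))

theorem exists_mul_symDenom_mem {f : RatField r} (hf : f ∈ Floc p1 hr) :
    ∃ k, f * symDenom p1 hr ^ k ∈ laurent r := by
  have hz := symDenom_mem_laurent (p1 := p1) hr
  induction hf using Algebra.adjoin_induction with
  | mem f hf =>
    rcases hf with hf | rfl
    · exact ⟨0, by rw [pow_zero, mul_one]; exact Algebra.subset_adjoin hf⟩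
    · refine ⟨1, ?_⟩
      rw [pow_one, symDenom_eq, inv_mul_cancel_left₀ (kD_ne_zero p1 hr)]
      exact denomMonomial_mem_laurent hr
  | algebraMap c => exact ⟨0, by rw [pow_zero, mul_one]; exact algebraMap_mem_laurent c⟩
  | add f g _ _ hf hg =>
    obtain ⟨k, hk⟩ := hf
    obtain ⟨l, hl⟩ := hg
    refine ⟨k + l, ?_⟩
    have : (f + g) * symDenom p1 hr ^ (k + l) = f * symDenom p1 hr ^ k * symDenom p1 hr ^ l +
      g * symDenom p1 hr ^ l * symDenom p1 hr ^ k := by ring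
    rw [this]
    exact add_mem (mul_mem hk (pow_mem hz _)) (mul_mem hl (pow_mem hz _))
  | mul f g _ _ hf hg =>
    obtain ⟨k, hk⟩ := hf
    obtain ⟨l, hl⟩ := hg
    refine ⟨k + l, ?_⟩
    have : (f * g) * symDenom p1 hr ^ (k + l) = (f * symDenom p1 hr ^ k) *
      (g * symDenom p1 hr ^ l) := by ring
    rw [this]
    exact mul_mem hk hl

theorem lmul_mem_locH {f : RatField r} (hf : f ∈ Floc p1 hr) :
    Algebra.lmul ℂ (RatField r) f ∈ (pairDatum p0 p1 hr).locH := by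
  obtain ⟨k, hk⟩ := exists_mul_symDenom_mem p1 hr hf
  obtain ⟨h, hh⟩ := stdRep_of_mem_laurent p0 p1 hk
  exact ⟨k, h, by rw [hh, map_mul, map_pow]; congr 2; exact stdRep_denomH p0 p1 hr⟩

theorem rep_mem_locH {x : HLoc r p0 p1} (hx : x ∈ HF p0 p1 hr) :
    HLoc.rep r p0 p1 x ∈ (pairDatum p0 p1 hr).locH := by
  induction hx using Submodule.span_induction with
  | mem x hx =>
    obtain ⟨f, hf, rfl⟩ := hx
    rw [HLoc.rep_ofK]
    exact lmul_mem_locH p0 p1 hr hf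
  | zero => rw [map_zero]; exact zero_mem _
  | add x y _ _ hx hy => rw [map_add]; exact add_mem hx hy
  | smul h x _ hx =>
    change HLoc.rep r p0 p1 (HLoc.ofHB p0 p1 h * x) ∈ _
    rw [map_mul, HLoc.rep_ofHB]
    exact map_mul_mem_rightLoc h hx

/-- The space `H_r^B · F_{n,m}` is the localization of `H_r^B` at the denominator. -/
noncomputable def hfEquiv : HF p0 p1 hr ≃ₗ[ℂ] (pairDatum p0 p1 hr).locH :=
  LinearEquiv.ofBijective
    (((HLoc.rep r p0 p1).toLinearMap.comp ((HF p0 p1 hr).subtype.restrictScalars ℂ)).codRestrict _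
      fun x => rep_mem_locH p0 p1 hr x.2) <| by
    refine ⟨fun x y h => Subtype.ext (HLoc.rep_injective p0 p1 (congrArg Subtype.val h)), ?_⟩
    rintro ⟨q, k, h, hq⟩
    refine ⟨⟨HLoc.ofHB p0 p1 h * HLoc.ofK p0 p1 ((symDenom p1 hr)⁻¹ ^ k), ?_⟩, ?_⟩
    · exact Submodule.smul_mem _ h (Submodule.subset_span
        ⟨_, pow_mem (symDenom_inv_mem_Floc p1 hr) k, rfl⟩)
    · refine Subtype.ext ?_
      change HLoc.rep r p0 p1 (HLoc.ofHB p0 p1 h * HLoc.ofK p0 p1 ((symDenom p1 hr)⁻¹ ^ k)) = q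
      rw [map_mul, HLoc.rep_ofHB, HLoc.rep_ofK, ← hq]
      have hz : stdRep r p0 p1 (pairDatum p0 p1 hr).zH
          = Algebra.lmul ℂ (RatField r) (symDenom p1 hr) := stdRep_denomH p0 p1 hr
      rw [hz, mul_assoc, ← map_pow, ← map_mul, ← mul_pow,
        mul_inv_cancel₀ (symDenom_ne_zero hr), one_pow, map_one, mul_one]

theorem hfEquiv_apply (x : HF p0 p1 hr) :
    (hfEquiv p0 p1 hr x : Module.End ℂ (RatField r)) = HLoc.rep r p0 p1 x := rfl

end Embedding

/-! ### The product of modules as a balanced product -/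

section TensorModule

variable {A B : Type*} [Ring A] [Ring B] [Algebra ℂ A] [Algebra ℂ B]
  (N M : Type*) [AddCommGroup N] [AddCommGroup M] [Module ℂ N] [Module ℂ M] [Module A N] [Module B M]
  [IsScalarTower ℂ A N] [IsScalarTower ℂ B M]

/-- The action of `A ⊗ B` on `N ⊗ M`. -/
noncomputable def tensorAction (A B : Type*) [Ring A] [Ring B] [Algebra ℂ A] [Algebra ℂ B]
    (N M : Type*) [AddCommGroup N] [AddCommGroup M] [Module ℂ N] [Module ℂ M] [Module A N] [Module B M]
    [IsScalarTower ℂ A N] [IsScalarTower ℂ B M] : A ⊗[ℂ] B →ₐ[ℂ] Module.End ℂ (N ⊗[ℂ] M) :=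
  Module.endTensorEndAlgHom.comp
    (Algebra.TensorProduct.map (Algebra.lsmul ℂ ℂ N) (Algebra.lsmul ℂ ℂ M))

/-- The outer tensor product of modules, a module over the tensor product of the algebras. -/
@[reducible]
noncomputable def tensorModule : Module (A ⊗[ℂ] B) (N ⊗[ℂ] M) :=
  Module.compHom _ (tensorAction A B N M).toRingHom

attribute [local instance] tensorModule

theorem tensor_smul_eq (a : A ⊗[ℂ] B) (v : N ⊗[ℂ] M) : a • v = tensorAction A B N M a v := rfl

theorem tensorAction_tmul_tmul (a : A) (b : B) (x : N) (y : M) :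
    tensorAction A B N M (a ⊗ₜ[ℂ] b) (x ⊗ₜ[ℂ] y) = (a • x) ⊗ₜ[ℂ] (b • y) := by
  rw [tensorAction, AlgHom.comp_apply, Algebra.TensorProduct.map_tmul,
    Module.endTensorEndAlgHom_apply]
  rfl

theorem tmul_smul_tmul (a : A) (b : B) (x : N) (y : M) :
    (a ⊗ₜ[ℂ] b) • (x ⊗ₜ[ℂ] y) = (a • x) ⊗ₜ[ℂ] (b • y) := by
  rw [tensor_smul_eq, tensorAction_tmul_tmul]

theorem tensor_isScalarTower : IsScalarTower ℂ (A ⊗[ℂ] B) (N ⊗[ℂ] M) where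
  smul_assoc c a v := by rw [tensor_smul_eq, map_smul]; rfl

theorem tensorAction_tmul_one (a : A) :
    tensorAction A B N M (a ⊗ₜ 1) = LinearMap.rTensor M (Algebra.lsmul ℂ ℂ N a) := by
  ext x y
  simp [tensorAction_tmul_tmul]

theorem tensorAction_one_tmul (b : B) :
    tensorAction A B N M (1 ⊗ₜ b) = LinearMap.lTensor N (Algebra.lsmul ℂ ℂ M b) := by
  ext x y
  simp [tensorAction_tmul_tmul]

end TensorModule

section DiamondBalanced

variable {n m r : ℕ} (p0 p1 : ℂˣ) (hr : n + m = r)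

theorem map_dElem {R S : Type*} [Ring R] [Algebra ℂ R] [Ring S] [Algebra ℂ S] (f : R →ₐ[ℂ] S)
    (x : Fin n → R) (y y' : Fin m → R) :
    f (dElem p1 x y y') = dElem p1 (fun i => f (x i)) (fun j => f (y j)) (fun j => f (y' j)) := by
  simp only [dElem, map_list_prod, List.map_map]
  congr 1
  refine List.map_congr_left fun i _ => ?_
  simp only [Function.comp_apply, map_list_prod, List.map_map]
  congr 1
  refine List.map_congr_left fun j _ => ?_
  simp only [Function.comp_apply, dFactor, map_mul, map_sub, map_smul]

/-- The element `D` of `H_n^B ⊗ H_m^B`. -/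
noncomputable def pairD (n m : ℕ) : HB n p0 p1 ⊗[ℂ] HB m p0 p1 :=
  dElem p1 (fun i => HB.X p0 p1 i ⊗ₜ 1) (fun j => 1 ⊗ₜ HB.X p0 p1 j)
    (fun j => 1 ⊗ₜ HB.Xinv p0 p1 j)

theorem blockRep_pairD : blockRep p0 p1 hr (pairD p0 p1 n m)
    = Algebra.lmul ℂ (RatField r) (kD p1 hr) := by
  rw [pairD, map_dElem, kD, map_dElem]
  simp only [pairRep_tmul, map_one, one_mul, mul_one, varRep_X, varRep_Xinv]

variable (N : Type u) (M : Type v) [AddCommGroup N] [AddCommGroup M] [Module ℂ N] [Module ℂ M]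
  [Module (HB n p0 p1) N] [IsScalarTower ℂ (HB n p0 p1) N]
  [Module (HB m p0 p1) M] [IsScalarTower ℂ (HB m p0 p1) M]

attribute [local instance] tensorModule

theorem pairD_smul (v : N ⊗[ℂ] M) : pairD p0 p1 n m • v = actD N M n m p0 p1 v := by
  rw [tensor_smul_eq, pairD, map_dElem, actD]
  simp only [tensorAction_tmul_one, tensorAction_one_tmul]

/-- The class of `q ⊗ v` in `N ◇ M`. -/
noncomputable def diamondCl :
    (pairDatum p0 p1 hr).locH →ₗ[ℂ] N ⊗[ℂ] M →ₗ[ℂ] Diamond N M p0 p1 hr :=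
  ((TensorProduct.mk ℂ (HF p0 p1 hr) (N ⊗[ℂ] M)).comp
    (hfEquiv p0 p1 hr).symm.toLinearMap).compr₂
    ((Submodule.mkQ (Submodule.span (HB r p0 p1) {z | DiamondRel N M p0 p1 hr z})).restrictScalars ℂ)

theorem diamondCl_hfEquiv (x : HF p0 p1 hr) (v : N ⊗[ℂ] M) :
    diamondCl p0 p1 hr N M (hfEquiv p0 p1 hr x) v = Submodule.Quotient.mk (x ⊗ₜ[ℂ] v) := by
  simp [diamondCl]

variable {N M}

theorem mk_eq_of_diamondRel {a b : (HF p0 p1 hr) ⊗[ℂ] (N ⊗[ℂ] M)}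
    (h : DiamondRel N M p0 p1 hr (a - b)) :
    (Submodule.Quotient.mk a : Diamond N M p0 p1 hr) = Submodule.Quotient.mk b :=
  (Submodule.Quotient.eq _).2 (Submodule.subset_span h)

theorem exists_hf_eq_of_mul {q q' : (pairDatum p0 p1 hr).locH} {x : HLoc r p0 p1}
    (h : (q' : Module.End ℂ (RatField r)) = q * HLoc.rep r p0 p1 x) :
    ∃ y y' : HF p0 p1 hr, hfEquiv p0 p1 hr y = q ∧ hfEquiv p0 p1 hr y' = q' ∧
      (y' : HLoc r p0 p1) = y * x := by
  obtain ⟨y, rfl⟩ := (hfEquiv p0 p1 hr).surjective q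
  obtain ⟨y', rfl⟩ := (hfEquiv p0 p1 hr).surjective q'
  refine ⟨y, y', rfl, rfl, HLoc.rep_injective p0 p1 ?_⟩
  rwa [map_mul]

/-- The elements of `H_n^B ⊗ H_m^B` over which the class map is balanced. -/
def balancedSubalgebra : Subalgebra ℂ (HB n p0 p1 ⊗[ℂ] HB m p0 p1) where
  carrier := {a | ∀ (q q' : (pairDatum p0 p1 hr).locH) (v : N ⊗[ℂ] M),
    (q' : Module.End ℂ (RatField r)) = q * blockRep p0 p1 hr a →
      diamondCl p0 p1 hr N M q' v = diamondCl p0 p1 hr N M q (a • v)}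
  mul_mem' := by
    intro a b ha hb q q' v h
    have hmem : (q : Module.End ℂ (RatField r)) * blockRep p0 p1 hr a ∈ (pairDatum p0 p1 hr).locH :=
      (pairDatum p0 p1 hr).locH_mul_locA q.2 (map_mem_rightLoc a)
    rw [mul_smul, ← ha q ⟨_, hmem⟩ _ rfl]
    exact hb _ _ _ (by rw [h, map_mul, mul_assoc])
  add_mem' := by
    intro a b ha hb q q' v h
    have hmem : ∀ a, (q : Module.End ℂ (RatField r)) * blockRep p0 p1 hr a ∈
      (pairDatum p0 p1 hr).locH := fun a =>
        (pairDatum p0 p1 hr).locH_mul_locA q.2 (map_mem_rightLoc a)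
    have : q' = (⟨_, hmem a⟩ : (pairDatum p0 p1 hr).locH) + ⟨_, hmem b⟩ :=
      Subtype.ext (by rw [h, map_add, mul_add]; rfl)
    rw [this, map_add, LinearMap.add_apply, ha q _ v rfl, hb q _ v rfl, add_smul, map_add]
  algebraMap_mem' := by
    intro c q q' v h
    have hq : q' = c • q := Subtype.ext (by
      rw [h, AlgHom.commutes, ← Algebra.commutes, ← Algebra.smul_def]; rfl)
    rw [hq, map_smul, LinearMap.smul_apply, tensor_smul_eq, AlgHom.commutes,
      Module.algebraMap_end_apply, map_smul]

theorem mem_balancedSubalgebra_of {a : HB n p0 p1 ⊗[ℂ] HB m p0 p1} {x : HLoc r p0 p1}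
    (hx : HLoc.rep r p0 p1 x = blockRep p0 p1 hr a)
    (h : ∀ (y y' : HF p0 p1 hr) (s : N) (t : M), (y' : HLoc r p0 p1) = y * x →
      (Submodule.Quotient.mk (y' ⊗ₜ[ℂ] (s ⊗ₜ[ℂ] t)) : Diamond N M p0 p1 hr)
        = Submodule.Quotient.mk (y ⊗ₜ[ℂ] (a • (s ⊗ₜ[ℂ] t)))) :
    a ∈ balancedSubalgebra p0 p1 hr (N := N) (M := M) := by
  intro q q' v hq
  rw [← hx] at hq
  obtain ⟨y, y', rfl, rfl, hy⟩ := exists_hf_eq_of_mul p0 p1 hr hq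
  induction v using TensorProduct.induction_on with
  | zero => rw [smul_zero, map_zero, map_zero]
  | add v w hv hw => rw [smul_add, map_add, map_add, hv, hw]
  | tmul s t => rw [diamondCl_hfEquiv, diamondCl_hfEquiv, h y y' s t hy]

theorem mem_balancedSubalgebra_inv {a b : HB n p0 p1 ⊗[ℂ] HB m p0 p1} (hab : a * b = 1)
    (hba : b * a = 1) (h : a ∈ balancedSubalgebra p0 p1 hr (N := N) (M := M)) :
    b ∈ balancedSubalgebra p0 p1 hr (N := N) (M := M) := by
  intro q q' v hq
  have := h q' q (b • v) (by rw [hq, mul_assoc, ← map_mul, hba, map_one, mul_one])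
  rw [this, ← mul_smul, hab, one_smul]

/-- The relations of `N ◇ M` impose balancedness for the generators, hence for all of
`H_n^B ⊗ H_m^B`. -/
theorem balancedSubalgebra_eq_top : ∀ a, a ∈ balancedSubalgebra p0 p1 hr (N := N) (M := M) := by
  have hL : ∀ a : HB n p0 p1, a ⊗ₜ 1 ∈ balancedSubalgebra p0 p1 hr (N := N) (M := M) := by
    intro a
    have hX : ∀ i : Fin n, HB.X p0 p1 i ⊗ₜ 1 ∈ balancedSubalgebra p0 p1 hr (N := N) (M := M) := by
      intro i
      refine mem_balancedSubalgebra_of p0 p1 hr (x := HLoc.ofHB p0 p1 (HB.X p0 p1 (posL hr i))) ?_ ?_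
      · rw [HLoc.rep_ofHB, pairRep_tmul, map_one, mul_one, varRep_X, varRep_X]; rfl
      · intro y y' s t h
        rw [tmul_smul_tmul, one_smul]
        exact mk_eq_of_diamondRel p0 p1 hr (.leftX i y y' s t h)
    refine HB.map_mem (Algebra.TensorProduct.includeLeft (R := ℂ) (S := ℂ)) _ ?_ hX ?_ a
    · intro i
      refine mem_balancedSubalgebra_of p0 p1 hr (x := HLoc.ofHB p0 p1 (HB.T p0 p1 (posL hr i))) ?_ ?_
      · rw [HLoc.rep_ofHB]
        change _ = blockRep p0 p1 hr (_ ⊗ₜ 1)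
        rw [pairRep_tmul, map_one, mul_one, varRep_posL_T]
      · intro y y' s t h
        change _ = Submodule.Quotient.mk (y ⊗ₜ ((HB.T p0 p1 i ⊗ₜ 1) • _))
        rw [tmul_smul_tmul, one_smul]
        exact mk_eq_of_diamondRel p0 p1 hr (.leftT i y y' s t h)
    · intro i
      refine mem_balancedSubalgebra_inv p0 p1 hr ?_ ?_ (hX i) <;>
        simp [HB.X_mul_Xinv, HB.Xinv_mul_X, Algebra.TensorProduct.one_def]
  have hR : ∀ a : HB m p0 p1, 1 ⊗ₜ a ∈ balancedSubalgebra p0 p1 hr (N := N) (M := M) := by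
    intro a
    have hX : ∀ i : Fin m, 1 ⊗ₜ HB.X p0 p1 i ∈ balancedSubalgebra p0 p1 hr (N := N) (M := M) := by
      intro i
      refine mem_balancedSubalgebra_of p0 p1 hr (x := HLoc.ofHB p0 p1 (HB.X p0 p1 (posR hr i))) ?_ ?_
      · rw [HLoc.rep_ofHB, pairRep_tmul, map_one, one_mul, varRep_X, varRep_X]; rfl
      · intro y y' s t h
        rw [tmul_smul_tmul, one_smul]
        exact mk_eq_of_diamondRel p0 p1 hr (.rightX i y y' s t h)
    refine HB.map_mem (Algebra.TensorProduct.includeRight (R := ℂ) (A := HB n p0 p1))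
      (balancedSubalgebra p0 p1 hr (N := N) (M := M)) ?_ hX ?_ a
    · intro i
      refine mem_balancedSubalgebra_of p0 p1 hr (x := embT p0 p1 hr i) ?_ ?_
      · rw [rep_embT]
        change _ = blockRep p0 p1 hr (1 ⊗ₜ _)
        rw [pairRep_tmul, map_one, one_mul]
      · intro y y' s t h
        change _ = Submodule.Quotient.mk (y ⊗ₜ ((1 ⊗ₜ HB.T p0 p1 i) • _))
        rw [tmul_smul_tmul, one_smul]
        exact mk_eq_of_diamondRel p0 p1 hr (.rightT i y y' s t h)
    · intro i
      refine mem_balancedSubalgebra_inv p0 p1 hr ?_ ?_ (hX i) <;>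
        simp [HB.X_mul_Xinv, HB.Xinv_mul_X, Algebra.TensorProduct.one_def]
  intro a
  induction a using TensorProduct.induction_on with
  | zero => exact zero_mem _
  | add a b ha hb => exact add_mem ha hb
  | tmul a b =>
    have := mul_mem (hL a) (hR b)
    rwa [Algebra.TensorProduct.tmul_mul_tmul, mul_one, one_mul] at this

/-- A map balanced over `H_n^B ⊗ H_m^B` respects the relations defining `N ◇ M`. -/
theorem lift_diamondRel {V : Type*} [AddCommGroup V] [Module ℂ V]
    (Ψ : (pairDatum p0 p1 hr).locH →ₗ[ℂ] N ⊗[ℂ] M →ₗ[ℂ] V)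
    (hΨ : ∀ (a : HB n p0 p1 ⊗[ℂ] HB m p0 p1) (q q' : (pairDatum p0 p1 hr).locH) (x : N ⊗[ℂ] M),
      (q' : Module.End ℂ (RatField r)) = q * blockRep p0 p1 hr a → Ψ q' x = Ψ q (a • x))
    {z : (HF p0 p1 hr) ⊗[ℂ] (N ⊗[ℂ] M)} (hz : DiamondRel N M p0 p1 hr z) :
    TensorProduct.lift (Ψ.comp (hfEquiv p0 p1 hr).toLinearMap) z = 0 := by
  have key : ∀ (a : HB n p0 p1 ⊗[ℂ] HB m p0 p1) (x : HLoc r p0 p1) (q q' : HF p0 p1 hr)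
      (v : N ⊗[ℂ] M), HLoc.rep r p0 p1 x = blockRep p0 p1 hr a → (q' : HLoc r p0 p1) = q * x →
      Ψ (hfEquiv p0 p1 hr q') v = Ψ (hfEquiv p0 p1 hr q) (a • v) := fun a x q q' v hx h =>
    hΨ a _ _ v (by rw [hfEquiv_apply, hfEquiv_apply, h, map_mul, hx])
  induction hz with
  | leftT i q q' x y h =>
    have := key (HB.T p0 p1 i ⊗ₜ 1) _ q q' (x ⊗ₜ y) (by
      rw [HLoc.rep_ofHB, pairRep_tmul, map_one, mul_one, varRep_posL_T]) h
    rw [tmul_smul_tmul, one_smul] at this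
    simpa [sub_eq_zero] using this
  | leftX i q q' x y h =>
    have := key (HB.X p0 p1 i ⊗ₜ 1) _ q q' (x ⊗ₜ y) (by
      rw [HLoc.rep_ofHB, pairRep_tmul, map_one, mul_one, varRep_X, varRep_X]; rfl) h
    rw [tmul_smul_tmul, one_smul] at this
    simpa [sub_eq_zero] using this
  | rightT i q q' x y h =>
    have := key (1 ⊗ₜ HB.T p0 p1 i) _ q q' (x ⊗ₜ y) (by
      rw [rep_embT, pairRep_tmul, map_one, one_mul]) h
    rw [tmul_smul_tmul, one_smul] at this
    simpa [sub_eq_zero] using this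
  | rightX i q q' x y h =>
    have := key (1 ⊗ₜ HB.X p0 p1 i) _ q q' (x ⊗ₜ y) (by
      rw [HLoc.rep_ofHB, pairRep_tmul, map_one, one_mul, varRep_X, varRep_X]; rfl) h
    rw [tmul_smul_tmul, one_smul] at this
    simpa [sub_eq_zero] using this
  | invD q q' v w h hw =>
    have := key (pairD p0 p1 n m) (HLoc.ofK p0 p1 (kD p1 hr)) q' q w (by
      rw [HLoc.rep_ofK, blockRep_pairD]) (by
      rw [h, mul_assoc, ← map_mul, inv_mul_cancel₀ (kD_ne_zero p1 hr), map_one, mul_one])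
    rw [pairD_smul, hw] at this
    simpa [sub_eq_zero] using this.symm

theorem smul_diamondRel (h : HB r p0 p1) {z : (HF p0 p1 hr) ⊗[ℂ] (N ⊗[ℂ] M)}
    (hz : DiamondRel N M p0 p1 hr z) : DiamondRel N M p0 p1 hr (h • z) := by
  have hs : ∀ {q q' : HF p0 p1 hr} {x : HLoc r p0 p1}, (q' : HLoc r p0 p1) = q * x →
      ((h • q' : HF p0 p1 hr) : HLoc r p0 p1) = (h • q : HF p0 p1 hr) * x := by
    intro q q' x hx
    change HLoc.ofHB p0 p1 h * (q' : HLoc r p0 p1) = HLoc.ofHB p0 p1 h * (q : HLoc r p0 p1) * x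
    rw [hx, mul_assoc]
  induction hz with
  | leftT i q q' x y e => rw [smul_sub]; exact .leftT i _ _ x y (hs e)
  | leftX i q q' x y e => rw [smul_sub]; exact .leftX i _ _ x y (hs e)
  | rightT i q q' x y e => rw [smul_sub]; exact .rightT i _ _ x y (hs e)
  | rightX i q q' x y e => rw [smul_sub]; exact .rightX i _ _ x y (hs e)
  | invD q q' v w e hw => rw [smul_sub]; exact .invD _ _ v w (hs e) hw

variable (N M) in
/-- `N ◇ M` is the balanced product over the localization of `H_n^B ⊗ H_m^B`. -/
theorem isBalancedProduct_diamond :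
    (pairDatum p0 p1 hr).IsBalancedProduct (diamondCl p0 p1 hr N M) where
  smul_cl := by
    intro h q q' v hq
    obtain ⟨y, rfl⟩ := (hfEquiv p0 p1 hr).surjective q
    have : q' = hfEquiv p0 p1 hr (h • y) := by
      refine Subtype.ext ?_
      rw [hq, hfEquiv_apply, hfEquiv_apply]
      change _ = HLoc.rep r p0 p1 (HLoc.ofHB p0 p1 h * (y : HLoc r p0 p1))
      rw [map_mul, HLoc.rep_ofHB]
    rw [this, diamondCl_hfEquiv, diamondCl_hfEquiv]
    rfl
  balanced a q q' v h := balancedSubalgebra_eq_top p0 p1 hr a q q' v h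
  span := by
    rw [eq_top_iff]
    rintro d -
    obtain ⟨z, rfl⟩ := Submodule.Quotient.mk_surjective _ d
    induction z using TensorProduct.induction_on with
    | zero => exact zero_mem _
    | add a b ha hb => exact add_mem ha hb
    | tmul x v => exact Submodule.subset_span ⟨_, v, diamondCl_hfEquiv p0 p1 hr N M x v⟩
  univ := by
    intro V _ _ Ψ hΨ
    let F := TensorProduct.lift (Ψ.comp (hfEquiv p0 p1 hr).toLinearMap)
    have hF : ∀ z ∈ Submodule.span (HB r p0 p1) {z | DiamondRel N M p0 p1 hr z}, F z = 0 := by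
      intro z hz
      -- `F` is not `H_r^B`-linear (there is no action on `V`), so all multiples are treated at
      -- once.
      suffices h : ∀ h : HB r p0 p1, F (h • z) = 0 by simpa using h 1
      induction hz using Submodule.span_induction with
      | mem z hz =>
        exact fun h => lift_diamondRel p0 p1 hr Ψ hΨ (smul_diamondRel p0 p1 hr h hz)
      | zero => intro h; rw [smul_zero, map_zero]
      | add a b _ _ ha hb => intro h; rw [smul_add, map_add, ha, hb, add_zero]
      | smul k z _ hz => intro h; rw [← mul_smul]; exact hz _
    refine ⟨((Submodule.restrictScalars ℂ
      (Submodule.span (HB r p0 p1) {z | DiamondRel N M p0 p1 hr z})).liftQ F (fun z hz => hF z hz)).comp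
      (Submodule.Quotient.restrictScalarsEquiv ℂ _).symm.toLinearMap, fun q v => ?_⟩
    obtain ⟨y, rfl⟩ := (hfEquiv p0 p1 hr).surjective q
    rw [diamondCl_hfEquiv]
    rfl

end DiamondBalanced

/-! ### Outer tensor products -/

theorem tmul_ne_zero {N M : Type*} [AddCommGroup N] [AddCommGroup M] [Module ℂ N] [Module ℂ M]
    {x : N} {y : M} (hx : x ≠ 0) (hy : y ≠ 0) : x ⊗ₜ[ℂ] y ≠ 0 := by
  intro h
  refine hx ((Module.forall_dual_apply_eq_zero_iff ℂ x).1 fun f => ?_)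
  have := congrArg (TensorProduct.lid ℂ M ∘ LinearMap.rTensor M f) h
  simpa [hy] using this

section SimpleTensor

variable {A B : Type*} [Ring A] [Ring B] [Algebra ℂ A] [Algebra ℂ B]
  {N M : Type*} [AddCommGroup N] [AddCommGroup M] [Module ℂ N] [Module ℂ M] [Module A N] [Module B M]
  [IsScalarTower ℂ A N] [IsScalarTower ℂ B M] [FiniteDimensional ℂ N] [FiniteDimensional ℂ M]

/-- Burnside's theorem: an algebra acts on a finite-dimensional simple module through all
endomorphisms. -/
theorem lsmul_surjective [IsSimpleModule A N] :
    Function.Surjective (Algebra.lsmul (A := A) ℂ ℂ N) := by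
  intro f
  let f' : Module.End (Module.End A N) N :=
    { toFun := f
      map_add' := map_add f
      map_smul' := fun g x => by
        obtain ⟨c, rfl⟩ := (IsSimpleModule.algebraMap_end_bijective_of_isAlgClosed (A := A) (V := N) ℂ).2 g
        exact map_smul f c x }
  classical
  let b := Module.finBasis ℂ N
  obtain ⟨a, ha⟩ := jacobson_density f' (Finset.univ.image b)
  exact ⟨a, b.ext fun i => (ha _ (Finset.mem_image_of_mem _ (Finset.mem_univ i))).symm⟩

theorem tensorAction_surjective [IsSimpleModule A N] [IsSimpleModule B M] :
    Function.Surjective (tensorAction A B N M) := by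
  intro f
  obtain ⟨t, rfl⟩ := (homTensorHomEquiv ℂ N M N M).surjective f
  induction t using TensorProduct.induction_on with
  | zero => exact ⟨0, by simp⟩
  | add a b ha hb =>
    obtain ⟨a', ha⟩ := ha
    obtain ⟨b', hb⟩ := hb
    exact ⟨a' + b', by rw [map_add, ha, hb, map_add]⟩
  | tmul f g =>
    obtain ⟨a, rfl⟩ := lsmul_surjective (A := A) f
    obtain ⟨b, rfl⟩ := lsmul_surjective (A := B) g
    refine ⟨a ⊗ₜ b, TensorProduct.ext' fun x y => ?_⟩
    rw [tensorAction_tmul_tmul, homTensorHomEquiv_apply, TensorProduct.homTensorHomMap_apply]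
    rfl

attribute [local instance] tensorModule

/-- Outer tensor products of simple modules are simple, as all endomorphisms come from `A ⊗ B`. -/
theorem tensor_isSimpleModule [IsSimpleModule A N] [IsSimpleModule B M] :
    IsSimpleModule (A ⊗[ℂ] B) (N ⊗[ℂ] M) := by
  have := IsSimpleModule.nontrivial A N
  have := IsSimpleModule.nontrivial B M
  have hnt : Nontrivial (N ⊗[ℂ] M) := by
    obtain ⟨x, hx⟩ := exists_ne (0 : N)
    obtain ⟨y, hy⟩ := exists_ne (0 : M)
    exact ⟨x ⊗ₜ y, 0, tmul_ne_zero hx hy⟩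
  refine isSimpleModule_iff_toSpanSingleton_surjective.2 ⟨hnt, fun v hv w => ?_⟩
  obtain ⟨f, hf⟩ := (isSimpleModule_iff_toSpanSingleton_surjective.1
    (inferInstance : IsSimpleModule (Module.End ℂ (N ⊗[ℂ] M)) (N ⊗[ℂ] M))).2 v hv w
  obtain ⟨c, rfl⟩ := tensorAction_surjective (A := A) (B := B) f
  exact ⟨c, hf⟩

/-- Schur's lemma for central elements. -/
theorem exists_central_scalar [IsSimpleModule A N] {z : A} (hz : ∀ a, Commute a z) :
    ∃ l : ℂ, ∀ x : N, z • x = l • x := by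
  obtain ⟨l, hl⟩ := (IsSimpleModule.algebraMap_end_bijective_of_isAlgClosed (A := A) (V := N) ℂ).2
    { toFun := fun x => z • x
      map_add' := smul_add z
      map_smul' := fun a x => by rw [RingHom.id_apply, ← mul_smul, ← mul_smul, (hz a).eq] }
  exact ⟨l, fun x => (DFunLike.congr_fun hl x).symm⟩

end SimpleTensor

section Eigen

variable {N M : Type*} [AddCommGroup N] [AddCommGroup M] [Module ℂ N] [Module ℂ M]

theorem hasEigenvalue_of_rTensor {f : Module.End ℂ N} {a : ℂ}
    (h : Module.End.HasEigenvalue (LinearMap.rTensor M f) a) : Module.End.HasEigenvalue f a := by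
  intro hb
  have hinj : Function.Injective (f - a • (1 : Module.End ℂ N)) := by
    rw [← LinearMap.ker_eq_bot, ← Module.End.eigenspace_def]; exact hb
  have := Module.Flat.rTensor_preserves_injective_linearMap (M := M) (f - a • (1 : Module.End ℂ N)) hinj
  obtain ⟨v, hv⟩ := h.exists_hasEigenvector
  refine hv.2 (this ?_)
  have h1 := hv.apply_eq_smul
  rw [map_zero, LinearMap.rTensor_sub, LinearMap.sub_apply, h1,
    LinearMap.rTensor_smul]
  simp [Module.End.one_eq_id]

theorem hasEigenvalue_of_lTensor {f : Module.End ℂ M} {a : ℂ}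
    (h : Module.End.HasEigenvalue (LinearMap.lTensor N f) a) : Module.End.HasEigenvalue f a := by
  intro hb
  have hinj : Function.Injective (f - a • (1 : Module.End ℂ M)) := by
    rw [← LinearMap.ker_eq_bot, ← Module.End.eigenspace_def]; exact hb
  have := Module.Flat.lTensor_preserves_injective_linearMap (M := N) (f - a • (1 : Module.End ℂ M)) hinj
  obtain ⟨v, hv⟩ := h.exists_hasEigenvector
  refine hv.2 (this ?_)
  have h1 := hv.apply_eq_smul
  rw [map_zero, LinearMap.lTensor_sub, LinearMap.sub_apply, h1,
    LinearMap.lTensor_smul]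
  simp [Module.End.one_eq_id]

theorem list_prod_apply_eq {V ι : Type*} [AddCommGroup V] [Module ℂ V] (l : List ι)
    (f : ι → Module.End ℂ V) (c : ι → ℂ) {v : V} (h : ∀ i, f i v = c i • v) :
    (l.map f).prod v = (l.map c).prod • v := by
  induction l with
  | nil => simp
  | cons i l ih =>
    rw [List.map_cons, List.map_cons, List.prod_cons, List.prod_cons, Module.End.mul_apply, ih,
      map_smul, h, smul_smul, mul_comm]

theorem dElem_apply {n m : ℕ} (p1 : ℂˣ) {V : Type*} [AddCommGroup V] [Module ℂ V]
    (f : Fin n → Module.End ℂ V) (g g' : Fin m → Module.End ℂ V) (a : Fin n → ℂ) (b b' : Fin m → ℂ)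
    {v : V} (hf : ∀ i, f i v = a i • v) (hg : ∀ j, g j v = b j • v) (hg' : ∀ j, g' j v = b' j • v) :
    dElem p1 f g g' v = dElem p1 a b b' • v := by
  refine list_prod_apply_eq _ _ _ fun i => list_prod_apply_eq _ _ _ fun j => ?_
  simp only [dFactor, Module.End.mul_apply, LinearMap.sub_apply, LinearMap.smul_apply, hf, hg, hg',
    map_smul, smul_smul, ← sub_smul, smul_eq_mul]
  congr 1
  ring

end Eigen

section InvariantSets

variable {p1 : ℂˣ} {J J₁ J₂ : Set ℂˣ}

theorem IsInvariantZZ2.inv_mem (h : IsInvariantZZ2 p1 J) {a : ℂˣ} (ha : a ∈ J) : a⁻¹ ∈ J := by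
  simpa using h a ha 0 (-1)

theorem IsInvariantZZ2.mul_sq_mem (h : IsInvariantZZ2 p1 J) {a : ℂˣ} (ha : a ∈ J) :
    a * p1 ^ 2 ∈ J := by
  simpa using h a ha 1 1

theorem dFactor_ne_zero (h₁ : IsInvariantZZ2 p1 J₁) (h₂ : IsInvariantZZ2 p1 J₂)
    (hd : Disjoint J₁ J₂) {a b : ℂˣ} (ha : a ∈ J₁) (hb : b ∈ J₂) :
    dFactor p1 (a : ℂ) (b : ℂ) (b : ℂ)⁻¹ ≠ 0 := by
  have hne : ∀ b ∈ J₂, a ≠ b := fun b hb h => Set.disjoint_left.1 hd ha (h ▸ hb)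
  have h1 : ∀ b ∈ J₂, (a : ℂ) - (b : ℂ) ≠ 0 := fun b hb h =>
    hne b hb (Units.ext (sub_eq_zero.1 h))
  have h2 : ∀ b ∈ J₂, (a : ℂ) - (p1 : ℂ) ^ 2 * (b : ℂ) ≠ 0 := fun b hb h => by
    refine h1 _ (h₂.mul_sq_mem hb) ?_
    rw [Units.val_mul, Units.val_pow_eq_pow_val, mul_comm]
    exact h
  have h3 : ∀ b ∈ J₂, (a : ℂ) - (p1 : ℂ)⁻¹ ^ 2 * (b : ℂ) ≠ 0 := fun b hb h => by
    have := h₂ b hb (-1) 1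
    refine h1 _ this ?_
    have e : ((b ^ ((1 : ℤˣ) : ℤ) * p1 ^ (2 * (-1 : ℤ)) : ℂˣ) : ℂ) = (p1 : ℂ)⁻¹ ^ 2 * (b : ℂ) := by
      simp [zpow_neg, mul_comm]
    rw [e]
    exact h
  have hb' := h₂.inv_mem hb
  rw [dFactor, ← Units.val_inv_eq_inv_val b]
  exact mul_ne_zero (mul_ne_zero (mul_ne_zero (mul_ne_zero (mul_ne_zero (h2 _ hb) (h3 _ hb))
    (h2 _ hb')) (h3 _ hb')) (h1 _ hb)) (h1 _ hb')

end InvariantSets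

/-! ### Simplicity of the product -/

section DiamondSimple

attribute [local instance] tensorModule tensor_isScalarTower

variable {n m r : ℕ} (p0 p1 : ℂˣ) (hr : n + m = r) {J₁ J₂ : Set ℂˣ}
  (N : Type u) (M : Type v) [AddCommGroup N] [AddCommGroup M] [Module ℂ N] [Module ℂ M]
  [Module (HB n p0 p1) N] [IsScalarTower ℂ (HB n p0 p1) N]
  [Module (HB m p0 p1) M] [IsScalarTower ℂ (HB m p0 p1) M]

theorem blockRep_injective : Function.Injective (blockRep p0 p1 hr) := pairRep_injective _ _ _ p0 p1

theorem commute_denomA (a : HB n p0 p1 ⊗[ℂ] HB m p0 p1) : Commute a (denomA p0 p1 hr) := by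
  refine blockRep_injective p0 p1 hr ?_
  rw [map_mul, map_mul, blockRep_denomA, (blockRep_commute (p0 := p0) p1 hr a).eq]

theorem exists_denomA_eq : ∃ d d' : HB n p0 p1 ⊗[ℂ] HB m p0 p1,
    denomA p0 p1 hr = pairD p0 p1 n m * d ∧ d * d' = 1 := by
  obtain ⟨d, hd⟩ := blockRep_of_mem_laurent p0 p1 hr (denomMonomial_mem_laurent hr)
  obtain ⟨d', hd'⟩ := blockRep_of_mem_laurent p0 p1 hr (denomMonomial_inv_mem_laurent hr)
  have hne : denomMonomial hr ≠ 0 := fun h => symDenom_ne_zero (p1 := p1) hr (by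
    rw [symDenom_eq, h, mul_zero])
  refine ⟨d, d', blockRep_injective p0 p1 hr ?_, blockRep_injective p0 p1 hr ?_⟩
  · rw [blockRep_denomA, map_mul, blockRep_pairD, hd, ← map_mul, symDenom_eq]
  · rw [map_mul, hd, hd', ← map_mul, mul_inv_cancel₀ hne, map_one, map_one]

variable {N M}

theorem actD_weight_ne_zero (h₁ : IsInvariantZZ2 p1 J₁) (h₂ : IsInvariantZZ2 p1 J₂)
    (hd : Disjoint J₁ J₂) (hN : IsOfType (n := n) p0 p1 J₁ N) (hM : IsOfType (n := m) p0 p1 J₂ M)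
    {a : Fin n → ℂ} {b : Fin m → ℂ} {x : N} {y : M}
    (hx : IsWeightVector p0 p1 a x) (hy : IsWeightVector p0 p1 b y) :
    actD N M n m p0 p1 (x ⊗ₜ y) ≠ 0 := by
  rw [actD, dElem_apply p1 _ _ _ a b (fun j => (b j)⁻¹)]
  · refine smul_ne_zero (List.prod_ne_zero ?_) (tmul_ne_zero hx.1 hy.1)
    rw [List.mem_map]
    rintro ⟨i, -, h⟩
    refine List.prod_ne_zero ?_ h
    rw [List.mem_map]
    rintro ⟨j, -, h⟩
    obtain ⟨u, hu, hu'⟩ := hN.2 i _ (hx.hasEigenvalue i)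
    obtain ⟨v, hv, hv'⟩ := hM.2 j _ (hy.hasEigenvalue j)
    simp only [← hu', ← hv'] at h
    exact dFactor_ne_zero h₁ h₂ hd hu hv h
  · intro i
    exact (congrArg (· ⊗ₜ[ℂ] y) (hx.2 i)).trans (TensorProduct.smul_tmul' _ _ _).symm
  · intro j
    exact (congrArg (x ⊗ₜ[ℂ] ·) (hy.2 j)).trans (TensorProduct.tmul_smul _ _ _)
  · intro j
    exact (congrArg (x ⊗ₜ[ℂ] ·) (hy.Xinv_smul j)).trans (TensorProduct.tmul_smul _ _ _)

/-- On an outer tensor product of simple modules of disjoint types, the denominator acts by a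
nonzero scalar. -/
theorem exists_isAdmissible_pair (h₁ : IsInvariantZZ2 p1 J₁) (h₂ : IsInvariantZZ2 p1 J₂)
    (hd : Disjoint J₁ J₂) [IsSimpleModule (HB n p0 p1) N] [IsSimpleModule (HB m p0 p1) M]
    (hN : IsOfType (n := n) p0 p1 J₁ N) (hM : IsOfType (n := m) p0 p1 J₂ M) :
    ∃ l, (pairDatum p0 p1 hr).IsAdmissible (N ⊗[ℂ] M) l := by
  have := hN.1
  have := hM.1
  have := IsSimpleModule.nontrivial (HB n p0 p1) N
  have := IsSimpleModule.nontrivial (HB m p0 p1) M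
  have := tensor_isSimpleModule (A := HB n p0 p1) (B := HB m p0 p1) (N := N) (M := M)
  obtain ⟨l, hl⟩ := exists_central_scalar (N := N ⊗[ℂ] M) (commute_denomA p0 p1 hr)
  refine ⟨l, ?_, hl, fun a ha x => ?_⟩
  · rintro rfl
    obtain ⟨a, x, hx⟩ := exists_isWeightVector (r := n) (p0 := p0) (p1 := p1) N
    obtain ⟨b, y, hy⟩ := exists_isWeightVector (r := m) (p0 := p0) (p1 := p1) M
    obtain ⟨d, d', h1, h2⟩ := exists_denomA_eq p0 p1 hr
    refine actD_weight_ne_zero p0 p1 h₁ h₂ hd hN hM hx hy ?_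
    have := hl (d' • (x ⊗ₜ[ℂ] y))
    rwa [h1, ← mul_smul, mul_assoc, h2, mul_one, zero_smul, pairD_smul] at this
  · have : a = 0 := blockRep_injective p0 p1 hr (by rw [map_zero]; exact ha)
    rw [this, zero_smul]

theorem mem_of_hasEigenvalue_blockX (hN : IsOfType (n := n) p0 p1 J₁ N)
    (hM : IsOfType (n := m) p0 p1 J₂ M) {k : Fin r}
    {a : ℂ} (h : Module.End.HasEigenvalue
      (Algebra.lsmul ℂ ℂ (N ⊗[ℂ] M) (blockX p0 p1 hr k)) a) :
    (k.val < n ∧ ∃ u ∈ J₁, (u : ℂ) = a) ∨ (¬ k.val < n ∧ ∃ u ∈ J₂, (u : ℂ) = a) := by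
  change Module.End.HasEigenvalue (tensorAction (HB n p0 p1) (HB m p0 p1) N M _) a at h
  rcases exists_pos hr k with ⟨i, rfl⟩ | ⟨i, rfl⟩
  · rw [blockX_posL, tensorAction_tmul_one] at h
    exact .inl ⟨i.2, hN.2 i a (hasEigenvalue_of_rTensor h)⟩
  · rw [blockX_posR, tensorAction_one_tmul] at h
    exact .inr ⟨by simp [posR], hM.2 i a (hasEigenvalue_of_lTensor h)⟩

/-- A lower set of positions that has `n` elements consists of the first `n` positions. -/
theorem lt_iff_of_sorted {Q : Fin r → Prop} (hQ : ∀ i j, j < i → Q i → Q j)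
    (π : Equiv.Perm (Fin r)) (hπ : ∀ i, Q (π i) ↔ i.val < n) (i : Fin r) : Q i ↔ i.val < n := by
  classical
  let S : Finset (Fin r) := Finset.univ.filter Q
  let I : Finset (Fin r) := Finset.univ.filter fun i => i.val < n
  have hcard : S.card = I.card := by
    refine (Finset.card_bij (fun i _ => π i) ?_ (fun a _ b _ h => π.injective h) ?_).symm
    · intro i hi
      simpa [S, hπ, I] using hi
    · intro i hi
      exact ⟨π.symm i, by simpa [S, I, ← hπ] using hi, by simp⟩
  have hSI : S = I := by
    by_cases h : S ⊆ I
    · exact Finset.eq_of_subset_of_card_le h hcard.ge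
    · obtain ⟨s, hs, hs'⟩ := Finset.not_subset.1 h
      refine (Finset.eq_of_subset_of_card_le (fun i hi => ?_) hcard.le).symm
      simp only [S, I, Finset.mem_filter, Finset.mem_univ, true_and] at hs hs' hi ⊢
      exact hQ s i (Fin.lt_def.2 (by omega)) hs
  have := Finset.ext_iff.1 hSI i
  simpa [S, I] using this

theorem separated_of_mem (h₁ : IsInvariantZZ2 p1 J₁) {a b : ℂˣ} (ha : a ∈ J₁) (hb : b ∉ J₁) :
    (b : ℂ) ≠ (p1 : ℂ) ^ 2 * (a : ℂ) ∧ (a : ℂ) ≠ (p1 : ℂ) ^ 2 * (b : ℂ) := by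
  constructor
  · intro h
    refine hb ?_
    have : b = a * p1 ^ 2 := Units.ext (by rw [h]; push_cast; ring)
    rw [this]
    exact h₁.mul_sq_mem ha
  · intro h
    refine hb ?_
    have e : a = p1 ^ 2 * b := Units.ext (by rw [h]; push_cast; ring)
    have := h₁ a ha (-1) 1
    convert this using 1
    rw [e]
    simp [mul_comm]

variable (N M) in
/-- The product of simple modules of disjoint types is simple. -/
theorem diamond_isSimpleModule (h₁ : IsInvariantZZ2 p1 J₁) (h₂ : IsInvariantZZ2 p1 J₂)
    (hd : Disjoint J₁ J₂) [IsSimpleModule (HB n p0 p1) N] [IsSimpleModule (HB m p0 p1) M]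
    (hN : IsOfType (n := n) p0 p1 J₁ N) (hM : IsOfType (n := m) p0 p1 J₂ M) :
    IsSimpleModule (HB r p0 p1) (Diamond N M p0 p1 hr) ∧
      IsOfType (n := r) p0 p1 (J₁ ∪ J₂) (Diamond N M p0 p1 hr) := by
  have := hN.1
  have := hM.1
  have := tensor_isSimpleModule (A := HB n p0 p1) (B := HB m p0 p1) (N := N) (M := M)
  have hcl := isBalancedProduct_diamond p0 p1 hr N M
  obtain ⟨l, hE⟩ := exists_isAdmissible_pair p0 p1 hr h₁ h₂ hd hN hM
  have hfin := hcl.finiteDimensional hE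
  have htype : ∀ (i : Fin r) (a : ℂ), Module.End.HasEigenvalue
      (Algebra.lsmul ℂ ℂ (Diamond N M p0 p1 hr) (HB.X p0 p1 i)) a → ∃ u ∈ J₁ ∪ J₂, (u : ℂ) = a := by
    intro i a h
    obtain ⟨d, hd⟩ := h.exists_hasEigenvector
    obtain ⟨s, hs⟩ := hcl.exists_hasEigenvalue hE hd.2 {i} (fun _ => a) (by
      rintro _ rfl
      exact hd.apply_eq_smul)
    rcases mem_of_hasEigenvalue_blockX p0 p1 hr hN hM (hs i rfl) with ⟨-, u, hu, e⟩ | ⟨-, u, hu, e⟩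
    · exact ⟨u, .inl hu, e⟩
    · exact ⟨u, .inr hu, e⟩
  refine ⟨hcl.isSimpleModule hE fun U hU => ?_, hfin, htype⟩
  have : Nontrivial U := Submodule.nontrivial_iff_ne_bot.2 hU
  have : FiniteDimensional ℂ U :=
    FiniteDimensional.of_injective (U.subtype.restrictScalars ℂ) Subtype.val_injective
  -- A submodule contains a weight vector whose weights in `J₁` come first; only the trivial
  -- shuffle can contribute to it.
  obtain ⟨a, d, hwt, hsort⟩ := exists_sorted_weight (r := r) (p0 := p0) (p1 := p1) (L := U)
    (fun c => ∃ u ∈ J₁, (u : ℂ) = c) (by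
      rintro a x hx i j ⟨u, hu, e⟩ hj
      rw [← e, ← Units.val_mk0 (hx.ne_zero j)]
      exact separated_of_mem p1 h₁ hu fun h => hj ⟨_, h, rfl⟩)
  have hd0 : (d : Diamond N M p0 p1 hr) ≠ 0 := fun h => hwt.1 (Subtype.ext h)
  have hdwt : ∀ i, HB.X p0 p1 i • (d : Diamond N M p0 p1 hr) = a i • (d : Diamond N M p0 p1 hr) :=
    fun i => congrArg Subtype.val (hwt.2 i)
  -- the positions of the weight with value in `J₁` are read off from any contributing shuffle
  have hcol : ∀ s : {π : Equiv.Perm (Fin r) // IsShuffle n π}, (∀ i, Module.End.HasEigenvalue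
      (Algebra.lsmul ℂ ℂ (N ⊗[ℂ] M) (blockX p0 p1 hr (s.1.symm i))) (a i)) →
      ∀ k, (∃ u ∈ J₁, (u : ℂ) = a (s.1 k)) ↔ k.val < n := by
    intro s hs k
    have := hs (s.1 k)
    rw [Equiv.symm_apply_apply] at this
    rcases mem_of_hasEigenvalue_blockX p0 p1 hr hN hM this with ⟨h1, h2⟩ | ⟨h1, v, hv, e⟩
    · exact ⟨fun _ => h1, fun _ => h2⟩
    · refine ⟨?_, fun h => absurd h h1⟩
      rintro ⟨u, hu, e'⟩
      have : u = v := Units.ext (e'.trans e.symm)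
      exact absurd hv (Set.disjoint_left.1 hd (this ▸ hu))
  obtain ⟨s, hs⟩ := hcl.exists_hasEigenvalue hE hd0 Set.univ a (fun i _ => hdwt i)
  have hlt := lt_iff_of_sorted (Q := fun i => ∃ u ∈ J₁, (u : ℂ) = a i) hsort s.1
    (hcol s fun i => hs i trivial)
  obtain ⟨x, hx⟩ := hcl.exists_eq_cl_one hE a hdwt (by
    intro s' hs'
    by_contra! hcon
    refine hs' (Subtype.ext (s'.2.eq_one fun k => ?_))
    rw [← hcol s' hcon k]
    exact hlt _)
  refine ⟨x, ?_, hx ▸ d.2⟩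
  rintro rfl
  exact hd0 (by rw [hx, map_zero])

end DiamondSimple

/-! ### Simple submodules and central polynomials -/

section SimplePair

theorem exists_isSimpleModule_submodule (A W : Type*) [Ring A] [Algebra ℂ A] [AddCommGroup W]
    [Module ℂ W] [Module A W] [IsScalarTower ℂ A W] [FiniteDimensional ℂ W] [Nontrivial W] :
    ∃ N : Submodule A W, IsSimpleModule A N := by
  have : IsArtinian A W := isArtinian_of_tower ℂ inferInstance
  obtain ⟨N, hN⟩ := IsAtomic.exists_atom (Submodule A W)
  exact ⟨N, isSimpleModule_iff_isAtom.2 hN⟩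

/-- A nonzero finite-dimensional module over `A ⊗ B` receives a nonzero map from an outer tensor
product of simple modules: take a simple `A`-submodule `N`, and a simple `B`-submodule of the
multiplicity space `Hom_A(N, W)`. -/
theorem exists_simple_tensor_hom {A B : Type*} [Ring A] [Ring B] [Algebra ℂ A] [Algebra ℂ B]
    (W : Type w) [AddCommGroup W] [Module ℂ W] [Module (A ⊗[ℂ] B) W]
    [IsScalarTower ℂ (A ⊗[ℂ] B) W] [FiniteDimensional ℂ W] [Nontrivial W] :
    ∃ (N : Type w) (_ : AddCommGroup N) (_ : Module ℂ N) (_ : Module A N) (_ : IsScalarTower ℂ A N)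
      (M : Type w) (_ : AddCommGroup M) (_ : Module ℂ M) (_ : Module B M) (_ : IsScalarTower ℂ B M),
      (IsSimpleModule A N ∧ FiniteDimensional ℂ N) ∧ (IsSimpleModule B M ∧ FiniteDimensional ℂ M) ∧
      (∃ φ : N ⊗[ℂ] M →ₗ[ℂ] W, φ ≠ 0 ∧
        ∀ (a : A) (b : B) (x : N) (y : M), φ ((a • x) ⊗ₜ (b • y)) = (a ⊗ₜ[ℂ] b) • φ (x ⊗ₜ y)) ∧
      (∀ a c, Module.End.HasEigenvalue (Algebra.lsmul (A := A) ℂ ℂ N a) c →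
        ∃ v : W, v ≠ 0 ∧ (a ⊗ₜ[ℂ] (1 : B)) • v = c • v) ∧
      (∀ b c, Module.End.HasEigenvalue (Algebra.lsmul (A := B) ℂ ℂ M b) c →
        ∃ v : W, v ≠ 0 ∧ ((1 : A) ⊗ₜ[ℂ] b) • v = c • v) := by
  let _ : Module A W := Module.compHom W
    (Algebra.TensorProduct.includeLeft (R := ℂ) (S := ℂ) (A := A) (B := B)).toRingHom
  let _ : Module B W := Module.compHom W
    (Algebra.TensorProduct.includeRight (R := ℂ) (A := A) (B := B)).toRingHom
  have hA : ∀ (a : A) (v : W), a • v = (a ⊗ₜ[ℂ] (1 : B)) • v := fun _ _ => rfl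
  have hB : ∀ (b : B) (v : W), b • v = ((1 : A) ⊗ₜ[ℂ] b) • v := fun _ _ => rfl
  have : IsScalarTower ℂ A W := ⟨fun c a v => by
    rw [hA, hA, ← TensorProduct.smul_tmul', smul_assoc]⟩
  have : IsScalarTower ℂ B W := ⟨fun c b v => by
    rw [hB, hB, TensorProduct.tmul_smul, smul_assoc]⟩
  have : SMulCommClass A B W := ⟨fun a b v => by
    rw [hA, hB, hA, hB, ← mul_smul, ← mul_smul]
    simp⟩
  obtain ⟨N, hN⟩ := exists_isSimpleModule_submodule A W
  have hfN : FiniteDimensional ℂ N :=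
    FiniteDimensional.of_injective (N.subtype.restrictScalars ℂ) Subtype.val_injective
  have hfH : FiniteDimensional ℂ (N →ₗ[A] W) :=
    FiniteDimensional.of_injective (LinearMap.restrictScalarsₗ ℂ A N W ℂ)
      (LinearMap.restrictScalars_injective _)
  have hnt : Nontrivial (N →ₗ[A] W) := by
    have := IsSimpleModule.nontrivial A N
    obtain ⟨x, hx⟩ := exists_ne (0 : N)
    exact ⟨N.subtype, 0, fun h => hx (Subtype.ext (DFunLike.congr_fun h x))⟩
  -- `B` acts on the multiplicity space, as it commutes with `A`.
  obtain ⟨M, hM⟩ := exists_isSimpleModule_submodule B (N →ₗ[A] W)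
  have hfM : FiniteDimensional ℂ M :=
    FiniteDimensional.of_injective (M.subtype.restrictScalars ℂ) Subtype.val_injective
  refine ⟨N, inferInstance, inferInstance, inferInstance, inferInstance, M, inferInstance,
    inferInstance, inferInstance, inferInstance, ⟨hN, hfN⟩, ⟨hM, hfM⟩, ?_, ?_, ?_⟩
  · let e : N →ₗ[ℂ] M →ₗ[ℂ] W := LinearMap.mk₂ ℂ (fun x f => (f : N →ₗ[A] W) x)
      (fun x y f => map_add _ x y) (fun c x f => LinearMap.map_smul_of_tower _ c x)
      (fun x f g => rfl) (fun c x f => rfl)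
    refine ⟨TensorProduct.lift e, ?_, ?_⟩
    · intro h
      have := IsSimpleModule.nontrivial B M
      obtain ⟨f, hf⟩ := exists_ne (0 : M)
      refine hf (Subtype.ext (LinearMap.ext fun x => ?_))
      exact DFunLike.congr_fun h (x ⊗ₜ f)
    · intro a b x f
      change b • (f : N →ₗ[A] W) (a • x) = (a ⊗ₜ[ℂ] b) • (f : N →ₗ[A] W) x
      rw [map_smul, hA, hB, ← mul_smul]
      simp
  · intro a c h
    obtain ⟨x, hx⟩ := h.exists_hasEigenvector
    exact ⟨x, fun h0 => hx.2 (Subtype.ext h0), congrArg Subtype.val hx.apply_eq_smul⟩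
  · intro b c h
    obtain ⟨f, hf⟩ := h.exists_hasEigenvector
    have hne : ∃ x, (f : N →ₗ[A] W) x ≠ 0 := by
      by_contra! hcon
      exact hf.2 (Subtype.ext (LinearMap.ext hcon))
    obtain ⟨x, hx⟩ := hne
    have h1 : b • f = c • f := hf.apply_eq_smul
    exact ⟨_, hx, DFunLike.congr_fun (congrArg Subtype.val h1) x⟩

end SimplePair

section CentralCharacter

variable {A V ι : Type*} [Ring A] [Algebra ℂ A] [AddCommGroup V] [Module ℂ V] [Module A V]
  [IsScalarTower ℂ A V]

theorem list_prod_smul_eq_zero {l : List ι} (f : ι → A) (hf : ∀ i k, Commute (f i) (f k)) {i : ι}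
    (hi : i ∈ l) {v : V} (h : f i • v = 0) : (l.map f).prod • v = 0 := by
  induction l with
  | nil => simp at hi
  | cons k l ih =>
    rw [List.map_cons, List.prod_cons]
    rcases List.mem_cons.1 hi with rfl | hi
    · have : Commute (f i) (l.map f).prod := Commute.list_prod_right _ _ (by
        simp only [List.mem_map]
        rintro _ ⟨k, -, rfl⟩
        exact hf i k)
      rw [this.eq, mul_smul, h, smul_zero]
    · rw [mul_smul, ih hi, smul_zero]

theorem list_prod_smul_eq {l : List ι} (f : ι → A) (c : ι → ℂ) {v : V}
    (h : ∀ i, f i • v = c i • v) : (l.map f).prod • v = (l.map c).prod • v := by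
  have := list_prod_apply_eq l (fun i => Algebra.lsmul ℂ ℂ V (f i)) c h
  rw [← this]
  change Algebra.lsmul ℂ ℂ V (l.map f).prod v = _
  rw [map_list_prod, List.map_map]
  rfl

/-- If the polynomial `∏_k (t - d_k)` has central coefficients, the eigenvalues of the `d_i` on a
cyclic module generated by a common eigenvector `u` are among their eigenvalues on `u`. -/
theorem exists_eq_of_central {l : List ι} {d : ι → A} (hd : ∀ i k, Commute (d i) (d k))
    (hc : ∀ (t : ℂ) (a : A) (x : V), a • (l.map fun k => algebraMap ℂ A t - d k).prod • x
      = (l.map fun k => algebraMap ℂ A t - d k).prod • a • x)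
    {u v : V} {θ : ι → ℂ} (hu : ∀ k, d k • u = θ k • u) (hv : v ∈ Submodule.span A {u}) (hv0 : v ≠ 0)
    {i : ι} (hi : i ∈ l) {β : ℂ} (h : d i • v = β • v) : ∃ k, β = θ k := by
  obtain ⟨a, rfl⟩ := Submodule.mem_span_singleton.1 hv
  have h1 : (l.map fun k => algebraMap ℂ A β - d k).prod • a • u = 0 := by
    refine list_prod_smul_eq_zero _ (fun i k => ?_) hi ?_
    · exact ((Algebra.commute_algebraMap_left _ _).sub_right
        (Algebra.commute_algebraMap_left _ _)).sub_left
        ((Algebra.commute_algebraMap_right _ _).sub_right (hd i k))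
    · rw [sub_smul, h, algebraMap_smul, sub_self]
  -- The product at `t = β` annihilates `v = a u`, and being central acts on it by the scalar it
  -- has on `u`.
  have h2 : (l.map fun k => algebraMap ℂ A β - d k).prod • u = (l.map fun k => β - θ k).prod • u :=
    list_prod_smul_eq _ _ fun k => by rw [sub_smul, hu, algebraMap_smul, sub_smul]
  rw [← hc, h2, smul_comm] at h1
  have h3 := (smul_eq_zero.1 h1).resolve_right hv0
  rw [List.prod_eq_zero_iff, List.mem_map] at h3
  obtain ⟨k, -, hk⟩ := h3
  exact ⟨k, sub_eq_zero.1 hk⟩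

theorem eq_or_eq_inv_of_add_inv_eq {b c : ℂ} (hb : b ≠ 0) (hc : c ≠ 0) (h : b + b⁻¹ = c + c⁻¹) :
    b = c ∨ b = c⁻¹ := by
  have : (b - c) * (b - c⁻¹) = 0 := by
    have h1 : b ^ 2 + 1 = (c + c⁻¹) * b := by rw [← h]; field_simp
    have h2 : c * c⁻¹ = 1 := mul_inv_cancel₀ hc
    linear_combination h1 + h2
  rcases mul_eq_zero.1 this with h | h
  · exact .inl (sub_eq_zero.1 h)
  · exact .inr (sub_eq_zero.1 h)

variable {n : ℕ} (p0 p1 : ℂˣ)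

theorem simpleAut_prod_trace (t : ℂ) (i : Fin n) :
    simpleAut id i (∏ k : Fin n, (algebraMap ℂ (RatField n) t - (kX k + (kX k)⁻¹)))
      = ∏ k : Fin n, (algebraMap ℂ (RatField n) t - (kX k + (kX k)⁻¹)) := by
  obtain ⟨π, ε, h⟩ := simpleAut_eq_signedAut i
  rw [h, map_prod]
  refine Eq.trans ?_ (Equiv.prod_comp π
    (fun k => algebraMap ℂ (RatField n) t - (kX k + (kX k)⁻¹)))
  refine Finset.prod_congr rfl fun k _ => ?_
  rw [map_sub, map_add, map_inv₀, AlgEquiv.commutes, signedAut_kX]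
  rcases Int.units_eq_one_or (ε k) with e | e <;> simp [e, add_comm]

theorem HB.commute_prod_trace (t : ℂ) (a : HB n p0 p1) : Commute a
    ((List.finRange n).map fun k => algebraMap ℂ (HB n p0 p1) t - (HB.X p0 p1 k + HB.Xinv p0 p1 k)).prod := by
  have hz : stdRep n p0 p1 ((List.finRange n).map fun k => algebraMap ℂ (HB n p0 p1) t -
      (HB.X p0 p1 k + HB.Xinv p0 p1 k)).prod = Algebra.lmul ℂ (RatField n)
        (∏ k : Fin n, (algebraMap ℂ (RatField n) t - (kX k + (kX k)⁻¹))) := by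
    rw [Fin.prod_univ_def, map_list_prod, map_list_prod, List.map_map, List.map_map]
    congr 1
    refine List.map_congr_left fun k _ => ?_
    simp only [Function.comp_apply, map_sub, map_add, AlgHom.commutes, varRep_X, varRep_Xinv, id]
  refine varRep_injective Function.injective_id p0 p1 ?_
  rw [map_mul, map_mul, hz]
  refine (commute_of_generators (stdRep n p0 p1) (fun i => ?_) (fun i => ?_) a).eq
  · rw [stdRep_T]
    exact dlOp_mul_lmul_of_fix (simpleAut_prod_trace t i)
  · rw [varRep_X]
    exact (Commute.all _ _).map _

end CentralCharacter

/-! ### Decomposition of simple modules -/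

section ActsBy

variable {r : ℕ} {p0 p1 : ℂˣ} {L : Type*} [AddCommGroup L] [Module ℂ L] [Module (HB r p0 p1) L]
  [IsScalarTower ℂ (HB r p0 p1) L] {x : L} {f g : RatField r} {c d : ℂ}

/-- The Laurent polynomial `f`, seen as an element of `H_r^B`, acts on `x` by the scalar `c`. -/
def ActsBy (p0 p1 : ℂˣ) [Module (HB r p0 p1) L] (x : L) (f : RatField r) (c : ℂ) : Prop :=
  ∃ h, stdRep r p0 p1 h = Algebra.lmul ℂ (RatField r) f ∧ h • x = c • x

theorem ActsBy.const (x : L) (c : ℂ) : ActsBy p0 p1 x (algebraMap ℂ (RatField r) c) c :=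
  ⟨algebraMap ℂ _ c, by rw [AlgHom.commutes, AlgHom.commutes], algebraMap_smul _ _ _⟩

theorem ActsBy.sub (hf : ActsBy p0 p1 x f c) (hg : ActsBy p0 p1 x g d) :
    ActsBy p0 p1 x (f - g) (c - d) := by
  obtain ⟨h, e, hh⟩ := hf
  obtain ⟨k, e', hk⟩ := hg
  exact ⟨h - k, by rw [map_sub, map_sub, e, e'], by rw [sub_smul, sub_smul, hh, hk]⟩

theorem ActsBy.mul (hf : ActsBy p0 p1 x f c) (hg : ActsBy p0 p1 x g d) :
    ActsBy p0 p1 x (f * g) (c * d) := by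
  obtain ⟨h, e, hh⟩ := hf
  obtain ⟨k, e', hk⟩ := hg
  exact ⟨h * k, by rw [map_mul, map_mul, e, e'], by
    rw [mul_smul, hk, smul_comm, hh, smul_smul, mul_comm]⟩

theorem ActsBy.pow (hf : ActsBy p0 p1 x f c) (k : ℕ) : ActsBy p0 p1 x (f ^ k) (c ^ k) := by
  induction k with
  | zero => simpa using ActsBy.const (p0 := p0) (p1 := p1) x 1
  | succ k ih => rw [pow_succ, pow_succ]; exact ih.mul hf

theorem ActsBy.smul (hf : ActsBy p0 p1 x f c) (d : ℂ) : ActsBy p0 p1 x (d • f) (d • c) := by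
  rw [Algebra.smul_def, smul_eq_mul]
  exact (ActsBy.const x d).mul hf

theorem ActsBy.prod {ι : Type*} (s : Finset ι) {f : ι → RatField r} {c : ι → ℂ}
    (h : ∀ i, ActsBy p0 p1 x (f i) (c i)) : ActsBy p0 p1 x (∏ i ∈ s, f i) (∏ i ∈ s, c i) := by
  classical
  induction s using Finset.induction_on with
  | empty => simpa using ActsBy.const (p0 := p0) (p1 := p1) x 1
  | insert i s hi ih => rw [Finset.prod_insert hi, Finset.prod_insert hi]; exact (h i).mul ih

theorem IsWeightVector.actsBy_kX {a : Fin r → ℂ} (h : IsWeightVector p0 p1 a x) (i : Fin r) :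
    ActsBy p0 p1 x (kX i) (a i) := ⟨_, varRep_X _ p0 p1 i, h.2 i⟩

theorem IsWeightVector.actsBy_kX_inv {a : Fin r → ℂ} (h : IsWeightVector p0 p1 a x) (i : Fin r) :
    ActsBy p0 p1 x (kX i)⁻¹ (a i)⁻¹ := ⟨_, varRep_Xinv _ p0 p1 i, h.Xinv_smul i⟩

theorem ActsBy.smul_eq (hf : ActsBy p0 p1 x f c) {h : HB r p0 p1}
    (hh : stdRep r p0 p1 h = Algebra.lmul ℂ (RatField r) f) : h • x = c • x := by
  obtain ⟨k, e, hk⟩ := hf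
  rw [varRep_injective Function.injective_id p0 p1 (hh.trans e.symm), hk]

end ActsBy

namespace CosetDatum

variable {r : ℕ} {p0 p1 : ℂˣ} {A : Type*} [Ring A] [Algebra ℂ A] (D : CosetDatum r p0 p1 A)

/-- An eigenvector of the denominator in an `H_r^B`-module generates a cyclic `𝔄`-module. -/
theorem exists_cyclic {L : Type w} [AddCommGroup L] [Module ℂ L] [Module (HB r p0 p1) L]
    [IsScalarTower ℂ (HB r p0 p1) L] [FiniteDimensional ℂ L] {l : ℂ} (hl : l ≠ 0) {x : L}
    (hx : D.zH • x = l • x) :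
    ∃ (W : Type w) (_ : AddCommGroup W) (_ : Module ℂ W) (_ : Module A W) (_ : IsScalarTower ℂ A W)
      (φ : W →ₗ[ℂ] L) (y : W), FiniteDimensional ℂ W ∧ Function.Injective φ ∧ φ y = x ∧
      (∀ v, v ∈ Submodule.span A {y}) ∧ (∀ v : W, D.zA • v = l • v) ∧
      (∀ a : A, D.j a = 0 → ∀ v : W, a • v = 0) ∧
      ∀ (a : A) (k : ℕ) (h : HB r p0 p1), D.j a * D.j D.zA ^ k = stdRep r p0 p1 h →
        ∀ v : W, h • φ v = l ^ k • φ (a • v) := by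
  obtain ⟨act, h1, h2⟩ := D.exists_action (L := L) hl
  let _ : Module A (D.zSpace L l) := Module.compHom _ act.toRingHom
  have hact : ∀ (a : A) (v : D.zSpace L l), a • v = act a v := fun _ _ => rfl
  have : IsScalarTower ℂ A (D.zSpace L l) := ⟨fun c a v => by
    rw [hact, hact, map_smul]; rfl⟩
  let y : D.zSpace L l := ⟨x, D.mem_zSpace.2 hx⟩
  let W : Submodule A (D.zSpace L l) := Submodule.span A {y}
  let φ : W →ₗ[ℂ] L := (D.zSpace L l).subtype.comp (W.subtype.restrictScalars ℂ)
  have hφ : ∀ v, φ v = ((v : D.zSpace L l) : L) := fun _ => rfl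
  have hinj : Function.Injective φ := fun v w h => Subtype.ext (Subtype.ext h)
  have hmul : ∀ (a : A) (k : ℕ) (h : HB r p0 p1), D.j a * D.j D.zA ^ k = stdRep r p0 p1 h →
        ∀ v : W, h • φ v = l ^ k • φ (a • v) := fun a k h e v => h1 a k h e v
  refine ⟨W, inferInstance, inferInstance, inferInstance, inferInstance, φ,
    ⟨y, Submodule.mem_span_singleton_self y⟩, FiniteDimensional.of_injective φ hinj, hinj, rfl,
    ?_, ?_, ?_, hmul⟩
  · rintro ⟨v, hv⟩
    obtain ⟨a, rfl⟩ := Submodule.mem_span_singleton.1 hv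
    exact Submodule.mem_span_singleton.2 ⟨a, rfl⟩
  · intro v
    refine hinj ?_
    have := hmul D.zA 0 D.zH (by rw [pow_zero, mul_one, D.j_zA]) v
    rw [pow_zero, one_smul] at this
    rw [← this, map_smul, hφ]
    exact D.mem_zSpace.1 (v : D.zSpace L l).2
  · intro a ha v
    refine Subtype.ext ?_
    change act a v = 0
    rw [h2 a ha]
    rfl

end CosetDatum

section CentralCharacter

variable {n : ℕ} {p0 p1 : ℂˣ} {B V : Type*} [Ring B] [Algebra ℂ B] [AddCommGroup V] [Module ℂ V]
  [Module B V] [IsScalarTower ℂ B V]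

theorem Xinv_smul_of_X_smul (j : HB n p0 p1 →ₐ[ℂ] B) {i : Fin n} {v : V} {b : ℂ} (hb : b ≠ 0)
    (h : j (HB.X p0 p1 i) • v = b • v) : j (HB.Xinv p0 p1 i) • v = b⁻¹ • v := by
  have h1 : v = b • j (HB.Xinv p0 p1 i) • v := by
    rw [smul_comm, ← h, ← mul_smul, ← map_mul, HB.Xinv_mul_X, map_one, one_smul]
  conv_rhs => rw [h1, smul_smul, inv_mul_cancel₀ hb, one_smul]

/-- The eigenvalues of the `X_i` on a cyclic module generated by a weight vector are the weights or
their inverses, provided that the centre of `H_n^B` acts centrally. -/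
theorem exists_eq_or_eq_inv (j : HB n p0 p1 →ₐ[ℂ] B)
    (hj : ∀ q : HB n p0 p1, (∀ a, Commute a q) → ∀ c : B, Commute c (j q))
    {u v : V} {a : Fin n → ℂ} (ha : ∀ k, a k ≠ 0) (hu : ∀ k, j (HB.X p0 p1 k) • u = a k • u)
    (hv : v ∈ Submodule.span B {u}) (hv0 : v ≠ 0) {i : Fin n} {b : ℂ} (hb : b ≠ 0)
    (h : j (HB.X p0 p1 i) • v = b • v) : ∃ k, b = a k ∨ b = (a k)⁻¹ := by
  obtain ⟨k, hk⟩ := exists_eq_of_central (l := List.finRange n)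
    (d := fun k => j (HB.X p0 p1 k + HB.Xinv p0 p1 k)) (θ := fun k => a k + (a k)⁻¹)
    (fun i k => by
      have hX : Commute (HB.X p0 p1 i) (HB.X p0 p1 k) := HB.X_comm p0 p1 i k
      have hXY : ∀ i k : Fin n, Commute (HB.X p0 p1 i) (HB.Xinv p0 p1 k) := fun i k =>
        HB.commute_Xinv p0 p1 (HB.X_comm p0 p1 i k)
      have hY : Commute (HB.Xinv p0 p1 i) (HB.Xinv p0 p1 k) := HB.commute_Xinv p0 p1 (hXY k i).symm.eq
      exact ((hX.add_right (hXY i k)).add_left ((hXY k i).symm.add_right hY)).map j)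
    (fun t c x => by
      have := hj _ (HB.commute_prod_trace p0 p1 t) c
      rw [map_list_prod, List.map_map] at this
      have e : (List.finRange n).map (fun k => algebraMap ℂ B t - j (HB.X p0 p1 k + HB.Xinv p0 p1 k))
          = (List.finRange n).map (j ∘ fun k => algebraMap ℂ (HB n p0 p1) t -
            (HB.X p0 p1 k + HB.Xinv p0 p1 k)) :=
        List.map_congr_left fun k _ => by rw [Function.comp_apply, map_sub, AlgHom.commutes]
      rw [e, ← mul_smul, ← mul_smul, this.eq])
    (fun k => by rw [map_add, add_smul, add_smul, hu, Xinv_smul_of_X_smul j (ha k) (hu k)])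
    hv hv0 (List.mem_finRange i) (β := b + b⁻¹)
    (by rw [map_add, add_smul, add_smul, h, Xinv_smul_of_X_smul j hb h])
  exact ⟨k, eq_or_eq_inv_of_add_inv_eq hb (ha k) hk⟩

theorem commute_tmul_one {A B : Type*} [Ring A] [Ring B] [Algebra ℂ A] [Algebra ℂ B] {q : A}
    (hq : ∀ a, Commute a q) (c : A ⊗[ℂ] B) : Commute c (q ⊗ₜ 1) := by
  induction c using TensorProduct.induction_on with
  | zero => exact Commute.zero_left _
  | add c d hc hd => exact hc.add_left hd
  | tmul a b => simp [Commute, SemiconjBy, (hq a).eq]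

theorem commute_one_tmul {A B : Type*} [Ring A] [Ring B] [Algebra ℂ A] [Algebra ℂ B] {q : B}
    (hq : ∀ a, Commute a q) (c : A ⊗[ℂ] B) : Commute c (1 ⊗ₜ q) := by
  induction c using TensorProduct.induction_on with
  | zero => exact Commute.zero_left _
  | add c d hc hd => exact hc.add_left hd
  | tmul a b => simp [Commute, SemiconjBy, (hq b).eq]

end CentralCharacter

section Decompose

attribute [local instance] tensorModule tensor_isScalarTower

variable {n m r : ℕ} {p0 p1 : ℂˣ} (hr : n + m = r) {J₁ J₂ : Set ℂˣ} {L : Type w} [AddCommGroup L]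
  [Module ℂ L] [Module (HB r p0 p1) L] [IsScalarTower ℂ (HB r p0 p1) L]

theorem exists_threshold {Q : Fin r → Prop} (hQ : ∀ i j, j < i → Q i → Q j) :
    ∃ n ≤ r, ∀ i : Fin r, Q i ↔ i.val < n := by
  classical
  by_cases h : ∃ k, ∃ hk : k < r, ¬ Q ⟨k, hk⟩
  · obtain ⟨hlt, hn⟩ := Nat.find_spec h
    refine ⟨Nat.find h, hlt.le, fun i => ⟨fun hi => ?_, fun hi => ?_⟩⟩
    · by_contra hcon
      rcases (not_lt.1 hcon).lt_or_eq with h' | h'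
      · exact hn (hQ i _ (Fin.lt_def.2 h') hi)
      · refine hn ?_
        convert hi
    · by_contra hcon
      exact Nat.find_min h hi ⟨i.2, hcon⟩
  · push Not at h
    exact ⟨r, le_rfl, fun i => iff_of_true (h i i.2) i.2⟩

theorem IsWeightVector.exists_denomH_smul (h₁ : IsInvariantZZ2 p1 J₁) (h₂ : IsInvariantZZ2 p1 J₂)
    (hd : Disjoint J₁ J₂) {a : Fin r → ℂ} {x : L} (hx : IsWeightVector p0 p1 a x)
    (hL : ∀ i : Fin n, ∃ u ∈ J₁, (u : ℂ) = a (posL hr i))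
    (hR : ∀ i : Fin m, ∃ u ∈ J₂, (u : ℂ) = a (posR hr i)) :
    ∃ l : ℂ, l ≠ 0 ∧ denomH p0 p1 hr • x = l • x := by
  have hfac : ∀ i j, ActsBy p0 p1 x (symFactor p1 (kX (posL hr i)) (kX (posR hr j)))
      (dFactor p1 (a (posL hr i)) (a (posR hr j)) (a (posR hr j))⁻¹ * (a (posL hr i))⁻¹ ^ 3) := by
    intro i j
    have hi := hx.actsBy_kX (posL hr i)
    have hj := hx.actsBy_kX (posR hr j)
    have hj' := hx.actsBy_kX_inv (posR hr j)
    exact ((((((hi.sub (hj.smul _)).mul (hi.sub (hj.smul _))).mul (hi.sub (hj'.smul _))).mul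
      (hi.sub (hj'.smul _))).mul (hi.sub hj)).mul (hi.sub hj')).mul ((hx.actsBy_kX_inv _).pow 3)
  have := ActsBy.prod (p0 := p0) (p1 := p1) (x := x) Finset.univ fun i =>
    ActsBy.prod (p0 := p0) (p1 := p1) (x := x) Finset.univ fun j => hfac i j
  refine ⟨_, ?_, this.smul_eq (stdRep_denomH p0 p1 hr)⟩
  refine Finset.prod_ne_zero_iff.2 fun i _ => Finset.prod_ne_zero_iff.2 fun j _ => ?_
  refine mul_ne_zero ?_ (pow_ne_zero _ (inv_ne_zero (hx.ne_zero _)))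
  obtain ⟨u, hu, e⟩ := hL i
  obtain ⟨v, hv, e'⟩ := hR j
  rw [← e, ← e']
  exact dFactor_ne_zero h₁ h₂ hd hu hv

/-- A simple module with a weight vector whose first `n` weights lie in `J₁` and whose last `m`
weights lie in `J₂` is a product. -/
theorem exists_equiv_diamond (h₁ : IsInvariantZZ2 p1 J₁) (h₂ : IsInvariantZZ2 p1 J₂)
    (hd : Disjoint J₁ J₂) [FiniteDimensional ℂ L] [IsSimpleModule (HB r p0 p1) L] {a : Fin r → ℂ}
    {x : L} (hx : IsWeightVector p0 p1 a x) (hL : ∀ i : Fin n, ∃ u ∈ J₁, (u : ℂ) = a (posL hr i))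
    (hR : ∀ i : Fin m, ∃ u ∈ J₂, (u : ℂ) = a (posR hr i)) :
    ∃ (N : Type w) (_ : AddCommGroup N) (_ : Module ℂ N) (_ : Module (HB n p0 p1) N)
      (_ : IsScalarTower ℂ (HB n p0 p1) N)
      (M : Type w) (_ : AddCommGroup M) (_ : Module ℂ M) (_ : Module (HB m p0 p1) M)
      (_ : IsScalarTower ℂ (HB m p0 p1) M),
      IsSimpleModule (HB n p0 p1) N ∧ IsOfType (n := n) p0 p1 J₁ N ∧
      IsSimpleModule (HB m p0 p1) M ∧ IsOfType (n := m) p0 p1 J₂ M ∧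
      Nonempty (L ≃ₗ[HB r p0 p1] Diamond N M p0 p1 hr) := by
  obtain ⟨l, hl, hz⟩ := hx.exists_denomH_smul hr h₁ h₂ hd hL hR
  obtain ⟨W, _, _, _, _, ψ, y, _, hψ, hy, hspan, hzW, hkW, hmul⟩ :=
    (pairDatum p0 p1 hr).exists_cyclic hl hz
  have hy0 : y ≠ 0 := by rintro rfl; exact hx.1 (by rw [← hy, map_zero])
  have : Nontrivial W := ⟨y, 0, hy0⟩
  have hact : ∀ (c : HB n p0 p1 ⊗[ℂ] HB m p0 p1) (h : HB r p0 p1) (b : ℂ),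
      blockRep p0 p1 hr c = stdRep r p0 p1 h → h • x = b • x → c • y = b • y := by
    intro c h b e hb
    have := hmul c 0 h (by rw [pow_zero, mul_one]; exact e) y
    rw [pow_zero, one_smul, hy, hb, ← hy, ← map_smul] at this
    exact (hψ this).symm
  have hXL : ∀ i : Fin n, (HB.X p0 p1 i ⊗ₜ[ℂ] (1 : HB m p0 p1)) • y = a (posL hr i) • y := fun i =>
    hact _ (HB.X p0 p1 (posL hr i)) _ (by
      rw [pairRep_tmul, map_one, mul_one, varRep_X, varRep_X]; rfl) (hx.2 _)
  have hXR : ∀ i : Fin m, ((1 : HB n p0 p1) ⊗ₜ[ℂ] HB.X p0 p1 i) • y = a (posR hr i) • y := fun i =>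
    hact _ (HB.X p0 p1 (posR hr i)) _ (by
      rw [pairRep_tmul, map_one, one_mul, varRep_X, varRep_X]; rfl) (hx.2 _)
  obtain ⟨N, _, _, _, _, M, _, _, _, _, ⟨hN, hfN⟩, ⟨hM, hfM⟩, ⟨φ, hφ0, hφ⟩, heN, heM⟩ :=
    exists_simple_tensor_hom (A := HB n p0 p1) (B := HB m p0 p1) W
  -- `W` is generated by `y`, so that the polynomial with roots `X_i + X_i⁻¹` confines the
  -- eigenvalues on `N` to the first weights of `x` and their inverses.
  have hNt : IsOfType (n := n) p0 p1 J₁ N := by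
    refine ⟨hfN, fun i b hb => ?_⟩
    obtain ⟨v, hv0, hv⟩ := heN _ _ hb
    obtain ⟨k, hk⟩ := exists_eq_or_eq_inv (Algebra.TensorProduct.includeLeft (R := ℂ) (S := ℂ)
      (A := HB n p0 p1) (B := HB m p0 p1)) (fun q hq c => commute_tmul_one hq c)
      (fun k => hx.ne_zero (posL hr k)) hXL (hspan v) hv0 (eigenvalue_ne_zero hb) hv
    obtain ⟨u, hu, e⟩ := hL k
    rcases hk with rfl | rfl
    · exact ⟨u, hu, e⟩
    · exact ⟨u⁻¹, h₁.inv_mem hu, by rw [Units.val_inv_eq_inv_val, e]⟩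
  have hMt : IsOfType (n := m) p0 p1 J₂ M := by
    refine ⟨hfM, fun i b hb => ?_⟩
    obtain ⟨v, hv0, hv⟩ := heM _ _ hb
    obtain ⟨k, hk⟩ := exists_eq_or_eq_inv (Algebra.TensorProduct.includeRight (R := ℂ)
      (A := HB n p0 p1) (B := HB m p0 p1)) (fun q hq c => commute_one_tmul hq c)
      (fun k => hx.ne_zero (posR hr k)) hXR (hspan v) hv0 (eigenvalue_ne_zero hb) hv
    obtain ⟨u, hu, e⟩ := hR k
    rcases hk with rfl | rfl
    · exact ⟨u, hu, e⟩
    · exact ⟨u⁻¹, h₂.inv_mem hu, by rw [Units.val_inv_eq_inv_val, e]⟩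
  obtain ⟨l', hE⟩ := exists_isAdmissible_pair p0 p1 hr h₁ h₂ hd hNt hMt
  have hφA : ∀ (c : HB n p0 p1 ⊗[ℂ] HB m p0 p1) (v : N ⊗[ℂ] M), φ (c • v) = c • φ v := by
    intro c v
    induction c using TensorProduct.induction_on with
    | zero => rw [zero_smul, zero_smul, map_zero]
    | add c d hc hd => rw [add_smul, add_smul, map_add, hc, hd]
    | tmul c d =>
      induction v using TensorProduct.induction_on with
      | zero => rw [smul_zero, map_zero, smul_zero]
      | add v w hv hw => rw [smul_add, map_add, map_add, smul_add, hv, hw]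
      | tmul s t => rw [tmul_smul_tmul, hφ]
  obtain ⟨v, hv⟩ : ∃ v, φ v ≠ 0 := by
    by_contra! hcon
    exact hφ0 (LinearMap.ext hcon)
  -- The scalars by which the denominator acts on `N ⊗ M` and on `W` agree, as `φ ≠ 0`.
  obtain rfl : l' = l := by
    have h1 := hφA (pairDatum p0 p1 hr).zA v
    rw [hE.smul_z, map_smul, hzW] at h1
    exact smul_left_injective _ hv h1
  have hcl := isBalancedProduct_diamond p0 p1 hr N M
  obtain ⟨Φ, hΦ⟩ := hcl.exists_hom hE (ψ.comp φ) (fun c k h e s => by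
    rw [LinearMap.comp_apply, LinearMap.comp_apply, hφA]
    exact hmul c k h e (φ s))
  have hΦ0 : Φ ≠ 0 := by
    rintro rfl
    have := hΦ v
    rw [LinearMap.zero_apply, LinearMap.comp_apply] at this
    exact hv (hψ (by rw [← this, map_zero]))
  -- Both modules are simple, so that the nonzero map `Φ` is an isomorphism.
  have := (diamond_isSimpleModule p0 p1 hr N M h₁ h₂ hd hNt hMt).1
  exact ⟨N, _, _, _, inferInstance, M, _, _, _, inferInstance, hN, hNt, hM, hMt,
    ⟨(LinearEquiv.ofBijective Φ (LinearMap.bijective_of_ne_zero hΦ0)).symm⟩⟩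

/-- A simple module of type `J₁ ∪ J₂` is a product of simple modules of types `J₁` and `J₂`. -/
theorem exists_equiv_diamond_of_isOfType (h₁ : IsInvariantZZ2 p1 J₁) (h₂ : IsInvariantZZ2 p1 J₂)
    (hd : Disjoint J₁ J₂) (hs : IsSimpleModule (HB r p0 p1) L)
    (hL : IsOfType (n := r) p0 p1 (J₁ ∪ J₂) L) :
    ∃ (n m : ℕ) (hr : n + m = r)
      (N : Type w) (_ : AddCommGroup N) (_ : Module ℂ N) (_ : Module (HB n p0 p1) N)
      (_ : IsScalarTower ℂ (HB n p0 p1) N)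
      (M : Type w) (_ : AddCommGroup M) (_ : Module ℂ M) (_ : Module (HB m p0 p1) M)
      (_ : IsScalarTower ℂ (HB m p0 p1) M),
      IsSimpleModule (HB n p0 p1) N ∧ IsOfType (n := n) p0 p1 J₁ N ∧
      IsSimpleModule (HB m p0 p1) M ∧ IsOfType (n := m) p0 p1 J₂ M ∧
      Nonempty (L ≃ₗ[HB r p0 p1] Diamond N M p0 p1 hr) := by
  have := hL.1
  have := IsSimpleModule.nontrivial (HB r p0 p1) L
  obtain ⟨a, x, hx, hsort⟩ := exists_sorted_weight (r := r) (p0 := p0) (p1 := p1) (L := L)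
    (fun c => ∃ u ∈ J₁, (u : ℂ) = c) (by
      rintro a x hx i j ⟨u, hu, e⟩ hj
      rw [← e, ← Units.val_mk0 (hx.ne_zero j)]
      exact separated_of_mem p1 h₁ hu fun h => hj ⟨_, h, rfl⟩)
  obtain ⟨n, hn, hlt⟩ := exists_threshold (Q := fun i => ∃ u ∈ J₁, (u : ℂ) = a i) hsort
  have hr : n + (r - n) = r := by omega
  refine ⟨n, r - n, hr, exists_equiv_diamond hr h₁ h₂ hd hx (fun i => (hlt _).2 i.2) fun i => ?_⟩
  obtain ⟨u, hu | hu, e⟩ := hL.2 _ _ (hx.hasEigenvalue (posR hr i))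
  · have := (hlt _).1 ⟨u, hu, e⟩
    simp [posR] at this
  · exact ⟨u, hu, e⟩

end Decompose

/-! ### The affine Hecke algebra of type A: generators and denominator -/

namespace HA

variable {n : ℕ} (p0 p1 : ℂˣ)

/-- The quotient map from the free algebra onto `H_n^A`. -/
noncomputable def mk (n : ℕ) (p1 : ℂˣ) : FreeAlgebra ℂ (HAGen n) →ₐ[ℂ] HA n p1 :=
  RingQuot.mkAlgHom ℂ (HARel (n := n) p1)

/-- The generator `T_i` of `H_n^A`, `1 ≤ i < n`. -/
noncomputable def T (i : Fin n) (hi : i.val ≠ 0) : HA n p1 := mk n p1 (FreeAlgebra.ι ℂ (.T i hi))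

/-- The generator `X_{i+1}` of `H_n^A`. -/
noncomputable def X (i : Fin n) : HA n p1 := mk n p1 (FreeAlgebra.ι ℂ (.X i))

/-- The inverse of the generator `X_{i+1}` of `H_n^A`. -/
noncomputable def Xinv (i : Fin n) : HA n p1 := mk n p1 (FreeAlgebra.ι ℂ (.Xinv i))

theorem mk_rel {a b : FreeAlgebra ℂ (HAGen n)} (h : HARel p1 a b) : mk n p1 a = mk n p1 b :=
  RingQuot.mkAlgHom_rel ℂ h

theorem X_mul_Xinv (i : Fin n) : X p1 i * Xinv p1 i = 1 := by
  simpa [X, Xinv] using mk_rel p1 (.X_mul_Xinv i)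

theorem X_comm (i j : Fin n) : X p1 i * X p1 j = X p1 j * X p1 i := by
  simpa [X] using mk_rel p1 (.X_comm i j)

theorem toHB_mk (g : HAGen n) : toHB n p0 p1 (mk n p1 (FreeAlgebra.ι ℂ g)) = genToHB p0 p1 g :=
  (RingQuot.liftAlgHom_mkAlgHom_apply ℂ _ _ _).trans (FreeAlgebra.lift_ι_apply _ _)

theorem toHB_T (i : Fin n) (hi : i.val ≠ 0) : toHB n p0 p1 (T p1 i hi) = HB.T p0 p1 i :=
  toHB_mk p0 p1 _

theorem toHB_X (i : Fin n) : toHB n p0 p1 (X p1 i) = HB.X p0 p1 i := toHB_mk p0 p1 _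

theorem toHB_Xinv (i : Fin n) : toHB n p0 p1 (Xinv p1 i) = HB.Xinv p0 p1 i := toHB_mk p0 p1 _

variable {p1}

theorem map_mem {R : Type*} [Ring R] [Algebra ℂ R] (ρ : HA n p1 →ₐ[ℂ] R) (S : Subalgebra ℂ R)
    (hT : ∀ i hi, ρ (T p1 i hi) ∈ S) (hX : ∀ i, ρ (X p1 i) ∈ S) (hY : ∀ i, ρ (Xinv p1 i) ∈ S)
    (a : HA n p1) : ρ a ∈ S := by
  obtain ⟨a, rfl⟩ : ∃ a', mk n p1 a' = a := RingQuot.mkAlgHom_surjective ℂ _ a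
  induction a using FreeAlgebra.induction with
  | grade0 c => rw [AlgHom.commutes, AlgHom.commutes]; exact S.algebraMap_mem c
  | grade1 g =>
    cases g with
    | T i hi => exact hT i hi
    | X i => exact hX i
    | Xinv i => exact hY i
  | mul a b ha hb => rw [map_mul, map_mul]; exact mul_mem ha hb
  | add a b ha hb => rw [map_add, map_add]; exact add_mem ha hb

end HA

section RootFactor

variable {r : ℕ} {p : ℂˣ}

/-- The product of the denominators occurring for a root whose exponential is `t` and for its
negative. -/
noncomputable def rootFactor {K : Type*} [Field K] [Algebra ℂ K] (p : ℂˣ) (t : K) : K :=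
  (algebraMap ℂ K p - (algebraMap ℂ K p)⁻¹ * t) * (algebraMap ℂ K p - (algebraMap ℂ K p)⁻¹ * t⁻¹)
    * (1 - t)

theorem map_rootFactor (σ : RatField r ≃ₐ[ℂ] RatField r) (t : RatField r) :
    σ (rootFactor p t) = rootFactor p (σ t) := by
  simp only [rootFactor, map_mul, map_sub, map_inv₀, AlgEquiv.commutes, map_one]

theorem rootFactor_ne_zero {K : Type*} [Field K] [Algebra ℂ K] {t : K} (h1 : t ≠ 1)
    (h2 : t ≠ algebraMap ℂ K ((p : ℂ) ^ 2)) (h3 : t⁻¹ ≠ algebraMap ℂ K ((p : ℂ) ^ 2)) :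
    rootFactor p t ≠ 0 := by
  have hp : algebraMap ℂ K p ≠ 0 := by simp
  have key : ∀ s : K, s ≠ algebraMap ℂ K ((p : ℂ) ^ 2) →
      algebraMap ℂ K p - (algebraMap ℂ K p)⁻¹ * s ≠ 0 := by
    intro s hs h
    refine hs ?_
    rw [map_pow, sq]
    nth_rw 1 [sub_eq_zero.1 h]
    field_simp
  exact mul_ne_zero (mul_ne_zero (key _ h2) (key _ h3)) (sub_ne_zero.2 h1.symm)

theorem sub_inv_mul_mem_laurent {t : RatField r} (ht : t ∈ laurent r) :
    algebraMap ℂ (RatField r) p - (algebraMap ℂ (RatField r) p)⁻¹ * t ∈ laurent r :=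
  sub_mem (algebraMap_mem_laurent _) (mul_mem (by rw [← map_inv₀]; exact algebraMap_mem_laurent _) ht)

theorem rootFactor_mem_laurent {t : RatField r} (ht : t ∈ laurent r) (ht' : t⁻¹ ∈ laurent r) :
    rootFactor p t ∈ laurent r :=
  mul_mem (mul_mem (sub_inv_mul_mem_laurent ht) (sub_inv_mul_mem_laurent ht'))
    (sub_mem (one_mem _) ht)

theorem laurentDvd_rootFactor {t : RatField r} (ht : t ∈ laurent r) (ht' : t⁻¹ ∈ laurent r)
    (h0 : t ≠ 0) :
    (LaurentDvd (algebraMap ℂ (RatField r) p - (algebraMap ℂ (RatField r) p)⁻¹ * t)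
        (rootFactor p t) ∧ LaurentDvd (1 - t) (rootFactor p t)) ∧
    LaurentDvd (algebraMap ℂ (RatField r) p - (algebraMap ℂ (RatField r) p)⁻¹ * t⁻¹)
        (rootFactor p t) ∧ LaurentDvd (1 - t⁻¹) (rootFactor p t) := by
  have h1 : 1 - t ∈ laurent r := sub_mem (one_mem _) ht
  have h2 := sub_inv_mul_mem_laurent (p := p) ht
  have h3 := sub_inv_mul_mem_laurent (p := p) ht'
  refine ⟨⟨⟨_, mul_mem h3 h1, by rw [rootFactor, mul_assoc]⟩, ⟨_, mul_mem h2 h3, ?_⟩⟩,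
    ⟨_, mul_mem h2 h1, ?_⟩, ⟨_, mul_mem (neg_mem ht) (mul_mem h2 h3), ?_⟩⟩
  · rw [rootFactor]; ring
  · rw [rootFactor]; ring
  · rw [rootFactor, ← mul_assoc, show (1 - t⁻¹) * -t = 1 - t by
      rw [sub_mul, one_mul, mul_neg, inv_mul_cancel₀ h0]; ring]
    ring

variable (p0 p1 : ℂˣ) (r)

/-- The denominator for `H_r^A` in `H_r^B`: all positive roots of type `B` that are not of type `A`,
a symmetric function of the variables. -/
noncomputable def posDenom : RatField r :=
  (∏ a : Fin r, rootFactor p0 (kX a ^ 2)) * ∏ a : Fin r, ∏ b : Fin r, rootFactor p1 (kX a * kX b)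

variable {r} {p0 p1}

theorem posDenom_mem_laurent : posDenom r p0 p1 ∈ laurent r := by
  refine mul_mem (prod_mem fun a _ => ?_) (prod_mem fun a _ => prod_mem fun b _ => ?_) <;>
    refine rootFactor_mem_laurent ?_ ?_
  · exact pow_mem (kX_mem_laurent a) 2
  · rw [← inv_pow]; exact pow_mem (kX_inv_mem_laurent a) 2
  · exact mul_mem (kX_mem_laurent a) (kX_mem_laurent b)
  · rw [mul_inv]; exact mul_mem (kX_inv_mem_laurent a) (kX_inv_mem_laurent b)

theorem posDenom_ne_zero : posDenom r p0 p1 ≠ 0 := by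
  have key : ∀ (p : ℂˣ) (a b : Fin r), rootFactor p (kX a * kX b) ≠ 0 := fun p a b =>
    rootFactor_ne_zero (kX_mul_ne_one a b) (kX_mul_ne _) fun h => by
      rw [inv_eq_iff_eq_inv, ← map_inv₀] at h
      exact kX_mul_ne _ h
  refine mul_ne_zero (Finset.prod_ne_zero_iff.2 fun a _ => ?_)
    (Finset.prod_ne_zero_iff.2 fun a _ => Finset.prod_ne_zero_iff.2 fun b _ => key p1 a b)
  rw [sq]
  exact key p0 a a

theorem swapAut_posDenom (i j : Fin r) : swapAut i j (posDenom r p0 p1) = posDenom r p0 p1 := by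
  have h : ∀ k, swapAut i j (kX k) = kX (Equiv.swap i j k) := fun k => by
    rw [swapAut, signedAut_kX]; simp
  simp only [posDenom, map_mul, map_prod, map_rootFactor, map_pow, h]
  congr 1
  · exact Equiv.prod_comp (Equiv.swap i j) fun a => rootFactor p0 (kX a ^ 2)
  · refine Eq.trans (Finset.prod_congr rfl fun a _ => ?_)
      (Equiv.prod_comp (Equiv.swap i j) fun a => ∏ b, rootFactor p1 (kX a * kX b))
    exact Equiv.prod_comp (Equiv.swap i j)
      fun b => rootFactor p1 (kX (Equiv.swap i j a) * kX b)

theorem laurentDvd_posDenom_sq (a : Fin r) (ε : ℤˣ) :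
    LaurentDvd (algebraMap ℂ (RatField r) p0 - (algebraMap ℂ (RatField r) p0)⁻¹
      * (kX a ^ (ε : ℤ))⁻¹ ^ 2) (posDenom r p0 p1) ∧
    LaurentDvd (1 - (kX a ^ (ε : ℤ))⁻¹ ^ 2) (posDenom r p0 p1) := by
  have hm : ∀ a : Fin r, kX a ^ 2 ∈ laurent r := fun a => pow_mem (kX_mem_laurent a) 2
  have hm' : ∀ a : Fin r, (kX a ^ 2)⁻¹ ∈ laurent r := fun a => by
    rw [← inv_pow]; exact pow_mem (kX_inv_mem_laurent a) 2
  have hd : LaurentDvd (rootFactor p0 (kX a ^ 2)) (posDenom r p0 p1) := by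
    refine (laurentDvd_prod (Finset.mem_univ a) fun a =>
      rootFactor_mem_laurent (hm a) (hm' a)).mul_right ?_
    exact prod_mem fun a _ => prod_mem fun b _ => rootFactor_mem_laurent
      (mul_mem (kX_mem_laurent a) (kX_mem_laurent b))
      (by rw [mul_inv]; exact mul_mem (kX_inv_mem_laurent a) (kX_inv_mem_laurent b))
  obtain ⟨⟨h1, h2⟩, h3, h4⟩ := laurentDvd_rootFactor (p := p0) (hm a) (hm' a)
    (pow_ne_zero 2 (kX_ne_zero a))
  rcases Int.units_eq_one_or ε with rfl | rfl
  · simp only [Units.val_one, zpow_one, inv_pow]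
    exact ⟨h3.trans hd, h4.trans hd⟩
  · simp only [Units.val_neg, Units.val_one, zpow_neg, zpow_one, inv_inv]
    exact ⟨h1.trans hd, h2.trans hd⟩

/-- Divisibility of the denominator by the factors of the root `X_a^ε / X_b^η`: up to inversion this
is `X_a X_b`, since the signs differ. -/
theorem laurentDvd_posDenom_mul (a b : Fin r) {ε η : ℤˣ} (h : ε ≠ η) :
    LaurentDvd (algebraMap ℂ (RatField r) p1 - (algebraMap ℂ (RatField r) p1)⁻¹
      * (kX a ^ (ε : ℤ) * (kX b ^ (η : ℤ))⁻¹)) (posDenom r p0 p1) ∧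
    LaurentDvd (1 - kX a ^ (ε : ℤ) * (kX b ^ (η : ℤ))⁻¹) (posDenom r p0 p1) := by
  have hm : ∀ a b : Fin r, kX a * kX b ∈ laurent r := fun a b =>
    mul_mem (kX_mem_laurent a) (kX_mem_laurent b)
  have hm' : ∀ a b : Fin r, (kX a * kX b)⁻¹ ∈ laurent r := fun a b => by
    rw [mul_inv]; exact mul_mem (kX_inv_mem_laurent a) (kX_inv_mem_laurent b)
  have hf : ∀ a b : Fin r, rootFactor p1 (kX a * kX b) ∈ laurent r := fun a b =>
    rootFactor_mem_laurent (hm a b) (hm' a b)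
  have hd : LaurentDvd (rootFactor p1 (kX a * kX b)) (posDenom r p0 p1) := by
    rw [posDenom, mul_comm (∏ a, rootFactor p0 (kX a ^ 2))]
    refine LaurentDvd.mul_right ?_ (prod_mem fun a _ => rootFactor_mem_laurent
      (pow_mem (kX_mem_laurent a) 2)
      (by rw [← inv_pow]; exact pow_mem (kX_inv_mem_laurent a) 2))
    exact LaurentDvd.trans
      (laurentDvd_prod (f := fun b => rootFactor p1 (kX a * kX b)) (Finset.mem_univ b) fun b => hf a b)
      (laurentDvd_prod (f := fun a => ∏ b, rootFactor p1 (kX a * kX b)) (Finset.mem_univ a)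
        fun a => prod_mem fun b _ => hf a b)
  obtain ⟨⟨h1, h2⟩, h3, h4⟩ := laurentDvd_rootFactor (p := p1) (hm a b) (hm' a b)
    (mul_ne_zero (kX_ne_zero a) (kX_ne_zero b))
  rcases Int.units_eq_one_or ε with rfl | rfl <;> rcases Int.units_eq_one_or η with rfl | rfl
  · exact absurd rfl h
  · simp only [Units.val_neg, Units.val_one, zpow_neg, zpow_one, inv_inv]
    exact ⟨h1.trans hd, h2.trans hd⟩
  · simp only [Units.val_neg, Units.val_one, zpow_neg, zpow_one, ← mul_inv (kX a)]
    exact ⟨h3.trans hd, h4.trans hd⟩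
  · exact absurd rfl h

end RootFactor

/-! ### Signed shuffles -/

section SignedShuffle

variable {n : ℕ}

/-- The signed permutations obtained from the identity by changing the sign of the value `0` and by
exchanging successive values of different signs: these are the minimal length representatives of
the cosets of the symmetric group in the Weyl group of type `B_n`. -/
inductive IsSignedShuffle : Equiv.Perm (Fin n) → (Fin n → ℤˣ) → Prop
  | one : IsSignedShuffle 1 1
  | flip (π : Equiv.Perm (Fin n)) (ε : Fin n → ℤˣ) (i : Fin n) (hi : i.val = 0)
      (h : IsSignedShuffle π ε) :
      IsSignedShuffle π (Function.update ε (π.symm i) (-ε (π.symm i)))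
  | swap (π : Equiv.Perm (Fin n)) (ε : Fin n → ℤˣ) (i j : Fin n) (hij : j.val + 1 = i.val)
      (h : IsSignedShuffle π ε) (hne : ε (π.symm j) ≠ ε (π.symm i)) :
      IsSignedShuffle (Equiv.swap j i * π) ε

/-- The signed value `±(π k + 1)` of a signed permutation. -/
def signedValue (π : Equiv.Perm (Fin n)) (ε : Fin n → ℤˣ) (k : Fin n) : ℤ :=
  (ε k : ℤ) * ((π k).val + 1)

variable {π : Equiv.Perm (Fin n)} {ε : Fin n → ℤˣ}

theorem signedValue_of_pos {k : Fin n} (h : ε k = 1) :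
    signedValue π ε k = (π k).val + 1 := by simp [signedValue, h]

theorem signedValue_of_neg {k : Fin n} (h : ε k = -1) :
    signedValue π ε k = -((π k).val + 1) := by simp [signedValue, h]

/-- The signed values of a signed shuffle increase, as neither move affects the relative order of
the signed values. -/
theorem IsSignedShuffle.strictMono (h : IsSignedShuffle π ε) : StrictMono (signedValue π ε) := by
  induction h with
  | one => intro a b hab; simpa [signedValue] using hab
  | flip π ε i hi _ ih =>
    intro a b hab
    have hne : π a ≠ π b := π.injective.ne hab.ne
    have hab' := ih hab
    rw [Ne, Fin.ext_iff] at hne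
    have hv : ∀ k, (π k = i ∧ signedValue π (Function.update ε (π.symm i) (-ε (π.symm i))) k
        = - signedValue π ε k ∧ (π k).val = 0) ∨ ((π k).val ≠ 0 ∧
        signedValue π (Function.update ε (π.symm i) (-ε (π.symm i))) k = signedValue π ε k) := by
      intro k
      by_cases hk : π k = i
      · left
        subst hk
        exact ⟨rfl, by simp [signedValue], hi⟩
      · right
        refine ⟨fun h => hk (Fin.ext (by omega)), ?_⟩
        have : k ≠ π.symm i := by rintro rfl; exact hk (π.apply_symm_apply i)
        simp [signedValue, Function.update_of_ne this]
    rcases Int.units_eq_one_or (ε a) with ha | ha <;> rcases Int.units_eq_one_or (ε b) with hb | hb <;>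
      simp only [signedValue_of_pos, signedValue_of_neg, ha, hb] at hab' <;>
      rcases hv a with ⟨-, h1, h2⟩ | ⟨h2, h1⟩ <;> rcases hv b with ⟨-, h3, h4⟩ | ⟨h4, h3⟩ <;>
      rw [h1, h3] <;> simp only [signedValue_of_pos, signedValue_of_neg, ha, hb] <;> omega
  | swap π ε i j hij _ hne ih =>
    intro a b hab
    have hab' := ih hab
    have hne' : π a ≠ π b := π.injective.ne hab.ne
    have hnot : ∀ a b, ε a = ε b → ¬ (π a = j ∧ π b = i) := by
      rintro a b h ⟨rfl, rfl⟩
      exact hne (by simpa using h)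
    have hv : ∀ k, ((Equiv.swap j i * π) k).val
        = if π k = j then i.val else if π k = i then j.val else (π k).val := by
      intro k
      rw [Equiv.Perm.mul_apply, Equiv.swap_apply_def]
      split_ifs <;> rfl
    have h1 := hnot a b
    have h2 := hnot b a
    rcases Int.units_eq_one_or (ε a) with ha | ha <;> rcases Int.units_eq_one_or (ε b) with hb | hb <;>
      simp only [signedValue_of_pos, signedValue_of_neg, ha, hb, hv, forall_true_left] at hab' h1 h2 ⊢ <;>
      simp only [Fin.ext_iff, Ne] at hne' h1 h2 ⊢ <;> split_ifs <;> omega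

theorem IsSignedShuffle.eq_one (h : IsSignedShuffle π ε) (hε : ∀ k, ε k = 1) : π = 1 ∧ ε = 1 := by
  have hmono : StrictMono π := by
    intro a b hab
    have := h.strictMono hab
    rw [signedValue_of_pos (hε a), signedValue_of_pos (hε b)] at this
    rw [Fin.lt_def]
    omega
  have := Subsingleton.elim (hmono.orderIsoOfSurjective π π.surjective) (OrderIso.refl (Fin n))
  refine ⟨?_, funext hε⟩
  ext k
  exact congrArg Fin.val (DFunLike.congr_fun this k)

/-- A strictly monotone integer-valued function on `Fin n` takes successive values at successive
arguments only. -/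
theorem val_succ_of_strictMono {f : Fin n → ℤ} (hf : StrictMono f) {a b : Fin n}
    (h : f a + 1 = f b) : a.val + 1 = b.val := by
  have hab : a < b := hf.lt_iff_lt.1 (by omega)
  rw [Fin.lt_def] at hab
  by_contra hne
  let c : Fin n := ⟨a.val + 1, by omega⟩
  have h1 : f a < f c := hf (Fin.lt_def.2 (by simp [c]))
  have h2 : f c < f b := hf (Fin.lt_def.2 (by simp only [c]; omega))
  omega

end SignedShuffle

/-! ### The coset datum of the affine Hecke algebra of type A -/

section IndDatum

variable {n : ℕ} (p0 p1 : ℂˣ)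

/-- The polynomial representation, restricted to `H_n^A`. -/
noncomputable def repA (n : ℕ) (p0 p1 : ℂˣ) : HA n p1 →ₐ[ℂ] Module.End ℂ (RatField n) :=
  (stdRep n p0 p1).comp (HA.toHB n p0 p1)

theorem repA_apply (a : HA n p1) : repA n p0 p1 a = stdRep n p0 p1 (HA.toHB n p0 p1 a) := rfl

theorem repA_T (i : Fin n) (hi : i.val ≠ 0) :
    repA n p0 p1 (HA.T p1 i hi) = stdRep n p0 p1 (HB.T p0 p1 i) := by
  rw [repA_apply, HA.toHB_T]

theorem repA_X (i : Fin n) :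
    repA n p0 p1 (HA.X p1 i) = Algebra.lmul ℂ (RatField n) (kX i) := by
  rw [repA_apply, HA.toHB_X, varRep_X]; rfl

theorem repA_Xinv (i : Fin n) :
    repA n p0 p1 (HA.Xinv p1 i) = Algebra.lmul ℂ (RatField n) (kX i)⁻¹ := by
  rw [repA_apply, HA.toHB_Xinv, varRep_Xinv]; rfl

theorem repA_of_mem_laurent {f : RatField n} (hf : f ∈ laurent n) :
    ∃ a, repA n p0 p1 a = Algebra.lmul ℂ (RatField n) f :=
  exists_of_mem_laurent _ (fun k => ⟨_, repA_X p0 p1 k⟩) (fun k => ⟨_, repA_Xinv p0 p1 k⟩) hf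

variable {p0 p1}

/-- The image of `H_n^A` commutes with symmetric functions of the variables. -/
theorem commute_repA {f : RatField n} (hf : ∀ i j, swapAut i j f = f) (a : HA n p1) :
    Commute (repA n p0 p1 a) (Algebra.lmul ℂ (RatField n) f) := by
  have : repA n p0 p1 a ∈ Subalgebra.centralizer ℂ {Algebra.lmul ℂ (RatField n) f} := by
    refine HA.map_mem _ _ (fun i hi => ?_) (fun i => ?_) (fun i => ?_) a <;>
      rw [Subalgebra.mem_centralizer_iff] <;> rintro _ rfl
    · obtain ⟨j, hj⟩ := exists_pred hi
      rw [repA_T, stdRep_T]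
      refine (dlOp_mul_lmul_of_fix ?_).symm.eq
      rw [simpleAut_succ id hj]
      exact hf _ _
    · rw [repA_X, ← map_mul, mul_comm, map_mul]
    · rw [repA_Xinv, ← map_mul, mul_comm, map_mul]
  rw [Subalgebra.mem_centralizer_iff] at this
  exact (this _ rfl).symm

variable (n p0 p1)

/-- The element of `H_n^A` acting as multiplication by the denominator. -/
noncomputable def posDenomA : HA n p1 :=
  (repA_of_mem_laurent p0 p1 (posDenom_mem_laurent (r := n) (p0 := p0) (p1 := p1))).choose

theorem repA_posDenomA :
    repA n p0 p1 (posDenomA n p0 p1) = Algebra.lmul ℂ (RatField n) (posDenom n p0 p1) :=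
  (repA_of_mem_laurent p0 p1 (posDenom_mem_laurent (r := n) (p0 := p0) (p1 := p1))).choose_spec

/-- The automorphisms permuting the variables. -/
noncomputable def permGroup (n : ℕ) : Subgroup (RatField n ≃ₐ[ℂ] RatField n) :=
  relGroup (fun _ _ ε => ε = 1) (fun _ => rfl) (fun _ _ _ _ _ h1 h2 => by rw [h1, h2, one_mul])

variable {n p0 p1}

theorem signedAut_mem_permGroup {π : Equiv.Perm (Fin n)} {ε : Fin n → ℤˣ}
    (h : signedAut π ε ∈ permGroup n) (k : Fin n) : ε k = 1 := by
  obtain ⟨l, η, hη, h⟩ := h.1 k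
  rw [signedAut_kX] at h
  rw [(kX_zpow_inj h).2, hη]

theorem simpleAut_mem_permGroup {i : Fin n} (hi : i.val ≠ 0) :
    simpleAut id i ∈ permGroup n := by
  obtain ⟨j, hj⟩ := exists_pred hi
  have h1 : ∀ k : Fin n, ∃ (l : Fin n) (ε : ℤˣ), ε = 1 ∧
      simpleAut id i (kX k) = kX l ^ ((ε : ℤˣ) : ℤ) := by
    intro k
    rw [simpleAut_succ id hj, swapAut, signedAut_kX]
    exact ⟨_, _, rfl, rfl⟩
  refine ⟨h1, ?_⟩
  rw [inv_eq_of_mul_eq_one_left (simpleAut_mul_self i)]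
  exact h1

theorem repA_mem_autSpan (a : HA n p1) : repA n p0 p1 a ∈ autSpan (permGroup n) := by
  refine HA.map_mem _ _ (fun i hi => ?_) (fun i => ?_) (fun i => ?_) a
  · rw [repA_T, stdRep_T]
    exact dlOp_mem_autSpan _ _ (simpleAut_mem_permGroup hi)
  · rw [repA_X]; exact lmul_mem_autSpan _
  · rw [repA_Xinv]; exact lmul_mem_autSpan _

/-- A monomial in two variables that a signed permutation sends to a root of type `A`. -/
theorem signedAut_signed_ratio (π : Equiv.Perm (Fin n)) (ε : Fin n → ℤˣ) {i j : Fin n}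
    (h : j.val + 1 = i.val) : signedAut π ε (kX (π.symm j) ^ (ε (π.symm j) : ℤ)
      * (kX (π.symm i) ^ (ε (π.symm i) : ℤ))⁻¹) = kRoot i := by
  rw [kRoot_succ h, map_mul, map_inv₀, map_zpow₀, map_zpow₀, signedAut_kX, signedAut_kX]
  simp [← zpow_mul]

theorem signedAut_signed_sq (π : Equiv.Perm (Fin n)) (ε : Fin n → ℤˣ) {i : Fin n}
    (h : i.val = 0) :
    signedAut π ε ((kX (π.symm i) ^ (ε (π.symm i) : ℤ))⁻¹ ^ 2) = kRoot i := by
  rw [kRoot_zero h, map_pow, map_inv₀, map_zpow₀, signedAut_kX]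
  simp [← zpow_mul]

variable (p0 p1)

theorem signedShuffle_mem {π : Equiv.Perm (Fin n)} {ε : Fin n → ℤˣ} (h : IsSignedShuffle π ε) :
    (signedAut π ε).toLinearMap ∈
      rightLoc (stdRep n p0 p1) (HA.toHB n p0 p1 (posDenomA n p0 p1)) := by
  have hz := repA_posDenomA n p0 p1
  rw [repA_apply] at hz
  induction h with
  | one =>
    rw [signedAut_one]
    simpa using map_mem_rightLoc (j := stdRep n p0 p1) 1
  | flip π ε i hi h ih =>
    have := simpleAut_mul_signedAut_mem hz ih i (signedAut_signed_sq π ε hi) (by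
      rw [show par p0 p1 i = p0 by simp [par, hi]]
      exact (laurentDvd_posDenom_sq _ _).1)
    rw [simpleAut_zero id hi, id] at this
    have h2 := flipAut_mul π ε (π.symm i)
    rw [Equiv.apply_symm_apply] at h2
    rwa [h2] at this
  | swap π ε i j hij h hne ih =>
    have := simpleAut_mul_signedAut_mem hz ih i (signedAut_signed_ratio π ε hij) (by
      rw [par_of_pos (by omega)]
      exact (laurentDvd_posDenom_mul _ _ hne).1)
    rwa [simpleAut_succ id hij, id, id, swapAut_mul] at this

/-- In the case of equal signs, `T_i` moves past the signed shuffle as a generator of `H_n^A`. -/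
theorem exists_T_mul_signedShuffle {π : Equiv.Perm (Fin n)} {ε : Fin n → ℤˣ}
    (h : IsSignedShuffle π ε) {i j : Fin n} (hij : j.val + 1 = i.val)
    (he : ε (π.symm j) = ε (π.symm i)) :
    ∃ a, stdRep n p0 p1 (HB.T p0 p1 i) * (signedAut π ε).toLinearMap
      = (signedAut π ε).toLinearMap * repA n p0 p1 a := by
  have hswap := swapAut_mul_signedAut π ε he
  rw [Equiv.apply_symm_apply, Equiv.apply_symm_apply] at hswap
  have hratio := signedAut_signed_ratio π ε hij
  have key : ∀ k l : Fin n, (hkl : l.val + 1 = k.val) → signedAut π ε (kX l * (kX k)⁻¹) = kRoot i →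
      swapAut l k = swapAut (π.symm j) (π.symm i) →
      ∃ a, stdRep n p0 p1 (HB.T p0 p1 i) * (signedAut π ε).toLinearMap
        = (signedAut π ε).toLinearMap * repA n p0 p1 a := by
    intro k l hkl h1 h2
    refine ⟨HA.T p1 k (by omega), ?_⟩
    rw [repA_T, stdRep_T, stdRep_T, par_of_pos (by omega), par_of_pos (by omega)]
    refine dlOp_mul_aut_of_conj ?_ ?_
    · rw [kRoot_succ hkl, h1]
    · rw [simpleAut_succ id hij, simpleAut_succ id hkl, id, id, id, id, h2, hswap]
  rw [← he] at hratio
  -- The preimages of neighbouring values of equal sign are neighbours, in reversed order if the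
  -- sign is negative.
  rcases Int.units_eq_one_or (ε (π.symm j)) with hs | hs
  · refine key (π.symm i) (π.symm j) (val_succ_of_strictMono h.strictMono ?_) ?_ rfl
    · rw [signedValue_of_pos hs, signedValue_of_pos (he ▸ hs), Equiv.apply_symm_apply,
        Equiv.apply_symm_apply]
      omega
    · simpa [hs] using hratio
  · refine key (π.symm j) (π.symm i) (val_succ_of_strictMono h.strictMono ?_) ?_ (swapAut_comm _ _)
    · rw [signedValue_of_neg hs, signedValue_of_neg (he ▸ hs), Equiv.apply_symm_apply,
        Equiv.apply_symm_apply]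
      omega
    · rw [← hratio, hs, mul_comm]
      simp

/-- The index set of the basis: the signed shuffles. -/
abbrev SignedShuffle (n : ℕ) : Type :=
  {x : Equiv.Perm (Fin n) × (Fin n → ℤˣ) // IsSignedShuffle x.1 x.2}

theorem exists_T_mul_signedShuffle_add (i : Fin n) (s : SignedShuffle n) :
    ∃ (s' : SignedShuffle n),
      ∃ q ∈ rightLoc (repA n p0 p1) (posDenomA n p0 p1),
      ∃ q' ∈ rightLoc (repA n p0 p1) (posDenomA n p0 p1),
      stdRep n p0 p1 (HB.T p0 p1 i) * (signedAut s.1.1 s.1.2).toLinearMap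
        = (signedAut s.1.1 s.1.2).toLinearMap * q + (signedAut s'.1.1 s'.1.2).toLinearMap * q' := by
  obtain ⟨⟨π, ε⟩, hs⟩ := s
  by_cases hi : i.val = 0
  · obtain ⟨q, hq, q', hq', h⟩ := T_mul_aut_of_dvd (p0 := p0) (p1 := p1) (repA_posDenomA n p0 p1)
      (fun f hf => repA_of_mem_laurent p0 p1 hf) i (signedAut π ε) (signedAut_signed_sq π ε hi)
      (pow_mem (by rw [← zpow_neg, ← Units.val_neg]; exact kX_zpow_mem_laurent _ _) 2)
      (laurentDvd_posDenom_sq _ _).2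
    have h2 := flipAut_mul π ε (π.symm i)
    rw [Equiv.apply_symm_apply] at h2
    exact ⟨⟨(π, Function.update ε (π.symm i) (-ε (π.symm i))), .flip π ε i hi hs⟩, q, hq, q', hq', by
      rw [h, simpleAut_zero id hi, id, h2]⟩
  · obtain ⟨j, hij⟩ := exists_pred hi
    by_cases he : ε (π.symm j) = ε (π.symm i)
    · obtain ⟨a, ha⟩ := exists_T_mul_signedShuffle p0 p1 hs hij he
      exact ⟨⟨_, hs⟩, _, map_mem_rightLoc a, 0, zero_mem _, by rw [ha, mul_zero, add_zero]⟩
    · obtain ⟨q, hq, q', hq', h⟩ := T_mul_aut_of_dvd (p0 := p0) (p1 := p1) (repA_posDenomA n p0 p1)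
        (fun f hf => repA_of_mem_laurent p0 p1 hf) i (signedAut π ε) (signedAut_signed_ratio π ε hij)
        (mul_mem (kX_zpow_mem_laurent _ _)
          (by rw [← zpow_neg, ← Units.val_neg]; exact kX_zpow_mem_laurent _ _))
        (laurentDvd_posDenom_mul _ _ he).2
      exact ⟨⟨(_, _), .swap π ε i j hij hs he⟩, q, hq, q', hq', by
        rw [h, simpleAut_succ id hij, id, id, swapAut_mul]⟩

theorem signedShuffle_indep [Fintype (SignedShuffle n)]
    (c : SignedShuffle n → Module.End ℂ (RatField n)) (hc : ∀ s, c s ∈ autSpan (permGroup n))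
    (h : ∑ s, (signedAut s.1.1 s.1.2).toLinearMap * c s = 0) : c ⟨(1, 1), .one⟩ = 0 :=
  eq_zero_of_sum_cosets (G := permGroup n) (I := SignedShuffle n)
    (fun s => signedAut s.1.1 s.1.2) (o := ⟨(1, 1), .one⟩) signedAut_one
    (fun s hs => Subtype.ext (Prod.ext
      (s.2.eq_one fun k => signedAut_mem_permGroup hs k).1
      (s.2.eq_one fun k => signedAut_mem_permGroup hs k).2)) c hc h

theorem repALoc_le_autSpan {q : Module.End ℂ (RatField n)}
    (hq : q ∈ rightLoc (repA n p0 p1) (posDenomA n p0 p1)) : q ∈ autSpan (permGroup n) :=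
  rightLoc_le_autSpan posDenom_ne_zero (repA_posDenomA n p0 p1) repA_mem_autSpan hq

/-- `X_{k+1}` or its inverse, according to the sign. -/
noncomputable def HA.signedX (p1 : ℂˣ) (k : Fin n) (ε : ℤˣ) : HA n p1 :=
  if ε = 1 then HA.X p1 k else HA.Xinv p1 k

theorem repA_signedX (k : Fin n) (ε : ℤˣ) :
    repA n p0 p1 (HA.signedX p1 k ε) = Algebra.lmul ℂ (RatField n) (kX k ^ (ε : ℤ)) := by
  rcases Int.units_eq_one_or ε with rfl | rfl
  · simp [HA.signedX, repA_X]
  · rw [HA.signedX, if_neg (by decide), repA_Xinv]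
    simp

theorem lmul_mul_signedAut (π : Equiv.Perm (Fin n)) (ε : Fin n → ℤˣ) (i : Fin n) (η : ℤˣ) :
    Algebra.lmul ℂ (RatField n) (kX i ^ (η : ℤ)) * (signedAut π ε).toLinearMap
      = (signedAut π ε).toLinearMap *
        repA n p0 p1 (HA.signedX p1 (π.symm i) (η * ε (π.symm i))) := by
  rw [repA_signedX, aut_mul_lmul, map_zpow₀ (signedAut π ε), signedAut_kX]
  rcases Int.units_eq_one_or (ε (π.symm i)) with h | h <;> simp [h]

variable (n) in
/-- The coset datum for `H_n^A` in `H_n^B`: the basis is given by the signed shuffles. -/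
noncomputable def indDatum : CosetDatum n p0 p1 (HA n p1) where
  j := repA n p0 p1
  zH := HA.toHB n p0 p1 (posDenomA n p0 p1)
  zA := posDenomA n p0 p1
  j_zA := rfl
  isUnit_z := by
    rw [repA_posDenomA]
    exact (IsUnit.mk0 _ posDenom_ne_zero).map _
  comm a := by
    rw [repA_posDenomA]
    exact commute_repA swapAut_posDenom a
  j_mem a := map_mem_rightLoc (HA.toHB n p0 p1 a)
  I := SignedShuffle n
  fintype := Fintype.ofFinite _
  aut s := signedAut s.1.1 s.1.2
  one := ⟨(1, 1), .one⟩
  aut_one := signedAut_one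
  aut_mem s := signedShuffle_mem p0 p1 s.2
  y s i := HA.signedX p1 (s.1.1.symm i) (s.1.2 (s.1.1.symm i))
  X_mul_aut s i := by
    have := lmul_mul_signedAut p0 p1 s.1.1 s.1.2 i 1
    rwa [Units.val_one, zpow_one, one_mul] at this
  Xinv_mul_aut s i := ⟨_, by
    have := lmul_mul_signedAut p0 p1 s.1.1 s.1.2 i (-1)
    rwa [Units.val_neg, Units.val_one, zpow_neg, zpow_one] at this⟩
  T_mul_aut i s := exists_T_mul_signedShuffle_add p0 p1 i s
  indep c h := @signedShuffle_indep _ (Fintype.ofFinite _) (fun s => (c s).1)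
    (fun s => repALoc_le_autSpan p0 p1 (c s).2) h

end IndDatum

namespace CosetDatum

variable {r : ℕ} {p0 p1 : ℂˣ} {A : Type*} [Ring A] [Algebra ℂ A] (D : CosetDatum r p0 p1 A)
  {M : Type u} [AddCommGroup M] [Module ℂ M] [Module A M] {l : ℂ}

theorem ind_mk_mul (f : A →ₐ[ℂ] HB r p0 p1) (b : HB r p0 p1) (a : A) (x : M) :
    (Submodule.Quotient.mk ((b * f a) ⊗ₜ[ℂ] x) : Ind f M) = Submodule.Quotient.mk (b ⊗ₜ[ℂ] (a • x)) :=
  (Submodule.Quotient.eq _).2 (Submodule.subset_span ⟨b, a, x, rfl⟩)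

/-- If `𝔄` maps to `H_r^B`, the balanced product over the localizations is the induced module. -/
theorem exists_isBalancedProduct_ind (f : A →ₐ[ℂ] HB r p0 p1)
    (hf : ∀ a, D.j a = stdRep r p0 p1 (f a)) (hE : D.IsAdmissible M l) :
    ∃ cl : D.locH →ₗ[ℂ] M →ₗ[ℂ] Ind f M, D.IsBalancedProduct cl := by
  have hinj := varRep_injective (Function.injective_id (α := Fin r)) p0 p1
  have hzH : D.zH = f D.zA := hinj (by rw [← hf, D.j_zA])
  let F : HB r p0 p1 →ₗ[ℂ] M →ₗ[ℂ] Ind f M := (TensorProduct.mk ℂ (HB r p0 p1) M).compr₂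
    ((Submodule.mkQ (Submodule.span (HB r p0 p1) {z : HB r p0 p1 ⊗[ℂ] M |
      ∃ (b : HB r p0 p1) (a : A) (x : M), z = (b * f a) ⊗ₜ[ℂ] x - b ⊗ₜ[ℂ] (a • x)})).restrictScalars ℂ)
  have hF : ∀ b x, F b x = Submodule.Quotient.mk (b ⊗ₜ[ℂ] x) := fun _ _ => rfl
  have hFmul : ∀ b a x, F (b * f a) x = F b (a • x) := fun b a x => ind_mk_mul f b a x
  obtain ⟨cl, hcl⟩ := exists_rightLoc_extension (j := stdRep r p0 p1) (z := D.zH)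
    (by rw [← D.j_zA]; exact D.isUnit_z) (F := F) hE.ne_zero
    (fun b => by
      ext x
      rw [hzH, hFmul, hE.smul_z, map_smul, LinearMap.smul_apply])
    (fun b hb => by rw [(map_eq_zero_iff _ hinj).1 hb, map_zero])
  have hcl0 : ∀ (q : D.locH) (b : HB r p0 p1), (q : Module.End ℂ (RatField r)) = stdRep r p0 p1 b →
      cl q = F b := fun q b h => by
    rw [hcl q 0 b (by rw [pow_zero, mul_one, h]), pow_zero, one_smul]
  refine ⟨cl, ?_, ?_, ?_, ?_⟩
  · intro h q q' x hq
    obtain ⟨k, b, hb⟩ := q.2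
    rw [hcl q k b hb, hcl q' k (h * b) (by rw [hq, mul_assoc, hb, map_mul]), LinearMap.smul_apply,
      LinearMap.smul_apply, smul_comm]
    rfl
  · intro a q q' x hq
    obtain ⟨k, b, hb⟩ := q.2
    rw [hcl q k b hb, hcl q' k (b * f a) (by
      rw [hq, map_mul, ← hb, ← hf, ← D.j_zA, mul_assoc, mul_assoc, ((D.comm a).pow_right k).eq]),
      LinearMap.smul_apply, LinearMap.smul_apply, hFmul]
  · rw [eq_top_iff]
    rintro d -
    obtain ⟨z, rfl⟩ := Submodule.Quotient.mk_surjective _ d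
    induction z using TensorProduct.induction_on with
    | zero => exact zero_mem _
    | add a b ha hb => exact add_mem ha hb
    | tmul b x =>
      refine Submodule.subset_span ⟨⟨_, map_mem_rightLoc b⟩, x, ?_⟩
      rw [hcl0 _ b rfl, hF]
  · intro V _ _ Ψ hΨ
    let e : HB r p0 p1 →ₗ[ℂ] D.locH :=
      (stdRep r p0 p1).toLinearMap.codRestrict D.locH fun b => map_mem_rightLoc b
    let Θ := TensorProduct.lift (Ψ.comp e)
    have hΘ : ∀ z ∈ Submodule.span (HB r p0 p1) {z : HB r p0 p1 ⊗[ℂ] M |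
        ∃ (b : HB r p0 p1) (a : A) (x : M), z = (b * f a) ⊗ₜ[ℂ] x - b ⊗ₜ[ℂ] (a • x)}, Θ z = 0 := by
      intro z hz
      -- All multiples are treated at once, since `Θ` is only `ℂ`-linear.
      suffices h : ∀ h : HB r p0 p1, Θ (h • z) = 0 by simpa using h 1
      induction hz using Submodule.span_induction with
      | mem z hz =>
        obtain ⟨b, a, x, rfl⟩ := hz
        intro h
        rw [smul_sub, map_sub, sub_eq_zero]
        refine hΨ a (e (h * b)) (e (h * (b * f a))) x ?_
        change stdRep r p0 p1 _ = stdRep r p0 p1 _ * _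
        rw [hf, ← map_mul, mul_assoc]
      | zero => intro h; rw [smul_zero, map_zero]
      | add a b _ _ ha hb => intro h; rw [smul_add, map_add, ha, hb, add_zero]
      | smul k z _ hz => intro h; rw [← mul_smul]; exact hz _
    refine ⟨((Submodule.restrictScalars ℂ (Submodule.span (HB r p0 p1) {z : HB r p0 p1 ⊗[ℂ] M |
        ∃ (b : HB r p0 p1) (a : A) (x : M),
          z = (b * f a) ⊗ₜ[ℂ] x - b ⊗ₜ[ℂ] (a • x)})).liftQ Θ (fun z hz => hΘ z hz)).comp
      (Submodule.Quotient.restrictScalarsEquiv ℂ _).symm.toLinearMap, fun q x => ?_⟩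
    obtain ⟨k, b, hb⟩ := q.2
    have h1 : Ψ (e b) x = l ^ k • Ψ q x := by
      rw [hΨ (D.zA ^ k) q (e b) x (by rw [map_pow, D.j_zA, hb]; rfl)]
      have : ∀ k : ℕ, D.zA ^ k • x = l ^ k • x := by
        intro k
        induction k with
        | zero => simp
        | succ k ih => rw [pow_succ', mul_smul, ih, hE.smul_z, smul_smul, pow_succ']
      rw [this, map_smul]
    rw [hcl q k b hb, LinearMap.smul_apply, map_smul]
    change (l⁻¹) ^ k • Ψ (e b) x = Ψ q x
    rw [h1, smul_smul, ← mul_pow, inv_mul_cancel₀ hE.ne_zero, one_pow, one_smul]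

end CosetDatum

/-! ### Modules induced from the affine Hecke algebra of type A -/

/-- A set of parameters, stable under multiplication by `p₁^{±2}`, that contains no two mutually
inverse elements, and for which the intertwiner of `T_0` is invertible. -/
structure IsPositiveHalf (p0 p1 : ℂˣ) (Jp : Set ℂˣ) : Prop where
  mul_mem : ∀ {u}, u ∈ Jp → ∀ k : ℤ, u * p1 ^ (2 * k) ∈ Jp
  inv_notMem : ∀ {u}, u ∈ Jp → u⁻¹ ∉ Jp
  sq_ne : ∀ {u}, u ∈ Jp → u ^ 2 ≠ p0 ^ 2
  sq_mul_ne : ∀ {u}, u ∈ Jp → u ^ 2 * p0 ^ 2 ≠ 1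

namespace IsPositiveHalf

variable {p0 p1 : ℂˣ} {Jp : Set ℂˣ}

theorem mul_ne (h : IsPositiveHalf p0 p1 Jp) {u v : ℂˣ} (hu : u ∈ Jp) (hv : v ∈ Jp) (k : ℤ) :
    u * v ≠ p1 ^ (2 * k) := by
  intro e
  refine h.inv_notMem hv ?_
  have := h.mul_mem hu (-k)
  rwa [mul_neg, zpow_neg, ← e, mul_inv_rev, mul_comm, mul_assoc, inv_mul_cancel, mul_one] at this

theorem rootFactor_mul_ne_zero (h : IsPositiveHalf p0 p1 Jp) {u v : ℂˣ} (hu : u ∈ Jp) (hv : v ∈ Jp) :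
    rootFactor p1 ((u : ℂ) * v) ≠ 0 := by
  refine rootFactor_ne_zero (fun e => h.mul_ne hu hv 0 (Units.ext (by simpa using e)))
    (fun e => h.mul_ne hu hv 1 (Units.ext (by simpa using e)))
    (fun e => h.mul_ne hu hv (-1) ?_)
  rw [inv_eq_iff_eq_inv] at e
  refine Units.ext ?_
  simpa [zpow_neg] using e

theorem rootFactor_sq_ne_zero (h : IsPositiveHalf p0 p1 Jp) {u : ℂˣ} (hu : u ∈ Jp) :
    rootFactor p0 ((u : ℂ) ^ 2) ≠ 0 := by
  refine rootFactor_ne_zero (fun e => h.mul_ne hu hu 0 (Units.ext ?_))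
    (fun e => h.sq_ne hu (Units.ext (by simpa using e)))
    (fun e => h.sq_mul_ne hu (Units.ext ?_))
  · rw [sq] at e
    simpa using e
  · push_cast
    have e' : ((u : ℂ) ^ 2)⁻¹ = (p0 : ℂ) ^ 2 := e
    rw [← e', mul_inv_cancel₀ (pow_ne_zero 2 u.ne_zero)]

section Weight

variable {n : ℕ} {L : Type*} [AddCommGroup L] [Module ℂ L] [Module (HB n p0 p1) L]
  [IsScalarTower ℂ (HB n p0 p1) L]

/-- The intertwiners move all eigenvalues into the positive half. -/
theorem exists_weight (h : IsPositiveHalf p0 p1 Jp) [FiniteDimensional ℂ L] [Nontrivial L]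
    (hL : ∀ (i : Fin n) (a : ℂ), Module.End.HasEigenvalue (Algebra.lsmul ℂ ℂ L (HB.X p0 p1 i)) a →
      ∃ u : ℂˣ, (u : ℂ) = a ∧ (u ∈ Jp ∨ u⁻¹ ∈ Jp)) :
    ∃ (a : Fin n → ℂˣ) (x : L), IsWeightVector p0 p1 (fun i => (a i : ℂ)) x ∧ ∀ i, a i ∈ Jp := by
  obtain ⟨a, x, hx, ha⟩ := exists_positive_weight (r := n) (p0 := p0) (p1 := p1) L
    (fun c => ∃ u ∈ Jp, (u : ℂ) = c) (by
      rintro a x hx i j ⟨u, hu, e⟩ hj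
      rw [← e, ← Units.val_mk0 (hx.ne_zero j)]
      refine ⟨fun e' => hj ⟨_, h.mul_mem hu 1, ?_⟩, fun e' => hj ⟨_, h.mul_mem hu (-1), ?_⟩⟩
      · rw [Units.val_mk0] at e'
        rw [e']
        push_cast
        rw [mul_comm]
        rfl
      · rw [Units.val_mk0] at e'
        have hp : (p1 : ℂ) ≠ 0 := p1.ne_zero
        push_cast
        rw [e', zpow_neg, mul_right_comm]
        field_simp) (by
      intro a x hx i hi
      obtain ⟨u, e, hu | hu⟩ := hL i _ (hx.hasEigenvalue i)
      · exact absurd ⟨u, hu, e⟩ hi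
      · rw [← e]
        refine ⟨⟨_, hu, Units.val_inv_eq_inv_val u⟩, fun e' => h.sq_mul_ne hu ?_,
          fun e' => h.sq_ne hu ?_⟩
        · have : u ^ 2 = p0 ^ 2 := Units.ext (by push_cast; exact e')
          rw [← this, ← mul_pow, inv_mul_cancel, one_pow]
        · have : u ^ 2 * p0 ^ 2 = 1 := Units.ext (by push_cast; exact e')
          rw [inv_pow]
          exact inv_eq_of_mul_eq_one_right this)
  choose u hu e using ha
  exact ⟨u, x, by rw [funext e]; exact hx, hu⟩

/-- On a weight vector with positive weights the denominator acts by a nonzero scalar. -/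
theorem exists_posDenom_smul (h : IsPositiveHalf p0 p1 Jp) {a : Fin n → ℂˣ} {x : L}
    (hx : IsWeightVector p0 p1 (fun i => (a i : ℂ)) x) (ha : ∀ i, a i ∈ Jp) :
    ∃ l : ℂ, l ≠ 0 ∧ (indDatum n p0 p1).zH • x = l • x := by
  have key : ∀ (p : ℂˣ) {t : RatField n} {c : ℂ}, ActsBy p0 p1 x t c → ActsBy p0 p1 x t⁻¹ c⁻¹ →
      ActsBy p0 p1 x (rootFactor p t) (rootFactor p c) := by
    intro p t c h1 h2
    have h3 : ActsBy p0 p1 x (algebraMap ℂ (RatField n) p)⁻¹ (p : ℂ)⁻¹ := by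
      rw [← map_inv₀]; exact ActsBy.const x _
    have h4 := ActsBy.const (r := n) (p0 := p0) (p1 := p1) x (p : ℂ)
    have h5 : ActsBy p0 p1 x (1 : RatField n) 1 := by
      simpa using ActsBy.const (r := n) (p0 := p0) (p1 := p1) x 1
    exact ((h4.sub (h3.mul h1)).mul (h4.sub (h3.mul h2))).mul (h5.sub h1)
  have h1 := ActsBy.prod (p0 := p0) (p1 := p1) (x := x) Finset.univ fun i : Fin n =>
    key p0 ((hx.actsBy_kX i).pow 2) (by
      rw [← inv_pow, ← inv_pow]; exact (hx.actsBy_kX_inv i).pow 2)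
  have h2 := ActsBy.prod (p0 := p0) (p1 := p1) (x := x) Finset.univ fun i : Fin n =>
    ActsBy.prod (p0 := p0) (p1 := p1) (x := x) Finset.univ fun j : Fin n =>
    key p1 ((hx.actsBy_kX i).mul (hx.actsBy_kX j)) (by
      rw [mul_inv, mul_inv]; exact (hx.actsBy_kX_inv i).mul (hx.actsBy_kX_inv j))
  exact ⟨_, mul_ne_zero (Finset.prod_ne_zero_iff.2 fun i _ => h.rootFactor_sq_ne_zero (ha i))
    (Finset.prod_ne_zero_iff.2 fun i _ => Finset.prod_ne_zero_iff.2 fun j _ =>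
      h.rootFactor_mul_ne_zero (ha i) (ha j)), (h1.mul h2).smul_eq (repA_posDenomA n p0 p1)⟩

end Weight

section Induced

variable {n : ℕ} {M : Type u} [AddCommGroup M] [Module ℂ M] [Module (HA n p1) M]
  [IsScalarTower ℂ (HA n p1) M] {l : ℂ}

theorem mem_of_hasEigenvalue_signedX
    (hM : ∀ (i : Fin n) (a : ℂ), Module.End.HasEigenvalue (Algebra.lsmul ℂ ℂ M (HA.X p1 i)) a →
      ∃ u ∈ Jp, (u : ℂ) = a) {k : Fin n} {ε : ℤˣ} {a : ℂ}
    (ha : Module.End.HasEigenvalue (Algebra.lsmul ℂ ℂ M (HA.signedX p1 k ε)) a) :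
    ∃ u : ℂˣ, (u : ℂ) = a ∧ u ^ (ε : ℤ) ∈ Jp := by
  rcases Int.units_eq_one_or ε with rfl | rfl
  · rw [HA.signedX, if_pos rfl] at ha
    obtain ⟨u, hu, e⟩ := hM k a ha
    exact ⟨u, e, by simpa using hu⟩
  · rw [HA.signedX, if_neg (by decide)] at ha
    obtain ⟨x, hx⟩ := ha.exists_hasEigenvector
    have h1 : HA.Xinv p1 k • x = a • x := hx.apply_eq_smul
    have h2 : x = a • HA.X p1 k • x := by
      rw [smul_comm, ← h1, ← mul_smul, HA.X_mul_Xinv, one_smul]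
    have ha0 : a ≠ 0 := by
      rintro rfl
      exact hx.2 (by rw [h2, zero_smul])
    have h3 : HA.X p1 k • x = a⁻¹ • x := by
      conv_rhs => rw [h2, smul_smul, inv_mul_cancel₀ ha0, one_smul]
    obtain ⟨u, hu, e⟩ := hM k a⁻¹
      (Module.End.hasEigenvalue_of_hasEigenvector ⟨Module.End.mem_eigenspace_iff.2 h3, hx.2⟩)
    exact ⟨u⁻¹, by rw [Units.val_inv_eq_inv_val, e, inv_inv], by simpa using hu⟩

/-- A simple `H_n^A`-module with positive eigenvalues induces to a simple module: a positive weight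
vector of the induced module lies in the component of the trivial coset. -/
theorem ind_isSimpleModule (h : IsPositiveHalf p0 p1 Jp) [FiniteDimensional ℂ M]
    [IsSimpleModule (HA n p1) M]
    (hM : ∀ (i : Fin n) (a : ℂ), Module.End.HasEigenvalue (Algebra.lsmul ℂ ℂ M (HA.X p1 i)) a →
      ∃ u ∈ Jp, (u : ℂ) = a)
    (hE : (indDatum n p0 p1).IsAdmissible M l)
    {cl : (indDatum n p0 p1).locH →ₗ[ℂ] M →ₗ[ℂ] Ind (HA.toHB n p0 p1) M}
    (hcl : (indDatum n p0 p1).IsBalancedProduct cl) :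
    IsSimpleModule (HB n p0 p1) (Ind (HA.toHB n p0 p1) M) := by
  have hfin := hcl.finiteDimensional hE
  refine hcl.isSimpleModule hE fun U hU => ?_
  have : Nontrivial U := Submodule.nontrivial_iff_ne_bot.2 hU
  have : FiniteDimensional ℂ U :=
    FiniteDimensional.of_injective (U.subtype.restrictScalars ℂ) Subtype.val_injective
  obtain ⟨a, d, hd, ha⟩ := h.exists_weight (n := n) (L := U) (by
    intro i a h
    obtain ⟨d, hd⟩ := h.exists_hasEigenvector
    obtain ⟨s, hs⟩ := hcl.exists_hasEigenvalue hE (d := (d : Ind (HA.toHB n p0 p1) M))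
      (fun h0 => hd.2 (Subtype.ext h0)) {i} (fun _ => a) (by
        rintro _ rfl
        exact congrArg Subtype.val hd.apply_eq_smul)
    obtain ⟨u, e, hu⟩ := mem_of_hasEigenvalue_signedX hM (hs i rfl)
    refine ⟨u, e, ?_⟩
    rcases Int.units_eq_one_or (s.1.2 (s.1.1.symm i)) with hε | hε <;> rw [hε] at hu
    · exact .inl (by simpa using hu)
    · exact .inr (by simpa using hu))
  have hd0 : (d : Ind (HA.toHB n p0 p1) M) ≠ 0 := fun h => hd.1 (Subtype.ext h)
  obtain ⟨x, hx⟩ := hcl.exists_eq_cl_one hE (fun i => (a i : ℂ))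
    (fun i => congrArg Subtype.val (hd.2 i)) (by
      intro s hs
      by_contra! hcon
      -- A sign `-1` would contribute the inverse of an element of the positive half.
      have hε : ∀ k, s.1.2 k = 1 := by
        intro k
        refine (Int.units_eq_one_or _).resolve_right fun hε => ?_
        obtain ⟨u, e, hu⟩ := mem_of_hasEigenvalue_signedX hM (hcon (s.1.1 k))
        rw [Equiv.symm_apply_apply, hε, Units.ext e] at hu
        exact h.inv_notMem (ha (s.1.1 k)) (by simpa using hu)
      exact hs (Subtype.ext (Prod.ext (s.2.eq_one hε).1 (s.2.eq_one hε).2)))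
  refine ⟨x, ?_, hx ▸ d.2⟩
  rintro rfl
  exact hd0 (by rw [hx, map_zero])

end Induced

/-- A simple module all of whose eigenvalues lie, up to inversion, in the positive half is induced
from a simple `H_n^A`-module. -/
theorem exists_equiv_ind (h : IsPositiveHalf p0 p1 Jp) {n : ℕ} {L : Type w} [AddCommGroup L]
    [Module ℂ L] [Module (HB n p0 p1) L] [IsScalarTower ℂ (HB n p0 p1) L] [FiniteDimensional ℂ L]
    (hs : IsSimpleModule (HB n p0 p1) L)
    (hL : ∀ (i : Fin n) (a : ℂ), Module.End.HasEigenvalue (Algebra.lsmul ℂ ℂ L (HB.X p0 p1 i)) a →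
      ∃ u : ℂˣ, (u : ℂ) = a ∧ (u ∈ Jp ∨ u⁻¹ ∈ Jp)) :
    ∃ (M : Type w) (_ : AddCommGroup M) (_ : Module ℂ M) (_ : Module (HA n p1) M)
      (_ : IsScalarTower ℂ (HA n p1) M),
      FiniteDimensional ℂ M ∧ IsSimpleModule (HA n p1) M ∧
      Nonempty (L ≃ₗ[HB n p0 p1] Ind (HA.toHB n p0 p1) M) := by
  have := IsSimpleModule.nontrivial (HB n p0 p1) L
  obtain ⟨a, x, hx, ha⟩ := h.exists_weight hL
  obtain ⟨l, hl, hz⟩ := h.exists_posDenom_smul hx ha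
  obtain ⟨W, _, _, _, _, ψ, y, _, hψ, hy, hspan, hzW, hkW, hmul⟩ :=
    (indDatum n p0 p1).exists_cyclic hl hz
  have hy0 : y ≠ 0 := by rintro rfl; exact hx.1 (by rw [← hy, map_zero])
  have : Nontrivial W := ⟨y, 0, hy0⟩
  obtain ⟨M, hMs⟩ := exists_isSimpleModule_submodule (HA n p1) W
  have : FiniteDimensional ℂ M :=
    FiniteDimensional.of_injective (M.subtype.restrictScalars ℂ) Subtype.val_injective
  have hXy : ∀ i, HA.X p1 i • y = (a i : ℂ) • y := by
    intro i
    have := hmul (HA.X p1 i) 0 (HB.X p0 p1 i) (by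
      rw [pow_zero, mul_one, ← HA.toHB_X]; rfl) y
    rw [pow_zero, one_smul, hy, hx.2, ← hy, ← map_smul] at this
    exact (hψ this).symm
  -- The symmetric polynomial `∏ (t - X_k)` commutes with the image of `H_n^A`, hence acts
  -- centrally on `W`, where the kernel of the representation acts by zero.
  have hcomm : ∀ (t : ℂ) (c : HA n p1) (v : W),
      c • ((List.finRange n).map fun k => algebraMap ℂ (HA n p1) t - HA.X p1 k).prod • v
      = ((List.finRange n).map fun k => algebraMap ℂ (HA n p1) t - HA.X p1 k).prod • c • v := by
    intro t c v
    set P := ((List.finRange n).map fun k => algebraMap ℂ (HA n p1) t - HA.X p1 k).prod with hP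
    have hrep : repA n p0 p1 P = Algebra.lmul ℂ (RatField n)
        (∏ k : Fin n, (algebraMap ℂ (RatField n) t - kX k)) := by
      rw [hP, Fin.prod_univ_def, map_list_prod, map_list_prod, List.map_map, List.map_map]
      congr 1
      refine List.map_congr_left fun k _ => ?_
      simp only [Function.comp_apply, map_sub, AlgHom.commutes, repA_X]
    rw [← sub_eq_zero, ← mul_smul, ← mul_smul, ← sub_smul]
    refine hkW _ ?_ v
    change repA n p0 p1 _ = 0
    rw [map_sub, map_mul, map_mul, hrep, sub_eq_zero]
    refine (commute_repA (fun i j => ?_) c).eq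
    have h : ∀ k, swapAut i j (kX k) = kX (Equiv.swap i j k) := fun k => by
      rw [swapAut, signedAut_kX]; simp
    simp only [map_prod, map_sub, AlgEquiv.commutes, h]
    exact Equiv.prod_comp (Equiv.swap i j) fun k => algebraMap ℂ (RatField n) t - kX k
  -- Consequently the eigenvalues on `W` are among those on the generator `y`.
  have hMt : ∀ (i : Fin n) (b : ℂ),
      Module.End.HasEigenvalue (Algebra.lsmul ℂ ℂ M (HA.X p1 i)) b → ∃ u ∈ Jp, (u : ℂ) = b := by
    intro i b hb
    obtain ⟨v, hv⟩ := hb.exists_hasEigenvector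
    obtain ⟨k, hk⟩ := exists_eq_of_central (l := List.finRange n) (d := fun k => HA.X p1 k)
      (θ := fun k => (a k : ℂ)) (fun i k => HA.X_comm p1 i k) hcomm hXy (hspan v)
      (fun h0 => hv.2 (Subtype.ext h0)) (List.mem_finRange i)
      (congrArg Subtype.val hv.apply_eq_smul)
    exact ⟨a k, ha k, hk.symm⟩
  have hE : (indDatum n p0 p1).IsAdmissible M l :=
    ⟨hl, fun v => Subtype.ext (hzW v), fun c hc v => Subtype.ext (hkW c hc v)⟩
  obtain ⟨cl, hcl⟩ := (indDatum n p0 p1).exists_isBalancedProduct_ind (HA.toHB n p0 p1)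
    (fun _ => rfl) hE
  obtain ⟨Φ, hΦ⟩ := hcl.exists_hom hE (ψ.comp (M.subtype.restrictScalars ℂ))
    (fun c k b e v => hmul c k b e v)
  have hΦ0 : Φ ≠ 0 := by
    rintro rfl
    have := IsSimpleModule.nontrivial (HA n p1) M
    obtain ⟨v, hv⟩ := exists_ne (0 : M)
    refine hv (Subtype.ext (hψ ?_))
    rw [Submodule.coe_zero, map_zero]
    exact (hΦ v).symm
  have := h.ind_isSimpleModule hMt hE hcl
  exact ⟨M, inferInstance, inferInstance, inferInstance, inferInstance, inferInstance, hMs,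
    ⟨(LinearEquiv.ofBijective Φ (LinearMap.bijective_of_ne_zero hΦ0)).symm⟩⟩

end IsPositiveHalf

/-- If an orbit splits into two mutually inverse `ℤ`-orbits and avoids `±p₀`, then they are
positive halves. -/
theorem isPositiveHalf_of_orbit {p0 p1 : ℂˣ} {J Jp Jm : Set ℂˣ} (hp : ∃ a, Jp = orbitZ p1 a)
    (hJ : J = Jp ∪ Jm) (hd : Disjoint Jp Jm) (hm : Jm = {b | b⁻¹ ∈ Jp}) (h0 : p0 ∉ J)
    (h0' : -p0 ∉ J) : IsPositiveHalf p0 p1 Jp := by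
  have hsq : ∀ {u : ℂˣ}, u ∈ J → u ^ 2 ≠ p0 ^ 2 := by
    intro u hu e
    rcases sq_eq_sq_iff_eq_or_eq_neg.1 (show (u : ℂ) ^ 2 = (p0 : ℂ) ^ 2 by
      exact_mod_cast congrArg Units.val e) with e | e
    · exact h0 (Units.ext e ▸ hu)
    · exact h0' ((show u = -p0 from Units.ext e) ▸ hu)
  refine ⟨?_, ?_, fun hu => hsq (hJ ▸ .inl hu), fun {u} hu e => hsq (u := u⁻¹) ?_ ?_⟩
  · obtain ⟨a, rfl⟩ := hp
    rintro _ ⟨k, rfl⟩ m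
    exact ⟨k + m, by rw [mul_assoc, ← zpow_add, mul_add]⟩
  · intro u hu hu'
    exact Set.disjoint_left.1 hd hu (hm ▸ hu')
  · rw [hJ, hm]
    exact .inr (by simpa using hu)
  · rw [inv_pow]
    exact inv_eq_of_mul_eq_one_right e

end AffineHecke

theorem proposition6p4 (p0 p1 : ℂˣ) (hp0 : p0 ^ 2 ≠ 1) (hp1 : p1 ^ 2 ≠ 1) :
    -- (1) and (2), for disjoint invariant subsets
    (∀ J₁ J₂ : Set ℂˣ, IsInvariantZZ2 p1 J₁ → IsInvariantZZ2 p1 J₂ → Disjoint J₁ J₂ →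
      (∀ (n m : ℕ)
          (N : Type u) [AddCommGroup N] [Module ℂ N] [Module (HB n p0 p1) N]
          [IsScalarTower ℂ (HB n p0 p1) N]
          (M : Type v) [AddCommGroup M] [Module ℂ M] [Module (HB m p0 p1) M]
          [IsScalarTower ℂ (HB m p0 p1) M],
          IsSimpleModule (HB n p0 p1) N → IsOfType (n := n) p0 p1 J₁ N →
          IsSimpleModule (HB m p0 p1) M → IsOfType (n := m) p0 p1 J₂ M →
            IsSimpleModule (HB (n + m) p0 p1) (Diamond N M p0 p1 (rfl : n + m = n + m)) ∧
            IsOfType (n := n + m) p0 p1 (J₁ ∪ J₂) (Diamond N M p0 p1 (rfl : n + m = n + m))) ∧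
      (∀ (n : ℕ)
          (L : Type w) [AddCommGroup L] [Module ℂ L] [Module (HB n p0 p1) L]
          [IsScalarTower ℂ (HB n p0 p1) L],
          IsSimpleModule (HB n p0 p1) L → IsOfType (n := n) p0 p1 (J₁ ∪ J₂) L →
          ∃ (m k : ℕ) (hmk : m + k = n)
            (N : Type w) (_ : AddCommGroup N) (_ : Module ℂ N) (_ : Module (HB m p0 p1) N)
            (_ : IsScalarTower ℂ (HB m p0 p1) N)
            (M : Type w) (_ : AddCommGroup M) (_ : Module ℂ M) (_ : Module (HB k p0 p1) M)
            (_ : IsScalarTower ℂ (HB k p0 p1) M),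
            IsSimpleModule (HB m p0 p1) N ∧ IsOfType (n := m) p0 p1 J₁ N ∧
            IsSimpleModule (HB k p0 p1) M ∧ IsOfType (n := k) p0 p1 J₂ M ∧
            Nonempty (L ≃ₗ[HB n p0 p1] Diamond N M p0 p1 hmk))) ∧
    -- (3)
    (∀ J Jp Jm : Set ℂˣ,
      (∃ a, J = orbitZZ2 p1 a) → (∃ a, Jp = orbitZ p1 a) → (∃ a, Jm = orbitZ p1 a) →
      J = Jp ∪ Jm → Disjoint Jp Jm → Jm = {b | b⁻¹ ∈ Jp} →
      1 ∉ J → -1 ∉ J → p0 ∉ J → -p0 ∉ J →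
      ∀ (n : ℕ)
        (L : Type w) [AddCommGroup L] [Module ℂ L] [Module (HB n p0 p1) L]
        [IsScalarTower ℂ (HB n p0 p1) L],
        IsSimpleModule (HB n p0 p1) L → IsOfType (n := n) p0 p1 J L →
        ∃ (M : Type w) (_ : AddCommGroup M) (_ : Module ℂ M) (_ : Module (HA n p1) M)
          (_ : IsScalarTower ℂ (HA n p1) M),
          FiniteDimensional ℂ M ∧ IsSimpleModule (HA n p1) M ∧
          Nonempty (L ≃ₗ[HB n p0 p1] Ind (HA.toHB n p0 p1) M)) := by
  refine ⟨fun J₁ J₂ h₁ h₂ hd => ⟨?_, ?_⟩, ?_⟩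
  · intro n m N _ _ _ _ M _ _ _ _ hN tN hM tM
    exact diamond_isSimpleModule p0 p1 rfl N M h₁ h₂ hd tN tM
  · intro n L _ _ _ _ hs hL
    exact exists_equiv_diamond_of_isOfType h₁ h₂ hd hs hL
  · rintro J Jp Jm - hJp - hJ hd hm - - h0 h0' n L _ _ _ _ hs hL
    have := hL.1
    refine (isPositiveHalf_of_orbit hJp hJ hd hm h0 h0').exists_equiv_ind hs fun i a ha => ?_
    obtain ⟨u, hu, e⟩ := hL.2 i a ha
    rw [hJ, hm] at hu
    exact ⟨u, e, hu⟩
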